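/- Let $1\le m\le n$. For a real $C^2$ function $v$ on an open set $D\subset\mathbb C^n$ write $dd^c v=\frac i2\sum_{j,k} \frac{\partial^2 v}{\partial z_j\partial\bar z_k}\,dz_j\wedge d\bar z_k$, and put $\beta=dd^c|z|^2$. A function $v\in C^2(D)$ is called $m$-subharmonic in $D$ if $(dd^c v)^k\wedge\beta^{n-k}\ge 0$ in $D$ for $k=1,\dots,m$. A function $u:D\to[-\infty,\infty)$ is called $m$-subharmonic, $u\in sh_m(D)$, if it is subharmonic (upper semicontinuous, in $L^1_{loc}(D)$, and at most its mean value over each closed ball contained in $D$, at the centre of the ball) and if $$\int_D u\; dd^c v_1\wedge\dots\wedge dd^c v_{m-1}\wedge\beta^{n-m}\wedge dd^c\varphi\ \ge 0$$ for all $m$-subharmonic $v_1,\dots,v_{m-1}\in C^2(D)$ and all nonnegative $\varphi\in C_0^\infty(D)$. Let $D\subset\mathbb C^n$ be a domain. A set $E\subset D$ is $m$-polar in $D$ if there is $u\in sh_m(D)$, $u\not\equiv-\infty$, with $u=-\infty$ on $E$. The domain $D$ is $m$-convex if there is $\rho\in sh_m(D)$ with $\lim_{z\to\partial D}\rho(z)=+\infty$,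 and $m$-regular if there is $\rho\in sh_m(D)$ with $\rho<0$ in $D$ and $\lim_{z\to\partial D}\rho(z)=0$. Here $z\to\partial D$ means that $z$ eventually leaves every compact subset of $D$ (so, for unbounded $D$, the point at infinity counts as a boundary point). **Theorem 3.** Let $D\subset\mathbb C^n$ be an $m$-convex domain, and let $E\subset D$ be a set such that for every domain $G$ that is relatively compact in $D$ the set $E\cap G$ is $m$-polar in $G$. Then $E$ is $m$-polar in $D$. Moreover, if $D$ is $m$-regular, then there is a function $u\in sh_m(D)$ with $u<0$ in $D$, $u\not\equiv-\infty$, and $u=-\infty$ on $E$. -/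

import Mathlib

open MeasureTheory Filter Topology
open scoped ContDiff

noncomputable section

/-- The space of `n` complex variables, with its Euclidean norm and Lebesgue measure. -/
abbrev Cn (n : ℕ) : Type := EuclideanSpace ℂ (Fin n)

/-- A domain: a nonempty connected open set. -/
def IsDomainSet {n : ℕ} (D : Set (Cn n)) : Prop := IsOpen D ∧ IsConnected D

/-- The matrix `(∂²v / ∂z_j ∂z̄_k)` of a real function `v` at `z`, that is, the coefficients of
`dd^c v = (i/2) ∑ v_{j k̄} dz_j ∧ dz̄_k` (with `d^c = (∂ - ∂̄) / (4i)`), where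
`∂/∂z_j = (∂/∂x_j - i ∂/∂y_j) / 2` and `∂/∂z̄_k = (∂/∂x_k + i ∂/∂y_k) / 2`. -/
def ddc {n : ℕ} (v : Cn n → ℝ) (z : Cn n) : Matrix (Fin n) (Fin n) ℂ :=
  Matrix.of fun j k =>
    let H : Cn n → Cn n → ℂ := fun a b => ((iteratedFDeriv ℝ 2 v z ![a, b] : ℝ) : ℂ)
    let ex : Fin n → Cn n := fun l => EuclideanSpace.single l 1
    let ey : Fin n → Cn n := fun l => EuclideanSpace.single l Complex.I
    (1 / 4 : ℂ) * (H (ex j) (ex k) + H (ey j) (ey k)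
      + Complex.I * (H (ex j) (ey k) - H (ey j) (ex k)))

/-- For `(1,1)`-forms `α_l = (i/2) ∑ (A l)_{j k} dz_j ∧ dz̄_k`, `l = 1, …, n`, the coefficient of
`α_1 ∧ … ∧ α_n` with respect to the volume form `∏_l (i/2) dz_l ∧ dz̄_l = dx_1 dy_1 … dx_n dy_n`:
expand the product and move each surviving term
`dz_{σ 1} ∧ dz̄_{τ 1} ∧ … ∧ dz_{σ n} ∧ dz̄_{τ n}` into the standard order. -/
def wedgeCoeff {n : ℕ} (A : Fin n → Matrix (Fin n) (Fin n) ℂ) : ℂ :=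
  ∑ σ : Equiv.Perm (Fin n), ∑ τ : Equiv.Perm (Fin n),
    ((Equiv.Perm.sign σ : ℤ) : ℂ) * ((Equiv.Perm.sign τ : ℤ) : ℂ) * ∏ l, A l (σ l) (τ l)

/-- The coefficient of `(dd^c v)^k ∧ β^(n-k)`, `β = dd^c |z|²` (whose matrix is the identity). -/
def hessianCoeff {n : ℕ} (k : ℕ) (v : Cn n → ℝ) (z : Cn n) : ℝ :=
  (wedgeCoeff fun l : Fin n => if (l : ℕ) < k then ddc v z else 1).re

/-- `v` is of class `C²` and `m`-subharmonic in the open set `D`: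
`(dd^c v)^k ∧ β^(n-k) ≥ 0` for `k = 1, …, m`. -/
def IsC2MSubharmonicOn {n : ℕ} (m : ℕ) (D : Set (Cn n)) (v : Cn n → ℝ) : Prop :=
  ContDiffOn ℝ 2 v D ∧ ∀ k, 1 ≤ k → k ≤ m → ∀ z ∈ D, 0 ≤ hessianCoeff k v z

/-- The coefficient of `dd^c v_1 ∧ … ∧ dd^c v_{m-1} ∧ β^(n-m) ∧ dd^c φ` (forms of even degree
commute, so the order of the factors is immaterial). -/
def mixedCoeff {n : ℕ} (m : ℕ) (v : Fin (m - 1) → Cn n → ℝ) (φ : Cn n → ℝ) (z : Cn n) : ℝ :=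
  (wedgeCoeff fun l : Fin n =>
    if h : (l : ℕ) < m - 1 then ddc (v ⟨l, h⟩) z
    else if (l : ℕ) = m - 1 then ddc φ z
    else 1).re

/-- `u : D → [-∞, ∞)` is `m`-subharmonic in the open set `D` (`1 ≤ m ≤ n`). Values outside `D` are
irrelevant. -/
structure IsMSubharmonicOn {n : ℕ} (m : ℕ) (D : Set (Cn n)) (u : Cn n → EReal) : Prop where
  usc : UpperSemicontinuousOn u D
  lt_top : ∀ z ∈ D, u z < ⊤
  /- `u ∈ L¹_loc(D)`; since `toReal` sends `-∞` to `0`, finiteness a.e. is stated separately -/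
  ae_finite : ∀ᵐ z ∂(volume.restrict D), u z ≠ ⊥
  locallyIntegrable : LocallyIntegrableOn (fun z => (u z).toReal) D volume
  /- `u` is subharmonic as a function, not only almost everywhere -/
  subMean : ∀ z ∈ D, ∀ r : ℝ, 0 < r → Metric.closedBall z r ⊆ D →
    u z ≤ ((⨍ w in Metric.closedBall z r, (u w).toReal ∂volume : ℝ) : EReal)
  /- the current `dd^c u ∧ dd^c v_1 ∧ … ∧ dd^c v_{m-1} ∧ β^(n-m)` is positive -/
  current_nonneg : ∀ v : Fin (m - 1) → Cn n → ℝ, (∀ i, IsC2MSubharmonicOn m D (v i)) →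
    ∀ φ : Cn n → ℝ, ContDiff ℝ ∞ φ → HasCompactSupport φ → tsupport φ ⊆ D → (∀ z, 0 ≤ φ z) →
      0 ≤ ∫ z in D, (u z).toReal * mixedCoeff m v φ z ∂volume

/-- `E` is `m`-polar in `D`. -/
def IsMPolarIn {n : ℕ} (m : ℕ) (E D : Set (Cn n)) : Prop :=
  E ⊆ D ∧ ∃ u : Cn n → EReal, IsMSubharmonicOn m D u ∧ (∃ z ∈ D, u z ≠ ⊥) ∧ ∀ z ∈ E, u z = ⊥

/-- `D` is `m`-convex: some `m`-subharmonic `ρ` on `D` tends to `+∞` at the boundary of `D`, that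
is, as `z` leaves the compact subsets of `D`. -/
def IsMConvex {n : ℕ} (m : ℕ) (D : Set (Cn n)) : Prop :=
  ∃ ρ : Cn n → EReal, IsMSubharmonicOn m D ρ ∧
    Tendsto (fun z : D => ρ z) (cocompact D) (𝓝 ⊤)

/-- `D` is `m`-regular: some negative `m`-subharmonic `ρ` on `D` tends to `0` at the boundary of
`D`, that is, as `z` leaves the compact subsets of `D`. -/
def IsMRegular {n : ℕ} (m : ℕ) (D : Set (Cn n)) : Prop :=
  ∃ ρ : Cn n → EReal, IsMSubharmonicOn m D ρ ∧ (∀ z ∈ D, ρ z < 0) ∧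
    Tendsto (fun z : D => ρ z) (cocompact D) (𝓝 0)

end

/-!
The theorem is a Josefson theorem for `m`-subharmonic functions: a set that is `m`-polar in small
balls is contained in the `-∞` set of one function, which is even `m`-subharmonic on the whole of
`ℂⁿ`. No Dirichlet problem is solved; relative extremal functions are replaced by envelopes below
an obstacle on `ℂⁿ`, for which second order regularity is elementary.

*The algebra.* The `m`-positive matrices (`MPos`) form the closed Gårding cone of the `m`-th
elementary symmetric function. Gårding's theory of hyperbolic polynomials shows that mixed forms are
nonnegative on it (`wedgeCoeff_nonneg_of_mPos`) and that the cone is dual to the functionals given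
by its own elements (`mPos_of_dual`). The former makes smooth `m`-subharmonic functions satisfy the
integral inequality of the definition (`integral_mul_mixedCoeff_nonneg`, after integration by
parts), the latter shows that mollifying preserves `m`-subharmonicity (`smoothing_mshAt`). Hence
decreasing limits of functions approximable from above are `m`-subharmonic
(`isMSubharmonicOn_iInf`).

*The local step.* Let `u` be `m`-subharmonic on a ball. The function `φ` is the largest
`m`-subharmonic function below `δ ‖z‖² - χ`, where `0 ≤ χ ≤ 1` is a smooth function supported in
`{u < -t}`. Averaging translates of competitors shows that `φ` is semiconcave; since its Laplacian is
nonnegative, it has bounded second derivatives and is twice differentiable almost everywhere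
(`LUA.ae_second_order`). Where `φ` is below the obstacle its Hessian form vanishes
(`sigmaForm_ddc_envelope_eq_zero`); where `φ = δ ‖z‖²` it is at most that of `δ ‖z‖²`
(`sigmaForm_ddc_le_of_contact`). As `φ = δ ‖z‖²` near infinity, the two functions have the same
total Hessian mass (`integral_sigmaForm_eq`), so the mass lost on `{φ < δ ‖z‖²}` must be carried by
the support of `χ`. By a Chern–Levine–Nirenberg estimate (`IsMSubharmonicOn.exists_hessian_bound`)
the mass there is `O(1 / t)`. Therefore `{φ < δ ‖z‖²}` has measure `O(1 / (t δ^m))`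
(`measure_envelope_lt_le`), although `φ ≤ δ ‖z‖² - 1` wherever `χ = 1`, in the limit on the whole
set `{u = -∞}`.

*Summation.* With `δ = 2^(-k-1)`, `t` large, and balls visited infinitely often, the sum of such
envelopes is a locally integrable function equal to `-∞` on `E` (`exists_potential`). For an
`m`-regular domain, small multiples of this potential are glued to the exhaustion function `ρ` along
compact subsets of `D`; a convergent series of the resulting negative functions
(`exists_glued_seq`) is the negative function sought.
-/

/-! ### Hyperbolic polynomials and the mixed discriminant -/

/-- If no polynomial of a continuous family of constant degree and leading coefficient has a root
on the line `ℓ = 0`, then the roots cannot leave the half-plane `ℓ < 0`. -/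
theorem polynomial_roots_no_crossing (d : ℕ) (c : ℂ) (hc : c ≠ 0) (q : ℝ → Polynomial ℂ)
    (hdeg : ∀ β, (q β).natDegree ≤ d) (hlead : ∀ β, (q β).coeff d = c)
    (hcont : ∀ k, Continuous fun β => (q β).coeff k) (ℓ : ℂ →L[ℝ] ℝ) (hℓ : ∀ z, |ℓ z| ≤ ‖z‖)
    (h0 : ∀ z, (q 0).eval z = 0 → ℓ z < 0)
    (hbd : ∀ β ∈ Set.Icc (0 : ℝ) 1, ∀ z, (q β).eval z = 0 → ℓ z ≠ 0) :
    ∀ β ∈ Set.Icc (0 : ℝ) 1, (∀ z, (q β).eval z = 0 → ℓ z < 0) ∧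
      ∀ z, 0 ≤ ℓ z → ‖c‖ * ℓ z ^ d ≤ ‖(q β).eval z‖ := by
  have hev : ∀ β z, (q β).eval z = ∑ k ∈ Finset.range (d + 1), (q β).coeff k * z ^ k := by
    intro β z
    exact Polynomial.eval_eq_sum_range' (Nat.lt_succ_of_le (hdeg β)) z
  have hcont2 : Continuous fun p : ℝ × ℂ => (q p.1).eval p.2 := by
    simp only [hev]
    refine continuous_finsetSum _ fun k _ => ?_
    exact ((hcont k).comp continuous_fst).mul (continuous_snd.pow k)
  have hnd : ∀ β, (q β).natDegree = d := fun β =>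
    le_antisymm (hdeg β) (Polynomial.le_natDegree_of_ne_zero (by rw [hlead]; exact hc))
  -- a polynomial with all roots in `ℓ < 0` is bounded below on `ℓ ≥ 0`
  have hlow : ∀ β, (∀ z, (q β).eval z = 0 → ℓ z < 0) →
      ∀ z, 0 ≤ ℓ z → ‖c‖ * ℓ z ^ d ≤ ‖(q β).eval z‖ := by
    intro β hβ z hz
    have hq0 : q β ≠ 0 := by
      intro h; have := hlead β; rw [h] at this; simp at this; exact hc this.symm
    have hlc : (q β).leadingCoeff = c := by
      rw [Polynomial.leadingCoeff, hnd, hlead]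
    have hs := IsAlgClosed.splits (q β)
    have hcard : Multiset.card (q β).roots = d := by
      rw [← hnd β]; exact hs.natDegree_eq_card_roots.symm
    rw [hs.eval_eq_prod_roots, hlc, norm_mul]
    refine mul_le_mul_of_nonneg_left ?_ (norm_nonneg _)
    have key : ∀ s : Multiset ℂ, (∀ r ∈ s, ℓ r < 0) →
        ℓ z ^ (Multiset.card s) ≤ ‖(s.map fun a => z - a).prod‖ := by
      intro s
      induction s using Multiset.induction_on with
      | empty => intro _; simp
      | cons a s ih =>
        intro hs
        have h1 := ih fun r hr => hs r (Multiset.mem_cons_of_mem hr)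
        have h2 : ℓ z ≤ ‖z - a‖ := by
          have := hs a (Multiset.mem_cons_self a s)
          have h3 := (le_abs_self _).trans (hℓ (z - a))
          rw [map_sub] at h3
          linarith
        rw [Multiset.card_cons, Multiset.map_cons, Multiset.prod_cons, norm_mul, pow_succ, mul_comm]
        exact mul_le_mul h2 h1 (pow_nonneg hz _) (norm_nonneg _)
    rw [← hcard]
    refine key _ fun r hr => hβ r ?_
    exact (Polynomial.mem_roots'.1 hr).2
  let S : Set ℝ := {β | ∀ z, 0 ≤ ℓ z → ‖c‖ * ℓ z ^ d ≤ ‖(q β).eval z‖}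
  have hScl : IsClosed S := by
    have : S = ⋂ z : ℂ, ⋂ (_ : 0 ≤ ℓ z), {β | ‖c‖ * ℓ z ^ d ≤ ‖(q β).eval z‖} := by
      ext β; simp [S]
    rw [this]
    refine isClosed_iInter fun z => isClosed_iInter fun _ => ?_
    refine isClosed_le continuous_const ?_
    exact (hcont2.comp (Continuous.prodMk continuous_id continuous_const)).norm
  have hSgood : ∀ β ∈ Set.Icc (0 : ℝ) 1, β ∈ S → ∀ z, (q β).eval z = 0 → ℓ z < 0 := by
    intro β hβ hS z hz
    by_contra hneg
    push Not at hneg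
    have hpos : 0 < ℓ z := lt_of_le_of_ne hneg (Ne.symm (hbd β hβ z hz))
    have := hS z hneg
    rw [hz, norm_zero] at this
    have h2 : 0 < ‖c‖ * ℓ z ^ d := mul_pos (norm_pos_iff.2 hc) (pow_pos hpos d)
    linarith
  -- a uniform bound for the roots
  obtain ⟨R, hR⟩ : ∃ R : ℝ, ∀ β ∈ Set.Icc (0 : ℝ) 1, ∀ z, (q β).eval z = 0 → ‖z‖ ≤ R := by
    have hA : Continuous fun β => ∑ k ∈ Finset.range d, ‖(q β).coeff k‖ :=
      continuous_finsetSum _ fun k _ => (hcont k).norm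
    obtain ⟨A, hA⟩ := (isCompact_Icc (a := (0 : ℝ)) (b := 1)).bddAbove_image hA.continuousOn
    refine ⟨max 1 (A / ‖c‖), fun β hβ z hz => ?_⟩
    by_contra hlt
    push Not at hlt
    have h1 : 1 < ‖z‖ := (le_max_left _ _).trans_lt hlt
    have h2 : A < ‖z‖ * ‖c‖ := by
      have := (le_max_right 1 (A / ‖c‖)).trans_lt hlt
      rwa [div_lt_iff₀ (norm_pos_iff.2 hc)] at this
    have h3 : ∑ k ∈ Finset.range d, ‖(q β).coeff k‖ ≤ A := hA ⟨β, hβ, rfl⟩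
    rw [hev, Finset.sum_range_succ, hlead] at hz
    have h4 : c * z ^ d = -∑ k ∈ Finset.range d, (q β).coeff k * z ^ k := by
      linear_combination hz
    rcases Nat.eq_zero_or_pos d with rfl | hd
    · simp at h4; exact hc h4
    have h5 : ‖c‖ * ‖z‖ ^ d ≤ A * ‖z‖ ^ (d - 1) := by
      calc ‖c‖ * ‖z‖ ^ d = ‖c * z ^ d‖ := by simp
        _ = ‖∑ k ∈ Finset.range d, (q β).coeff k * z ^ k‖ := by rw [h4, norm_neg]
        _ ≤ ∑ k ∈ Finset.range d, ‖(q β).coeff k‖ * ‖z‖ ^ (d - 1) := by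
            refine norm_sum_le_of_le _ fun k hk => ?_
            rw [norm_mul, norm_pow]
            refine mul_le_mul_of_nonneg_left ?_ (norm_nonneg _)
            exact pow_le_pow_right₀ h1.le (by have := Finset.mem_range.1 hk; omega)
        _ = (∑ k ∈ Finset.range d, ‖(q β).coeff k‖) * ‖z‖ ^ (d - 1) := by
            rw [Finset.sum_mul]
        _ ≤ _ := mul_le_mul_of_nonneg_right h3 (pow_nonneg (norm_nonneg _) _)
    have h6 : ‖z‖ ^ d = ‖z‖ ^ (d - 1) * ‖z‖ := by
      rw [← pow_succ]; congr 1; omega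
    have h7 : 0 < ‖z‖ ^ (d - 1) := pow_pos (by linarith) _
    rw [h6] at h5
    nlinarith
  have hsub : Set.Icc (0 : ℝ) 1 ⊆ S := by
    refine IsClosed.Icc_subset_of_forall_mem_nhdsWithin (hScl.inter isClosed_Icc) ?_ ?_
    · exact hlow 0 h0
    · rintro x ⟨hxS, hx⟩
      have hxI : x ∈ Set.Icc (0 : ℝ) 1 := ⟨hx.1, hx.2.le⟩
      have hxg := hSgood x hxI hxS
      have hZ : IsCompact (Metric.closedBall (0 : ℂ) R ∩ {z | 0 ≤ ℓ z}) :=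
        (isCompact_closedBall _ _).inter_right (isClosed_le continuous_const ℓ.continuous)
      have hev2 : ∀ᶠ β in 𝓝 x, ∀ z ∈ Metric.closedBall (0 : ℂ) R ∩ {z | 0 ≤ ℓ z},
          (q β).eval z ≠ 0 := by
        refine hZ.eventually_forall_of_forall_eventually fun z hz => ?_
        have hne : (q x).eval z ≠ 0 := fun h => absurd (hxg z h) (not_lt.2 hz.2)
        exact (hcont2.tendsto (x, z)).eventually_ne hne
      have hlt : ∀ᶠ β in 𝓝[>] x, β ∈ Set.Ioo x 1 := Ioo_mem_nhdsGT hx.2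
      filter_upwards [hlt, nhdsWithin_le_nhds hev2] with β hβ h
      have hβI : β ∈ Set.Icc (0 : ℝ) 1 := ⟨hx.1.trans hβ.1.le, hβ.2.le⟩
      refine hlow β fun z hz => ?_
      by_contra hneg
      push Not at hneg
      exact h z ⟨by simpa using hR β hβI z hz, hneg⟩ hz
  exact fun β hβ => ⟨hSgood β hβ (hsub hβ), hsub hβ⟩

section Mixed

variable {n : ℕ}

/-- `wedgeCoeff` as a multilinear map. -/
noncomputable def wedgeForm (n : ℕ) :
    MultilinearMap ℂ (fun _ : Fin n => Matrix (Fin n) (Fin n) ℂ) ℂ :=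
  ∑ σ : Equiv.Perm (Fin n), ∑ τ : Equiv.Perm (Fin n),
    (((Equiv.Perm.sign σ : ℤ) : ℂ) * ((Equiv.Perm.sign τ : ℤ) : ℂ)) •
      (MultilinearMap.mkPiAlgebra ℂ (Fin n) ℂ).compLinearMap
        fun l => Matrix.entryLinearMap ℂ ℂ (σ l) (τ l)

theorem wedgeForm_apply (A : Fin n → Matrix (Fin n) (Fin n) ℂ) :
    wedgeForm n A = wedgeCoeff A := by
  simp [wedgeForm, wedgeCoeff]

theorem continuous_wedgeCoeff :
    Continuous fun A : Fin n → Matrix (Fin n) (Fin n) ℂ => wedgeCoeff A := by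
  unfold wedgeCoeff
  refine continuous_finsetSum _ fun σ _ => continuous_finsetSum _ fun τ _ => ?_
  refine continuous_const.mul (continuous_finsetProd _ fun l _ => ?_)
  exact (continuous_apply_apply (σ l) (τ l)).comp (continuous_apply l)

theorem wedgeCoeff_comp_perm (A : Fin n → Matrix (Fin n) (Fin n) ℂ) (π : Equiv.Perm (Fin n)) :
    wedgeCoeff (fun l => A (π l)) = wedgeCoeff A := by
  unfold wedgeCoeff
  rw [← Equiv.sum_comp (Equiv.mulRight π)]
  refine Finset.sum_congr rfl fun σ _ => ?_
  rw [← Equiv.sum_comp (Equiv.mulRight π)]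
  refine Finset.sum_congr rfl fun τ _ => ?_
  have h : (((Equiv.Perm.sign π : ℤ) : ℂ)) * ((Equiv.Perm.sign π : ℤ) : ℂ) = 1 := by
    rcases Int.units_eq_one_or (Equiv.Perm.sign π) with h | h <;> simp [h]
  simp only [Equiv.coe_mulRight, Equiv.Perm.sign_mul, Units.val_mul, Int.cast_mul,
    Equiv.Perm.coe_mul, Function.comp]
  rw [Equiv.prod_comp π (fun l => A l (σ l) (τ l))]
  linear_combination (((Equiv.Perm.sign σ : ℤ) : ℂ)) * ((Equiv.Perm.sign τ : ℤ) : ℂ) *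
    (∏ i, A i (σ i) (τ i)) * h

theorem conj_wedgeCoeff (A : Fin n → Matrix (Fin n) (Fin n) ℂ) :
    (starRingEnd ℂ) (wedgeCoeff A) = wedgeCoeff fun l => (A l).conjTranspose := by
  unfold wedgeCoeff
  rw [Finset.sum_comm]
  simp only [map_sum, map_mul, map_prod, Matrix.conjTranspose_apply, Complex.star_def, map_intCast]
  refine Finset.sum_congr rfl fun σ _ => Finset.sum_congr rfl fun τ _ => ?_
  rw [mul_comm (((Equiv.Perm.sign τ : ℤ) : ℂ))]

theorem wedgeCoeff_diag (A : Matrix (Fin n) (Fin n) ℂ) :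
    wedgeCoeff (fun _ => A) = (n.factorial : ℂ) * A.det := by
  unfold wedgeCoeff
  have h : ∀ τ : Equiv.Perm (Fin n), ∑ σ : Equiv.Perm (Fin n),
      ((Equiv.Perm.sign σ : ℤ) : ℂ) * ((Equiv.Perm.sign τ : ℤ) : ℂ) * ∏ l, A (σ l) (τ l)
        = A.det := by
    intro τ
    rw [Matrix.det_apply', ← Equiv.sum_comp (Equiv.mulRight τ)]
    refine Finset.sum_congr rfl fun σ _ => ?_
    have h : (((Equiv.Perm.sign τ : ℤ) : ℂ)) * ((Equiv.Perm.sign τ : ℤ) : ℂ) = 1 := by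
      rcases Int.units_eq_one_or (Equiv.Perm.sign τ) with h | h <;> simp [h]
    simp only [Equiv.coe_mulRight, Equiv.Perm.sign_mul, Units.val_mul, Int.cast_mul,
      Equiv.Perm.coe_mul, Function.comp]
    rw [Equiv.prod_comp τ (fun l => A (σ l) l)]
    linear_combination ((Equiv.Perm.sign σ : ℤ) : ℂ) * (∏ i, A (σ i) i) * h
  rw [Finset.sum_comm, Finset.sum_congr rfl fun τ _ => h τ]
  simp [Fintype.card_perm]

end Mixed

/-! ### Gårding's theory for slotwise polarized forms -/

section Garding

variable {n : ℕ}

/-- Complex `n × n` matrices, the coefficient matrices of `(1,1)`-forms. -/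
abbrev CMat (n : ℕ) : Type := Matrix (Fin n) (Fin n) ℂ

/-- The mixed discriminant with `x` in the slots of `S` and the matrices `c` in the others: a
homogeneous polynomial of degree `#S` in `x`. -/
noncomputable def slotForm (S : Finset (Fin n)) (c : Fin n → CMat n) (x : CMat n) : ℂ :=
  wedgeCoeff (S.piecewise (fun _ => x) c)

/-- The polynomial `t ↦ slotForm S c (x + t a)`. -/
noncomputable def slotPoly (S : Finset (Fin n)) (c : Fin n → CMat n) (x a : CMat n) : Polynomial ℂ :=
  ∑ T ∈ S.powerset, Polynomial.C (wedgeCoeff (T.piecewise (fun _ => x)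
    (S.piecewise (fun _ => a) c))) * Polynomial.X ^ (S \ T).card

theorem continuous_slotForm (S : Finset (Fin n)) (c : Fin n → CMat n) :
    Continuous fun x => slotForm S c x := by
  refine continuous_wedgeCoeff.comp (continuous_pi fun l => ?_)
  by_cases h : l ∈ S
  · simpa [h] using continuous_id'
  · simpa [h] using continuous_const

theorem wedgeCoeff_piecewise_add (S : Finset (Fin n)) (c A B : Fin n → CMat n) :
    wedgeCoeff (S.piecewise (fun l => A l + B l) c) =
      ∑ T ∈ S.powerset, wedgeCoeff (T.piecewise A (S.piecewise B c)) := by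
  have h := (wedgeForm n).map_piecewise_add A (S.piecewise B c) S
  simp only [wedgeForm_apply] at h
  rw [← h]
  congr 1
  ext l : 1
  by_cases hl : l ∈ S <;> simp [hl]

theorem wedgeCoeff_piecewise_smul (S : Finset (Fin n)) (t : ℂ) (A c : Fin n → CMat n) :
    wedgeCoeff (S.piecewise (fun l => t • A l) c) = t ^ S.card * wedgeCoeff (S.piecewise A c) := by
  have h := (wedgeForm n).map_piecewise_smul (fun _ => t) (S.piecewise A c) S
  simp only [wedgeForm_apply, Finset.prod_const, smul_eq_mul] at h
  rw [← h]
  congr 1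
  ext l : 1
  by_cases hl : l ∈ S <;> simp [hl]

theorem slotForm_smul (S : Finset (Fin n)) (c : Fin n → CMat n) (t : ℂ) (x : CMat n) :
    slotForm S c (t • x) = t ^ S.card * slotForm S c x :=
  wedgeCoeff_piecewise_smul S t (fun _ => x) c

theorem slotPoly_eval (S : Finset (Fin n)) (c : Fin n → CMat n) (x a : CMat n) (t : ℂ) :
    (slotPoly S c x a).eval t = slotForm S c (x + t • a) := by
  rw [slotForm, wedgeCoeff_piecewise_add S c (fun _ => x) (fun _ => t • a), slotPoly,
    Polynomial.eval_finsetSum]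
  refine Finset.sum_congr rfl fun T hT => ?_
  have hTS := Finset.mem_powerset.1 hT
  simp only [Polynomial.eval_mul, Polynomial.eval_C, Polynomial.eval_pow, Polynomial.eval_X]
  have h := wedgeCoeff_piecewise_smul (S \ T) t (fun _ => a) (T.piecewise (fun _ => x) c)
  have e1 : ∀ b : Fin n → CMat n, (S \ T).piecewise b (T.piecewise (fun _ => x) c) =
      T.piecewise (fun _ => x) (S.piecewise b c) := by
    intro b; ext l : 1
    by_cases h1 : l ∈ T
    · simp [h1]
    · by_cases h2 : l ∈ S <;> simp [h1, h2]
  rw [e1, e1] at h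
  rw [h, mul_comm]

theorem slotPoly_natDegree_le (S : Finset (Fin n)) (c : Fin n → CMat n) (x a : CMat n) :
    (slotPoly S c x a).natDegree ≤ S.card := by
  refine Polynomial.natDegree_sum_le_of_forall_le _ _ fun T _ => ?_
  refine (Polynomial.natDegree_C_mul_X_pow_le _ _).trans ?_
  exact Finset.card_le_card Finset.sdiff_subset

theorem slotPoly_coeff (S : Finset (Fin n)) (c : Fin n → CMat n) (x a : CMat n) (k : ℕ) :
    (slotPoly S c x a).coeff k = ∑ T ∈ S.powerset, if k = (S \ T).card then
      wedgeCoeff (T.piecewise (fun _ => x) (S.piecewise (fun _ => a) c)) else 0 := by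
  rw [slotPoly, Polynomial.finsetSum_coeff]
  refine Finset.sum_congr rfl fun T _ => ?_
  rw [Polynomial.coeff_C_mul_X_pow]

theorem slotPoly_coeff_card (S : Finset (Fin n)) (c : Fin n → CMat n) (x a : CMat n) :
    (slotPoly S c x a).coeff S.card = slotForm S c a := by
  rw [slotPoly_coeff, Finset.sum_eq_single ∅]
  · simp [slotForm]
  · intro T hT hne
    have hTS := Finset.mem_powerset.1 hT
    rw [if_neg]
    rw [Finset.card_sdiff_of_subset hTS]
    have := Finset.card_le_card hTS
    have := Finset.card_pos.2 (Finset.nonempty_iff_ne_empty.2 hne)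
    omega
  · simp

theorem continuous_slotPoly_coeff (S : Finset (Fin n)) (c : Fin n → CMat n) (a : CMat n) (y : ℝ → CMat n)
    (hy : Continuous y) (k : ℕ) : Continuous fun β => (slotPoly S c (y β) a).coeff k := by
  simp only [slotPoly_coeff]
  refine continuous_finsetSum _ fun T _ => ?_
  split_ifs
  · refine continuous_wedgeCoeff.comp (continuous_pi fun l => ?_)
    by_cases h : l ∈ T
    · simpa [h] using hy
    · simpa [h] using continuous_const
  · exact continuous_const

/-- By symmetry the frozen slot can be chosen freely. -/
theorem slotForm_erase_update (S : Finset (Fin n)) (c : Fin n → CMat n) (a y : CMat n) {i j : Fin n}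
    (hi : i ∈ S) (hj : j ∈ S) :
    slotForm (S.erase i) (Function.update c i a) y =
      slotForm (S.erase j) (Function.update c j a) y := by
  unfold slotForm
  rw [← wedgeCoeff_comp_perm _ (Equiv.swap i j)]
  congr 1
  ext l : 1
  by_cases hij : i = j
  · subst hij; rw [Equiv.swap_self]; rfl
  by_cases hli : l = i
  · subst hli
    simp only [Equiv.swap_apply_left, Finset.piecewise, Finset.mem_erase, ne_eq, Ne.symm hij,
      not_false_eq_true, hj, and_self, if_true, hij, hi]
  · by_cases hlj : l = j
    · subst hlj
      simp [Finset.piecewise, hj]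
    · rw [Equiv.swap_apply_of_ne_of_ne hli hlj]
      simp [Finset.piecewise, hli, hlj]

theorem slotPoly_derivative (S : Finset (Fin n)) (c : Fin n → CMat n) (x a : CMat n) {i : Fin n}
    (hi : i ∈ S) : Polynomial.derivative (slotPoly S c x a) =
      (S.card : Polynomial ℂ) * slotPoly (S.erase i) (Function.update c i a) x a := by
  have h1 : ∀ j ∈ S, slotPoly (S.erase i) (Function.update c i a) x a =
      slotPoly (S.erase j) (Function.update c j a) x a := by
    intro j hj
    refine Polynomial.funext fun t => ?_
    rw [slotPoly_eval, slotPoly_eval]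
    exact slotForm_erase_update S c a _ hi hj
  have h2 : (S.card : Polynomial ℂ) * slotPoly (S.erase i) (Function.update c i a) x a =
      ∑ j ∈ S, slotPoly (S.erase j) (Function.update c j a) x a := by
    rw [← Finset.sum_congr rfl h1, Finset.sum_const, nsmul_eq_mul]
  have h3 : ∀ j ∈ S, slotPoly (S.erase j) (Function.update c j a) x a =
      ∑ T ∈ (S.erase j).powerset, Polynomial.C (wedgeCoeff (T.piecewise (fun _ => x)
        (S.piecewise (fun _ => a) c))) * Polynomial.X ^ ((S \ T).card - 1) := by
    intro j hj
    rw [slotPoly]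
    refine Finset.sum_congr rfl fun T hT => ?_
    have hTS := Finset.mem_powerset.1 hT
    have hjT : j ∉ T := fun h => by simpa using hTS h
    have e1 : (S.erase j).piecewise (fun _ => a) (Function.update c j a) =
        S.piecewise (fun _ => a) c := by
      ext l : 1
      by_cases hl : l = j
      · subst hl; simp [Finset.piecewise, hj]
      · simp [Finset.piecewise, hl]
    have e2 : S.erase j \ T = (S \ T).erase j := by
      ext l; simp only [Finset.mem_sdiff, Finset.mem_erase]; tauto
    rw [e1, e2, Finset.card_erase_of_mem (Finset.mem_sdiff.2 ⟨hj, hjT⟩)]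
  rw [h2, Finset.sum_congr rfl h3, slotPoly, Polynomial.derivative_sum]
  rw [Finset.sum_comm' (t' := S.powerset) (s' := fun T => S \ T)]
  · refine Finset.sum_congr rfl fun T _ => ?_
    rw [Finset.sum_const, Polynomial.derivative_C_mul_X_pow, nsmul_eq_mul]
    simp only [map_mul, map_natCast]
    ring
  · intro j T
    simp only [Finset.mem_powerset, Finset.mem_sdiff]
    constructor
    · rintro ⟨h1, h2⟩
      exact ⟨⟨h1, fun h => by simpa using h2 h⟩, h2.trans (Finset.erase_subset _ _)⟩
    · rintro ⟨⟨h1, h2⟩, h3⟩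
      exact ⟨h1, fun l hl => Finset.mem_erase.2 ⟨fun h => h2 (h ▸ hl), h3 hl⟩⟩

/-- `slotForm S c` is hyperbolic in the direction `e`: its restrictions to real lines parallel to
`e` have real roots only. -/
def SlotHyperbolic (S : Finset (Fin n)) (c : Fin n → CMat n) (e : CMat n) : Prop :=
  ∀ x : CMat n, x.IsHermitian → ∀ t : ℂ, slotForm S c (x + t • e) = 0 → t.im = 0

/-- The hyperbolicity cone of `slotForm S c` in the direction `e`. -/
def SlotCone (S : Finset (Fin n)) (c : Fin n → CMat n) (e a : CMat n) : Prop :=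
  a.IsHermitian ∧ ∀ s : ℝ, 0 ≤ s → slotForm S c (a + (s : ℂ) • e) ≠ 0

theorem isHermitian_real_smul {a : CMat n} (ha : a.IsHermitian) (s : ℝ) :
    ((s : ℂ) • a).IsHermitian := by
  rw [Matrix.IsHermitian, Matrix.conjTranspose_smul, ha.eq]; simp

variable {S : Finset (Fin n)} {c : Fin n → CMat n} {e a b : CMat n}

theorem conj_slotForm (hc : ∀ l, (c l).IsHermitian) (x : CMat n) :
    (starRingEnd ℂ) (slotForm S c x) = slotForm S c x.conjTranspose := by
  rw [slotForm, conj_wedgeCoeff, slotForm]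
  congr 1; ext l : 1
  by_cases hl : l ∈ S
  · simp [hl]
  · simpa [hl] using (hc l).eq

theorem slotForm_im (hc : ∀ l, (c l).IsHermitian) {x : CMat n} (hx : x.IsHermitian) :
    (slotForm S c x).im = 0 := by
  rw [← Complex.conj_eq_iff_im, conj_slotForm hc, hx.eq]

theorem SlotCone.ne_zero (h : SlotCone S c e a) : slotForm S c a ≠ 0 := by
  simpa using h.2 0 le_rfl

theorem slotForm_pencil_ne_zero (hS : SlotCone S c e a) (hyp : SlotHyperbolic S c e)
    {w t : ℂ} (ht : t ≠ 0) (h : slotForm S c (w • e + t • a) = 0) :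
    ∃ s : ℝ, s < 0 ∧ w = s * t := by
  have e1 : w • e + t • a = t • (a + (w / t) • e) := by
    rw [smul_add, smul_smul, mul_div_cancel₀ _ ht, add_comm]
  rw [e1, slotForm_smul] at h
  have h1 := (mul_eq_zero.1 h).resolve_left (pow_ne_zero _ ht)
  have h2 := hyp a hS.1 _ h1
  have h3 : w / t = ((w / t).re : ℂ) := by
    apply Complex.ext <;> simp [h2]
  refine ⟨(w / t).re, ?_, ?_⟩
  · by_contra hneg
    push Not at hneg
    rw [h3] at h1
    exact hS.2 _ hneg h1
  · rw [← h3, div_mul_cancel₀ _ ht]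

/-- Gårding: a polynomial hyperbolic in the direction `e` is hyperbolic in every direction of the
cone of `e`. -/
theorem SlotHyperbolic.of_cone (hc : ∀ l, (c l).IsHermitian)
    (hyp : SlotHyperbolic S c e) (he0 : slotForm S c e ≠ 0) (ha : SlotCone S c e a) :
    SlotHyperbolic S c a := by
  have ha0 := ha.ne_zero
  -- the shift by `i α e` keeps all roots in the lower half-plane
  have claim : ∀ x : CMat n, x.IsHermitian → ∀ α : ℝ, 0 < α → ∀ t : ℂ, 0 ≤ t.im →
      ‖slotForm S c a‖ * t.im ^ S.card ≤
        ‖slotForm S c (x + (α * Complex.I) • e + t • a)‖ := by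
    intro x hx α hα t ht
    have key := polynomial_roots_no_crossing S.card (slotForm S c a) ha0
      (fun β => slotPoly S c ((β : ℂ) • x + (α * Complex.I) • e) a)
      (fun β => slotPoly_natDegree_le _ _ _ _) (fun β => slotPoly_coeff_card _ _ _ _)
      (fun k => continuous_slotPoly_coeff _ _ _ _ (by fun_prop) k)
      Complex.imCLM (fun z => by simpa using Complex.abs_im_le_norm z) ?_ ?_ 1 (by simp)
    · have := key.2 t (by simpa using ht)
      rw [slotPoly_eval] at this
      simpa using this
    · intro z hz
      rw [slotPoly_eval] at hz
      simp only [Complex.ofReal_zero, zero_smul, zero_add] at hz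
      by_cases hz0 : z = 0
      · exfalso
        rw [hz0, zero_smul, add_zero, slotForm_smul] at hz
        refine mul_ne_zero (pow_ne_zero _ ?_) he0 hz
        simp [hα.ne']
      · obtain ⟨s, hs, hw⟩ := slotForm_pencil_ne_zero ha hyp hz0 hz
        have : α = s * z.im := by simpa using congrArg Complex.im hw
        simp only [Complex.imCLM_apply]
        by_contra hneg
        push Not at hneg
        nlinarith
    · intro β _ z hz hz0
      rw [slotPoly_eval] at hz
      have hzr : z = (z.re : ℂ) := by
        apply Complex.ext <;> simp
        simpa using hz0
      have hH : ((β : ℂ) • x + z • a).IsHermitian := by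
        rw [hzr]; exact (isHermitian_real_smul hx β).add (isHermitian_real_smul ha.1 _)
      have := hyp _ hH (α * Complex.I) (by rw [← hz]; congr 1; abel)
      simp at this
      exact hα.ne' this
  have claim2 : ∀ x : CMat n, x.IsHermitian → ∀ t : ℂ, 0 < t.im →
      slotForm S c (x + t • a) ≠ 0 := by
    intro x hx t ht h0
    have hlim : Tendsto (fun α : ℝ => ‖slotForm S c (x + ((α : ℂ) * Complex.I) • e + t • a)‖)
        (𝓝[>] 0) (𝓝 ‖slotForm S c (x + (((0 : ℝ) : ℂ) * Complex.I) • e + t • a)‖) := by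
      refine (Continuous.tendsto ?_ 0).mono_left nhdsWithin_le_nhds
      exact ((continuous_slotForm S c).comp (by fun_prop)).norm
    have := ge_of_tendsto hlim (by
      filter_upwards [self_mem_nhdsWithin] with α hα
      exact claim x hx α hα t ht.le)
    simp only [Complex.ofReal_zero, zero_mul, zero_smul, add_zero, h0, norm_zero] at this
    have h2 : 0 < ‖slotForm S c a‖ * t.im ^ S.card :=
      mul_pos (norm_pos_iff.2 ha0) (pow_pos ht _)
    linarith
  intro x hx t ht
  by_contra hne
  rcases lt_or_gt_of_ne hne with h | h
  · have h1 := conj_slotForm (S := S) hc (x + t • a)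
    rw [ht, map_zero, Matrix.conjTranspose_add, Matrix.conjTranspose_smul, hx.eq, ha.1.eq] at h1
    exact claim2 x hx (star t) (by simpa using h) h1.symm
  · exact claim2 x hx t h ht

/-- Gårding: the cone does not depend on the direction chosen in it. -/
theorem SlotCone.change (hc : ∀ l, (c l).IsHermitian) (he : e.IsHermitian)
    (hyp : SlotHyperbolic S c e) (he0 : slotForm S c e ≠ 0) (ha : SlotCone S c e a)
    (hb : SlotCone S c e b) : SlotCone S c a b := by
  have hypa := hyp.of_cone hc he0 ha
  refine ⟨hb.1, fun t ht h0 => ?_⟩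
  have key := polynomial_roots_no_crossing S.card (slotForm S c a) ha.ne_zero
    (fun β => slotPoly S c (((1 - β : ℝ) : ℂ) • e + (β : ℂ) • b) a)
    (fun β => slotPoly_natDegree_le _ _ _ _) (fun β => slotPoly_coeff_card _ _ _ _)
    (fun k => continuous_slotPoly_coeff _ _ _ _ (by fun_prop) k)
    Complex.reCLM (fun z => by simpa using Complex.abs_re_le_norm z) ?_ ?_ 1 (by simp)
  · have := key.1 t (by rw [slotPoly_eval]; simpa using h0)
    simp at this
    linarith
  · intro z hz
    rw [slotPoly_eval] at hz
    simp only [sub_zero, Complex.ofReal_one, one_smul, Complex.ofReal_zero, zero_smul,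
      add_zero] at hz
    by_cases hz0 : z = 0
    · rw [hz0, zero_smul, add_zero] at hz; exact absurd hz he0
    · obtain ⟨s, hs, hw⟩ := slotForm_pencil_ne_zero (w := 1) ha hyp hz0 (by rwa [one_smul])
      have : 1 = s * z.re := by simpa using congrArg Complex.re hw
      simp only [Complex.reCLM_apply]
      by_contra hneg
      push Not at hneg
      nlinarith
  · intro β hβ z hz hz0
    rw [slotPoly_eval] at hz
    have hH : (((1 - β : ℝ) : ℂ) • e + (β : ℂ) • b).IsHermitian :=
      (isHermitian_real_smul he _).add (isHermitian_real_smul hb.1 _)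
    have him := hypa _ hH z hz
    have hz1 : z = 0 := Complex.ext (by simpa using hz0) him
    rw [hz1, zero_smul, add_zero] at hz
    rcases hβ.1.eq_or_lt with h | h
    · rw [← h] at hz; simp at hz; exact he0 hz
    · have e1 : (((1 - β : ℝ) : ℂ) • e + (β : ℂ) • b) =
          (β : ℂ) • (b + (((1 - β) / β : ℝ) : ℂ) • e) := by
        rw [smul_add, smul_smul, ← Complex.ofReal_mul, mul_div_cancel₀ _ h.ne', add_comm]
      rw [e1, slotForm_smul] at hz
      refine mul_ne_zero (pow_ne_zero _ (by simpa using h.ne')) (hb.2 _ ?_) hz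
      exact div_nonneg (by linarith [hβ.2]) h.le

theorem slotForm_erase_root_mem {K : Set ℂ} (hK : Convex ℝ K) {i : Fin n} (hi : i ∈ S) {x : CMat n}
    (ha0 : slotForm S c a ≠ 0) (h : ∀ t, slotForm S c (x + t • a) = 0 → t ∈ K) (t : ℂ)
    (ht : slotForm (S.erase i) (Function.update c i a) (x + t • a) = 0) : t ∈ K := by
  have hcard : 0 < S.card := Finset.card_pos.2 ⟨i, hi⟩
  have hnd : (slotPoly S c x a).natDegree = S.card :=
    le_antisymm (slotPoly_natDegree_le _ _ _ _)
      (Polynomial.le_natDegree_of_ne_zero (by rw [slotPoly_coeff_card]; exact ha0))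
  have hdeg : 0 < (slotPoly S c x a).degree :=
    Polynomial.natDegree_pos_iff_degree_pos.1 (by omega)
  have hd0 : Polynomial.derivative (slotPoly S c x a) ≠ 0 := by
    intro h0
    have := Polynomial.derivative_eq_zero.1 h0
    omega
  have hp0 : slotPoly S c x a ≠ 0 := fun h0 => by simp [h0] at hdeg
  have hmem : t ∈ (Polynomial.derivative (slotPoly S c x a)).rootSet ℂ := by
    rw [Polynomial.mem_rootSet]
    refine ⟨hd0, ?_⟩
    rw [slotPoly_derivative S c x a hi]
    simp [slotPoly_eval, ht]
  have := Polynomial.rootSet_derivative_subset_convexHull_rootSet hdeg hmem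
  refine convexHull_min ?_ hK this
  intro z hz
  have hz2 := (Polynomial.mem_rootSet.1 hz).2
  refine h z ?_
  rw [← slotPoly_eval]
  simpa using hz2

theorem SlotHyperbolic.erase {i : Fin n} (hi : i ∈ S) (ha0 : slotForm S c a ≠ 0)
    (hyp : SlotHyperbolic S c a) : SlotHyperbolic (S.erase i) (Function.update c i a) a := by
  intro x hx t ht
  have hK : Convex ℝ {z : ℂ | z.im = 0} := by
    intro z hz w hw p q _ _ _
    simp only [Set.mem_ofPred_eq] at *
    simp [hz, hw]
  exact slotForm_erase_root_mem hK hi ha0 (fun t ht => hyp x hx t ht) t ht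

theorem SlotCone.erase {i : Fin n} (hi : i ∈ S) (ha0 : slotForm S c a ≠ 0)
    (hyp : SlotHyperbolic S c a) (hb : SlotCone S c a b) :
    SlotCone (S.erase i) (Function.update c i a) a b := by
  refine ⟨hb.1, fun s hs h0 => ?_⟩
  have hK : Convex ℝ {z : ℂ | z.re < 0} := convex_halfSpace_re_lt 0
  have := slotForm_erase_root_mem hK hi ha0 (x := b) (fun t ht => ?_) s h0
  · simp at this; linarith
  · have him := hyp b hb.1 t ht
    have htr : t = (t.re : ℂ) := by apply Complex.ext <;> simp [him]
    by_contra hneg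
    simp only [Set.mem_ofPred_eq, not_lt] at hneg
    rw [htr] at ht
    exact hb.2 _ hneg ht

theorem slotForm_self_cone (he : e.IsHermitian) (he0 : slotForm S c e ≠ 0) :
    SlotCone S c e e := by
  refine ⟨he, fun s hs => ?_⟩
  have : e + (s : ℂ) • e = ((1 + s : ℝ) : ℂ) • e := by
    rw [Complex.ofReal_add, add_smul]; simp
  rw [this, slotForm_smul]
  exact mul_ne_zero (pow_ne_zero _ (by exact_mod_cast (by linarith : (1 + s) ≠ 0))) he0

/-- On the cone of `e` the form has the sign it has at `e`. -/
theorem SlotCone.pos (hc : ∀ l, (c l).IsHermitian) (he : e.IsHermitian)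
    (he0 : 0 < (slotForm S c e).re) (ha : SlotCone S c e a) : 0 < (slotForm S c a).re := by
  by_contra hneg
  push Not at hneg
  let y : ℝ → CMat n := fun s => (s : ℂ) • a + ((1 - s : ℝ) : ℂ) • e
  have hy : Continuous fun s => (slotForm S c (y s)).re :=
    Complex.continuous_re.comp ((continuous_slotForm S c).comp (by fun_prop))
  have h0 : (slotForm S c (y 0)).re = (slotForm S c e).re := by simp [y]
  have h1 : (slotForm S c (y 1)).re = (slotForm S c a).re := by simp [y]
  obtain ⟨s, hs, hs0⟩ := intermediate_value_Icc' (zero_le_one (α := ℝ)) hy.continuousOn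
    (show (0 : ℝ) ∈ Set.Icc _ _ from ⟨h1 ▸ hneg, h0 ▸ he0.le⟩)
  have hH : (y s).IsHermitian := (isHermitian_real_smul ha.1 _).add (isHermitian_real_smul he _)
  have hz : slotForm S c (y s) = 0 := Complex.ext hs0 (slotForm_im hc hH)
  rcases hs.1.eq_or_lt with h | h
  · rw [← h] at hs0; simp only [h0] at hs0; linarith
  · have e1 : y s = (s : ℂ) • (a + (((1 - s) / s : ℝ) : ℂ) • e) := by
      simp only [y]
      rw [smul_add, smul_smul, ← Complex.ofReal_mul, mul_div_cancel₀ _ h.ne']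
    rw [e1, slotForm_smul] at hz
    refine mul_ne_zero (pow_ne_zero _ (by simpa using h.ne')) (ha.2 _ ?_) hz
    exact div_nonneg (by linarith [hs.2]) h.le

/-- Gårding's inequality in its qualitative form: the polarized form is positive on the cone. -/
theorem wedgeCoeff_pos_of_cone (k : ℕ) : ∀ (S : Finset (Fin n)), S.card = k →
    ∀ (c : Fin n → CMat n) (e : CMat n), (∀ l, (c l).IsHermitian) → e.IsHermitian →
    SlotHyperbolic S c e → 0 < (slotForm S c e).re → ∀ A : Fin n → CMat n,
    (∀ i ∈ S, SlotCone S c e (A i)) → 0 < (wedgeCoeff (S.piecewise A c)).re := by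
  induction k with
  | zero =>
    intro S hS c e hc he hyp he0 A hA
    rw [Finset.card_eq_zero] at hS
    subst hS
    simpa [slotForm] using he0
  | succ k ih =>
    intro S hS c e hc he hyp he0 A hA
    obtain ⟨i, hi⟩ : S.Nonempty := Finset.card_pos.1 (by omega)
    have he0' : slotForm S c e ≠ 0 := fun h => by simp [h] at he0
    have ha := hA i hi
    have hapos := ha.pos hc he he0
    have hypa := hyp.of_cone hc he0' ha
    have hypq := hypa.erase hi ha.ne_zero
    have heA : SlotCone S c (A i) e := ha.change hc he hyp he0' (slotForm_self_cone he he0')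
    have heq := heA.erase hi ha.ne_zero hypa
    have hc' : ∀ l, (Function.update c i (A i) l).IsHermitian := by
      intro l
      by_cases hl : l = i
      · subst hl; simpa using ha.1
      · simpa [hl] using hc l
    have hself : slotForm (S.erase i) (Function.update c i (A i)) (A i) = slotForm S c (A i) := by
      unfold slotForm
      congr 1; ext l : 1
      by_cases hl : l = i
      · subst hl; simp [Finset.piecewise, hi]
      · simp [Finset.piecewise, hl]
    have hqa : 0 < (slotForm (S.erase i) (Function.update c i (A i)) (A i)).re := by
      rw [hself]; exact hapos
    have hqa0 : slotForm (S.erase i) (Function.update c i (A i)) (A i) ≠ 0 := by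
      rw [hself]; exact ha.ne_zero
    have hqe := heq.pos hc' ha.1 hqa
    have hypqe := hypq.of_cone hc' hqa0 heq
    have := ih (S.erase i) (by rw [Finset.card_erase_of_mem hi]; omega)
      (Function.update c i (A i)) e hc' he hypqe hqe A (fun j hj => ?_)
    · convert this using 3
      ext l : 1
      by_cases hl : l = i
      · subst hl; simp [Finset.piecewise, hi]
      · simp [Finset.piecewise, hl]
    · have h1 := ha.change hc he hyp he0' (hA j (Finset.mem_of_mem_erase hj))
      exact heq.change hc' ha.1 hypq hqa0 (h1.erase hi ha.ne_zero hypa)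

end Garding

/-! ### The cones of the elementary symmetric functions -/

section Cone

variable {n : ℕ}

/-- The first `k` of the `n` slots. -/
def initSlots (n k : ℕ) : Finset (Fin n) := Finset.univ.filter fun l => (l : ℕ) < k

/-- `k! (n-k)!` times the `k`-th elementary symmetric function of the eigenvalues of `A`; this is
the coefficient of `α^k ∧ β^(n-k)` for the form `α` with matrix `A`. -/
noncomputable def sigmaForm (k : ℕ) (A : CMat n) : ℝ :=
  (wedgeCoeff fun l : Fin n => if (l : ℕ) < k then A else 1).re

/-- The closed Gårding cone of the `m`-th elementary symmetric function on Hermitian matrices. The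
condition for `k = 0` always holds, since `sigmaForm 0 A = n!`. -/
def MPos (m : ℕ) (A : CMat n) : Prop := A.IsHermitian ∧ ∀ k ≤ m, 0 ≤ sigmaForm k A

theorem mem_initSlots {k : ℕ} {l : Fin n} : l ∈ initSlots n k ↔ (l : ℕ) < k := by
  simp [initSlots]

theorem initSlots_piecewise (k : ℕ) (A c : Fin n → CMat n) :
    (initSlots n k).piecewise A c = fun l : Fin n => if (l : ℕ) < k then A l else c l := by
  ext l : 1
  by_cases h : (l : ℕ) < k <;> simp [Finset.piecewise, mem_initSlots, h]

theorem card_initSlots {k : ℕ} (hk : k ≤ n) : (initSlots n k).card = k := by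
  rw [initSlots, Fin.card_filter_val_lt]; simp [hk]

theorem sigmaForm_eq (k : ℕ) (A : CMat n) : sigmaForm k A = (slotForm (initSlots n k) 1 A).re := by
  rw [slotForm, initSlots_piecewise]; rfl

theorem slotForm_one_congr {T T' : Finset (Fin n)} (h : T.card = T'.card) (A : CMat n) :
    slotForm T 1 A = slotForm T' 1 A := by
  let e : {x // x ∈ T} ≃ {x // x ∈ T'} := Finset.equivOfCardEq h
  unfold slotForm
  rw [← wedgeCoeff_comp_perm (T'.piecewise (fun _ => A) 1) e.extendSubtype]
  congr 1
  ext l : 1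
  by_cases hl : l ∈ T
  · have := e.extendSubtype_mem l hl
    simp [hl, this]
  · have := e.extendSubtype_not_mem l hl
    simp [hl, this]

theorem slotForm_one_eq_sigmaForm {T : Finset (Fin n)} (A : CMat n) :
    (slotForm T 1 A).re = sigmaForm T.card A := by
  rw [sigmaForm_eq, slotForm_one_congr]
  have : T.card ≤ n := by simpa using Finset.card_le_univ T
  rw [card_initSlots this]

theorem isHermitian_pi_one (l : Fin n) : ((1 : Fin n → CMat n) l).IsHermitian :=
  Matrix.isHermitian_one

theorem slotForm_one_one (S : Finset (Fin n)) : slotForm S 1 (1 : CMat n) = n.factorial := by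
  have : S.piecewise (fun _ => (1 : CMat n)) 1 = fun _ => (1 : CMat n) := by
    ext l : 1; by_cases hl : l ∈ S <;> simp [hl]
  rw [slotForm, this, wedgeCoeff_diag, Matrix.det_one, mul_one]

theorem slotForm_one_one_re_pos (S : Finset (Fin n)) : 0 < (slotForm S 1 (1 : CMat n)).re := by
  rw [slotForm_one_one]; simpa using n.factorial_pos

theorem slotForm_one_one_ne_zero (S : Finset (Fin n)) : slotForm S 1 (1 : CMat n) ≠ 0 := by
  rw [slotForm_one_one]; exact_mod_cast n.factorial_ne_zero

/-- A zero `t` of `det (A + t)` is minus a Rayleigh quotient of `A`. -/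
theorem exists_rayleigh_of_slotForm_univ {A : CMat n} {t : ℂ}
    (h : slotForm Finset.univ 1 (A + t • (1 : CMat n)) = 0) :
    ∃ v : Fin n → ℂ, ∃ r : ℝ, 0 < r ∧ star v ⬝ᵥ A.mulVec v = -(t * r) := by
  rw [slotForm, Finset.piecewise_univ, wedgeCoeff_diag] at h
  have hdet := (mul_eq_zero.1 h).resolve_left (by exact_mod_cast n.factorial_ne_zero)
  obtain ⟨v, hv, hv0⟩ := Matrix.exists_mulVec_eq_zero_iff.2 hdet
  refine ⟨v, ∑ i, ‖v i‖ ^ 2, ?_, ?_⟩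
  · obtain ⟨i, hi⟩ : ∃ i, v i ≠ 0 := by
      by_contra hcon; push Not at hcon; exact hv (funext hcon)
    exact Finset.sum_pos' (fun _ _ => by positivity) ⟨i, Finset.mem_univ i, by
      have := norm_pos_iff.2 hi; positivity⟩
  · have h1 : A.mulVec v = -(t • v) := by
      rw [Matrix.add_mulVec, Matrix.smul_mulVec, Matrix.one_mulVec] at hv0
      exact eq_neg_of_add_eq_zero_left hv0
    have h2 : star v ⬝ᵥ v = ((∑ i, ‖v i‖ ^ 2 : ℝ) : ℂ) := by
      simp only [dotProduct, Pi.star_apply, Complex.ofReal_sum, Complex.ofReal_pow]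
      refine Finset.sum_congr rfl fun i _ => ?_
      rw [Complex.star_def, Complex.conj_mul']
    rw [h1, dotProduct_neg, dotProduct_smul, h2, smul_eq_mul]

theorem slotHyperbolic_univ : SlotHyperbolic Finset.univ (1 : Fin n → CMat n) 1 := by
  intro x hx t ht
  obtain ⟨v, r, hr, hv⟩ := exists_rayleigh_of_slotForm_univ ht
  have h1 := hx.im_star_dotProduct_mulVec_self v
  rw [hv] at h1
  simp at h1
  exact h1.resolve_right hr.ne'

theorem slotHyperbolic_one (S : Finset (Fin n)) : SlotHyperbolic S (1 : Fin n → CMat n) 1 := by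
  have key : ∀ T : Finset (Fin n), SlotHyperbolic Tᶜ (1 : Fin n → CMat n) 1 := by
    intro T
    induction T using Finset.induction_on with
    | empty => simpa using slotHyperbolic_univ
    | insert i T hi ih =>
      have h := ih.erase (i := i) (by simpa using hi) (slotForm_one_one_ne_zero _)
      rw [Function.update_eq_self_iff.2 (by rfl)] at h
      rwa [Finset.compl_insert]
  simpa using key Sᶜ

theorem slotForm_one_add (S : Finset (Fin n)) (A B : CMat n) :
    slotForm S 1 (A + B) = ∑ T ∈ S.powerset,
      wedgeCoeff (T.piecewise (fun _ => A) (S.piecewise (fun _ => B) 1)) :=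
  wedgeCoeff_piecewise_add S 1 (fun _ => A) fun _ => B

theorem slotForm_one_add_smul_one (S : Finset (Fin n)) (A : CMat n) (t : ℝ) :
    (slotForm S 1 (A + (t : ℂ) • (1 : CMat n))).re =
      ∑ T ∈ S.powerset, t ^ (S.card - T.card) * sigmaForm T.card A := by
  rw [← slotPoly_eval, slotPoly, Polynomial.eval_finsetSum, Complex.re_sum]
  refine Finset.sum_congr rfl fun T hT => ?_
  have e1 : S.piecewise (fun _ => (1 : CMat n)) 1 = 1 := by
    ext l : 1; by_cases hl : l ∈ S <;> simp [hl]
  rw [Finset.card_sdiff_of_subset (Finset.mem_powerset.1 hT), ← slotForm_one_eq_sigmaForm, e1]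
  simp only [Polynomial.eval_mul, Polynomial.eval_C, Polynomial.eval_pow, Polynomial.eval_X]
  rw [← Complex.ofReal_pow, Complex.re_mul_ofReal, mul_comm]
  rfl

theorem sigmaForm_zero (A : CMat n) : sigmaForm 0 A = n.factorial := by
  have := slotForm_one_eq_sigmaForm (T := ∅) A
  rw [Finset.card_empty] at this
  rw [← this, slotForm, Finset.piecewise_empty]
  have h2 := slotForm_one_one (n := n) ∅
  rw [slotForm, Finset.piecewise_empty] at h2
  rw [h2]; simp

/-- Shifting an element of the closed cone by a positive multiple of the identity moves it into the
open cone. -/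
theorem MPos.slotCone_add {m : ℕ} {A : CMat n} (hA : MPos m A) {S : Finset (Fin n)}
    (hS : S.card ≤ m) {t : ℝ} (ht : 0 < t) :
    SlotCone S 1 1 (A + (t : ℂ) • (1 : CMat n)) := by
  refine ⟨hA.1.add (isHermitian_real_smul Matrix.isHermitian_one t), fun s hs h0 => ?_⟩
  rw [add_assoc, ← add_smul, ← Complex.ofReal_add] at h0
  have h1 := slotForm_one_add_smul_one S A (t + s)
  rw [h0, Complex.zero_re] at h1
  have h2 : 0 < ∑ T ∈ S.powerset, (t + s) ^ (S.card - T.card) * sigmaForm T.card A := by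
    refine Finset.sum_pos' (fun T hT => ?_) ⟨∅, by simp, ?_⟩
    · have := Finset.card_le_card (Finset.mem_powerset.1 hT)
      exact mul_nonneg (pow_nonneg (by linarith) _) (hA.2 _ (this.trans hS))
    · rw [Finset.card_empty, sigmaForm_zero]
      have := n.factorial_pos
      positivity
  linarith

/-- Gårding: the mixed form of at most `m` elements of the closed cone is nonnegative. -/
theorem wedgeCoeff_nonneg_of_mPos {m : ℕ} {S : Finset (Fin n)} (hS : S.card ≤ m)
    {A : Fin n → CMat n} (hA : ∀ i ∈ S, MPos m (A i)) :
    0 ≤ (wedgeCoeff (S.piecewise A 1)).re := by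
  have hlim : Tendsto (fun t : ℝ => (wedgeCoeff (S.piecewise
      (fun l => A l + (t : ℂ) • (1 : CMat n)) 1)).re) (𝓝[>] 0)
      (𝓝 (wedgeCoeff (S.piecewise (fun l => A l + ((0 : ℝ) : ℂ) • (1 : CMat n)) 1)).re) := by
    refine (Continuous.tendsto ?_ 0).mono_left nhdsWithin_le_nhds
    refine Complex.continuous_re.comp (continuous_wedgeCoeff.comp (continuous_pi fun l => ?_))
    by_cases hl : l ∈ S
    · simp only [hl, Finset.piecewise_eq_of_mem]; fun_prop
    · simpa [hl] using continuous_const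
  simp only [Complex.ofReal_zero, zero_smul, add_zero] at hlim
  refine ge_of_tendsto hlim ?_
  filter_upwards [self_mem_nhdsWithin] with t ht
  refine (wedgeCoeff_pos_of_cone S.card S rfl 1 1 isHermitian_pi_one Matrix.isHermitian_one
    (slotHyperbolic_one S) (slotForm_one_one_re_pos S) _ fun i hi => ?_).le
  exact (hA i hi).slotCone_add hS ht

theorem sigmaForm_add_eq {k : ℕ} (A B : CMat n) :
    sigmaForm k (A + B) = ∑ T ∈ (initSlots n k).powerset, (wedgeCoeff ((initSlots n k).piecewise
      (T.piecewise (fun _ => A) fun _ => B) 1)).re := by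
  rw [sigmaForm_eq, slotForm_one_add, Complex.re_sum]
  refine Finset.sum_congr rfl fun T hT => ?_
  congr 2
  ext l : 1
  by_cases h1 : l ∈ T
  · have := Finset.mem_powerset.1 hT h1
    simp [h1, this]
  · by_cases h2 : l ∈ initSlots n k <;> simp [h1, h2]

theorem card_initSlots_le {k : ℕ} : (initSlots n k).card ≤ k := by
  rw [initSlots, Fin.card_filter_val_lt]; exact min_le_right _ _

theorem mPos_piecewise {m : ℕ} {A B : CMat n} (hA : MPos m A) (hB : MPos m B)
    (T : Finset (Fin n)) (i : Fin n) : MPos m (T.piecewise (fun _ => A) (fun _ => B) i) := by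
  by_cases h : i ∈ T <;> simp [h, hA, hB]

theorem MPos.add {m : ℕ} {A B : CMat n} (hA : MPos m A) (hB : MPos m B) : MPos m (A + B) := by
  refine ⟨hA.1.add hB.1, fun k hk => ?_⟩
  rw [sigmaForm_add_eq]
  refine Finset.sum_nonneg fun T _ => ?_
  exact wedgeCoeff_nonneg_of_mPos (card_initSlots_le.trans hk) fun i _ => mPos_piecewise hA hB T i

theorem sigmaForm_le_add {m k : ℕ} {A B : CMat n} (hA : MPos m A) (hB : MPos m B) (hk : k ≤ m) :
    sigmaForm k A ≤ sigmaForm k (A + B) := by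
  rw [sigmaForm_add_eq]
  have hnn : ∀ T ∈ (initSlots n k).powerset, 0 ≤ (wedgeCoeff ((initSlots n k).piecewise
      (T.piecewise (fun _ => A) fun _ => B) 1)).re := fun T _ =>
    wedgeCoeff_nonneg_of_mPos (card_initSlots_le.trans hk) fun i _ => mPos_piecewise hA hB T i
  have hle := Finset.single_le_sum hnn (Finset.mem_powerset_self (initSlots n k))
  refine le_of_eq_of_le ?_ hle
  rw [sigmaForm_eq, slotForm]
  congr 2
  ext l : 1
  by_cases h1 : l ∈ initSlots n k <;> simp [h1]

theorem sigmaForm_smul {k : ℕ} (hk : k ≤ n) (r : ℝ) (A : CMat n) :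
    sigmaForm k ((r : ℂ) • A) = r ^ k * sigmaForm k A := by
  rw [sigmaForm_eq, slotForm_smul, ← Complex.ofReal_pow, Complex.re_ofReal_mul, ← sigmaForm_eq,
    card_initSlots hk]

theorem sigmaForm_one {k : ℕ} : sigmaForm k (1 : CMat n) = n.factorial := by
  rw [sigmaForm_eq, slotForm_one_one]; simp

theorem MPos.smul {m : ℕ} (hm : m ≤ n) {A : CMat n} (hA : MPos m A) {r : ℝ} (hr : 0 ≤ r) :
    MPos m ((r : ℂ) • A) := by
  refine ⟨isHermitian_real_smul hA.1 r, fun k hk => ?_⟩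
  rw [sigmaForm_smul (hk.trans hm)]
  exact mul_nonneg (pow_nonneg hr _) (hA.2 k hk)

theorem continuous_sigmaForm (k : ℕ) : Continuous fun A : CMat n => sigmaForm k A := by
  simp only [sigmaForm_eq]
  exact Complex.continuous_re.comp (continuous_slotForm _ _)

theorem isClosed_mPos (m : ℕ) : IsClosed {A : CMat n | MPos m A} := by
  have : {A : CMat n | MPos m A} = {A | A.conjTranspose = A} ∩
      ⋂ k, ⋂ (_ : k ≤ m), {A | 0 ≤ sigmaForm k A} := by
    ext A; simp [MPos, Matrix.IsHermitian]
  rw [this]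
  refine (isClosed_eq (by fun_prop) continuous_id).inter ?_
  exact isClosed_iInter fun k => isClosed_iInter fun _ =>
    isClosed_le continuous_const (continuous_sigmaForm k)

/-- Positive semidefinite matrices lie in every closed cone. -/
theorem mPos_of_posSemidef {A : CMat n} (hA : A.IsHermitian)
    (h : ∀ v : Fin n → ℂ, 0 ≤ (star v ⬝ᵥ A.mulVec v).re) (m : ℕ) : MPos m A := by
  have hcone : ∀ t : ℝ, 0 < t → SlotCone Finset.univ 1 1 (A + (t : ℂ) • (1 : CMat n)) := by
    intro t ht
    refine ⟨hA.add (isHermitian_real_smul Matrix.isHermitian_one t), fun s hs h0 => ?_⟩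
    rw [add_assoc, ← add_smul, ← Complex.ofReal_add] at h0
    obtain ⟨v, r, hr, hv⟩ := exists_rayleigh_of_slotForm_univ h0
    have := h v
    rw [hv] at this
    simp at this
    nlinarith
  refine ⟨hA, fun k _ => ?_⟩
  have hlim : Tendsto (fun t : ℝ => sigmaForm k (A + (t : ℂ) • (1 : CMat n))) (𝓝[>] 0)
      (𝓝 (sigmaForm k (A + ((0 : ℝ) : ℂ) • (1 : CMat n)))) := by
    refine (Continuous.tendsto ?_ 0).mono_left nhdsWithin_le_nhds
    exact (continuous_sigmaForm k).comp (by fun_prop)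
  simp only [Complex.ofReal_zero, zero_smul, add_zero] at hlim
  refine ge_of_tendsto hlim ?_
  filter_upwards [self_mem_nhdsWithin] with t ht
  have := wedgeCoeff_pos_of_cone _ Finset.univ rfl 1 1 isHermitian_pi_one Matrix.isHermitian_one
    slotHyperbolic_univ (slotForm_one_one_re_pos _)
    (fun l : Fin n => if (l : ℕ) < k then A + (t : ℂ) • (1 : CMat n) else 1) fun i _ => ?_
  · rw [Finset.piecewise_univ] at this
    exact this.le
  · show SlotCone _ _ _ (if (i : ℕ) < k then A + (t : ℂ) • (1 : CMat n) else 1)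
    split_ifs
    · exact hcone t ht
    · exact slotForm_self_cone Matrix.isHermitian_one (slotForm_one_one_ne_zero _)

theorem mPos_one (m : ℕ) : MPos m (1 : CMat n) := by
  refine ⟨Matrix.isHermitian_one, fun k _ => ?_⟩
  rw [sigmaForm_one]; positivity

theorem sigmaForm_pos_of_cone {m k : ℕ} (hk : k ≤ m) {A : CMat n}
    (hA : SlotCone (initSlots n m) 1 1 A) : 0 < sigmaForm k A := by
  have e1 : (fun l : Fin n => if (l : ℕ) < k then A else 1) = (initSlots n m).piecewise
      (fun l : Fin n => if (l : ℕ) < k then A else 1) 1 := by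
    rw [initSlots_piecewise]
    ext l : 1
    by_cases h1 : (l : ℕ) < k
    · simp [h1, h1.trans_le hk]
    · simp [h1]
  rw [sigmaForm, e1]
  refine wedgeCoeff_pos_of_cone _ (initSlots n m) rfl 1 1 isHermitian_pi_one
    Matrix.isHermitian_one (slotHyperbolic_one _) (slotForm_one_one_re_pos _) _ fun i _ => ?_
  show SlotCone _ _ _ (if (i : ℕ) < k then A else 1)
  split_ifs
  · exact hA
  · exact slotForm_self_cone Matrix.isHermitian_one (slotForm_one_one_ne_zero _)

/-- An element of the closed cone with positive `m`-th form is an interior point. -/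
theorem MPos.exists_sub_of_pos {m : ℕ} {B : CMat n} (hB : MPos m B)
    (hpos : 0 < sigmaForm m B) : ∃ ε : ℝ, 0 < ε ∧ MPos m (B - (ε : ℂ) • (1 : CMat n)) := by
  have hcone : SlotCone (initSlots n m) 1 1 B := by
    refine ⟨hB.1, fun s hs h0 => ?_⟩
    rcases hs.eq_or_lt with rfl | hs
    · rw [Complex.ofReal_zero, zero_smul, add_zero] at h0
      rw [sigmaForm_eq, h0] at hpos
      simp at hpos
    · exact (hB.slotCone_add card_initSlots_le hs).ne_zero h0
  have hev : ∀ k ∈ Finset.range (m + 1), ∀ᶠ ε : ℝ in 𝓝[>] 0,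
      0 ≤ sigmaForm k (B - (ε : ℂ) • (1 : CMat n)) := by
    intro k hk
    have hlim : Tendsto (fun t : ℝ => sigmaForm k (B - (t : ℂ) • (1 : CMat n))) (𝓝[>] 0)
        (𝓝 (sigmaForm k (B - ((0 : ℝ) : ℂ) • (1 : CMat n)))) := by
      refine (Continuous.tendsto ?_ 0).mono_left nhdsWithin_le_nhds
      exact (continuous_sigmaForm k).comp (by fun_prop)
    simp only [Complex.ofReal_zero, zero_smul, sub_zero] at hlim
    have := sigmaForm_pos_of_cone (by simpa using Finset.mem_range_succ_iff.1 hk) hcone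
    exact (hlim.eventually (lt_mem_nhds this)).mono fun _ h => h.le
  have hall := (Filter.eventually_all_finset _).2 hev
  obtain ⟨ε, hε, hε0⟩ := (hall.and self_mem_nhdsWithin).exists
  exact ⟨ε, hε0, hB.1.sub (isHermitian_real_smul Matrix.isHermitian_one ε),
    fun k hk => hε k (Finset.mem_range_succ_iff.2 hk)⟩

/-- The closed cone is determined by the functionals `B ↦ wedgeCoeff (A, …, A, B, 1, …, 1)` given
by its elements `A`. If `B` is outside, then `p s = sigmaForm m (B + s)` has a largest positive root
`s₀`; for `s > s₀` the functional of `A = B + s` yields `s p' ≤ m p`, so that `p / s ^ m` cannot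
increase from the value `0`, although `p > 0` beyond `s₀`. -/
theorem mPos_of_dual {m : ℕ} (hm : 1 ≤ m) (hmn : m ≤ n) {B : CMat n} (hB : B.IsHermitian)
    (h : ∀ A : CMat n, MPos m A → 0 ≤ (wedgeCoeff fun l : Fin n => if (l : ℕ) < m - 1 then A
      else if (l : ℕ) = m - 1 then B else 1).re) : MPos m B := by
  set S := initSlots n m with hS
  have hcard : S.card = m := card_initSlots hmn
  let P := slotPoly S 1 B 1
  let p : ℝ → ℝ := fun s => (P.eval (s : ℂ)).re
  let i : Fin n := ⟨m - 1, by omega⟩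
  have hiS : i ∈ S := mem_initSlots.2 (by simp only [i]; omega)
  have hPe : ∀ s : ℂ, P.eval s = slotForm S 1 (B + s • (1 : CMat n)) := slotPoly_eval S 1 B 1
  have hherm : ∀ s : ℝ, (B + (s : ℂ) • (1 : CMat n)).IsHermitian := fun s =>
    hB.add (isHermitian_real_smul Matrix.isHermitian_one s)
  have hP0 : P ≠ 0 := by
    intro h0
    have := slotPoly_coeff_card S 1 B (1 : CMat n)
    rw [show slotPoly S 1 B 1 = 0 from h0, Polynomial.coeff_zero] at this
    exact slotForm_one_one_ne_zero S this.symm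
  -- the derivative of `p` through the mixed form
  have hp' : ∀ s : ℝ, HasDerivAt p
      (m * (slotForm (S.erase i) 1 (B + (s : ℂ) • (1 : CMat n))).re) s := by
    intro s
    have h1 := P.hasDerivAt (s : ℂ)
    rw [slotPoly_derivative S 1 B 1 hiS, Function.update_eq_self_iff.2 (by rfl),
      Polynomial.eval_mul, Polynomial.eval_natCast, slotPoly_eval, hcard] at h1
    have h2 := h1.real_of_complex
    convert h2 using 1
    simp
  -- real roots of `p` are roots of `P`
  have hroot : ∀ s : ℝ, p s = 0 → P.eval (s : ℂ) = 0 := by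
    intro s hs
    refine Complex.ext hs ?_
    rw [hPe]
    exact slotForm_im isHermitian_pi_one (hherm s)
  suffices hpos : ∀ s : ℝ, 0 < s → p s ≠ 0 by
    have hcone : ∀ s : ℝ, 0 < s → SlotCone S 1 1 (B + (s : ℂ) • (1 : CMat n)) := by
      intro s hs
      refine ⟨hherm s, fun r hr h0 => hpos (s + r) (by linarith) ?_⟩
      simp only [p]
      rw [hPe, Complex.ofReal_add, add_smul, ← add_assoc, h0, Complex.zero_re]
    refine ⟨hB, fun k hk => ?_⟩
    have hlim : Tendsto (fun t : ℝ => sigmaForm k (B + (t : ℂ) • (1 : CMat n))) (𝓝[>] 0)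
        (𝓝 (sigmaForm k (B + ((0 : ℝ) : ℂ) • (1 : CMat n)))) := by
      refine (Continuous.tendsto ?_ 0).mono_left nhdsWithin_le_nhds
      exact (continuous_sigmaForm k).comp (by fun_prop)
    simp only [Complex.ofReal_zero, zero_smul, add_zero] at hlim
    refine ge_of_tendsto hlim ?_
    filter_upwards [self_mem_nhdsWithin] with t ht
    exact (sigmaForm_pos_of_cone hk (hcone t ht)).le
  intro s₁ hs₁ hps₁
  -- the largest real root `s₀`
  have hfin : {s : ℝ | 0 < s ∧ p s = 0}.Finite := by
    have h1 : (P.roots.toFinset : Set ℂ).Finite := P.roots.toFinset.finite_toSet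
    refine (h1.preimage (f := ((↑) : ℝ → ℂ)) Complex.ofReal_injective.injOn).subset ?_
    intro s hs
    simp only [Set.mem_preimage, Finset.mem_coe, Multiset.mem_toFinset]
    exact (Polynomial.mem_roots hP0).2 (hroot s hs.2)
  obtain ⟨s₀, ⟨hs₀, hps₀⟩, hmax⟩ := Set.exists_max_image _ id hfin ⟨s₁, hs₁, hps₁⟩
  have hne : ∀ s, s₀ < s → p s ≠ 0 := fun s hs h0 =>
    absurd (hmax s ⟨hs₀.trans hs, h0⟩) (not_le.2 hs)
  have hcone : ∀ s : ℝ, s₀ < s → SlotCone S 1 1 (B + (s : ℂ) • (1 : CMat n)) := by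
    intro s hs
    refine ⟨hherm s, fun r hr h0 => hne (s + r) (by linarith) ?_⟩
    simp only [p]
    rw [hPe, Complex.ofReal_add, add_smul, ← add_assoc, h0, Complex.zero_re]
  have hppos : ∀ s, s₀ < s → 0 < p s := by
    intro s hs
    have := (hcone s hs).pos isHermitian_pi_one Matrix.isHermitian_one (slotForm_one_one_re_pos S)
    simpa only [p, hPe] using this
  -- the hypothesis says `s p' ≤ m p`
  have hineq : ∀ s, s₀ < s →
      s * (slotForm (S.erase i) 1 (B + (s : ℂ) • (1 : CMat n))).re ≤ p s := by
    intro s hs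
    set A := B + (s : ℂ) • (1 : CMat n) with hA
    have hAm : MPos m A := ⟨hherm s, fun k hk => (sigmaForm_pos_of_cone hk (hcone s hs)).le⟩
    have h1 := h A hAm
    let c : Fin n → CMat n := (S.erase i).piecewise (fun _ => A) 1
    have e1 : (fun l : Fin n => if (l : ℕ) < m - 1 then A
        else if (l : ℕ) = m - 1 then B else 1) = Function.update c i B := by
      ext l : 1
      by_cases hl : l = i
      · subst hl; simp [i]
      · have hl' : (l : ℕ) ≠ m - 1 := fun h => hl (Fin.ext h)
        rw [Function.update_of_ne hl]
        simp only [c, Finset.piecewise, Finset.mem_erase, hS, mem_initSlots, hl', if_false]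
        by_cases h3 : (l : ℕ) < m - 1
        · rw [if_pos h3, if_pos ⟨hl, by omega⟩]
        · rw [if_neg h3, if_neg (by omega)]; rfl
    have e2 : S.piecewise (fun _ => A) 1 = Function.update c i A := by
      ext l : 1
      by_cases hl : l = i
      · subst hl; simp [hiS]
      · rw [Function.update_of_ne hl]
        simp [c, Finset.piecewise, hl]
    have e3 : c = Function.update c i 1 := by
      rw [eq_comm, Function.update_eq_self_iff]
      simp [c]
    have h2 : slotForm S 1 A = wedgeCoeff (Function.update c i B) +
        (s : ℂ) * wedgeCoeff (Function.update c i 1) := by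
      rw [slotForm, e2, hA]
      simp only [← wedgeForm_apply]
      rw [MultilinearMap.map_update_add, MultilinearMap.map_update_smul, smul_eq_mul]
    rw [← e3] at h2
    have h3 : p s = (wedgeCoeff (Function.update c i B)).re + s * (wedgeCoeff c).re := by
      simp only [p, hPe]
      rw [← hA, h2, Complex.add_re, Complex.re_ofReal_mul]
    rw [e1] at h1
    rw [h3]
    change s * (wedgeCoeff c).re ≤ _
    linarith
  -- hence `p / s ^ m` does not increase, and it cannot leave the value `0` at `s₀`
  have hanti : AntitoneOn (fun s => p s / s ^ m) (Set.Ici s₀) := by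
    refine antitoneOn_of_deriv_nonpos (convex_Ici s₀) ?_ ?_ ?_
    · intro s hs
      have hs' : 0 < s := hs₀.trans_le hs
      exact ((hp' s).continuousAt.div (by fun_prop) (by positivity)).continuousWithinAt
    · intro s hs
      rw [interior_Ici] at hs
      have hs' : 0 < s := hs₀.trans hs
      exact ((hp' s).div (hasDerivAt_pow m s) (by positivity)).differentiableAt.differentiableWithinAt
    · intro s hs
      rw [interior_Ici] at hs
      have hs' : 0 < s := hs₀.trans hs
      have hd : HasDerivAt (fun s => p s / s ^ m) _ s :=
        (hp' s).div (hasDerivAt_pow m s) (by positivity)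
      rw [hd.deriv]
      refine div_nonpos_of_nonpos_of_nonneg ?_ (by positivity)
      have h1 := hineq s hs
      have h2 : s ^ m = s ^ (m - 1) * s := by rw [← pow_succ]; congr 1; omega
      rw [h2]
      have h3 : 0 ≤ (m : ℝ) * s ^ (m - 1) := by positivity
      nlinarith [mul_le_mul_of_nonneg_left h1 h3]
  have h1 := hanti (Set.self_mem_Ici) (show s₀ + 1 ∈ Set.Ici s₀ by simp) (by linarith)
  simp only [hps₀, zero_div] at h1
  have h2 := hppos (s₀ + 1) (by linarith)
  have : 0 < p (s₀ + 1) / (s₀ + 1) ^ m := div_pos h2 (by positivity)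
  linarith

end Cone

/-! ### Second derivatives and the Levi matrix -/

section SecondDeriv

variable {E : Type*} [NormedAddCommGroup E] [NormedSpace ℝ E]

/-- The second derivative as a bilinear form. -/
noncomputable abbrev secondDeriv (v : E → ℝ) (z : E) : E →L[ℝ] E →L[ℝ] ℝ :=
  fderiv ℝ (fderiv ℝ v) z

theorem contDiffAt_fderiv_differentiableAt {v : E → ℝ} {z : E} (hv : ContDiffAt ℝ 2 v z) :
    DifferentiableAt ℝ (fderiv ℝ v) z :=
  (hv.fderiv_right (m := 1) (by norm_num)).differentiableAt (by norm_num)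

theorem eventually_differentiableAt {v : E → ℝ} {z : E} (hv : ContDiffAt ℝ 2 v z) :
    ∀ᶠ y in 𝓝 z, DifferentiableAt ℝ v y :=
  (hv.eventually (by simp)).mono fun _ h => h.differentiableAt (by norm_num)

theorem secondDeriv_congr {v w : E → ℝ} {z : E} (h : v =ᶠ[𝓝 z] w) :
    secondDeriv v z = secondDeriv w z := h.fderiv.fderiv_eq

theorem secondDeriv_add {v w : E → ℝ} {z : E} (hv : ContDiffAt ℝ 2 v z)
    (hw : ContDiffAt ℝ 2 w z) :
    secondDeriv (fun y => v y + w y) z = secondDeriv v z + secondDeriv w z := by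
  have : fderiv ℝ (fun y => v y + w y) =ᶠ[𝓝 z] fun y => fderiv ℝ v y + fderiv ℝ w y := by
    filter_upwards [eventually_differentiableAt hv, eventually_differentiableAt hw] with y h1 h2
    exact fderiv_fun_add h1 h2
  rw [secondDeriv, this.fderiv_eq]
  exact fderiv_fun_add (contDiffAt_fderiv_differentiableAt hv)
    (contDiffAt_fderiv_differentiableAt hw)

theorem secondDeriv_const_mul {v : E → ℝ} {z : E} (hv : ContDiffAt ℝ 2 v z) (r : ℝ) :
    secondDeriv (fun y => r * v y) z = r • secondDeriv v z := by
  have : fderiv ℝ (fun y => r * v y) =ᶠ[𝓝 z] fun y => r • fderiv ℝ v y := by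
    filter_upwards [eventually_differentiableAt hv] with y h1
    exact fderiv_const_mul h1 r
  rw [secondDeriv, this.fderiv_eq]
  exact fderiv_fun_const_smul (contDiffAt_fderiv_differentiableAt hv) r

theorem secondDeriv_comp_add (v : E → ℝ) (h z : E) :
    secondDeriv (fun y => v (y + h)) z = secondDeriv v (z + h) := by
  have : fderiv ℝ (fun y => v (y + h)) = fun y => fderiv ℝ v (y + h) := by
    ext1 y; rw [fderiv_comp_add_right]
  rw [secondDeriv, this, fderiv_comp_add_right]

theorem secondDeriv_affine (L : E →L[ℝ] ℝ) (r : ℝ) (z : E) :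
    secondDeriv (fun y => L y + r) z = 0 := by
  have : fderiv ℝ (fun y => L y + r) = fun _ => L := by
    ext1 y; rw [fderiv_add_const, L.fderiv]
  rw [secondDeriv, this]; simp

theorem secondDeriv_comp {g : ℝ → ℝ} (hg : ContDiff ℝ 2 g) {u : E → ℝ} {z : E}
    (hu : ContDiffAt ℝ 2 u z) (a b : E) :
    secondDeriv (fun y => g (u y)) z a b =
      deriv g (u z) * secondDeriv u z a b + deriv (deriv g) (u z) * fderiv ℝ u z a * fderiv ℝ u z b := by
  have h1 : fderiv ℝ (fun y => g (u y)) =ᶠ[𝓝 z] fun y => deriv g (u y) • fderiv ℝ u y := by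
    filter_upwards [eventually_differentiableAt hu] with y hy
    exact ((hg.differentiable (by norm_num) (u y)).hasDerivAt.comp_hasFDerivAt y
      hy.hasFDerivAt).fderiv
  have hg1 : ContDiff ℝ 1 (deriv g) := by
    have hg' := hg
    rw [← one_add_one_eq_two] at hg'
    exact (contDiff_succ_iff_deriv.1 hg').2.2
  have h2 : HasFDerivAt (fun y => deriv g (u y)) (deriv (deriv g) (u z) • fderiv ℝ u z) z :=
    (hg1.differentiable (by norm_num) (u z)).hasDerivAt.comp_hasFDerivAt z
      (hu.differentiableAt (by norm_num)).hasFDerivAt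
  have h3 : HasFDerivAt (fun y => deriv g (u y) • fderiv ℝ u y) _ z :=
    h2.smul (contDiffAt_fderiv_differentiableAt hu).hasFDerivAt
  rw [secondDeriv, h1.fderiv_eq, h3.fderiv]
  simp [_root_.add_apply]

/-- Second order Taylor expansion at a point where the derivative is differentiable. -/
theorem taylor_two_isLittleO {v : E → ℝ} {z : E} (hv : ∀ y, DifferentiableAt ℝ v y)
    (h2 : DifferentiableAt ℝ (fderiv ℝ v) z) {η : ℝ} (hη : 0 < η) :
    ∃ r > 0, ∀ h : E, ‖h‖ < r →
      |v (z + h) - v z - fderiv ℝ v z h - (1 / 2) * secondDeriv v z h h| ≤ η * ‖h‖ ^ 2 := by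
  have hsymm : ∀ a b, secondDeriv v z a b = secondDeriv v z b a := fun a b =>
    second_derivative_symmetric (fun y => (hv y).hasFDerivAt) h2.hasFDerivAt a b
  have h3 := h2.hasFDerivAt.isLittleO
  rw [Asymptotics.isLittleO_iff] at h3
  obtain ⟨r, hr, hball⟩ := Metric.eventually_nhds_iff.1 (h3 hη)
  refine ⟨r, hr, fun h hh => ?_⟩
  let F : E → ℝ := fun y =>
    v y - fderiv ℝ v z (y - z) - (1 / 2) * secondDeriv v z (y - z) (y - z)
  have hF : ∀ y, HasFDerivAt F (fderiv ℝ v y - fderiv ℝ v z - secondDeriv v z (y - z)) y := by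
    intro y
    have e1 : HasFDerivAt (fun y => y - z) (ContinuousLinearMap.id ℝ E) y :=
      (hasFDerivAt_id y).sub_const z
    have e2 := (fderiv ℝ v z).hasFDerivAt.comp y e1
    have e3 := ((secondDeriv v z).hasFDerivAt.comp y e1).clm_apply e1
    have e4 := (((hv y).hasFDerivAt.sub e2).sub (e3.const_mul (1 / 2)))
    refine e4.congr_fderiv ?_
    ext w
    simp only [_root_.sub_apply, ContinuousLinearMap.comp_apply,
      _root_.smul_apply, _root_.add_apply,
      ContinuousLinearMap.id_apply, ContinuousLinearMap.flip_apply, Function.comp, smul_eq_mul]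
    have := hsymm w (y - z)
    simp only [secondDeriv] at this ⊢
    linear_combination (-(1 / 2) : ℝ) * this
  have hmv := (convex_closedBall z ‖h‖).norm_image_sub_le_of_norm_hasFDerivWithin_le
    (f := F) (f' := fun y => fderiv ℝ v y - fderiv ℝ v z - secondDeriv v z (y - z))
    (C := η * ‖h‖) (fun y _ => (hF y).hasFDerivWithinAt) (fun y hy => ?_)
    (Metric.mem_closedBall_self (norm_nonneg h)) (y := z + h) (by simp)
  · have e : F (z + h) - F z =
        v (z + h) - v z - fderiv ℝ v z h - (1 / 2) * secondDeriv v z h h := by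
      simp [F]; ring
    rw [e, Real.norm_eq_abs, add_sub_cancel_left] at hmv
    calc _ ≤ _ := hmv
      _ = _ := by ring
  · have hy' : dist y z ≤ ‖h‖ := hy
    refine (hball (hy'.trans_lt hh)).trans ?_
    rw [← dist_eq_norm]
    exact mul_le_mul_of_nonneg_left hy' hη.le

theorem secondDeriv_self_le {v : E → ℝ} (hv : ContDiff ℝ 2 v) {z h : E} {C : ℝ}
    (hC : ∀ t : ℝ, v (z + t • h) + v (z - t • h) - 2 * v z ≤ C * t ^ 2) :
    secondDeriv v z h h ≤ C := by
  by_contra hlt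
  push Not at hlt
  have hd : ∀ y, DifferentiableAt ℝ v y := hv.differentiable (by norm_num)
  have hd2 : DifferentiableAt ℝ (fderiv ℝ v) z := contDiffAt_fderiv_differentiableAt hv.contDiffAt
  set c := secondDeriv v z h h - C with hc
  have hcpos : 0 < c := by linarith
  obtain ⟨r, hr, hT⟩ := taylor_two_isLittleO hd hd2 (η := c / (4 * (‖h‖ ^ 2 + 1))) (by positivity)
  obtain ⟨t, ht0, htr⟩ : ∃ t : ℝ, 0 < t ∧ t * ‖h‖ < r := by
    refine ⟨r / (‖h‖ + 1), by positivity, ?_⟩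
    rw [div_mul_eq_mul_div, div_lt_iff₀ (by positivity)]
    nlinarith [norm_nonneg h]
  have hn : ‖t • h‖ = t * ‖h‖ := by rw [norm_smul, Real.norm_eq_abs, abs_of_pos ht0]
  have h1 := hT (t • h) (by rw [hn]; exact htr)
  have h2 := hT (-(t • h)) (by rw [norm_neg, hn]; exact htr)
  rw [norm_neg] at h2
  simp only [map_neg, map_smul, _root_.neg_apply, _root_.smul_apply,
    smul_eq_mul, ← sub_eq_add_neg, hn] at h1 h2
  have h3 := hC t
  have h4 : c / (4 * (‖h‖ ^ 2 + 1)) * (t * ‖h‖) ^ 2 ≤ c * t ^ 2 / 4 := by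
    rw [div_mul_eq_mul_div, div_le_iff₀ (by positivity)]
    have : 0 ≤ c * t ^ 2 := by positivity
    nlinarith
  have h5 := (abs_le.1 h1).1
  have h6 := (abs_le.1 h2).1
  have h7 : 0 < t ^ 2 := by positivity
  have h8 : secondDeriv v z h h = c + C := by rw [hc]; ring
  simp only [secondDeriv] at h8
  rw [h8] at h5 h6
  nlinarith [mul_pos hcpos h7]

end SecondDeriv

section Levi

variable {n : ℕ}

/-- The `(1,1)`-part `¼ (H(a,b) + H(ia,ib) + i (H(a,ib) - H(ia,b)))` of a real bilinear form,
linear in `a` and conjugate-linear in `b`. -/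
noncomputable def leviForm (H : Cn n →L[ℝ] Cn n →L[ℝ] ℝ) (a b : Cn n) : ℂ :=
  (1 / 4 : ℂ) * ((H a b : ℂ) + (H (Complex.I • a) (Complex.I • b) : ℂ)
    + Complex.I * ((H a (Complex.I • b) : ℂ) - (H (Complex.I • a) b : ℂ)))

/-- The matrix of `leviForm` in the standard basis. -/
noncomputable def leviMatrix (H : Cn n →L[ℝ] Cn n →L[ℝ] ℝ) : CMat n :=
  Matrix.of fun j k => leviForm H (EuclideanSpace.single j 1) (EuclideanSpace.single k 1)

theorem I_smul_single (j : Fin n) :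
    Complex.I • (EuclideanSpace.single j (1 : ℂ) : Cn n) = EuclideanSpace.single j Complex.I := by
  ext i
  by_cases h : i = j
  · subst h; simp
  · simp [h]

theorem ddc_eq (v : Cn n → ℝ) (z : Cn n) : ddc v z = leviMatrix (secondDeriv v z) := by
  ext j k
  simp only [ddc, leviMatrix, leviForm, Matrix.of_apply, iteratedFDeriv_two_apply,
    I_smul_single]
  simp

theorem leviMatrix_add (H K : Cn n →L[ℝ] Cn n →L[ℝ] ℝ) :
    leviMatrix (H + K) = leviMatrix H + leviMatrix K := by
  ext j k
  simp only [leviMatrix, leviForm, Matrix.of_apply, Matrix.add_apply,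
    _root_.add_apply, Complex.ofReal_add]
  ring

theorem leviMatrix_smul (r : ℝ) (H : Cn n →L[ℝ] Cn n →L[ℝ] ℝ) :
    leviMatrix (r • H) = (r : ℂ) • leviMatrix H := by
  ext j k
  simp only [leviMatrix, leviForm, Matrix.of_apply, Matrix.smul_apply,
    _root_.smul_apply, smul_eq_mul, Complex.ofReal_mul]
  ring

theorem leviMatrix_zero : leviMatrix (0 : Cn n →L[ℝ] Cn n →L[ℝ] ℝ) = 0 := by
  ext j k
  simp [leviMatrix, leviForm]

theorem continuous_leviMatrix :
    Continuous fun H : Cn n →L[ℝ] Cn n →L[ℝ] ℝ => leviMatrix H := by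
  refine continuous_pi fun j => continuous_pi fun k => ?_
  simp only [leviMatrix, leviForm, Matrix.of_apply]
  fun_prop

theorem leviMatrix_isHermitian {H : Cn n →L[ℝ] Cn n →L[ℝ] ℝ} (hH : ∀ a b, H a b = H b a) :
    (leviMatrix H).IsHermitian := by
  ext j k
  simp only [leviMatrix, leviForm, Matrix.of_apply, Matrix.conjTranspose_apply, Complex.star_def,
    map_mul, map_add, map_sub, Complex.conj_ofReal, Complex.conj_I]
  rw [hH (EuclideanSpace.single k 1) (EuclideanSpace.single j 1),
    hH (Complex.I • EuclideanSpace.single k 1) (Complex.I • EuclideanSpace.single j 1),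
    hH (EuclideanSpace.single k 1) (Complex.I • EuclideanSpace.single j 1),
    hH (Complex.I • EuclideanSpace.single k 1) (EuclideanSpace.single j 1)]
  simp only [one_div, map_inv₀, map_ofNat]
  ring

theorem leviForm_add_left (H : Cn n →L[ℝ] Cn n →L[ℝ] ℝ) (a a' b : Cn n) :
    leviForm H (a + a') b = leviForm H a b + leviForm H a' b := by
  simp only [leviForm, smul_add, map_add, _root_.add_apply, Complex.ofReal_add]
  ring

theorem leviForm_add_right (H : Cn n →L[ℝ] Cn n →L[ℝ] ℝ) (a b b' : Cn n) :
    leviForm H a (b + b') = leviForm H a b + leviForm H a b' := by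
  simp only [leviForm, smul_add, map_add, Complex.ofReal_add]
  ring

theorem complex_smul_eq (c : ℂ) (a : Cn n) : c • a = c.re • a + c.im • (Complex.I • a) := by
  ext i
  simp only [PiLp.smul_apply, PiLp.add_apply, smul_eq_mul, Complex.real_smul]
  conv_lhs => rw [← Complex.re_add_im c]
  ring

theorem leviForm_smul_left (H : Cn n →L[ℝ] Cn n →L[ℝ] ℝ) (c : ℂ) (a b : Cn n) :
    leviForm H (c • a) b = c * leviForm H a b := by
  have hI : Complex.I • c • a = c.re • (Complex.I • a) - c.im • a := by
    rw [complex_smul_eq c a, smul_add, smul_comm Complex.I c.re, smul_comm Complex.I c.im,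
      smul_smul Complex.I Complex.I, Complex.I_mul_I]
    simp [sub_eq_add_neg]
  rw [leviForm, hI, complex_smul_eq c a, leviForm]
  simp only [map_add, map_sub, map_smul, _root_.add_apply,
    _root_.sub_apply, _root_.smul_apply, smul_eq_mul,
    Complex.ofReal_add, Complex.ofReal_sub, Complex.ofReal_mul]
  conv_rhs => rw [← Complex.re_add_im c]
  linear_combination (-(1 / 4 : ℂ)) * c.im * (H a (Complex.I • b) - H (Complex.I • a) b) *
    Complex.I_sq

theorem leviForm_smul_right (H : Cn n →L[ℝ] Cn n →L[ℝ] ℝ) (c : ℂ) (a b : Cn n) :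
    leviForm H a (c • b) = (starRingEnd ℂ) c * leviForm H a b := by
  have hI : Complex.I • c • b = c.re • (Complex.I • b) - c.im • b := by
    rw [complex_smul_eq c b, smul_add, smul_comm Complex.I c.re, smul_comm Complex.I c.im,
      smul_smul Complex.I Complex.I, Complex.I_mul_I]
    simp [sub_eq_add_neg]
  rw [leviForm, hI, complex_smul_eq c b, leviForm]
  simp only [map_add, map_sub, map_smul, smul_eq_mul,
    Complex.ofReal_add, Complex.ofReal_sub, Complex.ofReal_mul]
  have hc : (starRingEnd ℂ) c = c.re - c.im * Complex.I := by
    apply Complex.ext <;> simp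
  rw [hc]
  linear_combination ((1 / 4 : ℂ)) * c.im * (H a (Complex.I • b) - H (Complex.I • a) b) *
    Complex.I_sq

theorem leviForm_sum_left {ι : Type*} (s : Finset ι) (H : Cn n →L[ℝ] Cn n →L[ℝ] ℝ)
    (f : ι → Cn n) (b : Cn n) : leviForm H (∑ i ∈ s, f i) b = ∑ i ∈ s, leviForm H (f i) b := by
  classical
  induction s using Finset.induction_on with
  | empty => simp [leviForm]
  | insert i s hi ih => rw [Finset.sum_insert hi, Finset.sum_insert hi, leviForm_add_left, ih]

theorem leviForm_sum_right {ι : Type*} (s : Finset ι) (H : Cn n →L[ℝ] Cn n →L[ℝ] ℝ)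
    (f : ι → Cn n) (b : Cn n) : leviForm H b (∑ i ∈ s, f i) = ∑ i ∈ s, leviForm H b (f i) := by
  classical
  induction s using Finset.induction_on with
  | empty => simp [leviForm]
  | insert i s hi ih => rw [Finset.sum_insert hi, Finset.sum_insert hi, leviForm_add_right, ih]

theorem sum_smul_single (x : Fin n → ℂ) :
    (WithLp.toLp 2 x : Cn n) = ∑ j, x j • (EuclideanSpace.single j (1 : ℂ) : Cn n) := by
  ext i
  simp [Finset.sum_apply, Pi.single_apply]

/-- The quadratic form of the Levi matrix. -/
theorem leviMatrix_quadratic (H : Cn n →L[ℝ] Cn n →L[ℝ] ℝ) (x : Fin n → ℂ) :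
    (star x ⬝ᵥ (leviMatrix H).mulVec x).re =
      (1 / 4) * (H (WithLp.toLp 2 (star x)) (WithLp.toLp 2 (star x)) +
        H (Complex.I • WithLp.toLp 2 (star x)) (Complex.I • WithLp.toLp 2 (star x))) := by
  have h1 : star x ⬝ᵥ (leviMatrix H).mulVec x =
      leviForm H (WithLp.toLp 2 (star x)) (WithLp.toLp 2 (star x)) := by
    rw [sum_smul_single, leviForm_sum_left]
    simp only [dotProduct, Matrix.mulVec, leviForm_sum_right, leviForm_smul_left,
      leviForm_smul_right, leviMatrix, Matrix.of_apply, Finset.mul_sum, Pi.star_apply,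
      Complex.star_def, Complex.conj_conj]
    refine Finset.sum_congr rfl fun j _ => Finset.sum_congr rfl fun k _ => ?_
    ring
  rw [h1, leviForm]
  generalize H _ _ = p
  generalize H (Complex.I • _) (Complex.I • _) = q
  generalize H _ (Complex.I • _) = r
  generalize H (Complex.I • _) _ = s
  have : ((1 / 4 : ℂ) * ((p : ℂ) + (q : ℂ) + Complex.I * ((r : ℂ) - (s : ℂ)))) =
      (((1 / 4) * (p + q) : ℝ) : ℂ) + (((1 / 4) * (r - s) : ℝ) : ℂ) * Complex.I := by
    push_cast; ring
  rw [this]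
  simp

theorem mPos_leviMatrix_of_nonneg {H : Cn n →L[ℝ] Cn n →L[ℝ] ℝ} (hH : ∀ a b, H a b = H b a)
    (h0 : ∀ a, 0 ≤ H a a) (m : ℕ) : MPos m (leviMatrix H) := by
  refine mPos_of_posSemidef (leviMatrix_isHermitian hH) (fun v => ?_) m
  rw [leviMatrix_quadratic]
  have h1 := h0 (WithLp.toLp 2 (star v))
  have h2 := h0 (Complex.I • WithLp.toLp 2 (star v))
  linarith

theorem secondDeriv_norm_sq (c z a b : Cn n) :
    secondDeriv (fun y : Cn n => ‖y - c‖ ^ 2) z a b = 2 * inner ℝ a b := by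
  have h := secondDeriv_comp_add (fun y : Cn n => ‖y‖ ^ 2) (-c) z
  simp only [← sub_eq_add_neg] at h
  rw [h, secondDeriv, fderiv_norm_sq, show (2 • ⇑(innerSL ℝ (E := Cn n)) : Cn n → _) =
    ⇑((2 : ℕ) • innerSL ℝ (E := Cn n)) from rfl, ContinuousLinearMap.fderiv]
  simp
  rfl

theorem real_inner_single (j k : Fin n) (p q : ℂ) :
    inner ℝ (EuclideanSpace.single j p : Cn n) (EuclideanSpace.single k q : Cn n) =
      if j = k then p.re * q.re + p.im * q.im else 0 := by
  rw [PiLp.inner_apply, Finset.sum_eq_single j]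
  · by_cases h : j = k
    · subst h
      simp [Complex.inner]
      ring
    · simp [h]
  · intro i _ hi
    simp [hi]
  · simp

theorem ddc_norm_sq (c z : Cn n) : ddc (fun y : Cn n => ‖y - c‖ ^ 2) z = 1 := by
  rw [ddc_eq]
  ext j k
  simp only [leviMatrix, leviForm, Matrix.of_apply, secondDeriv_norm_sq, real_inner_single,
    I_smul_single]
  by_cases h : j = k
  · subst h
    simp
    norm_num
  · simp [h]

end Levi

/-! ### Smooth `m`-subharmonic functions -/

section Smooth

theorem two_le_infty : (2 : WithTop ℕ∞) ≤ ∞ := by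
  exact WithTop.coe_le_coe.2 (le_top : (2 : ℕ∞) ≤ ⊤)

variable {n : ℕ}

theorem ddc_isHermitian {v : Cn n → ℝ} {z : Cn n} (hv : ContDiffAt ℝ 2 v z) :
    (ddc v z).IsHermitian := by
  rw [ddc_eq]
  exact leviMatrix_isHermitian fun a b => hv.isSymmSndFDerivAt (by simp) a b

theorem ddc_congr {v w : Cn n → ℝ} {z : Cn n} (h : v =ᶠ[𝓝 z] w) : ddc v z = ddc w z := by
  rw [ddc_eq, ddc_eq, secondDeriv_congr h]

theorem ddc_add {v w : Cn n → ℝ} {z : Cn n} (hv : ContDiffAt ℝ 2 v z) (hw : ContDiffAt ℝ 2 w z) :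
    ddc (fun y => v y + w y) z = ddc v z + ddc w z := by
  rw [ddc_eq, ddc_eq, ddc_eq, secondDeriv_add hv hw, leviMatrix_add]

theorem ddc_const_mul {v : Cn n → ℝ} {z : Cn n} (hv : ContDiffAt ℝ 2 v z) (r : ℝ) :
    ddc (fun y => r * v y) z = (r : ℂ) • ddc v z := by
  rw [ddc_eq, ddc_eq, secondDeriv_const_mul hv, leviMatrix_smul]

theorem ddc_sub {v w : Cn n → ℝ} {z : Cn n} (hv : ContDiffAt ℝ 2 v z) (hw : ContDiffAt ℝ 2 w z) :
    ddc (fun y => v y - w y) z = ddc v z - ddc w z := by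
  have h1 : (fun y => v y - w y) = fun y => v y + (-1) * w y := by ext; ring
  rw [h1, ddc_add hv (contDiffAt_const.mul hw), ddc_const_mul hw]
  simp [sub_eq_add_neg]

theorem ddc_comp_add (v : Cn n → ℝ) (h z : Cn n) :
    ddc (fun y => v (y + h)) z = ddc v (z + h) := by
  rw [ddc_eq, ddc_eq, secondDeriv_comp_add]

theorem ddc_affine (L : Cn n →L[ℝ] ℝ) (r : ℝ) (z : Cn n) : ddc (fun y => L y + r) z = 0 := by
  rw [ddc_eq, secondDeriv_affine, leviMatrix_zero]

theorem ddc_const (r : ℝ) (z : Cn n) : ddc (fun _ : Cn n => r) z = 0 := by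
  simpa using ddc_affine (0 : Cn n →L[ℝ] ℝ) r z

theorem ddc_add_const {v : Cn n → ℝ} {z : Cn n} (hv : ContDiffAt ℝ 2 v z) (r : ℝ) :
    ddc (fun y => v y + r) z = ddc v z := by
  rw [ddc_add hv contDiffAt_const, ddc_const, add_zero]

/-- `v` is smooth near `z` and its Levi matrix at `z` lies in the closed cone. -/
def MSHAt (m : ℕ) (v : Cn n → ℝ) (z : Cn n) : Prop :=
  ContDiffAt ℝ ∞ v z ∧ MPos m (ddc v z)

variable {m : ℕ} {v w : Cn n → ℝ} {z : Cn n}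

theorem MSHAt.contDiffAt_two (h : MSHAt m v z) : ContDiffAt ℝ 2 v z :=
  h.1.of_le two_le_infty

theorem MSHAt.congr (hv : MSHAt m v z) (h : w =ᶠ[𝓝 z] v) : MSHAt m w z :=
  ⟨hv.1.congr_of_eventuallyEq h, by rw [ddc_congr h]; exact hv.2⟩

theorem MSHAt.add (hv : MSHAt m v z) (hw : MSHAt m w z) : MSHAt m (fun y => v y + w y) z :=
  ⟨hv.1.add hw.1, by
    rw [ddc_add hv.contDiffAt_two hw.contDiffAt_two]; exact hv.2.add hw.2⟩

theorem MSHAt.const_mul (hm : m ≤ n) (hv : MSHAt m v z) {r : ℝ} (hr : 0 ≤ r) :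
    MSHAt m (fun y => r * v y) z :=
  ⟨contDiffAt_const.mul hv.1, by
    rw [ddc_const_mul hv.contDiffAt_two]; exact hv.2.smul hm hr⟩

theorem mPos_zero (m : ℕ) : MPos m (0 : CMat n) :=
  mPos_of_posSemidef Matrix.isHermitian_zero (by simp) m

theorem mshAt_affine (L : Cn n →L[ℝ] ℝ) (r : ℝ) (z : Cn n) : MSHAt m (fun y => L y + r) z :=
  ⟨(L.contDiff.add contDiff_const).contDiffAt, by rw [ddc_affine]; exact mPos_zero m⟩

theorem mshAt_const (r : ℝ) (z : Cn n) : MSHAt m (fun _ => r) z :=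
  ⟨contDiffAt_const, by rw [ddc_const]; exact mPos_zero m⟩

theorem MSHAt.add_const (hv : MSHAt m v z) (r : ℝ) : MSHAt m (fun y => v y + r) z :=
  hv.add (mshAt_const r z)

theorem mshAt_norm_sq (c z : Cn n) : MSHAt m (fun y => ‖y - c‖ ^ 2) z :=
  ⟨((contDiff_id.sub contDiff_const).norm_sq ℝ).contDiffAt, by
    rw [ddc_norm_sq]; exact mPos_one m⟩

theorem MSHAt.comp_add {h : Cn n} (hv : MSHAt m v (z + h)) : MSHAt m (fun y => v (y + h)) z :=
  ⟨ContDiffAt.comp (g := v) (f := fun y => y + h) z hv.1 (contDiff_id.add contDiff_const).contDiffAt, by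
    rw [ddc_comp_add]; exact hv.2⟩

/-- A smooth convex nondecreasing function with slope in `[0, 1]`, equal to `0` on `(-∞, -η]` and
of slope `1` on `[0, ∞)`. -/
noncomputable def softRamp (η x : ℝ) : ℝ :=
  η * ∫ s in (-1)..(x / η), Real.smoothTransition (s + 1)

theorem softRamp_hasDerivAt {η : ℝ} (hη : 0 < η) (x : ℝ) :
    HasDerivAt (softRamp η) (Real.smoothTransition (x / η + 1)) x := by
  have hc : Continuous fun s : ℝ => Real.smoothTransition (s + 1) :=
    Real.smoothTransition.continuous.comp (by fun_prop)
  have h1 : HasDerivAt (fun y : ℝ => ∫ s in (-1)..y, Real.smoothTransition (s + 1))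
      (Real.smoothTransition (x / η + 1)) (x / η) :=
    intervalIntegral.integral_hasDerivAt_right (hc.intervalIntegrable _ _)
      hc.stronglyMeasurable.stronglyMeasurableAtFilter hc.continuousAt
  have h2 : HasDerivAt (fun y : ℝ => y / η) (1 / η) x := (hasDerivAt_id x).div_const η
  have h3 : HasDerivAt (softRamp η) (η * (Real.smoothTransition (x / η + 1) * (1 / η))) x :=
    (HasDerivAt.comp (h₂ := fun y : ℝ => ∫ s in (-1)..y, Real.smoothTransition (s + 1))
      (h := fun y : ℝ => y / η) x h1 h2).const_mul η
  rwa [mul_one_div, mul_div_cancel₀ _ hη.ne'] at h3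

theorem softRamp_deriv {η : ℝ} (hη : 0 < η) :
    deriv (softRamp η) = fun x => Real.smoothTransition (x / η + 1) :=
  funext fun x => (softRamp_hasDerivAt hη x).deriv

theorem softRamp_contDiff {η : ℝ} (hη : 0 < η) : ContDiff ℝ ∞ (softRamp η) := by
  rw [contDiff_infty_iff_deriv]
  refine ⟨fun x => (softRamp_hasDerivAt hη x).differentiableAt, ?_⟩
  rw [softRamp_deriv hη]
  exact Real.smoothTransition.contDiff.comp (by fun_prop)

theorem softRamp_deriv_deriv_nonneg {η : ℝ} (hη : 0 < η) (x : ℝ) :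
    0 ≤ deriv (deriv (softRamp η)) x := by
  rw [softRamp_deriv hη]
  refine Monotone.deriv_nonneg fun a b hab => Real.smoothTransition.monotone ?_
  gcongr

theorem softRamp_mono {η : ℝ} (hη : 0 < η) : Monotone (softRamp η) :=
  monotone_of_deriv_nonneg (fun x => (softRamp_hasDerivAt hη x).differentiableAt) fun x => by
    rw [softRamp_deriv hη]; exact Real.smoothTransition.nonneg _

theorem softRamp_of_le {η : ℝ} (hη : 0 < η) {x : ℝ} (hx : x ≤ -η) : softRamp η x = 0 := by
  have h1 : ∀ y ≤ -η, deriv (softRamp η) y = 0 := by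
    intro y hy
    rw [softRamp_deriv hη]
    apply Real.smoothTransition.zero_of_nonpos
    have : y / η ≤ -1 := by rw [div_le_iff₀ hη]; linarith
    linarith
  have h2 : softRamp η (-η) = 0 := by
    rw [softRamp, neg_div, div_self hη.ne', intervalIntegral.integral_same, mul_zero]
  rcases hx.eq_or_lt with rfl | hlt
  · exact h2
  · obtain ⟨c, hc, hc2⟩ := exists_deriv_eq_slope (softRamp η) hlt
      (softRamp_contDiff hη).continuous.continuousOn
      fun y _ => (softRamp_hasDerivAt hη y).differentiableAt.differentiableWithinAt
    rw [h1 c hc.2.le, h2, eq_comm, div_eq_zero_iff] at hc2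
    rcases hc2 with h | h <;> linarith

theorem softRamp_nonneg {η : ℝ} (hη : 0 < η) (x : ℝ) : 0 ≤ softRamp η x := by
  rw [← softRamp_of_le hη (x := min x (-η)) (min_le_right _ _)]
  exact softRamp_mono hη (min_le_left _ _)

theorem softRamp_of_nonneg {η : ℝ} (hη : 0 < η) {x : ℝ} (hx : 0 ≤ x) :
    softRamp η x = x + softRamp η 0 := by
  rcases hx.eq_or_lt with rfl | hlt
  · simp
  · obtain ⟨c, hc, hc2⟩ := exists_deriv_eq_slope (softRamp η) hlt
      (softRamp_contDiff hη).continuous.continuousOn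
      fun y _ => (softRamp_hasDerivAt hη y).differentiableAt.differentiableWithinAt
    rw [softRamp_deriv hη] at hc2
    simp only at hc2
    rw [Real.smoothTransition.one_of_one_le (by
      have : 0 ≤ c / η := div_nonneg hc.1.le hη.le
      linarith), eq_comm, div_eq_iff (by linarith)] at hc2
    linarith

theorem softRamp_zero_le {η : ℝ} (hη : 0 < η) : softRamp η 0 ≤ η := by
  obtain ⟨c, hc, hc2⟩ := exists_deriv_eq_slope (softRamp η) (show -η < 0 by linarith)
    (softRamp_contDiff hη).continuous.continuousOn
    fun y _ => (softRamp_hasDerivAt hη y).differentiableAt.differentiableWithinAt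
  rw [softRamp_deriv hη, softRamp_of_le hη le_rfl, eq_comm, div_eq_iff (by linarith)] at hc2
  have := Real.smoothTransition.le_one (c / η + 1)
  nlinarith

theorem max_le_softRamp {η : ℝ} (hη : 0 < η) (x : ℝ) : max x 0 ≤ softRamp η x := by
  refine max_le ?_ (softRamp_nonneg hη x)
  rcases le_total 0 x with h | h
  · rw [softRamp_of_nonneg hη h]
    linarith [softRamp_nonneg hη 0]
  · exact h.trans (softRamp_nonneg hη x)

theorem softRamp_le {η : ℝ} (hη : 0 < η) (x : ℝ) : softRamp η x ≤ max x 0 + η := by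
  have := softRamp_zero_le hη
  rcases le_total 0 x with h | h
  · rw [softRamp_of_nonneg hη h, max_eq_left h]; linarith
  · rw [max_eq_right h, zero_add]; exact (softRamp_mono hη h).trans this

/-- A smooth version of `max v w`, equal to `w` where `v ≤ w - η`. -/
noncomputable def regMax (η : ℝ) (v w : Cn n → ℝ) (z : Cn n) : ℝ :=
  w z + softRamp η (v z - w z)

theorem max_le_regMax {η : ℝ} (hη : 0 < η) : max (v z) (w z) ≤ regMax η v w z := by
  have := max_le_softRamp hη (v z - w z)
  have h2 : max (v z) (w z) = w z + max (v z - w z) 0 := by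
    rw [← max_add_add_left]; simp
  rw [h2, regMax]; linarith

theorem regMax_le {η : ℝ} (hη : 0 < η) : regMax η v w z ≤ max (v z) (w z) + η := by
  have := softRamp_le hη (v z - w z)
  have h2 : max (v z) (w z) = w z + max (v z - w z) 0 := by
    rw [← max_add_add_left]; simp
  rw [h2, regMax]; linarith

theorem regMax_eq_right {η : ℝ} (hη : 0 < η) (h : v z ≤ w z - η) : regMax η v w z = w z := by
  rw [regMax, softRamp_of_le hη (by linarith), add_zero]

theorem MSHAt.regMax (hm : m ≤ n) {η : ℝ} (hη : 0 < η) (hv : MSHAt m v z) (hw : MSHAt m w z) :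
    MSHAt m (regMax η v w) z := by
  have hu : ContDiffAt ℝ ∞ (fun y => v y - w y) z := hv.1.sub hw.1
  have hu2 : ContDiffAt ℝ 2 (fun y => v y - w y) z := hu.of_le two_le_infty
  have hg : ContDiffAt ℝ ∞ (fun y => softRamp η (v y - w y)) z :=
    (softRamp_contDiff hη).contDiffAt.comp z hu
  have hg2 : ContDiffAt ℝ 2 (softRamp η) (v z - w z) :=
    (softRamp_contDiff hη).contDiffAt.of_le two_le_infty
  refine ⟨hw.1.add hg, ?_⟩
  set u : Cn n → ℝ := fun y => v y - w y with hudef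
  set g1 := deriv (softRamp η) (u z) with hg1
  set g2 := deriv (deriv (softRamp η)) (u z) with hg2def
  let R : Cn n →L[ℝ] Cn n →L[ℝ] ℝ := (fderiv ℝ u z).smulRight (fderiv ℝ u z)
  have hR : ∀ a b, R a b = fderiv ℝ u z a * fderiv ℝ u z b := fun a b => by simp [R]
  have hRpos : MPos m (leviMatrix R) :=
    mPos_leviMatrix_of_nonneg (fun a b => by rw [hR, hR, mul_comm])
      (fun a => by rw [hR]; exact mul_self_nonneg _) m
  have h1 : secondDeriv (fun y => softRamp η (u y)) z = g1 • secondDeriv u z + g2 • R := by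
    ext a b
    rw [secondDeriv_comp ((softRamp_contDiff hη).of_le two_le_infty) hu2]
    simp only [_root_.add_apply, _root_.smul_apply, smul_eq_mul, hR]
    ring
  have h2 : ddc (_root_.regMax η v w) z =
      ((1 - g1 : ℝ) : ℂ) • ddc w z + (g1 : ℂ) • ddc v z + (g2 : ℂ) • leviMatrix R := by
    have e1 : ddc (_root_.regMax η v w) z = ddc w z + ddc (fun y => softRamp η (u y)) z :=
      ddc_add hw.contDiffAt_two (hg.of_le two_le_infty)
    have e2 : ddc u z = ddc v z - ddc w z := ddc_sub hv.contDiffAt_two hw.contDiffAt_two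
    have e3 : ddc (fun y => softRamp η (u y)) z = (g1 : ℂ) • ddc u z + (g2 : ℂ) • leviMatrix R := by
      rw [ddc_eq, ddc_eq, h1, leviMatrix_add, leviMatrix_smul, leviMatrix_smul]
    rw [e1, e3, e2, smul_sub, Complex.ofReal_sub, sub_smul, Complex.ofReal_one, one_smul]
    abel
  rw [h2]
  have hg1' : g1 = Real.smoothTransition (u z / η + 1) := by rw [hg1, softRamp_deriv hη]
  have h0 : 0 ≤ g1 := hg1' ▸ Real.smoothTransition.nonneg _
  have h1' : g1 ≤ 1 := hg1' ▸ Real.smoothTransition.le_one _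
  exact ((hw.2.smul hm (by linarith)).add (hv.2.smul hm h0)).add
    (hRpos.smul hm (softRamp_deriv_deriv_nonneg hη _))

theorem isC2MSubharmonicOn_of_mshAt {D : Set (Cn n)} (h : ∀ z ∈ D, MSHAt m v z) :
    IsC2MSubharmonicOn m D v :=
  ⟨fun z hz => (h z hz).contDiffAt_two.contDiffWithinAt, fun k _ hk z hz => (h z hz).2.2 k hk⟩

theorem IsC2MSubharmonicOn.mPos {D : Set (Cn n)} (hD : IsOpen D) (h : IsC2MSubharmonicOn m D v)
    (hz : z ∈ D) : MPos m (ddc v z) := by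
  have hc : ContDiffAt ℝ 2 v z := (h.1 z hz).contDiffAt (hD.mem_nhds hz)
  refine ⟨ddc_isHermitian hc, fun k hk => ?_⟩
  rcases Nat.eq_zero_or_pos k with rfl | hk0
  · rw [sigmaForm_zero]; positivity
  · exact h.2 k hk0 hk z hz

end Smooth

/-! ### Integration by parts for mixed Hessians -/

section Wirtinger

variable {n : ℕ}

/-- `½ (∂/∂x_j + s ∂/∂y_j)`: for `s = -i` this is `∂/∂z_j`, for `s = i` it is `∂/∂z̄_j`. -/
noncomputable def wirtinger (s : ℂ) (j : Fin n) (f : Cn n → ℂ) (z : Cn n) : ℂ :=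
  (1 / 2 : ℂ) * (fderiv ℝ f z (EuclideanSpace.single j 1) +
    s * fderiv ℝ f z (EuclideanSpace.single j Complex.I))

theorem contDiff_fderiv_apply {f : Cn n → ℂ} (hf : ContDiff ℝ ∞ f) (a : Cn n) :
    ContDiff ℝ ∞ fun z => fderiv ℝ f z a :=
  (hf.fderiv_right (m := ∞) (by simp)).clm_apply contDiff_const

theorem contDiff_wirtinger {f : Cn n → ℂ} (hf : ContDiff ℝ ∞ f) (s : ℂ) (j : Fin n) :
    ContDiff ℝ ∞ (wirtinger s j f) :=
  contDiff_const.mul ((contDiff_fderiv_apply hf _).add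
    (contDiff_const.mul (contDiff_fderiv_apply hf _)))

theorem hasCompactSupport_wirtinger {f : Cn n → ℂ} (hf : HasCompactSupport f) (s : ℂ)
    (j : Fin n) : HasCompactSupport (wirtinger s j f) := by
  refine (hf.fderiv ℝ).mono ?_
  intro z hz
  contrapose! hz
  rw [Function.notMem_support] at hz ⊢
  simp [wirtinger, hz]

theorem fderiv_fderiv_apply_comm {f : Cn n → ℂ} (hf : ContDiff ℝ ∞ f) (a b z : Cn n) :
    fderiv ℝ (fun y => fderiv ℝ f y a) z b = fderiv ℝ (fun y => fderiv ℝ f y b) z a := by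
  have hd : DifferentiableAt ℝ (fderiv ℝ f) z :=
    (hf.fderiv_right (m := ∞) (by simp)).differentiable (by simp) z
  rw [fderiv_clm_apply hd (differentiableAt_const a), fderiv_clm_apply hd (differentiableAt_const b)]
  simp only [fderiv_fun_const, Pi.zero_apply, ContinuousLinearMap.comp_zero, zero_add,
    ContinuousLinearMap.flip_apply]
  exact (hf.contDiffAt (x := z)).isSymmSndFDerivAt (by simp [two_le_infty]) b a

theorem wirtinger_comm {f : Cn n → ℂ} (hf : ContDiff ℝ ∞ f) (s t : ℂ) (j k : Fin n) (z : Cn n) :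
    wirtinger s j (wirtinger t k f) z = wirtinger t k (wirtinger s j f) z := by
  have key : ∀ (s : ℂ) (j : Fin n) (a : Cn n), fderiv ℝ (wirtinger s j f) z a =
      (1 / 2 : ℂ) * (fderiv ℝ (fun y => fderiv ℝ f y (EuclideanSpace.single j 1)) z a +
        s * fderiv ℝ (fun y => fderiv ℝ f y (EuclideanSpace.single j Complex.I)) z a) := by
    intro s j a
    have h1 := ((contDiff_fderiv_apply hf (EuclideanSpace.single j 1)).differentiable
      (by simp) z)
    have h2 := ((contDiff_fderiv_apply hf (EuclideanSpace.single j Complex.I)).differentiable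
      (by simp) z)
    have h3 := ((h1.hasFDerivAt.add (h2.hasFDerivAt.const_mul s)).const_mul (1 / 2 : ℂ))
    have h4 : HasFDerivAt (wirtinger s j f) _ z := h3
    rw [h4.fderiv]
    simp
    ring
  rw [wirtinger, key, key, wirtinger, key, key]
  rw [fderiv_fderiv_apply_comm hf (EuclideanSpace.single k 1) (EuclideanSpace.single j 1),
    fderiv_fderiv_apply_comm hf (EuclideanSpace.single k 1) (EuclideanSpace.single j Complex.I),
    fderiv_fderiv_apply_comm hf (EuclideanSpace.single k Complex.I) (EuclideanSpace.single j 1),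
    fderiv_fderiv_apply_comm hf (EuclideanSpace.single k Complex.I)
      (EuclideanSpace.single j Complex.I)]
  ring

theorem wirtinger_mul {f g : Cn n → ℂ} (hf : ContDiff ℝ ∞ f) (hg : ContDiff ℝ ∞ g) (s : ℂ)
    (j : Fin n) (z : Cn n) : wirtinger s j (fun y => f y * g y) z =
      wirtinger s j f z * g z + f z * wirtinger s j g z := by
  have h : fderiv ℝ (fun y => f y * g y) z = _ :=
    fderiv_fun_mul (hf.differentiable (by simp) z) (hg.differentiable (by simp) z)
  simp only [wirtinger, h, _root_.add_apply, _root_.smul_apply, smul_eq_mul]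
  ring

theorem wirtinger_prod {ι : Type*} [DecidableEq ι] (t : Finset ι) {f : ι → Cn n → ℂ}
    (hf : ∀ i, ContDiff ℝ ∞ (f i)) (s : ℂ) (j : Fin n) (z : Cn n) :
    wirtinger s j (fun y => ∏ i ∈ t, f i y) z =
      ∑ i ∈ t, wirtinger s j (f i) z * ∏ k ∈ t.erase i, f k z := by
  induction t using Finset.induction_on with
  | empty => simp [wirtinger]
  | insert i t hi ih =>
    simp only [Finset.prod_insert hi]
    rw [wirtinger_mul (hf i) (contDiff_prod fun i _ => hf i), ih, Finset.sum_insert hi,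
      Finset.erase_insert hi, Finset.mul_sum]
    congr 1
    refine Finset.sum_congr rfl fun k hk => ?_
    have hki : i ≠ k := fun h => hi (h ▸ hk)
    rw [Finset.erase_insert_of_ne hki, Finset.prod_insert (fun h => hi (Finset.mem_of_mem_erase h))]
    ring

theorem integral_mul_wirtinger {F G : Cn n → ℂ} (hF : ContDiff ℝ ∞ F) (hG : ContDiff ℝ ∞ G)
    (hGc : HasCompactSupport G) (s : ℂ) (j : Fin n) :
    ∫ z, F z * wirtinger s j G z = -∫ z, wirtinger s j F z * G z := by
  have key : ∀ a : Cn n, ∫ z, F z * fderiv ℝ G z a = -∫ z, fderiv ℝ F z a * G z := by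
    intro a
    refine integral_mul_fderiv_eq_neg_fderiv_mul_of_integrable ?_ ?_ ?_
      (fun x _ => hF.differentiable (by simp) x) fun x _ => hG.differentiable (by simp) x
    · exact ((contDiff_fderiv_apply hF a).continuous.mul hG.continuous).integrable_of_hasCompactSupport
        hGc.mul_left
    · exact (hF.continuous.mul (contDiff_fderiv_apply hG a).continuous).integrable_of_hasCompactSupport
        (hGc.fderiv_apply ℝ a).mul_left
    · exact (hF.continuous.mul hG.continuous).integrable_of_hasCompactSupport hGc.mul_left
  have hi1 : ∀ a : Cn n, Integrable fun z => F z * fderiv ℝ G z a := fun a =>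
    (hF.continuous.mul (contDiff_fderiv_apply hG a).continuous).integrable_of_hasCompactSupport
        (hGc.fderiv_apply ℝ a).mul_left
  have hi2 : ∀ a : Cn n, Integrable fun z => fderiv ℝ F z a * G z := fun a =>
    ((contDiff_fderiv_apply hF a).continuous.mul hG.continuous).integrable_of_hasCompactSupport
        hGc.mul_left
  have e1 : ∀ z, F z * wirtinger s j G z = (1 / 2 : ℂ) * (F z * fderiv ℝ G z (EuclideanSpace.single j 1)) +
      (s / 2) * (F z * fderiv ℝ G z (EuclideanSpace.single j Complex.I)) := by
    intro z; rw [wirtinger]; ring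
  have e2 : ∀ z, wirtinger s j F z * G z = (1 / 2 : ℂ) * (fderiv ℝ F z (EuclideanSpace.single j 1) * G z) +
      (s / 2) * (fderiv ℝ F z (EuclideanSpace.single j Complex.I) * G z) := by
    intro z; rw [wirtinger]; ring
  simp only [e1, e2]
  rw [integral_add ((hi1 _).const_mul _) ((hi1 _).const_mul _),
    integral_add ((hi2 _).const_mul _) ((hi2 _).const_mul _), integral_const_mul, integral_const_mul,
    integral_const_mul, integral_const_mul, key, key]
  ring

/-- Antisymmetrization kills the terms with a repeated derivative: the mixed form is closed. -/
theorem sum_sign_wirtinger_prod_eq_zero {h : Fin n → Cn n → ℂ} (hh : ∀ l, ContDiff ℝ ∞ (h l))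
    (s : ℂ) (i : Fin n) (z : Cn n) :
    ∑ σ : Equiv.Perm (Fin n), ((Equiv.Perm.sign σ : ℤ) : ℂ) * wirtinger s (σ i)
      (fun y => ∏ l ∈ Finset.univ.erase i, wirtinger s (σ l) (h l) y) z = 0 := by
  have e1 : ∀ σ : Equiv.Perm (Fin n), wirtinger s (σ i)
      (fun y => ∏ l ∈ Finset.univ.erase i, wirtinger s (σ l) (h l) y) z =
      ∑ k ∈ Finset.univ.erase i, wirtinger s (σ i) (wirtinger s (σ k) (h k)) z *
        ∏ l ∈ (Finset.univ.erase i).erase k, wirtinger s (σ l) (h l) z := fun σ =>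
    wirtinger_prod _ (fun l => contDiff_wirtinger (hh l) s (σ l)) s (σ i) z
  simp only [e1, Finset.mul_sum]
  rw [Finset.sum_comm]
  refine Finset.sum_eq_zero fun k hk => ?_
  have hki : k ≠ i := Finset.ne_of_mem_erase hk
  set X : Equiv.Perm (Fin n) → ℂ := fun σ => ((Equiv.Perm.sign σ : ℤ) : ℂ) *
    (wirtinger s (σ i) (wirtinger s (σ k) (h k)) z *
        ∏ l ∈ (Finset.univ.erase i).erase k, wirtinger s (σ l) (h l) z) with hX
  have hneg : ∀ σ, X (σ * Equiv.swap i k) = -X σ := by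
    intro σ
    simp only [hX, Equiv.Perm.sign_mul, Equiv.Perm.sign_swap (Ne.symm hki), Equiv.Perm.coe_mul,
      Function.comp, Equiv.swap_apply_left, Equiv.swap_apply_right]
    rw [wirtinger_comm (hh k) s s (σ k) (σ i)]
    have : ∏ l ∈ (Finset.univ.erase i).erase k, wirtinger s (σ (Equiv.swap i k l)) (h l) z =
        ∏ l ∈ (Finset.univ.erase i).erase k, wirtinger s (σ l) (h l) z := by
      refine Finset.prod_congr rfl fun l hl => ?_
      have h1 := Finset.ne_of_mem_erase hl
      have h2 := Finset.ne_of_mem_erase (Finset.mem_of_mem_erase hl)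
      rw [Equiv.swap_apply_of_ne_of_ne h2 h1]
    rw [this]
    push_cast
    ring
  have h1 : ∑ σ, X σ = -∑ σ, X σ := by
    conv_lhs => rw [← Equiv.sum_comp (Equiv.mulRight (Equiv.swap i k))]
    simp only [Equiv.coe_mulRight, hneg, Finset.sum_neg_distrib]
  exact self_eq_neg.1 h1

theorem sum_sign_integral_wirtinger {h : Fin n → Cn n → ℂ} (hh : ∀ l, ContDiff ℝ ∞ (h l))
    {F G : Cn n → ℂ} (hF : ContDiff ℝ ∞ F) (hG : ContDiff ℝ ∞ G) (hGc : HasCompactSupport G)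
    (s : ℂ) (i : Fin n) :
    ∑ σ : Equiv.Perm (Fin n), ((Equiv.Perm.sign σ : ℤ) : ℂ) * ∫ z, F z *
      (∏ l ∈ Finset.univ.erase i, wirtinger s (σ l) (h l) z) * wirtinger s (σ i) G z =
    -∑ σ : Equiv.Perm (Fin n), ((Equiv.Perm.sign σ : ℤ) : ℂ) * ∫ z, wirtinger s (σ i) F z *
      (∏ l ∈ Finset.univ.erase i, wirtinger s (σ l) (h l) z) * G z := by
  have hP : ∀ σ : Equiv.Perm (Fin n), ContDiff ℝ ∞ fun z =>
      ∏ l ∈ Finset.univ.erase i, wirtinger s (σ l) (h l) z := fun σ =>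
    contDiff_prod fun l _ => contDiff_wirtinger (hh l) s (σ l)
  have hi1 : ∀ σ : Equiv.Perm (Fin n), Integrable fun z => wirtinger s (σ i) F z *
      (∏ l ∈ Finset.univ.erase i, wirtinger s (σ l) (h l) z) * G z := fun σ =>
    (((contDiff_wirtinger hF s (σ i)).continuous.mul (hP σ).continuous).mul
      hG.continuous).integrable_of_hasCompactSupport hGc.mul_left
  have hi2 : ∀ σ : Equiv.Perm (Fin n), Integrable fun z => F z * wirtinger s (σ i)
      (fun y => ∏ l ∈ Finset.univ.erase i, wirtinger s (σ l) (h l) y) z * G z := fun σ =>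
    ((hF.continuous.mul (contDiff_wirtinger (hP σ) s (σ i)).continuous).mul
      hG.continuous).integrable_of_hasCompactSupport hGc.mul_left
  have e1 : ∀ σ : Equiv.Perm (Fin n), ∫ z, F z *
      (∏ l ∈ Finset.univ.erase i, wirtinger s (σ l) (h l) z) * wirtinger s (σ i) G z =
      -((∫ z, wirtinger s (σ i) F z *
        (∏ l ∈ Finset.univ.erase i, wirtinger s (σ l) (h l) z) * G z) +
        ∫ z, F z * wirtinger s (σ i)
          (fun y => ∏ l ∈ Finset.univ.erase i, wirtinger s (σ l) (h l) y) z * G z) := by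
    intro σ
    rw [integral_mul_wirtinger (hF.mul (hP σ)) hG hGc, ← integral_add (hi1 σ) (hi2 σ)]
    congr 2
    ext z
    rw [wirtinger_mul hF (hP σ)]
    ring
  simp only [e1, mul_neg, mul_add, Finset.sum_neg_distrib, Finset.sum_add_distrib]
  have h0 : ∑ σ : Equiv.Perm (Fin n), ((Equiv.Perm.sign σ : ℤ) : ℂ) * ∫ z, F z * wirtinger s (σ i)
      (fun y => ∏ l ∈ Finset.univ.erase i, wirtinger s (σ l) (h l) y) z * G z = 0 := by
    simp only [← integral_const_mul]
    rw [← integral_finsetSum _ fun σ _ => (hi2 σ).const_mul _]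
    refine integral_eq_zero_of_ae (Eventually.of_forall fun z => ?_)
    have := sum_sign_wirtinger_prod_eq_zero hh s i z
    simp only [Pi.zero_apply]
    calc _ = (F z * G z) * ∑ σ : Equiv.Perm (Fin n), ((Equiv.Perm.sign σ : ℤ) : ℂ) *
          wirtinger s (σ i) (fun y => ∏ l ∈ Finset.univ.erase i, wirtinger s (σ l) (h l) y) z := by
          rw [Finset.mul_sum]
          refine Finset.sum_congr rfl fun σ _ => ?_
          ring
      _ = 0 := by rw [this, mul_zero]
  rw [h0, add_zero]

theorem contDiff_ofReal_comp {v : Cn n → ℝ} (hv : ContDiff ℝ ∞ v) :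
    ContDiff ℝ ∞ fun z => (v z : ℂ) := Complex.ofRealCLM.contDiff.comp hv

theorem ddc_eq_wirtinger {v : Cn n → ℝ} (hv : ContDiff ℝ ∞ v) (z : Cn n) (j k : Fin n) :
    ddc v z j k = wirtinger (-Complex.I) j (wirtinger Complex.I k fun y => (v y : ℂ)) z := by
  have hV := contDiff_ofReal_comp hv
  have h0 : ∀ y a, fderiv ℝ (fun y => (v y : ℂ)) y a = ((fderiv ℝ v y a : ℝ) : ℂ) := by
    intro y a
    have : HasFDerivAt (fun y => (v y : ℂ)) (Complex.ofRealCLM.comp (fderiv ℝ v y)) y :=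
      Complex.ofRealCLM.hasFDerivAt.comp y (hv.differentiable (by simp) y).hasFDerivAt
    rw [this.fderiv]; rfl
  have hd : DifferentiableAt ℝ (fderiv ℝ v) z :=
    (hv.fderiv_right (m := ∞) (by simp)).differentiable (by simp) z
  have h1 : ∀ a b, fderiv ℝ (fun y => fderiv ℝ (fun y => (v y : ℂ)) y a) z b =
      ((secondDeriv v z b a : ℝ) : ℂ) := by
    intro a b
    simp only [h0]
    have h2 : HasFDerivAt (fun y => fderiv ℝ v y a) _ z :=
      hd.hasFDerivAt.clm_apply (hasFDerivAt_const a z)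
    have : HasFDerivAt (fun y => ((fderiv ℝ v y a : ℝ) : ℂ)) (Complex.ofRealCLM.comp _) z :=
      Complex.ofRealCLM.hasFDerivAt.comp z h2
    rw [this.fderiv]
    simp
  have key : ∀ (a : Cn n), fderiv ℝ (wirtinger Complex.I k fun y => (v y : ℂ)) z a =
      (1 / 2 : ℂ) * (((secondDeriv v z a (EuclideanSpace.single k 1) : ℝ) : ℂ) +
        Complex.I * ((secondDeriv v z a (EuclideanSpace.single k Complex.I) : ℝ) : ℂ)) := by
    intro a
    have h1' := ((contDiff_fderiv_apply hV (EuclideanSpace.single k 1)).differentiable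
      (by simp) z)
    have h2 := ((contDiff_fderiv_apply hV (EuclideanSpace.single k Complex.I)).differentiable
      (by simp) z)
    have h4 : HasFDerivAt (wirtinger Complex.I k fun y => (v y : ℂ)) _ z :=
      ((h1'.hasFDerivAt.add (h2.hasFDerivAt.const_mul Complex.I)).const_mul (1 / 2 : ℂ))
    rw [h4.fderiv]
    simp [h1]
    ring
  rw [wirtinger, key, key]
  rw [ddc_eq, leviMatrix]
  simp only [Matrix.of_apply, leviForm, I_smul_single]
  linear_combination (1 / 4 : ℂ) * ((secondDeriv v z (EuclideanSpace.single j Complex.I)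
    (EuclideanSpace.single k Complex.I) : ℝ) : ℂ) * Complex.I_sq

theorem wedgeCoeff_update (A : Fin n → CMat n) (i : Fin n) (B : CMat n) :
    wedgeCoeff (Function.update A i B) = ∑ τ : Equiv.Perm (Fin n), ∑ σ : Equiv.Perm (Fin n),
      ((Equiv.Perm.sign τ : ℤ) : ℂ) * (((Equiv.Perm.sign σ : ℤ) : ℂ) *
        ((∏ l ∈ Finset.univ.erase i, A l (σ l) (τ l)) * B (σ i) (τ i))) := by
  rw [wedgeCoeff, Finset.sum_comm]
  refine Finset.sum_congr rfl fun τ _ => Finset.sum_congr rfl fun σ _ => ?_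
  rw [← Finset.mul_prod_erase Finset.univ _ (Finset.mem_univ i), Function.update_self]
  have : ∏ l ∈ Finset.univ.erase i, Function.update A i B l (σ l) (τ l) =
      ∏ l ∈ Finset.univ.erase i, A l (σ l) (τ l) :=
    Finset.prod_congr rfl fun l hl => by rw [Function.update_of_ne (Finset.ne_of_mem_erase hl)]
  rw [this]
  ring

theorem integral_mul_wedgeCoeff_update {A : Fin n → Cn n → CMat n} {B : Cn n → CMat n}
    {F : Cn n → ℂ} (i : Fin n) (hint : ∀ σ τ : Equiv.Perm (Fin n), Integrable fun z =>
      F z * (∏ l ∈ Finset.univ.erase i, A l z (σ l) (τ l)) * B z (σ i) (τ i)) :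
    ∫ z, F z * wedgeCoeff (Function.update (fun l => A l z) i (B z)) =
      ∑ τ : Equiv.Perm (Fin n), ((Equiv.Perm.sign τ : ℤ) : ℂ) * ∑ σ : Equiv.Perm (Fin n),
        ((Equiv.Perm.sign σ : ℤ) : ℂ) * ∫ z, F z *
        (∏ l ∈ Finset.univ.erase i, A l z (σ l) (τ l)) * B z (σ i) (τ i) := by
  have e : ∀ z, F z * wedgeCoeff (Function.update (fun l => A l z) i (B z)) =
      ∑ τ : Equiv.Perm (Fin n), ∑ σ : Equiv.Perm (Fin n), ((Equiv.Perm.sign τ : ℤ) : ℂ) *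
        (((Equiv.Perm.sign σ : ℤ) : ℂ) * (F z *
        (∏ l ∈ Finset.univ.erase i, A l z (σ l) (τ l)) * B z (σ i) (τ i))) := by
    intro z
    rw [wedgeCoeff_update, Finset.mul_sum]
    refine Finset.sum_congr rfl fun τ _ => ?_
    rw [Finset.mul_sum]
    refine Finset.sum_congr rfl fun σ _ => ?_
    ring
  simp only [e]
  have hi2 : ∀ σ τ : Equiv.Perm (Fin n), Integrable fun z => ((Equiv.Perm.sign τ : ℤ) : ℂ) *
        (((Equiv.Perm.sign σ : ℤ) : ℂ) * (F z *
        (∏ l ∈ Finset.univ.erase i, A l z (σ l) (τ l)) * B z (σ i) (τ i))) := fun σ τ =>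
    ((hint σ τ).const_mul _).const_mul _
  rw [integral_finsetSum _ fun τ _ => integrable_finsetSum _ fun σ _ => hi2 σ τ]
  refine Finset.sum_congr rfl fun τ _ => ?_
  rw [integral_finsetSum _ fun σ _ => hi2 σ τ, Finset.mul_sum]
  refine Finset.sum_congr rfl fun σ _ => ?_
  rw [integral_const_mul, integral_const_mul]

/-- Symmetry of the mixed Hessian pairing for smooth functions. -/
theorem integral_mul_wedgeCoeff_swap {g : Fin n → Cn n → ℝ} (hg : ∀ l, ContDiff ℝ ∞ (g l))
    {w φ : Cn n → ℝ} (hw : ContDiff ℝ ∞ w) (hφ : ContDiff ℝ ∞ φ) (hφc : HasCompactSupport φ)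
    (i : Fin n) :
    ∫ z, (w z : ℂ) * wedgeCoeff (Function.update (fun l => ddc (g l) z) i (ddc φ z)) =
      ∫ z, (φ z : ℂ) * wedgeCoeff (Function.update (fun l => ddc (g l) z) i (ddc w z)) := by
  have hG : ∀ l, ContDiff ℝ ∞ fun z => (g l z : ℂ) := fun l => contDiff_ofReal_comp (hg l)
  have hW := contDiff_ofReal_comp hw
  have hΦ := contDiff_ofReal_comp hφ
  have hΦc : HasCompactSupport fun z => (φ z : ℂ) := hφc.comp_left Complex.ofReal_zero
  have hD : ∀ {v : Cn n → ℝ}, ContDiff ℝ ∞ v → ∀ j k, Continuous fun z => ddc v z j k := by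
    intro v hv j k
    simp only [ddc_eq_wirtinger hv]
    exact (contDiff_wirtinger (contDiff_wirtinger (contDiff_ofReal_comp hv) _ _) _ _).continuous
  have hPc : ∀ σ τ : Equiv.Perm (Fin n), Continuous fun z =>
      ∏ l ∈ Finset.univ.erase i, ddc (g l) z (σ l) (τ l) := fun σ τ =>
    continuous_finsetProd _ fun l _ => hD (hg l) _ _
  have hddcφ : ∀ j k, HasCompactSupport fun z => ddc φ z j k := by
    intro j k
    simp only [ddc_eq_wirtinger hφ]
    exact hasCompactSupport_wirtinger (hasCompactSupport_wirtinger hΦc _ _) _ _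
  rw [integral_mul_wedgeCoeff_update (A := fun l => ddc (g l)) (B := ddc φ) i fun σ τ =>
      ((hW.continuous.mul (hPc σ τ)).mul (hD hφ _ _)).integrable_of_hasCompactSupport
        (hddcφ _ _).mul_left,
    integral_mul_wedgeCoeff_update (A := fun l => ddc (g l)) (B := ddc w) i fun σ τ =>
      ((hΦ.continuous.mul (hPc σ τ)).mul (hD hw _ _)).integrable_of_hasCompactSupport
        (hΦc.mul_right.mul_right)]
  -- move the `z`-derivative
  have h1 : ∀ τ : Equiv.Perm (Fin n), ∑ σ : Equiv.Perm (Fin n),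
      ((Equiv.Perm.sign σ : ℤ) : ℂ) * ∫ z, (w z : ℂ) *
        (∏ l ∈ Finset.univ.erase i, ddc (g l) z (σ l) (τ l)) * ddc φ z (σ i) (τ i) =
      -∑ σ : Equiv.Perm (Fin n), ((Equiv.Perm.sign σ : ℤ) : ℂ) *
        ∫ z, wirtinger (-Complex.I) (σ i) (fun y => (w y : ℂ)) z *
        (∏ l ∈ Finset.univ.erase i, ddc (g l) z (σ l) (τ l)) *
          wirtinger Complex.I (τ i) (fun y => (φ y : ℂ)) z := by
    intro τ
    have := sum_sign_integral_wirtinger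
      (h := fun l => wirtinger Complex.I (τ l) fun y => (g l y : ℂ))
      (fun l => contDiff_wirtinger (hG l) _ _) hW (contDiff_wirtinger hΦ Complex.I (τ i))
      (hasCompactSupport_wirtinger hΦc _ _) (-Complex.I) i
    simpa only [← ddc_eq_wirtinger (hg _), ← ddc_eq_wirtinger hφ] using this
  -- move the `z̄`-derivative
  have h2 : ∀ σ : Equiv.Perm (Fin n), ∑ τ : Equiv.Perm (Fin n),
      ((Equiv.Perm.sign τ : ℤ) : ℂ) * ∫ z, wirtinger (-Complex.I) (σ i) (fun y => (w y : ℂ)) z *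
        (∏ l ∈ Finset.univ.erase i, ddc (g l) z (σ l) (τ l)) *
          wirtinger Complex.I (τ i) (fun y => (φ y : ℂ)) z =
      -∑ τ : Equiv.Perm (Fin n), ((Equiv.Perm.sign τ : ℤ) : ℂ) *
        ∫ z, (φ z : ℂ) * (∏ l ∈ Finset.univ.erase i, ddc (g l) z (σ l) (τ l)) *
          ddc w z (σ i) (τ i) := by
    intro σ
    have := sum_sign_integral_wirtinger
      (h := fun l => wirtinger (-Complex.I) (σ l) fun y => (g l y : ℂ))
      (fun l => contDiff_wirtinger (hG l) _ _) (contDiff_wirtinger hW (-Complex.I) (σ i)) hΦ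
      hΦc Complex.I i
    simp only [wirtinger_comm (hG _) Complex.I (-Complex.I), wirtinger_comm hW Complex.I
      (-Complex.I), ← ddc_eq_wirtinger (hg _), ← ddc_eq_wirtinger hw] at this
    rw [this]
    congr 1
    refine Finset.sum_congr rfl fun τ _ => ?_
    congr 2
    ext z
    ring
  rw [Finset.sum_congr rfl fun τ _ => by rw [h1 τ]]
  simp only [mul_neg, Finset.mul_sum, Finset.sum_neg_distrib]
  rw [Finset.sum_comm]
  have h3 : ∀ σ : Equiv.Perm (Fin n), ∑ τ : Equiv.Perm (Fin n), ((Equiv.Perm.sign τ : ℤ) : ℂ) *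
      (((Equiv.Perm.sign σ : ℤ) : ℂ) *
        ∫ z, wirtinger (-Complex.I) (σ i) (fun y => (w y : ℂ)) z *
        (∏ l ∈ Finset.univ.erase i, ddc (g l) z (σ l) (τ l)) *
          wirtinger Complex.I (τ i) (fun y => (φ y : ℂ)) z) =
      -∑ τ : Equiv.Perm (Fin n), ((Equiv.Perm.sign τ : ℤ) : ℂ) * (((Equiv.Perm.sign σ : ℤ) : ℂ) *
        ∫ z, (φ z : ℂ) * (∏ l ∈ Finset.univ.erase i, ddc (g l) z (σ l) (τ l)) *
          ddc w z (σ i) (τ i)) := by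
    intro σ
    have := congrArg (fun x => ((Equiv.Perm.sign σ : ℤ) : ℂ) * x) (h2 σ)
    simp only [mul_neg, Finset.mul_sum] at this
    calc _ = _ := Finset.sum_congr rfl fun τ _ => by ring
      _ = _ := this
      _ = _ := by
        congr 1
        exact Finset.sum_congr rfl fun τ _ => by ring
  rw [Finset.sum_congr rfl fun σ _ => h3 σ, Finset.sum_neg_distrib, neg_neg, Finset.sum_comm]

end Wirtinger

/-! ### Quadratic functions and the trace -/

section Quadratic

variable {E : Type*} [NormedAddCommGroup E] [NormedSpace ℝ E]

theorem fderiv_quadratic {H : E →L[ℝ] E →L[ℝ] ℝ} (hH : ∀ a b, H a b = H b a) (L : E →L[ℝ] ℝ)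
    (c : ℝ) : fderiv ℝ (fun y => (1 / 2) * H y y + L y + c) = fun y => H y + L := by
  ext1 y
  have h1 := (H.hasFDerivAt (x := y)).clm_apply (hasFDerivAt_id y)
  have h2 : HasFDerivAt (fun y => (1 / 2) * H y y + L y + c) _ y :=
    ((h1.const_mul (1 / 2 : ℝ)).add L.hasFDerivAt).add_const c
  rw [h2.fderiv]
  ext w
  simp [hH w y]
  ring

theorem secondDeriv_quadratic {H : E →L[ℝ] E →L[ℝ] ℝ} (hH : ∀ a b, H a b = H b a) (L : E →L[ℝ] ℝ)
    (c : ℝ) (z : E) : secondDeriv (fun y => (1 / 2) * H y y + L y + c) z = H := by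
  rw [secondDeriv, fderiv_quadratic hH, fderiv_add_const, H.fderiv]

theorem contDiff_quadratic (H : E →L[ℝ] E →L[ℝ] ℝ) (L : E →L[ℝ] ℝ) (c : ℝ) :
    ContDiff ℝ ∞ fun y => (1 / 2) * H y y + L y + c :=
  (((contDiff_const.mul (H.contDiff.clm_apply contDiff_id))).add L.contDiff).add contDiff_const

theorem fderiv_comp_const_sub {F : Type*} [NormedAddCommGroup F] [NormedSpace ℝ F] (f : E → F)
    (z x : E) : fderiv ℝ (fun x => f (z - x)) x = -fderiv ℝ f (z - x) := by
  have h := fderiv_comp_smul (𝕜 := ℝ) (f := fun w => f (w + z)) (x := x) (-1)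
  simp only [neg_smul, one_smul] at h
  have e : (fun x => f (z - x)) = fun x => f (-x + z) := by ext x; congr 1; abel
  rw [e, h, fderiv_comp_add_right]
  congr 2; abel

theorem secondDeriv_const_sub (k : E → ℝ) (z y : E) :
    secondDeriv (fun x => k (z - x)) y = secondDeriv k (z - y) := by
  rw [secondDeriv, show fderiv ℝ (fun x => k (z - x)) = fun x => -fderiv ℝ k (z - x) from
    funext (fderiv_comp_const_sub k z), fderiv_fun_neg, fderiv_comp_const_sub, neg_neg]

theorem continuous_secondDeriv {v : E → ℝ} (hv : ContDiff ℝ 2 v) :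
    Continuous fun z => secondDeriv v z :=
  (hv.fderiv_right (m := 1) (by norm_num)).continuous_fderiv (by norm_num)

end Quadratic

section Trace

variable {n : ℕ}

/-- Every Hermitian matrix is the Levi matrix of a symmetric real bilinear form. -/
theorem exists_leviMatrix_eq {A : CMat n} (hA : A.IsHermitian) :
    ∃ H : Cn n →L[ℝ] Cn n →L[ℝ] ℝ, (∀ a b, H a b = H b a) ∧ leviMatrix H = A := by
  let S : Cn n → Cn n → ℂ := fun a b => ∑ j, ∑ k, A j k * a j * (starRingEnd ℂ) (b k)
  have hconj : ∀ a b, S b a = (starRingEnd ℂ) (S a b) := by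
    intro a b
    simp only [S, map_sum, map_mul, Complex.conj_conj]
    rw [Finset.sum_comm]
    refine Finset.sum_congr rfl fun j _ => Finset.sum_congr rfl fun k _ => ?_
    rw [← hA.apply k j, Complex.star_def]
    ring
  have hadd : ∀ a a' b, S (a + a') b = S a b + S a' b := by
    intro a a' b
    simp only [S, ← Finset.sum_add_distrib, PiLp.add_apply]
    refine Finset.sum_congr rfl fun j _ => Finset.sum_congr rfl fun k _ => ?_
    ring
  have hsmul : ∀ (c : ℂ) a b, S (c • a) b = c * S a b := by
    intro c a b
    simp only [S, Finset.mul_sum, PiLp.smul_apply, smul_eq_mul]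
    refine Finset.sum_congr rfl fun j _ => Finset.sum_congr rfl fun k _ => ?_
    ring
  have hsymm : ∀ a b, (S a b).re = (S b a).re := fun a b => by rw [hconj a b, Complex.conj_re]
  have hrsmul : ∀ (c : ℝ) a b, S (c • a) b = c * S a b := fun c a b => by
    rw [← hsmul]; rfl
  let B : Cn n →ₗ[ℝ] Cn n →ₗ[ℝ] ℝ := LinearMap.mk₂ ℝ (fun a b => 2 * (S a b).re)
    (fun a a' b => by simp only [hadd, Complex.add_re]; ring)
    (fun c a b => by simp only [hrsmul, Complex.re_ofReal_mul, smul_eq_mul]; ring)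
    (fun a b b' => by rw [hsymm, hadd, hsymm a b, hsymm a b', Complex.add_re]; ring)
    (fun c a b => by
      rw [hsymm, hrsmul, hsymm a b, Complex.re_ofReal_mul, smul_eq_mul]; ring)
  have hB : ∀ a b, B.toContinuousBilinearMap a b = 2 * (S a b).re := fun a b => rfl
  refine ⟨B.toContinuousBilinearMap, fun a b => by rw [hB, hB, hsymm], ?_⟩
  have hsr : ∀ a b, S a (Complex.I • b) = -Complex.I * S a b := by
    intro a b
    rw [hconj, hsmul, map_mul, Complex.conj_I, ← hconj]
  have hlevi : ∀ a b, leviForm B.toContinuousBilinearMap a b = S a b := by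
    intro a b
    simp only [leviForm, hB, hsr, hsmul]
    generalize S a b = s
    apply Complex.ext <;> simp <;> ring
  ext j k
  rw [leviMatrix, Matrix.of_apply, hlevi]
  simp only [S]
  rw [Finset.sum_eq_single j, Finset.sum_eq_single k]
  · simp
  · intro l _ hl; simp [hl]
  · simp
  · intro l _ hl; simp [hl]
  · simp

theorem sum_perm_apply_eq (i : Fin n) (f : Fin n → ℂ) :
    (n : ℂ) * ∑ σ : Equiv.Perm (Fin n), f (σ i) = (n.factorial : ℂ) * ∑ j, f j := by
  have h1 : ∀ j, ∑ σ : Equiv.Perm (Fin n), f (σ j) = ∑ σ : Equiv.Perm (Fin n), f (σ i) := by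
    intro j
    refine Fintype.sum_equiv (Equiv.mulRight (Equiv.swap i j)) _ _ fun σ => ?_
    simp
  calc (n : ℂ) * ∑ σ : Equiv.Perm (Fin n), f (σ i)
      = ∑ j, ∑ σ : Equiv.Perm (Fin n), f (σ j) := by simp [h1]
    _ = ∑ σ : Equiv.Perm (Fin n), ∑ j, f (σ j) := Finset.sum_comm
    _ = ∑ σ : Equiv.Perm (Fin n), ∑ j, f j :=
        Finset.sum_congr rfl fun σ _ => Equiv.sum_comp σ f
    _ = _ := by simp [Fintype.card_perm]

theorem sigmaForm_one_eq_trace (A : CMat n) (hn : 1 ≤ n) :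
    n * sigmaForm 1 A = n.factorial * A.trace.re := by
  let i : Fin n := ⟨0, hn⟩
  have h1 : (wedgeCoeff fun l : Fin n => if (l : ℕ) < 1 then A else 1) =
      ∑ σ : Equiv.Perm (Fin n), A (σ i) (σ i) := by
    unfold wedgeCoeff
    refine Finset.sum_congr rfl fun σ _ => ?_
    rw [Finset.sum_eq_single σ]
    · rw [← Finset.mul_prod_erase Finset.univ _ (Finset.mem_univ i), Finset.prod_eq_one]
      · have := Int.units_mul_self (Equiv.Perm.sign σ)
        rw [← Int.cast_mul, ← Units.val_mul, this]
        simp [i]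
      · intro l hl
        have hl' : ¬ ((l : ℕ) < 1) := fun h => Finset.ne_of_mem_erase hl (Fin.ext (by simp [i]; omega))
        simp only [hl', if_false, Matrix.one_apply_eq]
    · intro τ _ hτ
      have : ∃ l ∈ Finset.univ.erase i, σ l ≠ τ l := by
        by_contra hcon
        push Not at hcon
        apply hτ
        have hne : ∀ l, l ≠ i → σ l = τ l := fun l hl =>
          hcon l (Finset.mem_erase.2 ⟨hl, Finset.mem_univ _⟩)
        ext1 l
        by_cases hl : l = i
        · subst hl
          obtain ⟨j, hj⟩ := σ.surjective (τ i)
          by_cases hji : j = i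
          · rw [← hj, hji]
          · rw [hne j hji] at hj
            exact absurd (τ.injective hj) hji
        · exact (hne l hl).symm
      obtain ⟨l, hl, hne⟩ := this
      have hl' : ¬ ((l : ℕ) < 1) := fun h => Finset.ne_of_mem_erase hl (Fin.ext (by simp [i]; omega))
      rw [Finset.prod_eq_zero (Finset.mem_univ l) (by simp only [hl', if_false]; exact Matrix.one_apply_ne hne), mul_zero]
    · simp
  have h2 := congrArg Complex.re (sum_perm_apply_eq i fun j => A j j)
  rw [← h1] at h2
  have h3 : ((n.factorial : ℂ) * ∑ j, A j j).re = n.factorial * A.trace.re := by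
    rw [← Complex.ofReal_natCast, Complex.re_ofReal_mul]; rfl
  have h4 : ∀ x : ℂ, ((n : ℂ) * x).re = n * x.re := fun x => by
    rw [← Complex.ofReal_natCast, Complex.re_ofReal_mul]
  rw [h3, h4] at h2
  exact h2

theorem MPos.trace_nonneg {m : ℕ} (hm : 1 ≤ m) (hn : 1 ≤ n) {A : CMat n} (hA : MPos m A) :
    0 ≤ A.trace.re := by
  have h1 := sigmaForm_one_eq_trace A hn
  have h2 := hA.2 1 hm
  have h3 : (0 : ℝ) < n.factorial := by positivity
  have h4 : 0 ≤ n.factorial * A.trace.re := h1 ▸ by positivity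
  exact nonneg_of_mul_nonneg_right h4 h3

theorem trace_leviMatrix (H : Cn n →L[ℝ] Cn n →L[ℝ] ℝ) :
    (leviMatrix H).trace.re = (1 / 4) * ∑ j : Fin n,
      (H (EuclideanSpace.single j 1) (EuclideanSpace.single j 1) +
        H (EuclideanSpace.single j Complex.I) (EuclideanSpace.single j Complex.I)) := by
  rw [Matrix.trace, Complex.re_sum, Finset.mul_sum]
  refine Finset.sum_congr rfl fun j _ => ?_
  simp only [Matrix.diag_apply, leviMatrix, Matrix.of_apply, leviForm, I_smul_single]
  generalize H (EuclideanSpace.single j 1) (EuclideanSpace.single j 1) = p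
  generalize H (EuclideanSpace.single j Complex.I) (EuclideanSpace.single j Complex.I) = q
  simp

end Trace

/-! ### Duality and mollification -/

section Smoothing

variable {E : Type*} [NormedAddCommGroup E] [InnerProductSpace ℝ E] [FiniteDimensional ℝ E]
  [MeasurableSpace E] [BorelSpace E]

/-- The convolution of `g` with the kernel `k`. -/
noncomputable def smoothing (k g : E → ℝ) (z : E) : ℝ := ∫ y, g y * k (z - y)

theorem smoothing_eq_convolution (k g : E → ℝ) :
    smoothing k g = convolution g k (ContinuousLinearMap.mul ℝ ℝ) volume := rfl

theorem smoothing_contDiff {k g : E → ℝ} (hk : ContDiff ℝ ∞ k) (hkc : HasCompactSupport k)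
    (hg : LocallyIntegrable g) : ContDiff ℝ ∞ (smoothing k g) := by
  rw [smoothing_eq_convolution]
  exact hkc.contDiff_convolution_right _ hg hk

theorem integrable_smul_kernel {F : Type*} [NormedAddCommGroup F] [NormedSpace ℝ F]
    {k : E → F} {g : E → ℝ} (hk : Continuous k)
    (hkc : HasCompactSupport k) (hg : LocallyIntegrable g) (z : E) :
    Integrable fun y => g y • k (z - y) := by
  refine hg.integrable_smul_right_of_hasCompactSupport (hk.comp (by fun_prop)) ?_
  exact hkc.comp_homeomorph (Homeomorph.subLeft z)

theorem fderiv_integral_smul_kernel {F : Type*} [NormedAddCommGroup F] [NormedSpace ℝ F]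
    [CompleteSpace F] {k : E → F} {g : E → ℝ} (hk : ContDiff ℝ 1 k) (hkc : HasCompactSupport k)
    (hg : LocallyIntegrable g) (z : E) :
    fderiv ℝ (fun x => ∫ y, g y • k (x - y)) z = ∫ y, g y • fderiv ℝ k (z - y) := by
  have h : HasFDerivAt (fun x => ∫ y, g y • k (x - y))
      (convolution g (fderiv ℝ k) ((ContinuousLinearMap.lsmul ℝ ℝ).precompR E) volume z) z :=
    hkc.hasFDerivAt_convolution_right (ContinuousLinearMap.lsmul ℝ ℝ) hg hk z
  rw [h.fderiv, convolution_def]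
  refine integral_congr_ae (Eventually.of_forall fun y => ?_)
  ext a
  simp [ContinuousLinearMap.precompR_apply]

theorem clm_fderiv_integral_smul_kernel {F : Type*} [NormedAddCommGroup F] [NormedSpace ℝ F]
    [CompleteSpace F] {k : E → F} {g : E → ℝ} (hk : ContDiff ℝ 1 k) (hkc : HasCompactSupport k)
    (hg : LocallyIntegrable g) (z : E) (ℓ : (E →L[ℝ] F) →L[ℝ] ℝ) :
    ℓ (fderiv ℝ (fun x => ∫ y, g y • k (x - y)) z) = ∫ y, g y * ℓ (fderiv ℝ k (z - y)) := by
  rw [fderiv_integral_smul_kernel hk hkc hg z, ← ContinuousLinearMap.integral_comp_comm _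
    (integrable_smul_kernel (hk.continuous_fderiv one_ne_zero) (hkc.fderiv ℝ) hg z)]
  refine integral_congr_ae (Eventually.of_forall fun y => ?_)
  exact ℓ.map_smul (g y) _

theorem secondDeriv_smoothing_clm {k g : E → ℝ} (hk : ContDiff ℝ 2 k)
    (hkc : HasCompactSupport k) (hg : LocallyIntegrable g) (z : E)
    (ℓ : (E →L[ℝ] E →L[ℝ] ℝ) →L[ℝ] ℝ) :
    ℓ (secondDeriv (smoothing k g) z) = ∫ y, g y * ℓ (secondDeriv k (z - y)) := by
  have hk1 : ContDiff ℝ 1 (fderiv ℝ k) := hk.fderiv_right (m := 1) (by norm_num)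
  have e1 : fderiv ℝ (smoothing k g) = fun x => ∫ y, g y • fderiv ℝ k (x - y) :=
    funext fun x => fderiv_integral_smul_kernel (hk.of_le (by norm_num)) hkc hg x
  rw [secondDeriv, e1]
  exact clm_fderiv_integral_smul_kernel hk1 (hkc.fderiv ℝ) hg z ℓ

theorem secondDeriv_smoothing_apply {k g : E → ℝ} (hk : ContDiff ℝ 2 k)
    (hkc : HasCompactSupport k) (hg : LocallyIntegrable g) (z a b : E) :
    secondDeriv (smoothing k g) z a b = ∫ y, g y * secondDeriv k (z - y) a b :=
  secondDeriv_smoothing_clm hk hkc hg z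
    ((ContinuousLinearMap.apply ℝ ℝ b).comp (ContinuousLinearMap.apply ℝ (E →L[ℝ] ℝ) a))

end Smoothing

section Dual

variable {n : ℕ}

/-- The functional `B ↦ A^(m-1) ∧ B ∧ β^(n-m)` that tests membership in the closed cone. -/
noncomputable def dualForm (m : ℕ) (A B : CMat n) : ℝ :=
  (wedgeCoeff fun l : Fin n => if (l : ℕ) < m - 1 then A else if (l : ℕ) = m - 1 then B else 1).re

theorem dualForm_eq_update {m : ℕ} (hm : 1 ≤ m) (hmn : m ≤ n) (A B : CMat n) :
    dualForm m A B = (wedgeCoeff (Function.update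
      (fun l : Fin n => if (l : ℕ) < m - 1 then A else 1) ⟨m - 1, by omega⟩ B)).re := by
  rw [dualForm]
  congr 2
  ext1 l
  by_cases h : l = ⟨m - 1, by omega⟩
  · subst h; simp
  · have : (l : ℕ) ≠ m - 1 := fun h' => h (Fin.ext h')
    rw [Function.update_of_ne h, if_neg this]

theorem dualForm_nonneg {m : ℕ} (hm : 1 ≤ m) {A B : CMat n} (hA : MPos m A)
    (hB : MPos m B) : 0 ≤ dualForm m A B := by
  have h1 : (fun l : Fin n => if (l : ℕ) < m - 1 then A else if (l : ℕ) = m - 1 then B else 1) =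
      (initSlots n m).piecewise (fun l : Fin n => if (l : ℕ) < m - 1 then A else B) 1 := by
    ext1 l
    by_cases h : (l : ℕ) < m
    · rw [Finset.piecewise_eq_of_mem _ _ _ (mem_initSlots.2 h)]
      by_cases h2 : (l : ℕ) < m - 1
      · simp [h2]
      · have : (l : ℕ) = m - 1 := by omega
        simp [this]
    · rw [Finset.piecewise_eq_of_notMem _ _ _ (fun h' => h (mem_initSlots.1 h'))]
      have h2 : ¬ ((l : ℕ) < m - 1) := by omega
      have h3 : ¬ ((l : ℕ) = m - 1) := by omega
      simp [h2, h3]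
  rw [dualForm, h1]
  refine wedgeCoeff_nonneg_of_mPos card_initSlots_le fun i _ => ?_
  split_ifs <;> assumption

theorem exists_dualForm_clm {m : ℕ} (hm : 1 ≤ m) (hmn : m ≤ n) (A : CMat n) :
    ∃ ℓ : (Cn n →L[ℝ] Cn n →L[ℝ] ℝ) →L[ℝ] ℝ, ∀ H, ℓ H = dualForm m A (leviMatrix H) := by
  refine ⟨⟨⟨⟨fun H => dualForm m A (leviMatrix H), fun H K => ?_⟩, fun r H => ?_⟩, ?_⟩,
    fun H => rfl⟩
  · simp only [dualForm_eq_update hm hmn, ← wedgeForm_apply]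
    rw [leviMatrix_add, MultilinearMap.map_update_add, Complex.add_re]
  · simp only [dualForm_eq_update hm hmn, ← wedgeForm_apply]
    rw [leviMatrix_smul, MultilinearMap.map_update_smul, smul_eq_mul, Complex.re_ofReal_mul]
    rfl
  · simp only [dualForm_eq_update hm hmn]
    refine Complex.continuous_re.comp (continuous_wedgeCoeff.comp ?_)
    exact continuous_const.update _ continuous_leviMatrix

/-- `g` is `m`-subharmonic on `Ω` in the sense of distributions, tested against constant forms. -/
def DistMSH (m : ℕ) (Ω : Set (Cn n)) (g : Cn n → ℝ) : Prop :=
  ∀ A : CMat n, MPos m A → ∀ ψ : Cn n → ℝ, ContDiff ℝ ∞ ψ → HasCompactSupport ψ →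
    tsupport ψ ⊆ Ω → (∀ z, 0 ≤ ψ z) → 0 ≤ ∫ z, g z * dualForm m A (ddc ψ z)

theorem continuous_ddc {v : Cn n → ℝ} (hv : ContDiff ℝ ∞ v) : Continuous fun z => ddc v z := by
  simp only [ddc_eq]
  exact continuous_leviMatrix.comp (continuous_secondDeriv (hv.of_le two_le_infty))

/-- A smooth function with Levi matrix everywhere equal to a given Hermitian matrix. -/
theorem exists_ddc_eq {A : CMat n} (hA : A.IsHermitian) :
    ∃ v : Cn n → ℝ, ContDiff ℝ ∞ v ∧ ∀ z, ddc v z = A := by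
  obtain ⟨H, hH, hHA⟩ := exists_leviMatrix_eq hA
  refine ⟨_, contDiff_quadratic H 0 0, fun z => ?_⟩
  rw [ddc_eq, secondDeriv_quadratic hH, hHA]

theorem distMSH_of_mshAt {m : ℕ} (hm : 1 ≤ m) (hmn : m ≤ n) {v : Cn n → ℝ}
    (hv : ∀ z, MSHAt m v z) (Ω : Set (Cn n)) : DistMSH m Ω v := by
  intro A hA ψ hψ hψc _ hψ0
  have hvs : ContDiff ℝ ∞ v := contDiff_iff_contDiffAt.2 fun z => (hv z).1
  obtain ⟨q, hq, hqA⟩ := exists_ddc_eq hA.1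
  let g : Fin n → Cn n → ℝ := fun l => if (l : ℕ) < m - 1 then q else fun z => ‖z - 0‖ ^ 2
  have hg : ∀ l, ContDiff ℝ ∞ (g l) := by
    intro l
    simp only [g]
    split_ifs
    · exact hq
    · exact (contDiff_id.sub contDiff_const).norm_sq ℝ
  have hgd : ∀ z, (fun l => ddc (g l) z) = fun l : Fin n => if (l : ℕ) < m - 1 then A else 1 := by
    intro z
    ext1 l
    simp only [g]
    split_ifs
    · exact hqA z
    · exact ddc_norm_sq 0 z
  have hswap := integral_mul_wedgeCoeff_swap hg hvs hψ hψc ⟨m - 1, by omega⟩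
  have hre : ∀ (a b : Cn n → ℝ), ContDiff ℝ ∞ a → ContDiff ℝ ∞ b →
      HasCompactSupport b ∨ HasCompactSupport a →
      (∫ z, (a z : ℂ) * wedgeCoeff (Function.update (fun l => ddc (g l) z) ⟨m - 1, by omega⟩
        (ddc b z))).re = ∫ z, a z * dualForm m A (ddc b z) := by
    intro a b ha hb hc
    rw [← Complex.reCLM_apply, ← ContinuousLinearMap.integral_comp_comm]
    · refine integral_congr_ae (Eventually.of_forall fun z => ?_)
      simp only [Complex.reCLM_apply, Complex.re_ofReal_mul, hgd, dualForm_eq_update hm hmn]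
    · have hcont : Continuous fun z => (a z : ℂ) * wedgeCoeff (Function.update
          (fun l => ddc (g l) z) ⟨m - 1, by omega⟩ (ddc b z)) := by
        refine (Complex.continuous_ofReal.comp ha.continuous).mul (continuous_wedgeCoeff.comp ?_)
        simp only [hgd]
        exact continuous_const.update _ (continuous_ddc hb)
      refine hcont.integrable_of_hasCompactSupport ?_
      rcases hc with hc | hc
      · refine HasCompactSupport.mul_left ?_
        refine hc.mono' ?_
        intro z hz
        by_contra hzt
        apply hz
        have : ddc b z = 0 := by
          have he : b =ᶠ[𝓝 z] fun _ => 0 := notMem_tsupport_iff_eventuallyEq.1 hzt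
          rw [ddc_congr he, ddc_const]
        simp only [this]
        rw [← wedgeForm_apply]
        exact (wedgeForm n).map_coord_zero ⟨m - 1, by omega⟩ (by simp)
      · exact HasCompactSupport.mul_right (hc.comp_left Complex.ofReal_zero)
  have h2 := congrArg Complex.re hswap
  rw [hre v ψ hvs hψ (Or.inl hψc), hre ψ v hψ hvs (Or.inr hψc)] at h2
  rw [h2]
  exact integral_nonneg fun z => mul_nonneg (hψ0 z) (dualForm_nonneg hm hA (hv z).2)

/-- Mollifying a distributionally `m`-subharmonic function gives a smooth `m`-subharmonic one. -/
theorem smoothing_mshAt {m : ℕ} (hm : 1 ≤ m) (hmn : m ≤ n) {k g : Cn n → ℝ} (hk : ContDiff ℝ ∞ k)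
    (hkc : HasCompactSupport k) (hk0 : ∀ z, 0 ≤ k z) (hg : LocallyIntegrable g) {Ω : Set (Cn n)}
    (hd : DistMSH m Ω g) {z : Cn n} (hz : ∀ y ∈ tsupport k, z - y ∈ Ω) :
    MSHAt m (smoothing k g) z := by
  have hs := smoothing_contDiff hk hkc hg
  refine ⟨hs.contDiffAt, mPos_of_dual hm hmn
    (ddc_isHermitian (hs.contDiffAt.of_le two_le_infty)) fun A hA => ?_⟩
  obtain ⟨ℓ, hℓ⟩ := exists_dualForm_clm hm hmn A
  change 0 ≤ dualForm m A (ddc (smoothing k g) z)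
  rw [ddc_eq, ← hℓ, secondDeriv_smoothing_clm (hk.of_le two_le_infty) hkc hg]
  have h1 := hd A hA (fun y => k (z - y)) (hk.comp (contDiff_const.sub contDiff_id))
    (hkc.comp_homeomorph (Homeomorph.subLeft z)) (fun y hy => ?_) fun y => hk0 _
  · refine h1.trans_eq (integral_congr_ae (Eventually.of_forall fun y => ?_))
    simp only [hℓ, ddc_eq, secondDeriv_const_sub]
  · have := hz (z - y) (by
      have := tsupport_comp_eq_preimage k (Homeomorph.subLeft z)
      have h2 : y ∈ tsupport (k ∘ Homeomorph.subLeft z) := hy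
      rw [this] at h2
      exact h2)
    simpa using this

end Dual

/-! ### The radial mollifier -/

section Kernel

section Profile

variable {E : Type*} [NormedAddCommGroup E]

/-- A smooth radially decreasing profile supported in the closed unit ball. -/
noncomputable def profile (y : E) : ℝ := softRamp 1 (-‖y‖ ^ 2)

theorem profile_nonneg (y : E) : 0 ≤ profile y := softRamp_nonneg one_pos _

theorem profile_eq_zero {y : E} (hy : 1 ≤ ‖y‖) : profile y = 0 :=
  softRamp_of_le one_pos (by nlinarith)

theorem profile_zero_pos : 0 < profile (0 : E) := by
  have h : softRamp 1 (-‖(0 : E)‖ ^ 2) = softRamp 1 0 := by simp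
  rw [profile, h]
  obtain ⟨c, hc, hc2⟩ := exists_deriv_eq_slope (softRamp 1) (show (-1 : ℝ) < 0 by norm_num)
    (softRamp_contDiff one_pos).continuous.continuousOn
    fun y _ => (softRamp_hasDerivAt one_pos y).differentiableAt.differentiableWithinAt
  rw [softRamp_deriv one_pos, softRamp_of_le one_pos le_rfl] at hc2
  have := Real.smoothTransition.pos_of_pos (x := c / 1 + 1) (by linarith [hc.1])
  simp only at hc2
  rw [hc2] at this
  linarith

theorem profile_hasCompactSupport [ProperSpace E] : HasCompactSupport (profile : E → ℝ) :=
  HasCompactSupport.intro (isCompact_closedBall (0 : E) 1) fun y hy =>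
    profile_eq_zero (by simpa using (not_le.1 (by simpa using hy)).le)

end Profile

variable {E : Type*} [NormedAddCommGroup E] [InnerProductSpace ℝ E]

theorem profile_contDiff : ContDiff ℝ ∞ (profile : E → ℝ) :=
  (softRamp_contDiff one_pos).comp ((contDiff_norm_sq ℝ).neg)

theorem secondDeriv_const_smul_comp {f : E → ℝ} (hf : ContDiff ℝ 2 f) (c : ℝ) (y : E) :
    secondDeriv (fun x => f (c • x)) y = (c * c) • secondDeriv f (c • y) := by
  have h1 : fderiv ℝ (fun x => f (c • x)) = fun x => c • fderiv ℝ f (c • x) := by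
    ext1 x
    exact fderiv_comp_smul (f := f) c
  have h2 : fderiv ℝ (fun x => c • fderiv ℝ f (c • x)) y =
      c • fderiv ℝ (fun x => fderiv ℝ f (c • x)) y := by
    exact fderiv_fun_const_smul (DifferentiableAt.comp (g := fderiv ℝ f) (f := fun x => c • x) y
      (contDiffAt_fderiv_differentiableAt hf.contDiffAt) (by fun_prop)) c
  rw [secondDeriv, h1, h2, fderiv_comp_smul (f := fderiv ℝ f) c, smul_smul]

variable [FiniteDimensional ℝ E] [MeasurableSpace E] [BorelSpace E]

theorem profile_integral_pos : 0 < ∫ y : E, profile y :=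
  Continuous.integral_pos_of_hasCompactSupport_nonneg_nonzero (x := (0 : E))
    profile_contDiff.continuous profile_hasCompactSupport profile_nonneg profile_zero_pos.ne'

/-- The mollifying kernel of radius `ε`. -/
noncomputable def kern (ε : ℝ) (y : E) : ℝ :=
  (ε ^ Module.finrank ℝ E * ∫ y : E, profile y)⁻¹ * profile (ε⁻¹ • y)

theorem kern_contDiff (ε : ℝ) : ContDiff ℝ ∞ (kern ε : E → ℝ) :=
  contDiff_const.mul (profile_contDiff.comp (contDiff_const_smul _))

theorem kern_nonneg {ε : ℝ} (hε : 0 < ε) (y : E) : 0 ≤ kern ε y :=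
  mul_nonneg (by have := profile_integral_pos (E := E); positivity) (profile_nonneg _)

theorem kern_eq_zero {ε : ℝ} (hε : 0 < ε) {y : E} (hy : ε ≤ ‖y‖) : kern ε y = 0 := by
  rw [kern, profile_eq_zero, mul_zero]
  rw [norm_smul, norm_inv, Real.norm_eq_abs, abs_of_pos hε, ← div_eq_inv_mul, le_div_iff₀ hε]
  linarith

theorem kern_neg (ε : ℝ) (y : E) : kern ε (-y) = kern ε y := by
  simp [kern, profile]

theorem kern_hasCompactSupport {ε : ℝ} (hε : 0 < ε) : HasCompactSupport (kern ε : E → ℝ) :=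
  HasCompactSupport.intro (isCompact_closedBall (0 : E) ε) fun y hy =>
    kern_eq_zero hε (by simpa using (not_le.1 (by simpa using hy)).le)

theorem tsupport_kern {ε : ℝ} (hε : 0 < ε) :
    tsupport (kern ε : E → ℝ) ⊆ Metric.closedBall 0 ε := by
  refine closure_minimal (fun y hy => ?_) Metric.isClosed_closedBall
  by_contra h
  exact hy (kern_eq_zero hε (by simpa using (not_le.1 (by simpa using h)).le))

theorem kern_integral {ε : ℝ} (hε : 0 < ε) : ∫ y : E, kern ε y = 1 := by
  have hp := profile_integral_pos (E := E)
  simp only [kern]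
  rw [integral_const_mul, Measure.integral_comp_inv_smul_of_nonneg volume _ hε.le, smul_eq_mul,
    inv_mul_cancel₀ (by positivity)]

theorem kern_integrable {ε : ℝ} (hε : 0 < ε) : Integrable (kern ε : E → ℝ) :=
  (kern_contDiff ε).continuous.integrable_of_hasCompactSupport (kern_hasCompactSupport hε)

/-- Mollification at scale `ε`. -/
noncomputable def moll (ε : ℝ) (g : E → ℝ) : E → ℝ := smoothing (kern ε) g

theorem moll_eq (ε : ℝ) (g : E → ℝ) (z : E) : moll ε g z = ∫ y, g (z - y) * kern ε y := by
  rw [moll, smoothing, ← integral_sub_left_eq_self (fun y => g y * kern ε (z - y)) volume z]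
  simp

variable {ε : ℝ} {g h : E → ℝ}

theorem moll_integrable (hε : 0 < ε) (hg : LocallyIntegrable g) (z : E) :
    Integrable fun y => g y * kern ε (z - y) :=
  integrable_smul_kernel (kern_contDiff ε).continuous (kern_hasCompactSupport hε) hg z

theorem moll_integrable' (hε : 0 < ε) (hg : LocallyIntegrable g) (z : E) :
    Integrable fun y => g (z - y) * kern ε y := by
  have := (moll_integrable hε hg z).comp_sub_left z
  simpa using this

theorem moll_contDiff (hε : 0 < ε) (hg : LocallyIntegrable g) : ContDiff ℝ ∞ (moll ε g) :=
  smoothing_contDiff (kern_contDiff ε) (kern_hasCompactSupport hε) hg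

theorem moll_mono (hε : 0 < ε) (hg : LocallyIntegrable g) (hh : LocallyIntegrable h) {z : E}
    (hle : ∀ᵐ y, y ∈ Metric.closedBall z ε → g y ≤ h y) : moll ε g z ≤ moll ε h z := by
  refine integral_mono_ae (moll_integrable hε hg z) (moll_integrable hε hh z) ?_
  filter_upwards [hle] with y hy
  by_cases hb : y ∈ Metric.closedBall z ε
  · exact mul_le_mul_of_nonneg_right (hy hb) (kern_nonneg hε _)
  · have : kern ε (z - y) = 0 := kern_eq_zero hε (by
      rw [← dist_eq_norm, dist_comm]; exact (not_le.1 hb).le)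
    simp [this]

theorem moll_const (hε : 0 < ε) (r : ℝ) (z : E) : moll ε (fun _ => r) z = r := by
  rw [moll_eq, integral_const_mul, kern_integral hε, mul_one]

theorem moll_le (hε : 0 < ε) (hg : LocallyIntegrable g) {z : E} {r : ℝ}
    (hle : ∀ᵐ y, y ∈ Metric.closedBall z ε → g y ≤ r) : moll ε g z ≤ r :=
  (moll_mono hε hg (locallyIntegrable_const r) hle).trans_eq (moll_const hε r z)

theorem le_moll (hε : 0 < ε) (hg : LocallyIntegrable g) {z : E} {r : ℝ}
    (hle : ∀ᵐ y, y ∈ Metric.closedBall z ε → r ≤ g y) : r ≤ moll ε g z :=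
  (moll_const hε r z).symm.trans_le (moll_mono hε (locallyIntegrable_const r) hg hle)

theorem abs_moll_sub_le (hε : 0 < ε) (hg : LocallyIntegrable g) {z : E} {r η : ℝ}
    (hle : ∀ y ∈ Metric.closedBall z ε, |g y - r| ≤ η) : |moll ε g z - r| ≤ η := by
  rw [abs_le]
  constructor
  · have := le_moll hε hg (r := r - η) (Eventually.of_forall fun y hy => by
      linarith [(abs_le.1 (hle y hy)).1])
    linarith
  · have := moll_le hε hg (r := r + η) (Eventually.of_forall fun y hy => by
      linarith [(abs_le.1 (hle y hy)).2])
    linarith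

theorem moll_add (hε : 0 < ε) (hg : LocallyIntegrable g) (hh : LocallyIntegrable h) (z : E) :
    moll ε (fun y => g y + h y) z = moll ε g z + moll ε h z := by
  simp only [moll, smoothing, add_mul]
  exact integral_add (moll_integrable hε hg z) (moll_integrable hε hh z)

/-- A second difference bound passes to the mollification. -/
theorem moll_second_difference (hε : 0 < ε) (hg : LocallyIntegrable g) {C : ℝ} {a : E}
    (hC : ∀ z, g (z + a) + g (z - a) - 2 * g z ≤ C) (z : E) :
    moll ε g (z + a) + moll ε g (z - a) - 2 * moll ε g z ≤ C := by
  have h1 := moll_integrable' hε hg (z + a)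
  have h2 := moll_integrable' hε hg (z - a)
  have h3 := moll_integrable' hε hg z
  calc moll ε g (z + a) + moll ε g (z - a) - 2 * moll ε g z
      = ∫ y, (g (z + a - y) * kern ε y + g (z - a - y) * kern ε y - 2 * (g (z - y) * kern ε y)) := by
        have h12 : Integrable fun y => g (z + a - y) * kern ε y + g (z - a - y) * kern ε y :=
          h1.add h2
        rw [integral_sub h12 (h3.const_mul 2), integral_add h1 h2, integral_const_mul,
          moll_eq, moll_eq, moll_eq]
    _ ≤ ∫ y, C * kern ε y := by
        refine integral_mono ((h1.add h2).sub (h3.const_mul 2))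
          ((kern_integrable hε).const_mul C) fun y => ?_
        have := mul_le_mul_of_nonneg_right (hC (z - y)) (kern_nonneg hε y)
        rw [show z - y + a = z + a - y by abel, show z - y - a = z - a - y by abel] at this
        simp only
        linarith
    _ = C := by rw [integral_const_mul, kern_integral hε, mul_one]

theorem secondDeriv_kern_apply (ε : ℝ) (y a b : E) :
    secondDeriv (kern ε) y a b = (ε ^ Module.finrank ℝ E * ∫ y : E, profile y)⁻¹ *
      (ε⁻¹ * ε⁻¹ * secondDeriv profile (ε⁻¹ • y) a b) := by
  have h1 : ContDiffAt ℝ 2 (fun y : E => profile (ε⁻¹ • y)) y :=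
    (profile_contDiff.comp (contDiff_const_smul _)).contDiffAt.of_le two_le_infty
  have h2 : secondDeriv (kern ε) y = (ε ^ Module.finrank ℝ E * ∫ y : E, profile y)⁻¹ •
      secondDeriv (fun y : E => profile (ε⁻¹ • y)) y := secondDeriv_const_mul h1 _
  rw [h2, secondDeriv_const_smul_comp (profile_contDiff.of_le two_le_infty)]
  simp only [_root_.smul_apply, smul_eq_mul]

theorem integral_abs_secondDeriv_kern (hε : 0 < ε) (a b : E) :
    ∫ y : E, |secondDeriv (kern ε) y a b| =
      ε⁻¹ * ε⁻¹ * ((∫ y : E, profile y)⁻¹ * ∫ y : E, |secondDeriv profile y a b|) := by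
  have hp := profile_integral_pos (E := E)
  simp only [secondDeriv_kern_apply, abs_mul]
  rw [integral_const_mul, integral_const_mul, Measure.integral_comp_inv_smul_of_nonneg volume
    (fun y : E => |secondDeriv profile y a b|) hε.le, smul_eq_mul, abs_of_pos (inv_pos.2 hε),
    abs_of_pos (inv_pos.2 (mul_pos (pow_pos hε _) hp))]
  field_simp

theorem integrable_secondDeriv_kern (hε : 0 < ε) (a b : E) :
    Integrable fun y : E => secondDeriv (kern ε) y a b := by
  have h : Continuous fun y : E => secondDeriv (kern ε) y a b :=
    ((continuous_secondDeriv ((kern_contDiff ε).of_le two_le_infty)).clm_apply continuous_const).clm_apply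
      continuous_const
  refine h.integrable_of_hasCompactSupport ?_
  refine (((kern_hasCompactSupport hε).fderiv ℝ).fderiv ℝ).mono' fun y hy => ?_
  by_contra hn
  apply hy
  simp [image_eq_zero_of_notMem_tsupport hn]

theorem moll_quadratic (hε : 0 < ε) {H : E →L[ℝ] E →L[ℝ] ℝ} (hH : ∀ a b, H a b = H b a)
    (L : E →L[ℝ] ℝ) (c : ℝ) : ∃ c', moll ε (fun y => (1 / 2) * H y y + L y + c) =
      fun y => (1 / 2) * H y y + L y + c' := by
  have hodd : ∀ M : E →L[ℝ] ℝ, ∫ y, M y * kern ε y = 0 := by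
    intro M
    have h := integral_neg_eq_self (fun y => M y * kern ε y) (volume : Measure E)
    simp only [map_neg, kern_neg, neg_mul, integral_neg] at h
    linarith
  refine ⟨c + ∫ y, (1 / 2) * H y y * kern ε y, funext fun z => ?_⟩
  have hi : ∀ f : E → ℝ, Continuous f → Integrable fun y => f y * kern ε y := fun f hf =>
    (hf.mul (kern_contDiff ε).continuous).integrable_of_hasCompactSupport
      (kern_hasCompactSupport hε).mul_left
  have h1 := hi (fun _ => (1 / 2) * H z z + L z + c) continuous_const
  have h2 := hi (H z + L : E →L[ℝ] ℝ) (H z + L).continuous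
  have h3 := hi (fun y => (1 / 2) * H y y)
    (continuous_const.mul (H.continuous.clm_apply continuous_id))
  have e : ∀ y, ((1 / 2) * H (z - y) (z - y) + L (z - y) + c) * kern ε y =
      ((1 / 2) * H z z + L z + c) * kern ε y - (H z + L : E →L[ℝ] ℝ) y * kern ε y +
        (1 / 2) * H y y * kern ε y := by
    intro y
    simp only [map_sub, _root_.sub_apply, _root_.add_apply, hH y z]
    ring
  rw [moll_eq]
  simp only [e]
  have h12 : Integrable fun y => ((1 / 2) * H z z + L z + c) * kern ε y -
      (H z + L : E →L[ℝ] ℝ) y * kern ε y := h1.sub h2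
  rw [integral_add h12 h3, integral_sub h1 h2, hodd, integral_const_mul, kern_integral hε]
  ring

/-- At a point of second order differentiability the second derivatives of the mollifications
converge to the second order Taylor form. -/
theorem tendsto_secondDeriv_moll (hg : LocallyIntegrable g) {x : E} {H : E →L[ℝ] E →L[ℝ] ℝ}
    (hH : ∀ a b, H a b = H b a) {L : E →L[ℝ] ℝ}
    (hT : ∀ η > 0, ∃ r > 0, ∀ h : E, ‖h‖ < r →
      |g (x + h) - g x - L h - (1 / 2) * H h h| ≤ η * ‖h‖ ^ 2) (a b : E) :
    Tendsto (fun ε => secondDeriv (moll ε g) x a b) (𝓝[>] 0) (𝓝 (H a b)) := by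
  set M := (∫ y : E, profile y)⁻¹ * ∫ y : E, |secondDeriv profile y a b| with hM
  have hM0 : 0 ≤ M := mul_nonneg (inv_nonneg.2 profile_integral_pos.le)
    (integral_nonneg fun _ => abs_nonneg _)
  rw [Metric.tendsto_nhds]
  intro δ hδ
  obtain ⟨r, hr, hT⟩ := hT (δ / (2 * (M + 1))) (by positivity)
  -- the Taylor polynomial, as a quadratic function of `y`
  let T : E → ℝ := fun y => (1 / 2) * H y y + (L - H x) y + (g x - L x + (1 / 2) * H x x)
  have hTe : ∀ y, T y = g x + L (y - x) + (1 / 2) * H (y - x) (y - x) := by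
    intro y
    simp only [T, map_sub, _root_.sub_apply, hH y x]
    ring
  have hTc : Continuous T := (contDiff_quadratic H (L - H x) _).continuous
  filter_upwards [self_mem_nhdsWithin, nhdsWithin_le_nhds (Iio_mem_nhds hr)] with ε hε hεr
  have hε : 0 < ε := hε
  have hεr : ε < r := hεr
  obtain ⟨c', hc'⟩ := moll_quadratic hε hH (L - H x) (g x - L x + (1 / 2) * H x x)
  have hQ : secondDeriv (moll ε T) x a b = H a b := by
    rw [show moll ε T = _ from hc', secondDeriv_quadratic hH]
  have hk := kern_contDiff (E := E) ε
  have hkc := kern_hasCompactSupport (E := E) hε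
  have hi : ∀ f : E → ℝ, LocallyIntegrable f →
      Integrable fun y => f y * secondDeriv (kern ε) (x - y) a b := by
    intro f hf
    refine integrable_smul_kernel (k := fun y => secondDeriv (kern ε) y a b) ?_ ?_ hf x
    · exact ((continuous_secondDeriv (hk.of_le two_le_infty)).clm_apply continuous_const).clm_apply continuous_const
    · refine ((hkc.fderiv ℝ).fderiv ℝ).mono' fun y hy => ?_
      by_contra hn
      apply hy
      simp [image_eq_zero_of_notMem_tsupport hn]
  have hdiff : secondDeriv (moll ε g) x a b - H a b =
      ∫ y, (g y - T y) * secondDeriv (kern ε) (x - y) a b := by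
    rw [← hQ, moll, moll, secondDeriv_smoothing_apply (hk.of_le two_le_infty) hkc hg,
      secondDeriv_smoothing_apply (hk.of_le two_le_infty) hkc hTc.locallyIntegrable,
      ← integral_sub (hi g hg) (hi T hTc.locallyIntegrable)]
    simp only [sub_mul]
  rw [Real.dist_eq, hdiff]
  calc |∫ y, (g y - T y) * secondDeriv (kern ε) (x - y) a b|
      ≤ ∫ y, δ / (2 * (M + 1)) * ε ^ 2 * |secondDeriv (kern ε) (x - y) a b| := by
        refine (abs_integral_le_integral_abs).trans (integral_mono_of_nonneg
          (Eventually.of_forall fun y => abs_nonneg _) ?_ (Eventually.of_forall fun y => ?_))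
        · exact ((integrable_secondDeriv_kern hε a b).comp_sub_left x).abs.const_mul _
        · simp only [abs_mul]
          by_cases hy : ‖x - y‖ ≤ ε
          · refine mul_le_mul_of_nonneg_right ?_ (abs_nonneg _)
            have hn : ‖y - x‖ ≤ ε := by rwa [norm_sub_rev]
            have := hT (y - x) (hn.trans_lt hεr)
            rw [add_sub_cancel] at this
            rw [hTe, show g y - (g x + L (y - x) + 1 / 2 * (H (y - x)) (y - x)) =
              g y - g x - L (y - x) - (1 / 2) * H (y - x) (y - x) by ring]
            refine this.trans ?_
            have : ‖y - x‖ ^ 2 ≤ ε ^ 2 := pow_le_pow_left₀ (norm_nonneg _) hn 2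
            exact mul_le_mul_of_nonneg_left this (by positivity)
          · have : secondDeriv (kern ε) (x - y) = 0 := by
              have hn : x - y ∉ tsupport (fderiv ℝ (fderiv ℝ (kern (E := E) ε))) := by
                intro hmem
                have h1 := tsupport_kern hε (tsupport_fderiv_subset ℝ
                  (tsupport_fderiv_subset ℝ hmem))
                exact hy (by simpa using h1)
              exact image_eq_zero_of_notMem_tsupport hn
            simp [this]
    _ = δ / (2 * (M + 1)) * ε ^ 2 * (ε⁻¹ * ε⁻¹ * M) := by
        rw [integral_const_mul, integral_sub_left_eq_self
          (fun y => |secondDeriv (kern ε) y a b|) volume x, integral_abs_secondDeriv_kern hε]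
    _ = δ / (2 * (M + 1)) * M := by field_simp
    _ < δ := by
        rw [div_mul_eq_mul_div, div_lt_iff₀ (by positivity)]
        nlinarith

theorem kern_anti (hε : 0 < ε) {x y : E} (h : ‖x‖ ≤ ‖y‖) : kern ε y ≤ kern ε x := by
  have := profile_integral_pos (E := E)
  refine mul_le_mul_of_nonneg_left (softRamp_mono one_pos ?_) (by positivity)
  rw [norm_smul, norm_smul]
  have : ‖ε⁻¹‖ * ‖x‖ ≤ ‖ε⁻¹‖ * ‖y‖ := by gcongr
  exact neg_le_neg (pow_le_pow_left₀ (by positivity) this 2)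

/-- A function with nonnegative integrals over all small balls about `z` has nonnegative
mollification at `z`: the radially decreasing kernel is a superposition of balls. -/
theorem moll_nonneg_of_ball [Nontrivial E] (hε : 0 < ε) (hg : LocallyIntegrable g) {z : E}
    (h0 : ∀ ρ, 0 < ρ → ρ ≤ ε → 0 ≤ ∫ y in Metric.closedBall z ρ, g y) : 0 ≤ moll ε g z := by
  set k : E → ℝ := fun y => kern ε (z - y) with hk
  have hkc : Continuous k := (kern_contDiff ε).continuous.comp (by fun_prop)
  have hk0 : ∀ y, 0 ≤ k y := fun y => kern_nonneg hε _
  have hkz : ∀ y, ε ≤ dist y z → k y = 0 := fun y hy =>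
    kern_eq_zero hε (by rwa [← dist_eq_norm, dist_comm])
  set M := k z
  have hkM : ∀ y, k y ≤ M := fun y => kern_anti hε (by simp)
  set B := Metric.closedBall z ε
  set G : E → ℝ := B.indicator g with hG
  have hGi : Integrable G := (integrable_indicator_iff measurableSet_closedBall).2
    (hg.integrableOn_isCompact (isCompact_closedBall z ε))
  let F : E → ℝ → ℝ := fun y s => Set.indicator {p : E × ℝ | p.2 ≤ k p.1} (fun p => G p.1) (y, s)
  have hms : MeasurableSet {p : E × ℝ | p.2 ≤ k p.1} :=
    measurableSet_le measurable_snd (hkc.measurable.comp measurable_fst)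
  have hFi : Integrable (Function.uncurry F) (volume.prod (volume.restrict (Set.Ioc 0 M))) :=
    (hGi.comp_fst _).indicator hms
  have hswap := integral_integral_swap hFi
  have hinner : ∀ y, ∫ s in Set.Ioc 0 M, F y s = g y * k y := by
    intro y
    have e : ∀ s, F y s = Set.indicator (Set.Iic (k y)) (fun _ => G y) s := fun s => rfl
    simp only [e]
    rw [integral_indicator measurableSet_Iic, integral_const, smul_eq_mul,
      measureReal_restrict_apply_univ, measureReal_restrict_apply measurableSet_Iic]
    have : Set.Iic (k y) ∩ Set.Ioc 0 M = Set.Ioc 0 (k y) := by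
      ext s
      constructor
      · rintro ⟨h1, h2⟩
        exact ⟨h2.1, h1⟩
      · rintro ⟨h1, h2⟩
        exact ⟨h2, h1, h2.trans (hkM y)⟩
    rw [this, Real.volume_real_Ioc_of_le (hk0 y), sub_zero, mul_comm]
    by_cases hy : y ∈ B
    · rw [hG, Set.indicator_of_mem hy]
    · rw [hkz y (not_le.1 hy).le, mul_zero, mul_zero]
  have hlhs : moll ε g z = ∫ y, ∫ s in Set.Ioc 0 M, F y s := by
    simp only [hinner]; rfl
  rw [hlhs, hswap]
  refine setIntegral_nonneg measurableSet_Ioc fun s hs => ?_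
  have e : ∀ y, F y s = Set.indicator {y | s ≤ k y} G y := fun y => rfl
  simp only [e]
  have hclosed : IsClosed {y | s ≤ k y} := isClosed_le continuous_const hkc
  rw [integral_indicator hclosed.measurableSet]
  -- the superlevel set is a ball
  have hsub : {y | s ≤ k y} ⊆ B := fun y hy => by
    by_contra hn
    have h1 := hkz y (not_le.1 hn).le
    have h2 : s ≤ k y := hy
    linarith [hs.1]
  have hcomp : IsCompact {y | s ≤ k y} := (isCompact_closedBall z ε).of_isClosed_subset hclosed hsub
  obtain ⟨y0, hy0, hmax⟩ := hcomp.exists_isMaxOn ⟨z, hs.2⟩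
    (f := fun y => dist y z) (by fun_prop)
  have hball : {y | s ≤ k y} = Metric.closedBall z (dist y0 z) := by
    ext y
    refine ⟨fun hy => hmax hy, fun hy => ?_⟩
    have h1 : k y0 ≤ k y := kern_anti hε (by
      rw [← dist_eq_norm, ← dist_eq_norm, dist_comm z, dist_comm z]; exact hy)
    exact le_trans (show s ≤ k y0 from hy0) h1
  rw [setIntegral_congr_fun hclosed.measurableSet
    fun y hy => show G y = g y from Set.indicator_of_mem (hsub hy) g, hball]
  rcases (dist_nonneg (x := y0) (y := z)).eq_or_lt with h | h
  · rw [← h, Metric.closedBall_zero, Measure.restrict_singleton]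
    simp
  · exact h0 _ h (hsub hy0)

theorem le_moll_of_le_average [Nontrivial E] (hε : 0 < ε) (hg : LocallyIntegrable g) {z : E}
    {r : ℝ} (hr : ∀ ρ, 0 < ρ → ρ ≤ ε → r ≤ ⨍ y in Metric.closedBall z ρ, g y) :
    r ≤ moll ε g z := by
  have h1 : 0 ≤ moll ε (fun y => g y + -r) z := by
    have hga : LocallyIntegrable fun y => g y + -r := hg.add (locallyIntegrable_const (-r))
    refine moll_nonneg_of_ball hε hga fun ρ hρ hρε => ?_
    have hv : 0 < volume.real (Metric.closedBall z ρ) :=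
      ENNReal.toReal_pos (Metric.measure_closedBall_pos volume z hρ).ne'
        (isCompact_closedBall z ρ).measure_lt_top.ne
    have h2 := hr ρ hρ hρε
    rw [setAverage_eq, smul_eq_mul, ← div_eq_inv_mul, le_div_iff₀ hv] at h2
    rw [integral_add (hg.integrableOn_isCompact (isCompact_closedBall z ρ))
      (continuous_const.continuousOn.integrableOn_compact (isCompact_closedBall z ρ)), setIntegral_const, smul_eq_mul]
    linarith
  rw [moll_add hε hg (locallyIntegrable_const _), moll_const hε] at h1
  linarith

end Kernel

/-! ### Cutoff functions and the mean value inequality -/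

section MeanValue

theorem exists_smooth_cutoff {E : Type*} [NormedAddCommGroup E] [NormedSpace ℝ E]
    [FiniteDimensional ℝ E] {K U : Set E} (hK : IsCompact K) (hU : IsOpen U) (hKU : K ⊆ U) :
    ∃ χ : E → ℝ, ContDiff ℝ ∞ χ ∧ HasCompactSupport χ ∧ tsupport χ ⊆ U ∧ (∀ z, 0 ≤ χ z) ∧
      (∀ z, χ z ≤ 1) ∧ ∃ O, IsOpen O ∧ K ⊆ O ∧ ∀ z ∈ O, χ z = 1 := by
  have : ProperSpace E := FiniteDimensional.proper_real E
  obtain ⟨T, hT, hKT, hTU⟩ := exists_compact_between hK hU hKU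
  obtain ⟨f, hf1, hf0, hf01⟩ := exists_contMDiffMap_one_nhds_of_subset_interior (n := ⊤)
    (modelWithCornersSelf ℝ E) hK.isClosed hKT
  have hsupp : tsupport f ⊆ T := closure_minimal (fun z hz => by
    by_contra hn
    exact hz (hf0 z hn)) hT.isClosed
  obtain ⟨O, hO, hKO, hO1⟩ := mem_nhdsSet_iff_exists.1 hf1
  exact ⟨f, f.contMDiff.contDiff, hT.of_isClosed_subset (isClosed_tsupport _) hsupp,
    hsupp.trans hTU, fun z => (hf01 z).1, fun z => (hf01 z).2, O, hO, hKO, fun z hz => hO1 hz⟩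

/-- A function smooth near a compact set agrees near it with a smooth compactly supported one. -/
theorem exists_contDiff_eq_near {E : Type*} [NormedAddCommGroup E] [NormedSpace ℝ E]
    [FiniteDimensional ℝ E] {K U : Set E} (hK : IsCompact K) (hU : IsOpen U) (hKU : K ⊆ U)
    {w : E → ℝ} {N : ℕ∞} (hw : ∀ z ∈ U, ContDiffAt ℝ N w z) :
    ∃ w' : E → ℝ, ContDiff ℝ N w' ∧ HasCompactSupport w' ∧
      ∃ O, IsOpen O ∧ K ⊆ O ∧ ∀ z ∈ O, w' z = w z := by
  obtain ⟨χ, hχ, hχc, hχU, -, -, O, hO, hKO, hO1⟩ := exists_smooth_cutoff hK hU hKU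
  refine ⟨fun z => χ z * w z, ?_, hχc.mul_right, O, hO, hKO, fun z hz => by simp [hO1 z hz]⟩
  rw [contDiff_iff_contDiffAt]
  intro z
  by_cases hz : z ∈ U
  · exact (hχ.contDiffAt.of_le (by exact_mod_cast le_top)).mul (hw z hz)
  · have h0 : (fun z => χ z * w z) =ᶠ[𝓝 z] fun _ => 0 := by
      filter_upwards [notMem_tsupport_iff_eventuallyEq.1 fun h => hz (hχU h)] with y hy
      simp [hy]
    exact contDiffAt_const.congr_of_eventuallyEq h0

/-- Integration by parts along the direction `a` against a test function. -/
theorem integral_fderiv_mul_fderiv {E : Type*} [NormedAddCommGroup E] [InnerProductSpace ℝ E]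
    [FiniteDimensional ℝ E] [MeasurableSpace E] [BorelSpace E] {w Φ : E → ℝ}
    (hw : ContDiff ℝ ∞ w) (hΦ : ContDiff ℝ ∞ Φ) (hΦc : HasCompactSupport Φ) (z : E) (s : ℝ)
    (a : E) : ∫ y, fderiv ℝ w (z + s • y) a * fderiv ℝ Φ y a =
      ∫ y, s * secondDeriv w (z + s • y) a a * (-Φ y) := by
  have hw1 : ContDiff ℝ ∞ (fderiv ℝ w) := hw.fderiv_right (m := ∞) (by simp)
  let f : E → ℝ := fun y => fderiv ℝ w (z + s • y) a
  have hf1 : ContDiff ℝ ∞ f := (hw1.comp (by fun_prop)).clm_apply contDiff_const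
  have happ : ∀ {g : E → ℝ}, ContDiff ℝ ∞ g → Continuous fun y => fderiv ℝ g y a := fun hg =>
    (hg.continuous_fderiv (by simp)).clm_apply continuous_const
  have hfd : ∀ y, fderiv ℝ f y a = s * secondDeriv w (z + s • y) a a := by
    intro y
    have e1 : HasFDerivAt (fun y : E => z + s • y) (s • ContinuousLinearMap.id ℝ E) y :=
      ((hasFDerivAt_id y).const_smul s).const_add z
    have e2 : HasFDerivAt (fun y => fderiv ℝ w (z + s • y)) _ y :=
      HasFDerivAt.comp y (hw1.differentiable (by simp) (z + s • y)).hasFDerivAt e1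
    have e3 : HasFDerivAt f _ y := e2.clm_apply (hasFDerivAt_const a y)
    rw [e3.fderiv]
    simp
  have := integral_mul_fderiv_eq_neg_fderiv_mul_of_integrable (μ := (volume : Measure E))
    (f := f) (g := Φ) (v := a) ((happ hf1).mul hΦ.continuous |>.integrable_of_hasCompactSupport
      hΦc.mul_left) ((hf1.continuous.mul (happ hΦ)).integrable_of_hasCompactSupport
      (hΦc.fderiv_apply ℝ a).mul_left)
    ((hf1.continuous.mul hΦ.continuous).integrable_of_hasCompactSupport hΦc.mul_left)
    (fun x _ => hf1.differentiable (by simp) x) fun x _ => hΦ.differentiable (by simp) x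
  simp only [hfd] at this
  rw [this, ← integral_neg]
  simp only [mul_neg]

variable {n : ℕ}

/-- The Laplacian in real coordinates. -/
noncomputable def laplace (v : Cn n → ℝ) (z : Cn n) : ℝ := ∑ j : Fin n,
  (secondDeriv v z (EuclideanSpace.single j 1) (EuclideanSpace.single j 1) +
    secondDeriv v z (EuclideanSpace.single j Complex.I) (EuclideanSpace.single j Complex.I))

theorem laplace_nonneg {m : ℕ} (hm : 1 ≤ m) (hn : 1 ≤ n) {v : Cn n → ℝ} {z : Cn n}
    (h : MPos m (ddc v z)) : 0 ≤ laplace v z := by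
  have h1 := h.trace_nonneg hm hn
  rw [ddc_eq, trace_leviMatrix] at h1
  change 0 ≤ 1 / 4 * laplace v z at h1
  linarith

theorem eq_sum_single (y : Cn n) : y = ∑ j : Fin n,
    ((y j).re • (EuclideanSpace.single j 1 : Cn n) +
      (y j).im • (EuclideanSpace.single j Complex.I : Cn n)) := by
  conv_lhs => rw [show y = WithLp.toLp 2 (fun j => y j) from rfl, sum_smul_single]
  refine Finset.sum_congr rfl fun j _ => ?_
  rw [complex_smul_eq, I_smul_single]

set_option maxHeartbeats 1000000 in
/-- Monotonicity in the radius of weighted means of a function with nonnegative Laplacian, in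
integrated form: the mean with a radial weight is at least the value at the centre. -/
theorem mul_integral_le_of_laplace_nonneg {w : Cn n → ℝ} (hw : ContDiff ℝ ∞ w)
    (hwc : HasCompactSupport w) {z : Cn n} {R : ℝ} {ψ : ℝ → ℝ} (hψ : ContDiff ℝ ∞ ψ)
    (hψ0 : ∀ x, 0 ≤ ψ x) (hψR : ∀ x, R ^ 2 ≤ x → ψ x = 0) (hR : 0 ≤ R)
    (hlap : ∀ y ∈ Metric.closedBall z R, 0 ≤ laplace w y) :
    w z * ∫ y : Cn n, ψ (‖y‖ ^ 2) ≤ ∫ y : Cn n, w (z + y) * ψ (‖y‖ ^ 2) := by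
  let k : Cn n → ℝ := fun y => ψ (‖y‖ ^ 2)
  have hk : ContDiff ℝ ∞ k := hψ.comp (contDiff_norm_sq ℝ)
  have hk0 : ∀ y : Cn n, R ≤ ‖y‖ → k y = 0 := fun y hy => hψR _ (by gcongr)
  have hkc : HasCompactSupport k := HasCompactSupport.intro (isCompact_closedBall 0 R) fun y hy =>
    hk0 y (by simpa using (not_le.1 (by simpa using hy)).le)
  -- a radial potential with gradient `k y • y`
  let G : ℝ → ℝ := fun t => (1 / 2) * ∫ x in (R ^ 2)..t, ψ x
  have hGd : ∀ t, HasDerivAt G ((1 / 2) * ψ t) t := fun t =>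
    (intervalIntegral.integral_hasDerivAt_right (hψ.continuous.intervalIntegrable _ _)
      hψ.continuous.stronglyMeasurable.stronglyMeasurableAtFilter hψ.continuous.continuousAt).const_mul _
  have hGs : ContDiff ℝ ∞ G := by
    rw [contDiff_infty_iff_deriv]
    refine ⟨fun x => (hGd x).differentiableAt, ?_⟩
    rw [show deriv G = fun t => (1 / 2) * ψ t from funext fun t => (hGd t).deriv]
    exact contDiff_const.mul hψ
  have hG0 : ∀ t, R ^ 2 ≤ t → G t = 0 := by
    intro t ht
    have : ∫ x in (R ^ 2)..t, ψ x = ∫ x in (R ^ 2)..t, (0 : ℝ) :=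
      intervalIntegral.integral_congr fun x hx => hψR x (by
        rw [Set.uIcc_of_le ht] at hx; exact hx.1)
    simp [G, this]
  have hGneg : ∀ t, G t ≤ 0 := by
    intro t
    rcases le_total (R ^ 2) t with h | h
    · exact (hG0 t h).le
    · have h1 : 0 ≤ ∫ x in t..(R ^ 2), ψ x := intervalIntegral.integral_nonneg h fun x _ => hψ0 x
      simp only [G]
      rw [intervalIntegral.integral_symm]
      linarith
  let Φ : Cn n → ℝ := fun y => G (‖y‖ ^ 2)
  have hΦ : ContDiff ℝ ∞ Φ := hGs.comp (contDiff_norm_sq ℝ)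
  have hΦ0 : ∀ y : Cn n, R ≤ ‖y‖ → Φ y = 0 := fun y hy => hG0 _ (by gcongr)
  have hΦc : HasCompactSupport Φ := HasCompactSupport.intro (isCompact_closedBall 0 R) fun y hy =>
    hΦ0 y (by simpa using (not_le.1 (by simpa using hy)).le)
  have hΦd : ∀ y a, fderiv ℝ Φ y a = k y * inner ℝ y a := by
    intro y a
    have h1 := (hGd (‖y‖ ^ 2)).comp_hasFDerivAt y (hasStrictFDerivAt_norm_sq y).hasFDerivAt
    have h2 : HasFDerivAt Φ _ y := h1
    rw [h2.fderiv]
    simp [k]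
    ring
  let F : ℝ → ℝ := fun s => ∫ y, w (z + s • y) * k y
  let F' : ℝ → ℝ := fun s => ∫ y, fderiv ℝ w (z + s • y) y * k y
  have hw1 : ContDiff ℝ ∞ (fderiv ℝ w) := hw.fderiv_right (m := ∞) (by simp)
  obtain ⟨C, hC⟩ := hw1.continuous.bounded_above_of_compact_support (hwc.fderiv ℝ)
  have hcd : ∀ s : ℝ, Continuous fun y => fderiv ℝ w (z + s • y) y * k y := fun s =>
    ((hw1.continuous.comp (by fun_prop)).clm_apply continuous_id).mul hk.continuous
  have hF : ∀ s, HasDerivAt F (F' s) s := by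
    intro s
    refine (hasDerivAt_integral_of_dominated_loc_of_deriv_le (s := Set.univ)
      (F := fun s y => w (z + s • y) * k y)
      (F' := fun s y => fderiv ℝ w (z + s • y) y * k y)
      (bound := fun y => C * ‖y‖ * k y) univ_mem ?_ ?_ ?_ ?_ ?_ ?_).2
    · exact Eventually.of_forall fun s => ((hw.continuous.comp (by fun_prop)).mul
        hk.continuous).aestronglyMeasurable
    · exact ((hw.continuous.comp (by fun_prop)).mul
        hk.continuous).integrable_of_hasCompactSupport hkc.mul_left
    · exact (hcd s).aestronglyMeasurable
    · refine Eventually.of_forall fun y s _ => ?_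
      rw [norm_mul, Real.norm_of_nonneg (hψ0 _ : 0 ≤ k y)]
      refine mul_le_mul_of_nonneg_right ?_ (hψ0 _)
      refine ((fderiv ℝ w (z + s • y)).le_opNorm y).trans ?_
      exact mul_le_mul_of_nonneg_right (hC _) (norm_nonneg _)
    · exact ((continuous_const.mul continuous_norm).mul hk.continuous).integrable_of_hasCompactSupport
        hkc.mul_left
    · refine Eventually.of_forall fun y s _ => ?_
      have h1 : HasDerivAt (fun s : ℝ => z + s • y) y s := by
        simpa using ((hasDerivAt_id s).smul_const y).const_add z
      exact ((hw.differentiable (by simp) _).hasFDerivAt.comp_hasDerivAt s h1).mul_const _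
  -- integration by parts turns the derivative into an integral of the Laplacian
  have hparts : ∀ (s : ℝ) (a : Cn n), ∫ y, fderiv ℝ w (z + s • y) a * (k y * inner ℝ y a) =
      ∫ y, s * secondDeriv w (z + s • y) a a * (-Φ y) := by
    intro s a
    rw [← integral_fderiv_mul_fderiv hw hΦ hΦc]
    simp only [hΦd]
  have hi1 : ∀ (s : ℝ) (a : Cn n),
      Integrable fun y => fderiv ℝ w (z + s • y) a * (k y * inner ℝ y a) := fun s a => by
    refine Continuous.integrable_of_hasCompactSupport ?_ hkc.mul_right.mul_left
    exact ((hw1.continuous.comp (by fun_prop)).clm_apply continuous_const).mul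
      (hk.continuous.mul (by fun_prop))
  have hi2 : ∀ (s : ℝ) (a : Cn n),
      Integrable fun y => s * secondDeriv w (z + s • y) a a * (-Φ y) := fun s a => by
    refine Continuous.integrable_of_hasCompactSupport ?_ hΦc.neg.mul_left
    refine Continuous.mul (continuous_const.mul ?_) hΦ.continuous.neg
    exact ((((continuous_secondDeriv (hw.of_le two_le_infty)).comp (by fun_prop : Continuous fun y : Cn n => z + s • y)).clm_apply
      continuous_const).clm_apply continuous_const)
  have hF'2 : ∀ s, F' s = ∫ y, s * laplace w (z + s • y) * (-Φ y) := by
    intro s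
    have e1 : ∀ y : Cn n, fderiv ℝ w (z + s • y) y * k y = ∑ j : Fin n,
        (fderiv ℝ w (z + s • y) (EuclideanSpace.single j 1) *
            (k y * inner ℝ y (EuclideanSpace.single j 1)) +
          fderiv ℝ w (z + s • y) (EuclideanSpace.single j Complex.I) *
            (k y * inner ℝ y (EuclideanSpace.single j Complex.I))) := by
      intro y
      have hin : ∀ (j : Fin n) (c : ℂ), inner ℝ y (EuclideanSpace.single j c) =
          (y j).re * c.re + (y j).im * c.im := by
        intro j c
        rw [PiLp.inner_apply, Finset.sum_eq_single j]
        · simp [Complex.inner]; ring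
        · intro i _ hi; simp [hi]
        · simp
      conv_lhs => rw [show fderiv ℝ w (z + s • y) y = fderiv ℝ w (z + s • y) (∑ j : Fin n,
        ((y j).re • (EuclideanSpace.single j 1 : Cn n) +
        (y j).im • (EuclideanSpace.single j Complex.I : Cn n))) by rw [← eq_sum_single y]]
      rw [map_sum, Finset.sum_mul]
      refine Finset.sum_congr rfl fun j _ => ?_
      rw [hin, hin]
      simp
      ring
    have e2 : ∀ y : Cn n, s * laplace w (z + s • y) * (-Φ y) = ∑ j : Fin n,
        (s * secondDeriv w (z + s • y) (EuclideanSpace.single j 1) (EuclideanSpace.single j 1) *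
            (-Φ y) +
          s * secondDeriv w (z + s • y) (EuclideanSpace.single j Complex.I)
            (EuclideanSpace.single j Complex.I) * (-Φ y)) := by
      intro y
      rw [laplace, Finset.mul_sum, Finset.sum_mul]
      refine Finset.sum_congr rfl fun j _ => ?_
      ring
    simp only [F', e1, e2]
    have key : ∀ (f f' g g' : Fin n → Cn n → ℝ), (∀ j, Integrable (f j)) → (∀ j, Integrable (f' j)) →
        (∀ j, Integrable (g j)) → (∀ j, Integrable (g' j)) →
        (∀ j, ∫ y, (f j y + f' j y) = ∫ y, (g j y + g' j y)) →
        ∫ y, ∑ j, (f j y + f' j y) = ∫ y, ∑ j, (g j y + g' j y) := by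
      intro f f' g g' h1 h2 h3 h4 h
      have h12 : ∀ j, Integrable fun y => f j y + f' j y := fun j => (h1 j).add (h2 j)
      have h34 : ∀ j, Integrable fun y => g j y + g' j y := fun j => (h3 j).add (h4 j)
      rw [integral_finsetSum _ fun j _ => h12 j, integral_finsetSum _ fun j _ => h34 j]
      exact Finset.sum_congr rfl fun j _ => h j
    refine key _ _ _ _ (fun j => hi1 s _) (fun j => hi1 s _) (fun j => hi2 s _)
      (fun j => hi2 s _) fun j => ?_
    rw [integral_add (hi1 s _) (hi1 s _), integral_add (hi2 s _) (hi2 s _), hparts, hparts]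
  have hmono : MonotoneOn F (Set.Icc 0 1) := by
    refine monotoneOn_of_deriv_nonneg (convex_Icc 0 1)
      (fun s _ => (hF s).continuousAt.continuousWithinAt)
      (fun s _ => (hF s).differentiableAt.differentiableWithinAt) fun s hs => ?_
    rw [interior_Icc] at hs
    rw [(hF s).deriv, hF'2]
    refine integral_nonneg fun y => ?_
    by_cases hy : R ≤ ‖y‖
    · simp [hΦ0 y hy]
    · refine mul_nonneg (mul_nonneg hs.1.le (hlap _ ?_)) (neg_nonneg.2 (hGneg _))
      have : ‖s • y‖ ≤ R := by
        rw [norm_smul, Real.norm_of_nonneg hs.1.le]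
        nlinarith [hs.2, not_le.1 hy, norm_nonneg y]
      simpa using this
  have h01 := hmono (by simp) (by simp) zero_le_one
  simp only [F, zero_smul, add_zero, one_smul] at h01
  rw [integral_const_mul] at h01
  exact h01

/-- The mean value inequality for smooth `m`-subharmonic functions. -/
theorem le_average_of_mshAt {m : ℕ} (hm : 1 ≤ m) (hn : 1 ≤ n) {w : Cn n → ℝ} {z : Cn n} {r : ℝ}
    (hr : 0 < r) {U : Set (Cn n)} (hU : IsOpen U) (hzU : Metric.closedBall z r ⊆ U)
    (hw : ∀ y ∈ U, MSHAt m w y) : w z ≤ ⨍ y in Metric.closedBall z r, w y := by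
  obtain ⟨w', hw's, hw'c, O, hO, hKO, hO1⟩ :=
    exists_contDiff_eq_near (isCompact_closedBall z r) hU hzU (w := w) (N := ⊤) fun y hy => (hw y hy).1
  have hOU : IsOpen (O ∩ U) := hO.inter hU
  obtain ⟨δ, hδ, hδO⟩ := (isCompact_closedBall z r).exists_cthickening_subset_open hOU
    (Set.subset_inter hKO hzU)
  rw [cthickening_closedBall hδ.le hr.le] at hδO
  have hlap : ∀ y ∈ Metric.closedBall z (δ + r), 0 ≤ laplace w' y := by
    intro y hy
    refine laplace_nonneg hm hn ?_
    have : w' =ᶠ[𝓝 y] w := by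
      filter_upwards [hO.mem_nhds (hδO hy).1] with x hx using hO1 x hx
    rw [ddc_congr this]
    exact (hw y (hδO hy).2).2
  have hv : 0 < volume.real (Metric.closedBall z r) :=
    ENNReal.toReal_pos (Metric.measure_closedBall_pos volume z hr).ne'
      (isCompact_closedBall z r).measure_lt_top.ne
  -- radial weights decreasing to the indicator function of the ball
  obtain ⟨N, hN⟩ := exists_nat_gt ((δ * δ)⁻¹)
  let ψ : ℕ → ℝ → ℝ := fun j x => Real.smoothTransition ((N + j) * (r ^ 2 - x) + 1)
  have hNpos : (0 : ℝ) < N := (by positivity : (0 : ℝ) < (δ * δ)⁻¹).trans hN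
  have hψR : ∀ j x, (δ + r) ^ 2 ≤ x → ψ j x = 0 := by
    intro j x hx
    apply Real.smoothTransition.zero_of_nonpos
    have h1 : δ * δ ≤ x - r ^ 2 := by nlinarith
    have h2 : 1 ≤ N * (δ * δ) := by
      have := (inv_lt_iff_one_lt_mul₀ (by positivity : 0 < δ * δ)).1 hN
      linarith
    have h3 : (N : ℝ) * (δ * δ) ≤ (N + j) * (x - r ^ 2) :=
      mul_le_mul (by linarith [(Nat.cast_nonneg j : (0 : ℝ) ≤ j)]) h1 (by positivity) (by positivity)
    nlinarith
  have hψ1 : ∀ j x, x ≤ r ^ 2 → ψ j x = 1 := by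
    intro j x hx
    apply Real.smoothTransition.one_of_one_le
    have : 0 ≤ ((N : ℝ) + j) * (r ^ 2 - x) := mul_nonneg (by positivity) (by linarith)
    linarith
  have hψlim : ∀ y : Cn n, Tendsto (fun j => ψ j (‖y‖ ^ 2)) atTop
      (𝓝 (Set.indicator (Metric.closedBall 0 r) (fun _ => (1 : ℝ)) y)) := by
    intro y
    by_cases hy : y ∈ Metric.closedBall 0 r
    · rw [Set.indicator_of_mem hy]
      have hy' : ‖y‖ ≤ r := by simpa using hy
      simp only [hψ1 _ _ (by gcongr : ‖y‖ ^ 2 ≤ r ^ 2)]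
      exact tendsto_const_nhds
    · rw [Set.indicator_of_notMem hy]
      have hy' : r < ‖y‖ := by simpa using hy
      have h1 : 0 < ‖y‖ ^ 2 - r ^ 2 := by nlinarith
      obtain ⟨J, hJ⟩ := exists_nat_gt ((‖y‖ ^ 2 - r ^ 2)⁻¹)
      refine tendsto_const_nhds.congr' ?_
      filter_upwards [eventually_ge_atTop J] with j hj
      symm
      apply Real.smoothTransition.zero_of_nonpos
      have h2 := (inv_lt_iff_one_lt_mul₀ h1).1 hJ
      have h3 : (J : ℝ) ≤ N + j := by
        have : (J : ℝ) ≤ j := by exact_mod_cast hj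
        linarith
      nlinarith
  have hball : ∀ y : Cn n, Set.indicator (Metric.closedBall 0 (δ + r)) (fun _ => (1 : ℝ)) y ≥ 0 :=
    fun y => Set.indicator_nonneg (fun _ _ => zero_le_one) y
  have hψb : ∀ j (y : Cn n), |ψ j (‖y‖ ^ 2)| ≤
      Set.indicator (Metric.closedBall 0 (δ + r)) (fun _ => (1 : ℝ)) y := by
    intro j y
    rw [abs_of_nonneg (Real.smoothTransition.nonneg _)]
    by_cases hy : y ∈ Metric.closedBall 0 (δ + r)
    · rw [Set.indicator_of_mem hy]; exact Real.smoothTransition.le_one _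
    · rw [Set.indicator_of_notMem hy]
      have hy' : δ + r < ‖y‖ := by simpa using hy
      exact (hψR j _ (by gcongr)).le
  have hψs : ∀ j, ContDiff ℝ ∞ (ψ j) := fun j =>
    Real.smoothTransition.contDiff.comp (by fun_prop)
  have hbi : Integrable (Set.indicator (Metric.closedBall (0 : Cn n) (δ + r)) (fun _ => (1 : ℝ))) :=
    (integrable_indicator_iff measurableSet_closedBall).2
      (continuousOn_const.integrableOn_compact (isCompact_closedBall _ _))
  have hmain := fun j => mul_integral_le_of_laplace_nonneg hw's hw'c (hψs j)
    (fun x => Real.smoothTransition.nonneg _) (hψR j) (by positivity) hlap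
  obtain ⟨C, hC⟩ := hw's.continuous.bounded_above_of_compact_support hw'c
  have hl1 : Tendsto (fun j => ∫ y : Cn n, ψ j (‖y‖ ^ 2)) atTop
      (𝓝 (∫ y, Set.indicator (Metric.closedBall (0 : Cn n) r) (fun _ => (1 : ℝ)) y)) :=
    tendsto_integral_of_dominated_convergence _
      (fun j => ((hψs j).continuous.comp (by fun_prop)).aestronglyMeasurable) hbi
      (fun j => Eventually.of_forall fun y => hψb j y) (Eventually.of_forall hψlim)
  have hl2 : Tendsto (fun j => ∫ y : Cn n, w' (z + y) * ψ j (‖y‖ ^ 2)) atTop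
      (𝓝 (∫ y, w' (z + y) * Set.indicator (Metric.closedBall (0 : Cn n) r) (fun _ => (1 : ℝ)) y)) := by
    refine tendsto_integral_of_dominated_convergence _
      (fun j => ((hw's.continuous.comp (by fun_prop)).mul
        ((hψs j).continuous.comp (by fun_prop))).aestronglyMeasurable) (hbi.const_mul C)
      (fun j => Eventually.of_forall fun y => ?_)
      (Eventually.of_forall fun y => (hψlim y).const_mul _)
    rw [norm_mul]
    exact mul_le_mul (hC _) (hψb j y) (norm_nonneg _) ((norm_nonneg _).trans (hC 0))
  have hfin := le_of_tendsto_of_tendsto' (hl1.const_mul (w' z)) hl2 hmain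
  have e1 : ∫ y, Set.indicator (Metric.closedBall (0 : Cn n) r) (fun _ => (1 : ℝ)) y =
      volume.real (Metric.closedBall z r) := by
    rw [integral_indicator measurableSet_closedBall, setIntegral_const, smul_eq_mul, mul_one]
    simp only [Measure.real, Measure.addHaar_closedBall_center volume z r]
  have e2 : ∫ y, w' (z + y) * Set.indicator (Metric.closedBall (0 : Cn n) r) (fun _ => (1 : ℝ)) y =
      ∫ y in Metric.closedBall z r, w y := by
    have e3 : ∀ y : Cn n, w' (z + y) * Set.indicator (Metric.closedBall (0 : Cn n) r)
        (fun _ => (1 : ℝ)) y = Set.indicator (Metric.closedBall z r) w' (z + y) := by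
      intro y
      by_cases hy : y ∈ Metric.closedBall 0 r
      · rw [Set.indicator_of_mem hy, Set.indicator_of_mem (by simpa using hy), mul_one]
      · rw [Set.indicator_of_notMem hy, Set.indicator_of_notMem (by simpa using hy), mul_zero]
    simp only [e3]
    rw [integral_add_left_eq_self (fun y => Set.indicator (Metric.closedBall z r) w' y) z,
      integral_indicator measurableSet_closedBall]
    exact setIntegral_congr_fun measurableSet_closedBall fun y hy => hO1 y (hKO hy)
  rw [e1, e2, hO1 z (hKO (Metric.mem_closedBall_self hr.le))] at hfin
  rw [setAverage_eq, smul_eq_mul, ← div_eq_inv_mul, le_div_iff₀ hv]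
  exact hfin

end MeanValue

/-! ### The mixed pairing with `C²` functions -/

section Pairing

variable {n : ℕ}

theorem norm_wedgeCoeff_le {A : Fin n → CMat n} {R : Fin n → ℝ}
    (hR : ∀ l j k, ‖A l j k‖ ≤ R l) :
    ‖wedgeCoeff A‖ ≤ n.factorial * n.factorial * ∏ l, R l := by
  have hs : ∀ σ : Equiv.Perm (Fin n), ‖((Equiv.Perm.sign σ : ℤ) : ℂ)‖ = 1 := by
    intro σ
    rcases Int.units_eq_one_or (Equiv.Perm.sign σ) with h | h <;> simp [h]
  calc ‖wedgeCoeff A‖ ≤ ∑ σ : Equiv.Perm (Fin n), ∑ τ : Equiv.Perm (Fin n), ∏ l, R l := by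
        refine (norm_sum_le _ _).trans (Finset.sum_le_sum fun σ _ => (norm_sum_le _ _).trans
          (Finset.sum_le_sum fun τ _ => ?_))
        rw [norm_mul, norm_mul, hs, hs, one_mul, one_mul, norm_prod]
        exact Finset.prod_le_prod (fun _ _ => norm_nonneg _) fun l _ => hR l _ _
    _ = n.factorial * n.factorial * ∏ l, R l := by
        simp [Fintype.card_perm]; ring

theorem norm_leviMatrix_le {H : Cn n →L[ℝ] Cn n →L[ℝ] ℝ} {C : ℝ}
    (hC : ∀ a b, |H a b| ≤ C * ‖a‖ * ‖b‖) (j k : Fin n) : ‖leviMatrix H j k‖ ≤ C := by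
  have h1 : ∀ a b : Cn n, ‖a‖ = 1 → ‖b‖ = 1 → ‖(H a b : ℂ)‖ ≤ C := by
    intro a b ha hb
    rw [Complex.norm_real, Real.norm_eq_abs]
    simpa [ha, hb] using hC a b
  have hI : ∀ l : Fin n, ‖(Complex.I • EuclideanSpace.single l (1 : ℂ) : Cn n)‖ = 1 := by
    intro l; simp [norm_smul]
  have h11 : ∀ l : Fin n, ‖(EuclideanSpace.single l (1 : ℂ) : Cn n)‖ = 1 := by
    intro l; simp
  rw [leviMatrix, Matrix.of_apply, leviForm, norm_mul]
  have e1 := h1 _ _ (h11 j) (h11 k)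
  have e2 := h1 _ _ (hI j) (hI k)
  have e3 := h1 _ _ (h11 j) (hI k)
  have e4 := h1 _ _ (hI j) (h11 k)
  have := norm_add_le ((H (EuclideanSpace.single j 1) (EuclideanSpace.single k 1) : ℂ) +
    (H (Complex.I • EuclideanSpace.single j 1) (Complex.I • EuclideanSpace.single k 1) : ℂ))
    (Complex.I * ((H (EuclideanSpace.single j 1) (Complex.I • EuclideanSpace.single k 1) : ℂ) -
      (H (Complex.I • EuclideanSpace.single j 1) (EuclideanSpace.single k 1) : ℂ)))
  have h5 := norm_add_le (H (EuclideanSpace.single j 1) (EuclideanSpace.single k 1) : ℂ)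
    (H (Complex.I • EuclideanSpace.single j 1) (Complex.I • EuclideanSpace.single k 1) : ℂ)
  have h6 := norm_sub_le (H (EuclideanSpace.single j 1) (Complex.I • EuclideanSpace.single k 1) : ℂ)
    (H (Complex.I • EuclideanSpace.single j 1) (EuclideanSpace.single k 1) : ℂ)
  rw [norm_mul, Complex.norm_I, one_mul] at this
  have h7 : ‖(1 / 4 : ℂ)‖ = 1 / 4 := by norm_num
  rw [h7]
  linarith

theorem continuousOn_secondDeriv {E : Type*} [NormedAddCommGroup E] [NormedSpace ℝ E] {D : Set E}
    (hD : IsOpen D) {v : E → ℝ} (hv : ContDiffOn ℝ 2 v D) :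
    ContinuousOn (fun z => secondDeriv v z) D :=
  (hv.fderiv_of_isOpen hD (m := 1) (by norm_num)).continuousOn_fderiv_of_isOpen hD (by norm_num)

theorem continuousOn_ddc {D : Set (Cn n)} (hD : IsOpen D) {v : Cn n → ℝ}
    (hv : ContDiffOn ℝ 2 v D) : ContinuousOn (fun z => ddc v z) D := by
  simp only [ddc_eq]
  exact continuous_leviMatrix.comp_continuousOn (continuousOn_secondDeriv hD hv)

section Moll

variable {E : Type*} [NormedAddCommGroup E] [InnerProductSpace ℝ E] [FiniteDimensional ℝ E]
  [MeasurableSpace E] [BorelSpace E]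

/-- For a compactly supported `C²` function the mollification commutes with second
derivatives. -/
theorem secondDeriv_moll_clm {v : E → ℝ} (hv : ContDiff ℝ 2 v) (hvc : HasCompactSupport v)
    {ε : ℝ} (hε : 0 < ε) (z : E) (ℓ : (E →L[ℝ] E →L[ℝ] ℝ) →L[ℝ] ℝ) :
    ℓ (secondDeriv (moll ε v) z) = moll ε (fun y => ℓ (secondDeriv v y)) z := by
  have h1 : moll ε v = smoothing v (kern ε) := by
    ext x
    rw [moll_eq, smoothing]
    simp only [mul_comm]
  rw [h1, secondDeriv_smoothing_clm hv hvc (kern_integrable hε).locallyIntegrable, moll_eq]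
  simp only [mul_comm]

theorem tendsto_secondDeriv_moll_clm {v : E → ℝ} (hv : ContDiff ℝ 2 v)
    (hvc : HasCompactSupport v) (z : E) (ℓ : (E →L[ℝ] E →L[ℝ] ℝ) →L[ℝ] ℝ) :
    Tendsto (fun ε => ℓ (secondDeriv (moll ε v) z)) (𝓝[>] 0) (𝓝 (ℓ (secondDeriv v z))) := by
  have hc : Continuous fun y => ℓ (secondDeriv v y) := ℓ.continuous.comp (continuous_secondDeriv hv)
  rw [Metric.tendsto_nhds]
  intro δ hδ
  obtain ⟨r, hr, hball⟩ := Metric.continuousAt_iff.1 (hc.continuousAt (x := z)) (δ / 2) (by positivity)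
  filter_upwards [self_mem_nhdsWithin, nhdsWithin_le_nhds (Iio_mem_nhds hr)] with ε hε hεr
  have hε : 0 < ε := hε
  rw [secondDeriv_moll_clm hv hvc hε, Real.dist_eq]
  have h2 := abs_moll_sub_le hε hc.locallyIntegrable (z := z) (r := ℓ (secondDeriv v z))
    (η := δ / 2) fun y hy => (hball (lt_of_le_of_lt hy hεr)).le
  linarith

theorem abs_secondDeriv_moll_le {v : E → ℝ} (hv : ContDiff ℝ 2 v) (hvc : HasCompactSupport v)
    {C : ℝ} (hC : ∀ y a b, |secondDeriv v y a b| ≤ C * ‖a‖ * ‖b‖) {ε : ℝ} (hε : 0 < ε) (z a b : E) :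
    |secondDeriv (moll ε v) z a b| ≤ C * ‖a‖ * ‖b‖ := by
  let ℓ : (E →L[ℝ] E →L[ℝ] ℝ) →L[ℝ] ℝ :=
    (ContinuousLinearMap.apply ℝ ℝ b).comp (ContinuousLinearMap.apply ℝ (E →L[ℝ] ℝ) a)
  have h1 : secondDeriv (moll ε v) z a b = moll ε (fun y => secondDeriv v y a b) z :=
    secondDeriv_moll_clm hv hvc hε z ℓ
  have hc : Continuous fun y => secondDeriv v y a b :=
    ((continuous_secondDeriv hv).clm_apply continuous_const).clm_apply continuous_const
  have h2 := abs_moll_sub_le hε hc.locallyIntegrable (z := z) (r := 0) (η := C * ‖a‖ * ‖b‖)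
    fun y _ => by
      rw [sub_zero]
      exact hC y a b
  rwa [sub_zero, ← h1] at h2

end Moll

theorem exists_ddc_entry_clm (j k : Fin n) : ∃ ℓ ℓ' : (Cn n →L[ℝ] Cn n →L[ℝ] ℝ) →L[ℝ] ℝ,
    ∀ H, leviMatrix H j k = (ℓ H : ℂ) + (ℓ' H : ℂ) * Complex.I := by
  have hcont : Continuous fun H : Cn n →L[ℝ] Cn n →L[ℝ] ℝ => leviMatrix H j k :=
    (continuous_apply k).comp ((continuous_apply j).comp continuous_leviMatrix)
  refine ⟨⟨⟨⟨fun H => (leviMatrix H j k).re, fun H K => by simp [leviMatrix_add]⟩,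
    fun r H => by simp [leviMatrix_smul]⟩, Complex.continuous_re.comp hcont⟩,
    ⟨⟨⟨fun H => (leviMatrix H j k).im, fun H K => by simp [leviMatrix_add]⟩,
    fun r H => by simp [leviMatrix_smul]⟩, Complex.continuous_im.comp hcont⟩, fun H => ?_⟩
  exact (Complex.re_add_im _).symm

theorem tendsto_ddc_moll {v : Cn n → ℝ} (hv : ContDiff ℝ 2 v) (hvc : HasCompactSupport v)
    (z : Cn n) : Tendsto (fun ε => ddc (moll ε v) z) (𝓝[>] 0) (𝓝 (ddc v z)) := by
  refine tendsto_pi_nhds.2 fun j => tendsto_pi_nhds.2 fun k => ?_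
  obtain ⟨ℓ, ℓ', hℓ⟩ := exists_ddc_entry_clm (n := n) j k
  simp only [ddc_eq, hℓ]
  exact ((Complex.continuous_ofReal.tendsto _).comp (tendsto_secondDeriv_moll_clm hv hvc z ℓ)).add
    (((Complex.continuous_ofReal.tendsto _).comp
      (tendsto_secondDeriv_moll_clm hv hvc z ℓ')).mul_const _)

theorem mixedCoeff_eq_update {m : ℕ} (hm : 1 ≤ m) (hmn : m ≤ n) (v : Fin (m - 1) → Cn n → ℝ)
    (φ : Cn n → ℝ) (z : Cn n) : mixedCoeff m v φ z = (wedgeCoeff (Function.update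
      (fun l : Fin n => if h : (l : ℕ) < m - 1 then ddc (v ⟨l, h⟩) z else 1) ⟨m - 1, by omega⟩
      (ddc φ z))).re := by
  rw [mixedCoeff]
  congr 2
  ext1 l
  by_cases h : l = ⟨m - 1, by omega⟩
  · subst h; simp
  · have : (l : ℕ) ≠ m - 1 := fun h' => h (Fin.ext h')
    rw [Function.update_of_ne h, if_neg this]

theorem mixedCoeff_nonneg {m : ℕ} (hm : 1 ≤ m) {v : Fin (m - 1) → Cn n → ℝ}
    {φ : Cn n → ℝ} {z : Cn n} (hv : ∀ i, MPos m (ddc (v i) z)) (hφ : MPos m (ddc φ z)) :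
    0 ≤ mixedCoeff m v φ z := by
  have h1 : (fun l : Fin n => if h : (l : ℕ) < m - 1 then ddc (v ⟨l, h⟩) z
      else if (l : ℕ) = m - 1 then ddc φ z else 1) = (initSlots n m).piecewise
        (fun l : Fin n => if h : (l : ℕ) < m - 1 then ddc (v ⟨l, h⟩) z else ddc φ z) 1 := by
    ext1 l
    by_cases h : (l : ℕ) < m
    · rw [Finset.piecewise_eq_of_mem _ _ _ (mem_initSlots.2 h)]
      by_cases h2 : (l : ℕ) < m - 1
      · simp [h2]
      · have : (l : ℕ) = m - 1 := by omega
        simp [this]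
    · rw [Finset.piecewise_eq_of_notMem _ _ _ (fun h' => h (mem_initSlots.1 h'))]
      have h2 : ¬ ((l : ℕ) < m - 1) := by omega
      have h3 : ¬ ((l : ℕ) = m - 1) := by omega
      simp [h2, h3]
  rw [mixedCoeff, h1]
  refine wedgeCoeff_nonneg_of_mPos card_initSlots_le fun i _ => ?_
  split_ifs
  · exact hv _
  · exact hφ

theorem ddc_eq_zero_of_notMem_tsupport {φ : Cn n → ℝ} {z : Cn n} (hz : z ∉ tsupport φ) :
    ddc φ z = 0 := by
  have h : φ =ᶠ[𝓝 z] fun _ => (0 : ℝ) := notMem_tsupport_iff_eventuallyEq.1 hz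
  rw [ddc_congr h, ddc_const]

theorem wedgeCoeff_update_zero (A : Fin n → CMat n) (i : Fin n) :
    wedgeCoeff (Function.update A i 0) = 0 := by
  rw [← wedgeForm_apply]
  exact (wedgeForm n).map_coord_zero i (by simp)

theorem mixedCoeff_eq_zero {m : ℕ} (hm : 1 ≤ m) (hmn : m ≤ n) {v : Fin (m - 1) → Cn n → ℝ}
    {φ : Cn n → ℝ} {z : Cn n} (hz : z ∉ tsupport φ) : mixedCoeff m v φ z = 0 := by
  rw [mixedCoeff_eq_update hm hmn, ddc_eq_zero_of_notMem_tsupport hz, wedgeCoeff_update_zero]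
  rfl

theorem exists_bound_fderiv {E F : Type*} [NormedAddCommGroup E] [NormedSpace ℝ E]
    [NormedAddCommGroup F] [NormedSpace ℝ F] {f : E → F} (hf : ContDiff ℝ 1 f)
    (hfc : HasCompactSupport f) : ∃ C, 0 ≤ C ∧ ∀ y a, ‖fderiv ℝ f y a‖ ≤ C * ‖a‖ := by
  obtain ⟨C, hC⟩ := (hf.continuous_fderiv one_ne_zero).bounded_above_of_compact_support
    (hfc.fderiv ℝ)
  exact ⟨C, (norm_nonneg _).trans (hC 0), fun y a => ((fderiv ℝ f y).le_opNorm a).trans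
    (mul_le_mul_of_nonneg_right (hC y) (norm_nonneg a))⟩

theorem exists_bound_secondDeriv {E : Type*} [NormedAddCommGroup E] [NormedSpace ℝ E]
    {v : E → ℝ} (hv : ContDiff ℝ 2 v) (hvc : HasCompactSupport v) :
    ∃ C, 0 ≤ C ∧ ∀ y a b, |secondDeriv v y a b| ≤ C * ‖a‖ * ‖b‖ := by
  obtain ⟨C, hC0, hC⟩ := exists_bound_fderiv (hv.fderiv_right (m := 1) (by norm_num))
    (hvc.fderiv ℝ)
  refine ⟨C, hC0, fun y a b => ?_⟩
  rw [← Real.norm_eq_abs]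
  exact ((secondDeriv v y a).le_opNorm b).trans
    (mul_le_mul_of_nonneg_right (hC y a) (norm_nonneg b))

/-- Symmetry of the mixed pairing when the coefficient functions are only `C²`. -/
theorem integral_mul_wedgeCoeff_swap_two {S : Finset (Fin n)} {g : Fin n → Cn n → ℝ}
    (hg : ∀ l, ContDiff ℝ 2 (g l)) (hgc : ∀ l, HasCompactSupport (g l))
    {w φ : Cn n → ℝ} (hw : ContDiff ℝ ∞ w) (hφ : ContDiff ℝ ∞ φ) (hφc : HasCompactSupport φ)
    (hwc : HasCompactSupport w) (i : Fin n) :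
    ∫ z, (w z : ℂ) * wedgeCoeff (Function.update (S.piecewise (fun l => ddc (g l) z) 1) i (ddc φ z)) =
      ∫ z, (φ z : ℂ) * wedgeCoeff (Function.update (S.piecewise (fun l => ddc (g l) z) 1) i
        (ddc w z)) := by
  classical
  let G : ℝ → Fin n → Cn n → ℝ := fun ε l => if l ∈ S then moll ε (g l) else fun z => ‖z - 0‖ ^ 2
  have hGs : ∀ ε, 0 < ε → ∀ l, ContDiff ℝ ∞ (G ε l) := by
    intro ε hε l
    simp only [G]
    split_ifs
    · exact moll_contDiff hε (hg l).continuous.locallyIntegrable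
    · exact (contDiff_id.sub contDiff_const).norm_sq ℝ
  have hGd : ∀ ε z, (fun l => ddc (G ε l) z) = S.piecewise (fun l => ddc (moll ε (g l)) z) 1 := by
    intro ε z
    ext1 l
    simp only [G, Finset.piecewise]
    split_ifs
    · rfl
    · exact ddc_norm_sq 0 z
  have hswap := fun ε (hε : 0 < ε) => integral_mul_wedgeCoeff_swap (hGs ε hε) hw hφ hφc i
  simp only [hGd] at hswap
  choose C hC0 hC using fun l => exists_bound_secondDeriv (hg l) (hgc l)
  -- dominated convergence for either side
  have key : ∀ a b : Cn n → ℝ, ContDiff ℝ ∞ a → ContDiff ℝ ∞ b → HasCompactSupport a →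
      HasCompactSupport b → Tendsto (fun ε => ∫ z, (a z : ℂ) * wedgeCoeff (Function.update
        (S.piecewise (fun l => ddc (moll ε (g l)) z) 1) i (ddc b z))) (𝓝[>] 0)
        (𝓝 (∫ z, (a z : ℂ) * wedgeCoeff (Function.update
        (S.piecewise (fun l => ddc (g l) z) 1) i (ddc b z)))) := by
    intro a b ha hb hac hbc
    obtain ⟨Cb, hCb0, hCb⟩ := exists_bound_secondDeriv (hb.of_le two_le_infty) hbc
    let R : Fin n → ℝ := fun l => C l + Cb + 1
    have hcontw : ∀ F : Cn n → Fin n → CMat n, Continuous F →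
        Continuous fun z => (a z : ℂ) * wedgeCoeff (F z) := fun F hF =>
      (Complex.continuous_ofReal.comp ha.continuous).mul (continuous_wedgeCoeff.comp hF)
    refine tendsto_integral_filter_of_dominated_convergence
      (fun z => |a z| * (n.factorial * n.factorial * ∏ l, R l)) ?_ ?_ ?_ ?_
    · filter_upwards [self_mem_nhdsWithin] with ε hε
      refine (hcontw _ ?_).aestronglyMeasurable
      refine Continuous.update (continuous_pi fun l => ?_) _ (continuous_ddc hb)
      simp only [Finset.piecewise]
      split_ifs
      · exact continuous_ddc (moll_contDiff hε (hg l).continuous.locallyIntegrable)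
      · exact continuous_const
    · filter_upwards [self_mem_nhdsWithin] with ε hε
      refine Eventually.of_forall fun z => ?_
      rw [norm_mul, Complex.norm_real, Real.norm_eq_abs]
      refine mul_le_mul_of_nonneg_left (norm_wedgeCoeff_le fun l j k => ?_) (abs_nonneg _)
      by_cases hl : l = i
      · subst hl
        rw [Function.update_self, ddc_eq]
        refine (norm_leviMatrix_le (C := Cb) (hCb z) j k).trans ?_
        simp only [R]; linarith [hC0 l]
      · rw [Function.update_of_ne hl]
        simp only [Finset.piecewise]
        split_ifs
        · rw [ddc_eq]
          refine (norm_leviMatrix_le (C := C l) (fun x y =>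
            abs_secondDeriv_moll_le (hg l) (hgc l) (hC l) hε z x y) j k).trans ?_
          simp only [R]; linarith
        · have : ‖(1 : CMat n) j k‖ ≤ 1 := by
            rw [Matrix.one_apply]; split_ifs <;> simp
          refine this.trans ?_
          simp only [R]; linarith [hC0 l]
    · exact ((ha.continuous.abs).mul continuous_const).integrable_of_hasCompactSupport
        (hac.norm.mul_right)
    · refine Eventually.of_forall fun z => Tendsto.const_mul _ ?_
      refine (continuous_wedgeCoeff.tendsto _).comp (tendsto_pi_nhds.2 fun l => ?_)
      by_cases hl : l = i
      · subst hl
        simp only [Function.update_self]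
        exact tendsto_const_nhds
      · simp only [Function.update_of_ne hl, Finset.piecewise]
        split_ifs
        · exact tendsto_ddc_moll (hg l) (hgc l) z
        · exact tendsto_const_nhds
  refine tendsto_nhds_unique_of_eventuallyEq (key w φ hw hφ hwc hφc) (key φ w hφ hw hφc hwc) ?_
  filter_upwards [self_mem_nhdsWithin] with ε hε using hswap ε hε

/-- Smooth `m`-subharmonic functions satisfy the inequality that defines `m`-subharmonicity. -/
theorem integral_mul_mixedCoeff_nonneg {m : ℕ} (hm : 1 ≤ m) (hmn : m ≤ n) {D : Set (Cn n)}
    (hD : IsOpen D) {v : Fin (m - 1) → Cn n → ℝ} (hv : ∀ i, IsC2MSubharmonicOn m D (v i))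
    {φ : Cn n → ℝ} (hφ : ContDiff ℝ ∞ φ) (hφc : HasCompactSupport φ) (hφD : tsupport φ ⊆ D)
    (hφ0 : ∀ z, 0 ≤ φ z) {w : Cn n → ℝ} {O : Set (Cn n)} (hO : IsOpen O) (hφO : tsupport φ ⊆ O)
    (hw : ∀ z ∈ O, MSHAt m w z) : 0 ≤ ∫ z, w z * mixedCoeff m v φ z := by
  classical
  set i0 : Fin n := ⟨m - 1, by omega⟩ with hi0
  obtain ⟨w', hw's, hw'c, W, hWo, hKW, hW⟩ := exists_contDiff_eq_near (N := ⊤) hφc.isCompact hO hφO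
    fun z hz => (hw z hz).1
  have hex : ∀ l : Fin n, ∃ g : Cn n → ℝ, ContDiff ℝ 2 g ∧ HasCompactSupport g ∧ ∃ U, IsOpen U ∧
      tsupport φ ⊆ U ∧ ∀ h : (l : ℕ) < m - 1, ∀ z ∈ U, g z = v ⟨l, h⟩ z := by
    intro l
    by_cases h : (l : ℕ) < m - 1
    · obtain ⟨g, hg, hgc, U, hU, hKU, hgU⟩ := exists_contDiff_eq_near (N := 2) hφc.isCompact hD hφD
        (w := v ⟨l, h⟩) fun z hz => ((hv ⟨l, h⟩).1 z hz).contDiffAt (hD.mem_nhds hz)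
      exact ⟨g, hg, hgc, U, hU, hKU, fun _ => hgU⟩
    · exact ⟨fun _ => 0, contDiff_const, HasCompactSupport.zero, Set.univ, isOpen_univ,
        Set.subset_univ _, fun h' => absurd h' h⟩
  choose g hg hgc U hU hKU hgU using hex
  have hswap := integral_mul_wedgeCoeff_swap_two (S := initSlots n (m - 1)) hg hgc hw's hφ hφc hw'c i0
  have hslots : ∀ z ∈ tsupport φ, (initSlots n (m - 1)).piecewise (fun l => ddc (g l) z) 1 =
      fun l : Fin n => if h : (l : ℕ) < m - 1 then ddc (v ⟨l, h⟩) z else 1 := by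
    intro z hz
    ext1 l
    by_cases h : (l : ℕ) < m - 1
    · rw [Finset.piecewise_eq_of_mem _ _ _ (mem_initSlots.2 h), dif_pos h]
      refine ddc_congr ?_
      filter_upwards [(hU l).mem_nhds (hKU l hz)] with y hy using hgU l h y hy
    · rw [Finset.piecewise_eq_of_notMem _ _ _ (fun h' => h (mem_initSlots.1 h')), dif_neg h]
      rfl
  have hcont : ∀ a b : Cn n → ℝ, ContDiff ℝ ∞ a → ContDiff ℝ ∞ b → HasCompactSupport a →
      Integrable fun z => (a z : ℂ) * wedgeCoeff (Function.update ((initSlots n (m - 1)).piecewise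
        (fun l => ddc (g l) z) 1) i0 (ddc b z)) := by
    intro a b ha hb hac
    refine Continuous.integrable_of_hasCompactSupport ?_
      (HasCompactSupport.mul_right (hac.comp_left Complex.ofReal_zero))
    refine (Complex.continuous_ofReal.comp ha.continuous).mul (continuous_wedgeCoeff.comp
      (Continuous.update (continuous_pi fun l => ?_) _ (continuous_ddc hb)))
    simp only [Finset.piecewise]
    split_ifs
    · simp only [ddc_eq]
      exact continuous_leviMatrix.comp (continuous_secondDeriv (hg l))
    · exact continuous_const
  have h2 := congrArg Complex.re hswap
  have hre : ∀ {f : Cn n → ℂ}, Integrable f → (∫ z, f z).re = ∫ z, (f z).re := fun hf => by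
    rw [← Complex.reCLM_apply, ← ContinuousLinearMap.integral_comp_comm _ hf]; rfl
  rw [hre (hcont w' φ hw's hφ hw'c), hre (hcont φ w' hφ hw's hφc)] at h2
  have e1 : ∫ z, w z * mixedCoeff m v φ z = ∫ z, ((w' z : ℂ) * wedgeCoeff (Function.update
      ((initSlots n (m - 1)).piecewise (fun l => ddc (g l) z) 1) i0 (ddc φ z))).re := by
    refine integral_congr_ae (Eventually.of_forall fun z => ?_)
    simp only [Complex.re_ofReal_mul]
    by_cases hz : z ∈ tsupport φ
    · rw [hslots z hz, mixedCoeff_eq_update hm hmn, hW z (hKW hz)]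
    · rw [mixedCoeff_eq_zero hm hmn hz, ddc_eq_zero_of_notMem_tsupport hz, wedgeCoeff_update_zero]
      simp
  rw [e1, h2]
  refine integral_nonneg fun z => ?_
  simp only [Complex.re_ofReal_mul]
  by_cases hz : z ∈ tsupport φ
  · rw [hslots z hz, ← mixedCoeff_eq_update hm hmn]
    refine mul_nonneg (hφ0 z) (mixedCoeff_nonneg hm (fun i => (hv i).mPos hD (hφD hz)) ?_)
    have : w' =ᶠ[𝓝 z] w := by
      filter_upwards [hWo.mem_nhds (hKW hz)] with y hy using hW y hy
    rw [ddc_congr this]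
    exact (hw z (hφO hz)).2
  · rw [image_eq_zero_of_notMem_tsupport hz]
    simp

end Pairing

/-! ### Decreasing limits -/

section Limits

/-- Monotone convergence for a decreasing sequence of real functions with bounded integrals. -/
theorem antitone_limit {X : Type*} [MeasurableSpace X] {μ : Measure X} {S : ℕ → X → ℝ}
    (hS : ∀ N, Integrable (S N) μ) (hanti : ∀ᵐ z ∂μ, Antitone fun N => S N z) {C : ℝ}
    (hC : ∀ N, ∫ z, (S 0 z - S N z) ∂μ ≤ C) :
    (∀ᵐ z ∂μ, (⨅ N, (S N z : EReal)) ≠ ⊥) ∧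
    Integrable (fun z => (⨅ N, (S N z : EReal)).toReal) μ ∧
    ∀ h : X → ℝ, AEStronglyMeasurable h μ → (∃ B, ∀ᵐ z ∂μ, |h z| ≤ B) →
      Tendsto (fun N => ∫ z, S N z * h z ∂μ) atTop
        (𝓝 (∫ z, (⨅ N, (S N z : EReal)).toReal * h z ∂μ)) := by
  have hfi : ∀ N, Integrable (fun z => S 0 z - S N z) μ := fun N => (hS 0).sub (hS N)
  have hf0 : ∀ N, ∀ᵐ z ∂μ, 0 ≤ S 0 z - S N z := fun N => by
    filter_upwards [hanti] with z hz
    have : S N z ≤ S 0 z := hz (Nat.zero_le N)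
    linarith
  have hlin : ∀ N, ∫⁻ z, ENNReal.ofReal (S 0 z - S N z) ∂μ ≤ ENNReal.ofReal C := fun N => by
    rw [← ofReal_integral_eq_lintegral_ofReal (hfi N) (hf0 N)]
    exact ENNReal.ofReal_le_ofReal (hC N)
  have hsup : ∫⁻ z, ⨆ N, ENNReal.ofReal (S 0 z - S N z) ∂μ ≤ ENNReal.ofReal C := by
    rw [lintegral_iSup' (fun N => (hfi N).aemeasurable.ennreal_ofReal)]
    · exact iSup_le hlin
    · filter_upwards [hanti] with z hz
      intro N M hNM
      have : S M z ≤ S N z := hz hNM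
      exact ENNReal.ofReal_le_ofReal (by linarith)
  have hfin : ∀ᵐ z ∂μ, ⨆ N, ENNReal.ofReal (S 0 z - S N z) < ⊤ :=
    ae_lt_top' (AEMeasurable.iSup fun N => (hfi N).aemeasurable.ennreal_ofReal)
      (hsup.trans_lt ENNReal.ofReal_lt_top).ne
  -- at almost every point the sequence converges to a real limit
  have hlim : ∀ᵐ z ∂μ, ∃ l : ℝ, (⨅ N, (S N z : EReal)) = l ∧
      Tendsto (fun N => S N z) atTop (𝓝 l) := by
    filter_upwards [hfin, hanti] with z hz hz2
    have hb : BddBelow (Set.range fun N => S N z) := by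
      refine ⟨S 0 z - (⨆ N, ENNReal.ofReal (S 0 z - S N z)).toReal, ?_⟩
      rintro _ ⟨N, rfl⟩
      have h1 : ENNReal.ofReal (S 0 z - S N z) ≤ ⨆ N, ENNReal.ofReal (S 0 z - S N z) :=
        le_iSup (fun N => ENNReal.ofReal (S 0 z - S N z)) N
      have h2 := (ENNReal.ofReal_le_iff_le_toReal hz.ne).1 h1
      simp only
      linarith
    have h1 := tendsto_atTop_ciInf hz2 hb
    refine ⟨_, ?_, h1⟩
    have h2 : Tendsto (fun N => (S N z : EReal)) atTop (𝓝 ((⨅ N, S N z : ℝ) : EReal)) :=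
      (continuous_coe_real_ereal.tendsto _).comp h1
    exact tendsto_nhds_unique (tendsto_atTop_iInf fun N M h => EReal.coe_le_coe_iff.2 (hz2 h)) h2
  set u : X → ℝ := fun z => (⨅ N, (S N z : EReal)).toReal with hu
  have hlim2 : ∀ᵐ z ∂μ, Tendsto (fun N => S N z) atTop (𝓝 (u z)) := by
    filter_upwards [hlim] with z ⟨l, hl, hl2⟩
    simp only [hu, hl, EReal.toReal_coe]
    exact hl2
  have hum : AEStronglyMeasurable u μ :=
    aestronglyMeasurable_of_tendsto_ae atTop (fun N => (hS N).1) hlim2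
  have hle : ∀ᵐ z ∂μ, ∀ N, u z ≤ S N z := by
    filter_upwards [hlim2, hanti] with z h1 h2 N using h2.le_of_tendsto h1 N
  have hdi : Integrable (fun z => S 0 z - u z) μ := by
    refine ⟨(hS 0).1.sub hum, ?_⟩
    rw [hasFiniteIntegral_iff_ofReal]
    · refine lt_of_le_of_lt ?_ (ENNReal.ofReal_lt_top (r := C))
      refine le_trans (lintegral_mono_ae ?_) hsup
      filter_upwards [hlim2] with z hz
      have h1 : Tendsto (fun N => ENNReal.ofReal (S 0 z - S N z)) atTop
          (𝓝 (ENNReal.ofReal (S 0 z - u z))) :=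
        (ENNReal.continuous_ofReal.tendsto _).comp (hz.const_sub _)
      exact le_of_tendsto' h1 fun N => le_iSup (fun N => ENNReal.ofReal (S 0 z - S N z)) N
    · filter_upwards [hle] with z hz
      have := hz 0
      simp only [Pi.zero_apply]
      linarith
  have hui : Integrable u μ := by
    have := (hS 0).sub hdi
    refine this.congr (Eventually.of_forall fun z => ?_)
    simp
  refine ⟨?_, hui, fun h hh ⟨B, hB⟩ => ?_⟩
  · filter_upwards [hlim] with z ⟨l, hl, _⟩
    rw [hl]
    exact EReal.coe_ne_bot l
  · refine tendsto_integral_of_dominated_convergence (fun z => (|S 0 z| + |u z|) * B)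
      (fun N => (hS N).1.mul hh) (((hS 0).abs.add hui.abs).mul_const B) (fun N => ?_) ?_
    · filter_upwards [hB, hle, hanti] with z h1 h2 h3
      rw [norm_mul, Real.norm_eq_abs, Real.norm_eq_abs]
      refine mul_le_mul ?_ h1 (abs_nonneg _) (by positivity)
      have h4 : S N z ≤ S 0 z := h3 (Nat.zero_le N)
      have h5 := h2 N
      rw [abs_le]
      constructor
      · linarith [neg_abs_le (u z), abs_nonneg (S 0 z)]
      · linarith [le_abs_self (S 0 z), abs_nonneg (u z)]
    · filter_upwards [hlim2] with z hz using hz.mul_const _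

variable {n : ℕ}

theorem continuousOn_mixedCoeff {m : ℕ} {D : Set (Cn n)} (hD : IsOpen D)
    {v : Fin (m - 1) → Cn n → ℝ} (hv : ∀ i, ContDiffOn ℝ 2 (v i) D) {φ : Cn n → ℝ}
    (hφ : ContDiff ℝ ∞ φ) : ContinuousOn (fun z => mixedCoeff m v φ z) D := by
  refine Complex.continuous_re.comp_continuousOn (continuous_wedgeCoeff.comp_continuousOn
    (continuousOn_pi.2 fun l => ?_))
  by_cases h : (l : ℕ) < m - 1
  · simp only [dif_pos h]
    exact continuousOn_ddc hD (hv _)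
  · simp only [dif_neg h]
    split_ifs
    · exact (continuous_ddc hφ).continuousOn
    · exact continuousOn_const

/-- Real functions that are upper semicontinuous, locally integrable, and approximable from above,
locally in `L¹`, by smooth `m`-subharmonic functions. -/
structure RApprox (m : ℕ) (Ω : Set (Cn n)) (g : Cn n → ℝ) : Prop where
  usc : UpperSemicontinuousOn g Ω
  locInt : LocallyIntegrableOn g Ω volume
  approx : ∀ K ⊆ Ω, IsCompact K → ∀ ε > 0, ∃ (w : Cn n → ℝ) (O : Set (Cn n)), IsOpen O ∧ K ⊆ O ∧
    O ⊆ Ω ∧ (∀ z ∈ O, MSHAt m w z) ∧ (∀ z ∈ K, g z ≤ w z) ∧ ∫ z in K, (w z - g z) ≤ ε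

variable {m : ℕ} {Ω : Set (Cn n)}

theorem integrableOn_of_mshAt {w : Cn n → ℝ} {O K : Set (Cn n)} (hw : ∀ z ∈ O, MSHAt m w z)
    (hK : IsCompact K) (hKO : K ⊆ O) : IntegrableOn w K :=
  (show ContinuousOn w K from fun z hz =>
    (hw z (hKO hz)).1.continuousAt.continuousWithinAt).integrableOn_compact hK

theorem RApprox.le_average (hm : 1 ≤ m) (hn : 1 ≤ n) {g : Cn n → ℝ} (hg : RApprox m Ω g)
    {z : Cn n} {r : ℝ} (hr : 0 < r) (hzr : Metric.closedBall z r ⊆ Ω) :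
    g z ≤ ⨍ y in Metric.closedBall z r, g y := by
  set K := Metric.closedBall z r
  have hK : IsCompact K := isCompact_closedBall z r
  have hv : 0 < volume.real K :=
    ENNReal.toReal_pos (Metric.measure_closedBall_pos volume z hr).ne' hK.measure_lt_top.ne
  rw [setAverage_eq, smul_eq_mul, ← div_eq_inv_mul, le_div_iff₀ hv]
  refine le_of_forall_pos_le_add fun ε hε => ?_
  obtain ⟨w, O, hO, hKO, hOΩ, hw, hgw, hint⟩ := hg.approx K hzr hK ε hε
  have h1 := le_average_of_mshAt hm hn hr hO hKO hw
  rw [setAverage_eq, smul_eq_mul, ← div_eq_inv_mul, le_div_iff₀ hv] at h1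
  have h2 := hgw z (Metric.mem_closedBall_self hr.le)
  rw [integral_sub (integrableOn_of_mshAt hw hK hKO)
    (hg.locInt.integrableOn_compact_subset hzr hK)] at hint
  nlinarith

theorem RApprox.integral_mixedCoeff_nonneg (hm : 1 ≤ m) (hmn : m ≤ n) (hΩ : IsOpen Ω)
    {g : Cn n → ℝ} (hg : RApprox m Ω g) {v : Fin (m - 1) → Cn n → ℝ}
    (hv : ∀ i, IsC2MSubharmonicOn m Ω (v i)) {φ : Cn n → ℝ} (hφ : ContDiff ℝ ∞ φ)
    (hφc : HasCompactSupport φ) (hφΩ : tsupport φ ⊆ Ω) (hφ0 : ∀ z, 0 ≤ φ z) :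
    0 ≤ ∫ z in tsupport φ, g z * mixedCoeff m v φ z := by
  set K := tsupport φ
  have hK : IsCompact K := hφc.isCompact
  have hc : ContinuousOn (fun z => mixedCoeff m v φ z) K :=
    (continuousOn_mixedCoeff hΩ (fun i => (hv i).1) hφ).mono hφΩ
  obtain ⟨B, hB⟩ := hK.exists_bound_of_continuousOn hc
  have hB' : ∀ z ∈ K, |mixedCoeff m v φ z| ≤ |B| := fun z hz => (hB z hz).trans (le_abs_self B)
  refine le_of_forall_pos_le_add fun ε hε => ?_
  obtain ⟨w, O, hO, hKO, hOΩ, hw, hgw, hint⟩ := hg.approx K hφΩ hK (ε / (|B| + 1)) (by positivity)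
  have h1 := integral_mul_mixedCoeff_nonneg hm hmn hΩ hv hφ hφc hφΩ hφ0 hO hKO hw
  rw [← setIntegral_eq_integral_of_forall_compl_eq_zero (s := K) fun z hz => by
    rw [mixedCoeff_eq_zero hm hmn hz, mul_zero]] at h1
  have hwi := integrableOn_of_mshAt hw hK hKO
  have hgi := hg.locInt.integrableOn_compact_subset hφΩ hK
  have hcm : AEStronglyMeasurable (fun z => mixedCoeff m v φ z) (volume.restrict K) :=
    hc.aestronglyMeasurable hK.measurableSet
  have hbd : ∀ᵐ z ∂volume.restrict K, ‖mixedCoeff m v φ z‖ ≤ |B| :=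
    (ae_restrict_mem hK.measurableSet).mono fun z hz => hB' z hz
  have i1 : Integrable (fun z => w z * mixedCoeff m v φ z) (volume.restrict K) :=
    hwi.mul_bdd hcm hbd
  have i2 : Integrable (fun z => g z * mixedCoeff m v φ z) (volume.restrict K) :=
    hgi.mul_bdd hcm hbd
  have h2 : (∫ z in K, w z * mixedCoeff m v φ z) - ∫ z in K, g z * mixedCoeff m v φ z ≤ ε := by
    rw [← integral_sub i1 i2]
    calc ∫ z in K, (w z * mixedCoeff m v φ z - g z * mixedCoeff m v φ z)
        ≤ ∫ z in K, |B| * (w z - g z) := by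
          refine setIntegral_mono_on (i1.sub i2) ((hwi.sub hgi).const_mul _) hK.measurableSet
            fun z hz => ?_
          have h3 := (abs_le.1 (hB' z hz)).2
          have h4 := hgw z hz
          nlinarith
      _ = |B| * ∫ z in K, (w z - g z) := integral_const_mul _ _
      _ ≤ |B| * (ε / (|B| + 1)) := mul_le_mul_of_nonneg_left hint (abs_nonneg _)
      _ ≤ ε := by
          rw [mul_div_assoc', div_le_iff₀ (by positivity)]
          nlinarith [abs_nonneg B]
  linarith

theorem ae_restrict_of_forall_compact {U : Set (Cn n)} (hU : IsOpen U) {p : Cn n → Prop}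
    (h : ∀ K ⊆ U, IsCompact K → ∀ᵐ z ∂volume.restrict K, p z) : ∀ᵐ z ∂volume.restrict U, p z := by
  let e : CompactExhaustion U := Classical.choice (by
    have : LocallyCompactSpace U := hU.locallyCompactSpace
    exact ⟨default⟩)
  have hcover : U = ⋃ N, Subtype.val '' (e N) := by
    rw [← Set.image_iUnion, e.iUnion_eq, Set.image_univ, Subtype.range_coe]
  rw [hcover, ae_restrict_iUnion_iff]
  intro N
  refine h _ ?_ ((e.isCompact N).image continuous_subtype_val)
  rintro _ ⟨x, _, rfl⟩
  exact x.2

/-- A decreasing limit of approximable functions whose integrals stay locally bounded is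
`m`-subharmonic. -/
theorem isMSubharmonicOn_iInf (hm : 1 ≤ m) (hmn : m ≤ n) (hΩ : IsOpen Ω) {S : ℕ → Cn n → ℝ}
    (hS : ∀ N, RApprox m Ω (S N)) (hanti : ∀ z ∈ Ω, Antitone fun N => S N z)
    (hbd : ∀ K ⊆ Ω, IsCompact K → ∃ C, ∀ N, ∫ z in K, (S 0 z - S N z) ≤ C) :
    IsMSubharmonicOn m Ω fun z => ⨅ N, (S N z : EReal) := by
  have hlim := fun (K : Set (Cn n)) (hKΩ : K ⊆ Ω) (hK : IsCompact K) =>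
    antitone_limit (μ := volume.restrict K) (S := S)
      (fun N => (hS N).locInt.integrableOn_compact_subset hKΩ hK)
      ((ae_restrict_mem hK.measurableSet).mono fun z hz => hanti z (hKΩ hz))
      (hbd K hKΩ hK).choose_spec
  have hlt : ∀ z, (⨅ N, (S N z : EReal)) < ⊤ := fun z =>
    (iInf_le _ 0).trans_lt (EReal.coe_lt_top _)
  refine ⟨?_, fun z _ => hlt z, ?_, ?_, ?_, ?_⟩
  · intro z hz y hy
    obtain ⟨N, hN⟩ := iInf_lt_iff.1 hy
    obtain ⟨c, hc1, hc2⟩ := EReal.lt_iff_exists_real_btwn.1 hN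
    filter_upwards [(hS N).usc z hz c (EReal.coe_lt_coe_iff.1 hc1)] with x hx
    exact (iInf_le _ N).trans_lt ((EReal.coe_lt_coe_iff.2 hx).trans hc2)
  · exact ae_restrict_of_forall_compact hΩ fun K hKΩ hK => (hlim K hKΩ hK).1
  · rw [locallyIntegrableOn_iff hΩ.isLocallyClosed]
    exact fun K hKΩ hK => (hlim K hKΩ hK).2.1
  · intro z hz r hr hzr
    have hK : IsCompact (Metric.closedBall z r) := isCompact_closedBall z r
    have hv : 0 < volume.real (Metric.closedBall z r) :=
      ENNReal.toReal_pos (Metric.measure_closedBall_pos volume z hr).ne' hK.measure_lt_top.ne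
    have h1 := (hlim _ hzr hK).2.2 (fun _ => 1) aestronglyMeasurable_const
      ⟨1, Eventually.of_forall fun _ => by simp⟩
    simp only [mul_one] at h1
    have h2 : Tendsto (fun N => ⨍ y in Metric.closedBall z r, S N y) atTop
        (𝓝 (⨍ y in Metric.closedBall z r, (⨅ N, (S N y : EReal)).toReal)) := by
      simp only [setAverage_eq]
      exact h1.const_smul _
    have h3 := (continuous_coe_real_ereal.tendsto _).comp h2
    refine ge_of_tendsto' h3 fun N => (iInf_le _ N).trans ?_
    exact EReal.coe_le_coe_iff.2 ((hS N).le_average hm (hm.trans hmn) hr hzr)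
  · intro v hv φ hφ hφc hφΩ hφ0
    have hK : IsCompact (tsupport φ) := hφc.isCompact
    have hc : ContinuousOn (fun z => mixedCoeff m v φ z) (tsupport φ) :=
      (continuousOn_mixedCoeff hΩ (fun i => (hv i).1) hφ).mono hφΩ
    obtain ⟨B, hB⟩ := hK.exists_bound_of_continuousOn hc
    have h1 := (hlim _ hφΩ hK).2.2 (fun z => mixedCoeff m v φ z)
      (hc.aestronglyMeasurable hK.measurableSet)
      ⟨B, (ae_restrict_mem hK.measurableSet).mono fun z hz => hB z hz⟩
    rw [setIntegral_eq_of_subset_of_forall_sdiff_eq_zero hΩ.measurableSet hφΩ fun z hz => by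
      rw [mixedCoeff_eq_zero hm hmn hz.2, mul_zero]]
    exact ge_of_tendsto' h1 fun N => (hS N).integral_mixedCoeff_nonneg hm hmn hΩ hv hφ hφc hφΩ hφ0

end Limits

/-! ### Approximation from above -/

section Approximation

variable {n m : ℕ}

/-- Locally uniform limits of smooth functions that are `m`-subharmonic on the whole space, that is,
locally uniformly approximable functions. -/
structure LUA (m : ℕ) (a : Cn n → ℝ) : Prop where
  cont : Continuous a
  approx : ∀ K : Set (Cn n), IsCompact K → ∀ ε > 0, ∃ v : Cn n → ℝ, (∀ z, MSHAt m v z) ∧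
    ∀ z ∈ K, |v z - a z| ≤ ε

theorem LUA.of_mshAt {v : Cn n → ℝ} (hv : ∀ z, MSHAt m v z) : LUA m v :=
  ⟨continuous_iff_continuousAt.2 fun z => (hv z).1.continuousAt,
    fun K _ ε hε => ⟨v, hv, fun z _ => by simpa using hε.le⟩⟩

theorem LUA.add {a b : Cn n → ℝ} (ha : LUA m a) (hb : LUA m b) : LUA m fun z => a z + b z := by
  refine ⟨ha.cont.add hb.cont, fun K hK ε hε => ?_⟩
  obtain ⟨v, hv, hva⟩ := ha.approx K hK (ε / 2) (by positivity)
  obtain ⟨w, hw, hwb⟩ := hb.approx K hK (ε / 2) (by positivity)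
  refine ⟨fun z => v z + w z, fun z => (hv z).add (hw z), fun z hz => ?_⟩
  have h1 := hva z hz
  have h2 := hwb z hz
  rw [abs_le] at *
  constructor <;> linarith [h1.1, h1.2, h2.1, h2.2]

theorem LUA.const_mul (hmn : m ≤ n) {a : Cn n → ℝ} (ha : LUA m a) {r : ℝ} (hr : 0 ≤ r) :
    LUA m fun z => r * a z := by
  refine ⟨continuous_const.mul ha.cont, fun K hK ε hε => ?_⟩
  obtain ⟨v, hv, hva⟩ := ha.approx K hK (ε / (r + 1)) (by positivity)
  refine ⟨fun z => r * v z, fun z => (hv z).const_mul hmn hr, fun z hz => ?_⟩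
  rw [← mul_sub, abs_mul, abs_of_nonneg hr]
  calc r * |v z - a z| ≤ r * (ε / (r + 1)) := mul_le_mul_of_nonneg_left (hva z hz) hr
    _ ≤ ε := by rw [mul_div_assoc', div_le_iff₀ (by positivity)]; nlinarith

theorem LUA.sum {ι : Type*} (s : Finset ι) {f : ι → Cn n → ℝ} (hf : ∀ i ∈ s, LUA m (f i)) :
    LUA m fun y => ∑ i ∈ s, f i y := by
  classical
  induction s using Finset.induction_on with
  | empty => simpa using LUA.of_mshAt fun z => mshAt_const 0 z
  | insert i s hi ih =>
    simp only [Finset.sum_insert hi]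
    exact (hf i (Finset.mem_insert_self i s)).add
      (ih fun j hj => hf j (Finset.mem_insert_of_mem hj))

theorem continuous_dualForm_ddc (hm : 1 ≤ m) (hmn : m ≤ n) (A : CMat n) {ψ : Cn n → ℝ}
    (hψ : ContDiff ℝ ∞ ψ) : Continuous fun z => dualForm m A (ddc ψ z) := by
  simp only [dualForm_eq_update hm hmn]
  exact Complex.continuous_re.comp (continuous_wedgeCoeff.comp
    (continuous_const.update _ (continuous_ddc hψ)))

theorem dualForm_ddc_eq_zero (hm : 1 ≤ m) (hmn : m ≤ n) {A : CMat n} {ψ : Cn n → ℝ} {z : Cn n}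
    (hz : z ∉ tsupport ψ) : dualForm m A (ddc ψ z) = 0 := by
  rw [dualForm_eq_update hm hmn, ddc_eq_zero_of_notMem_tsupport hz, wedgeCoeff_update_zero]
  rfl

theorem LUA.distMSH (hm : 1 ≤ m) (hmn : m ≤ n) {a : Cn n → ℝ} (ha : LUA m a) :
    DistMSH m Set.univ a := by
  intro A hA ψ hψ hψc hψΩ hψ0
  have hc := continuous_dualForm_ddc hm hmn A hψ
  have hdc : HasCompactSupport fun z => dualForm m A (ddc ψ z) :=
    HasCompactSupport.intro hψc.isCompact fun z hz => dualForm_ddc_eq_zero hm hmn hz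
  have hi : ∀ {f : Cn n → ℝ}, Continuous f → Integrable fun z => f z * dualForm m A (ddc ψ z) :=
    fun hf => (hf.mul hc).integrable_of_hasCompactSupport hdc.mul_left
  have hdi : Integrable fun z => dualForm m A (ddc ψ z) := hc.integrable_of_hasCompactSupport hdc
  set B := ∫ z, |dualForm m A (ddc ψ z)| with hB
  have hB0 : 0 ≤ B := integral_nonneg fun _ => abs_nonneg _
  refine le_of_forall_pos_le_add fun ε hε => ?_
  obtain ⟨v, hv, hva⟩ := ha.approx _ hψc.isCompact (ε / (B + 1)) (by positivity)
  have h1 := distMSH_of_mshAt hm hmn hv Set.univ A hA ψ hψ hψc hψΩ hψ0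
  have hvc : Continuous v := continuous_iff_continuousAt.2 fun z => (hv z).1.continuousAt
  have h2 : (∫ z, v z * dualForm m A (ddc ψ z)) - ∫ z, a z * dualForm m A (ddc ψ z) ≤ ε := by
    rw [← integral_sub (hi hvc) (hi ha.cont)]
    calc ∫ z, (v z * dualForm m A (ddc ψ z) - a z * dualForm m A (ddc ψ z))
        ≤ ∫ z, ε / (B + 1) * |dualForm m A (ddc ψ z)| := by
          refine integral_mono ((hi hvc).sub (hi ha.cont)) (hdi.abs.const_mul _) fun z => ?_
          simp only
          rw [← sub_mul]
          by_cases hz : z ∈ tsupport ψ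
          · refine (le_abs_self _).trans ?_
            rw [abs_mul]
            exact mul_le_mul_of_nonneg_right (hva z hz) (abs_nonneg _)
          · simp [dualForm_ddc_eq_zero hm hmn hz]
      _ = ε / (B + 1) * B := integral_const_mul _ _
      _ ≤ ε := by rw [div_mul_eq_mul_div, div_le_iff₀ (by positivity)]; nlinarith
  linarith

theorem LUA.rApprox {a : Cn n → ℝ} (ha : LUA m a) {Ω : Set (Cn n)} (hΩ : IsOpen Ω) :
    RApprox m Ω a := by
  refine ⟨ha.cont.upperSemicontinuous.upperSemicontinuousOn Ω,
    ha.cont.locallyIntegrable.locallyIntegrableOn Ω, fun K hKΩ hK ε hε => ?_⟩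
  set V := volume.real K
  have hV : 0 ≤ V := measureReal_nonneg
  obtain ⟨v, hv, hva⟩ := ha.approx K hK (ε / (2 * (V + 1))) (by positivity)
  refine ⟨fun z => v z + ε / (2 * (V + 1)), Ω, hΩ, hKΩ, subset_rfl,
    fun z _ => (hv z).add_const _, fun z hz => by linarith [(abs_le.1 (hva z hz)).1], ?_⟩
  have hvc : Continuous v := continuous_iff_continuousAt.2 fun z => (hv z).1.continuousAt
  calc ∫ z in K, (v z + ε / (2 * (V + 1)) - a z) ≤ ∫ z in K, ε / (V + 1) := by
        refine setIntegral_mono_on (((hvc.add continuous_const).sub ha.cont).continuousOn.integrableOn_compact hK)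
          (continuous_const.continuousOn.integrableOn_compact hK) hK.measurableSet fun z hz => ?_
        have h1 := (abs_le.1 (hva z hz)).2
        have h2 : ε / (V + 1) = ε / (2 * (V + 1)) + ε / (2 * (V + 1)) := by field_simp; ring
        rw [h2]
        linarith
    _ = V * (ε / (V + 1)) := by rw [setIntegral_const, smul_eq_mul]
    _ ≤ ε := by rw [mul_div_assoc', div_le_iff₀ (by positivity)]; nlinarith

variable {Ω : Set (Cn n)}

theorem RApprox.add {g h : Cn n → ℝ} (hg : RApprox m Ω g) (hh : RApprox m Ω h) :
    RApprox m Ω fun z => g z + h z := by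
  refine ⟨hg.usc.add hh.usc, hg.locInt.add hh.locInt, fun K hKΩ hK ε hε => ?_⟩
  obtain ⟨w1, O1, hO1, hK1, hΩ1, hw1, hgw1, hi1⟩ := hg.approx K hKΩ hK (ε / 2) (by positivity)
  obtain ⟨w2, O2, hO2, hK2, hΩ2, hw2, hgw2, hi2⟩ := hh.approx K hKΩ hK (ε / 2) (by positivity)
  refine ⟨fun z => w1 z + w2 z, O1 ∩ O2, hO1.inter hO2, Set.subset_inter hK1 hK2,
    fun z hz => hΩ1 hz.1, fun z hz => (hw1 z hz.1).add (hw2 z hz.2),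
    fun z hz => add_le_add (hgw1 z hz) (hgw2 z hz), ?_⟩
  have e : ∀ z, w1 z + w2 z - (g z + h z) = (w1 z - g z) + (w2 z - h z) := fun z => by ring
  simp only [e]
  have j1 : IntegrableOn (fun z => w1 z - g z) K := (integrableOn_of_mshAt hw1 hK hK1).sub
    (hg.locInt.integrableOn_compact_subset hKΩ hK)
  have j2 : IntegrableOn (fun z => w2 z - h z) K := (integrableOn_of_mshAt hw2 hK hK2).sub
    (hh.locInt.integrableOn_compact_subset hKΩ hK)
  rw [integral_add j1 j2]
  linarith

theorem RApprox.const_mul (hmn : m ≤ n) {g : Cn n → ℝ} (hg : RApprox m Ω g) {r : ℝ} (hr : 0 ≤ r) :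
    RApprox m Ω fun z => r * g z := by
  refine ⟨?_, fun x hx => (hg.locInt x hx).imp fun s hs => ⟨hs.1, hs.2.const_mul r⟩, fun K hKΩ hK ε hε => ?_⟩
  · intro z hz
    exact (continuous_const.mul continuous_id).continuousAt.comp_upperSemicontinuousWithinAt
      (g := fun x => r * x) (hg.usc z hz) fun a b hab => mul_le_mul_of_nonneg_left hab hr
  · obtain ⟨w1, O1, hO1, hK1, hΩ1, hw1, hgw1, hi1⟩ := hg.approx K hKΩ hK (ε / (r + 1)) (by positivity)
    refine ⟨fun z => r * w1 z, O1, hO1, hK1, hΩ1, fun z hz => (hw1 z hz).const_mul hmn hr,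
      fun z hz => mul_le_mul_of_nonneg_left (hgw1 z hz) hr, ?_⟩
    simp only [← mul_sub]
    rw [integral_const_mul]
    calc _ ≤ r * (ε / (r + 1)) := mul_le_mul_of_nonneg_left hi1 hr
      _ ≤ ε := by rw [mul_div_assoc', div_le_iff₀ (by positivity)]; nlinarith

theorem RApprox.sum (hΩ : IsOpen Ω) {ι : Type*} (s : Finset ι) {f : ι → Cn n → ℝ}
    (hf : ∀ i ∈ s, RApprox m Ω (f i)) : RApprox m Ω fun y => ∑ i ∈ s, f i y := by
  classical
  induction s using Finset.induction_on with
  | empty => simpa using (LUA.of_mshAt fun z => mshAt_const 0 z).rApprox hΩ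
  | insert i s hi ih =>
    simp only [Finset.sum_insert hi]
    exact (hf i (Finset.mem_insert_self i s)).add
      (ih fun j hj => hf j (Finset.mem_insert_of_mem hj))

theorem IsMSubharmonicOn.exists_bound {u : Cn n → EReal} (hu : IsMSubharmonicOn m Ω u)
    {K : Set (Cn n)} (hK : IsCompact K) (hKΩ : K ⊆ Ω) : ∃ M : ℝ, ∀ z ∈ K, u z < M := by
  rcases K.eq_empty_or_nonempty with rfl | hne
  · exact ⟨0, fun z hz => absurd hz (Set.notMem_empty z)⟩
  · obtain ⟨z0, hz0, hmax⟩ := (hu.usc.mono hKΩ).exists_isMaxOn hne hK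
    obtain ⟨M, hM, -⟩ := EReal.lt_iff_exists_real_btwn.1 (hu.lt_top z0 (hKΩ hz0))
    exact ⟨M, fun z hz => lt_of_le_of_lt (hmax hz) hM⟩

/-- An `m`-subharmonic function, cut off outside a compact set, is `m`-subharmonic in the sense of
distributions inside. -/
theorem IsMSubharmonicOn.distMSH (hm : 1 ≤ m) (hmn : m ≤ n) {u : Cn n → EReal}
    (hu : IsMSubharmonicOn m Ω u) {K : Set (Cn n)} (hKΩ : K ⊆ Ω) :
    DistMSH m (interior K) (K.indicator fun z => (u z).toReal) := by
  intro A hA ψ hψ hψc hψK hψ0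
  obtain ⟨q, hq, hqA⟩ := exists_ddc_eq hA.1
  have h1 := hu.current_nonneg (fun _ => q)
    (fun _ => isC2MSubharmonicOn_of_mshAt fun z _ => ⟨hq.contDiffAt, by rw [hqA]; exact hA⟩)
    ψ hψ hψc (hψK.trans (interior_subset.trans hKΩ)) hψ0
  have h2 : ∀ z, mixedCoeff m (fun _ => q) ψ z = dualForm m A (ddc ψ z) := by
    intro z
    simp only [mixedCoeff, dualForm, hqA, dite_eq_ite]
  simp only [h2] at h1
  rw [setIntegral_eq_integral_of_forall_compl_eq_zero fun z hz => by
    rw [dualForm_ddc_eq_zero hm hmn fun h => hz (hKΩ (interior_subset (hψK h))), mul_zero]] at h1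
  refine h1.trans_eq (integral_congr_ae (Eventually.of_forall fun z => ?_))
  by_cases hz : z ∈ tsupport ψ
  · simp only [Set.indicator_of_mem (interior_subset (hψK hz))]
  · simp only [dualForm_ddc_eq_zero hm hmn hz, mul_zero]

/-- Near a compact set an `m`-subharmonic function lies below smooth ones that are close to it
in `L¹`: by the submean value property its mollifications with radially decreasing kernels
decrease to it. -/
theorem IsMSubharmonicOn.exists_smooth_above (hm : 1 ≤ m) (hmn : m ≤ n) {u : Cn n → EReal}
    (hΩ : IsOpen Ω) (hu : IsMSubharmonicOn m Ω u) {K : Set (Cn n)} (hK : IsCompact K)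
    (hKΩ : K ⊆ Ω) {ε : ℝ} (hε : 0 < ε) : ∃ (w : Cn n → ℝ) (O : Set (Cn n)), IsOpen O ∧ K ⊆ O ∧
      O ⊆ Ω ∧ (∀ z ∈ O, MSHAt m w z) ∧ (∀ z ∈ K, u z ≤ w z) ∧
      ∫ z in K, (w z - (u z).toReal) ≤ ε := by
  have : Nontrivial (Cn n) := by
    have : Nonempty (Fin n) := ⟨⟨0, by omega⟩⟩
    infer_instance
  obtain ⟨K', hK', hKK', hK'Ω⟩ := exists_compact_between hK hΩ hKΩ
  obtain ⟨δ, hδ, hδK⟩ := hK.exists_cthickening_subset_open isOpen_interior hKK'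
  set g : Cn n → ℝ := K'.indicator fun z => (u z).toReal with hg
  have hgi : Integrable g := (integrable_indicator_iff hK'.measurableSet).2
    (hu.locallyIntegrable.integrableOn_compact_subset hK'Ω hK')
  have hgl := hgi.locallyIntegrable
  obtain ⟨M, hM⟩ := hu.exists_bound hK' hK'Ω
  have hae : ∀ᵐ y, y ∈ Ω → u y ≠ ⊥ := (ae_restrict_iff' hΩ.measurableSet).1 hu.ae_finite
  have hball : ∀ z ∈ K, ∀ r, 0 < r → r ≤ δ → Metric.closedBall z r ⊆ K' := by
    intro z hz r hr hrδ
    refine Set.Subset.trans ?_ (hδK.trans interior_subset)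
    exact (Metric.closedBall_subset_cthickening hz r).trans (Metric.cthickening_mono hrδ K)
  -- comparison of the truncated function with a real constant on a small ball
  have hgle : ∀ (S : Set (Cn n)) (c : ℝ), S ⊆ K' → (∀ y ∈ S, u y < c) → ∀ᵐ y, y ∈ S → g y ≤ c := by
    intro S c hS hc
    filter_upwards [hae] with y hy hyS
    rw [hg, Set.indicator_of_mem (hS hyS)]
    have h1 := hy (hK'Ω (hS hyS))
    have h2 := (hc y hyS).le
    exact EReal.toReal_le_toReal h2 h1 (EReal.coe_ne_top c)
  have hupper : ∀ z ∈ K, ∀ r, 0 < r → r ≤ δ → u z ≤ (moll r g z : EReal) := by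
    intro z hz r hr hrδ
    by_cases hbot : u z = ⊥
    · rw [hbot]; exact bot_le
    · have hz' : u z = ((u z).toReal : EReal) :=
        (EReal.coe_toReal (hu.lt_top z (hKΩ hz)).ne hbot).symm
      rw [hz', EReal.coe_le_coe_iff]
      refine le_moll_of_le_average hr hgl fun s hs hsr => ?_
      have hsK := hball z hz s hs (hsr.trans hrδ)
      have h1 := hu.subMean z (hKΩ hz) s hs (hsK.trans hK'Ω)
      rw [hz', EReal.coe_le_coe_iff] at h1
      refine h1.trans_eq ?_
      rw [setAverage_eq, setAverage_eq]
      congr 1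
      exact setIntegral_congr_fun measurableSet_closedBall fun y hy => by
        simp only [hg, Set.indicator_of_mem (hsK hy)]
  have hlim : ∀ᵐ z ∂volume.restrict K, Tendsto (fun r => moll r g z) (𝓝[>] 0)
      (𝓝 (u z).toReal) := by
    filter_upwards [ae_restrict_mem hK.measurableSet, ae_restrict_of_ae hae] with z hz hz2
    have hbot := hz2 (hKΩ hz)
    have hz' : u z = ((u z).toReal : EReal) :=
      (EReal.coe_toReal (hu.lt_top z (hKΩ hz)).ne hbot).symm
    rw [Metric.tendsto_nhds]
    intro η hη
    have h1 : ∀ᶠ y in 𝓝[Ω] z, u y < ((u z).toReal + η / 2 : ℝ) := by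
      refine hu.usc z (hKΩ hz) _ ?_
      exact hz'.trans_lt (EReal.coe_lt_coe_iff.2 (by linarith))
    rw [hΩ.nhdsWithin_eq (hKΩ hz)] at h1
    obtain ⟨r0, hr0, hr0b⟩ := Metric.eventually_nhds_iff.1 h1
    filter_upwards [self_mem_nhdsWithin, nhdsWithin_le_nhds (Iio_mem_nhds (lt_min hr0 hδ))]
      with r hr hr2
    have hr : 0 < r := hr
    have hr2 : r < min r0 δ := hr2
    have h2 := hupper z hz r hr (hr2.le.trans (min_le_right _ _))
    rw [hz', EReal.coe_le_coe_iff] at h2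
    have h3 := moll_le hr hgl (hgle (Metric.closedBall z r) _
      (hball z hz r hr (hr2.le.trans (min_le_right _ _)))
      fun y hy => hr0b (lt_of_le_of_lt hy (hr2.trans_le (min_le_left _ _))))
    rw [Real.dist_eq, abs_lt]
    constructor <;> linarith
  have hui := hu.locallyIntegrable.integrableOn_compact_subset hKΩ hK
  have hint : Tendsto (fun r => ∫ z in K, (moll r g z - (u z).toReal)) (𝓝[>] 0) (𝓝 0) := by
    have h0 : ∫ z in K, ((u z).toReal - (u z).toReal) = 0 := by simp
    conv => arg 3; rw [← h0]
    refine tendsto_integral_filter_of_dominated_convergence (fun z => |M| + |(u z).toReal|) ?_ ?_ ?_ ?_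
    · filter_upwards [self_mem_nhdsWithin] with r hr
      exact (moll_contDiff hr hgl).continuous.aestronglyMeasurable.sub hui.1
    · filter_upwards [self_mem_nhdsWithin, nhdsWithin_le_nhds (Iio_mem_nhds hδ)] with r hr hrδ
      have hr : 0 < r := hr
      have hrδ : r < δ := hrδ
      filter_upwards [ae_restrict_mem hK.measurableSet, ae_restrict_of_ae hae] with z hz hz2
      have hbot := hz2 (hKΩ hz)
      have hz' : u z = ((u z).toReal : EReal) :=
        (EReal.coe_toReal (hu.lt_top z (hKΩ hz)).ne hbot).symm
      have h2 := hupper z hz r hr hrδ.le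
      rw [hz', EReal.coe_le_coe_iff] at h2
      have h3 := moll_le hr hgl (hgle (Metric.closedBall z r) M (hball z hz r hr hrδ.le)
        fun y hy => hM y (hball z hz r hr hrδ.le hy))
      rw [Real.norm_eq_abs, abs_le]
      constructor <;> linarith [le_abs_self M, neg_abs_le (u z).toReal, abs_nonneg M,
        abs_nonneg (u z).toReal]
    · exact (continuous_const.continuousOn.integrableOn_compact hK).add hui.abs
    · filter_upwards [hlim] with z hz using hz.sub_const _
  have hev : ∀ᶠ r in 𝓝[>] (0 : ℝ), ∫ z in K, (moll r g z - (u z).toReal) < ε :=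
    hint.eventually (Iio_mem_nhds hε)
  obtain ⟨r, ⟨hr1, hr2⟩, hr⟩ := ((hev.and (nhdsWithin_le_nhds (Iio_mem_nhds
    (by positivity : (0 : ℝ) < δ / 2)))).and self_mem_nhdsWithin).exists
  have hr : 0 < r := hr
  have hr2 : r < δ / 2 := hr2
  refine ⟨moll r g, Metric.thickening (δ / 2) K, Metric.isOpen_thickening,
    Metric.self_subset_thickening (by positivity) K, ?_, fun z hz => ?_,
    fun z hz => hupper z hz r hr (by linarith), hr1.le⟩
  · refine (Metric.thickening_subset_cthickening _ _).trans ?_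
    exact (Metric.cthickening_mono (by linarith) K).trans
      (hδK.trans (interior_subset.trans hK'Ω))
  · refine smoothing_mshAt hm hmn (kern_contDiff r) (kern_hasCompactSupport hr)
      (kern_nonneg hr) hgl (hu.distMSH hm hmn hK'Ω) fun y hy => ?_
    have h1 : ‖y‖ ≤ r := by simpa using tsupport_kern hr hy
    obtain ⟨x, hx, hxz⟩ := Metric.mem_thickening_iff.1 hz
    apply hδK
    refine Metric.thickening_subset_cthickening _ _ (Metric.mem_thickening_iff.2 ⟨x, hx, ?_⟩)
    have h2 := dist_triangle (z - y) z x
    have h3 : dist (z - y) z = ‖y‖ := by rw [dist_eq_norm]; simp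
    linarith

end Approximation

/-! ### Gluing with a boundary function -/

section Gluing

variable {n m : ℕ} {D L L' : Set (Cn n)} {a : Cn n → ℝ} {ρ : Cn n → EReal} {η : ℝ}

open Classical in
/-- The function `max a ρ` on `L`, extended by `ρ`, as a real function. On `L` the maximum is never
`-∞`; the truncation `toReal` matters only outside `L`, where `ρ` will be finite. -/
noncomputable def glue (L : Set (Cn n)) (a : Cn n → ℝ) (ρ : Cn n → EReal) (z : Cn n) : ℝ :=
  if z ∈ L then (max (a z : EReal) (ρ z)).toReal else (ρ z).toReal

theorem coe_glue_of_mem {z : Cn n} (hz : z ∈ L) (ht : ρ z < ⊤) :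
    (glue L a ρ z : EReal) = max (a z : EReal) (ρ z) := by
  rw [glue, if_pos hz, EReal.coe_toReal]
  · exact (max_lt (EReal.coe_lt_top _) ht).ne
  · exact (lt_of_lt_of_le (EReal.bot_lt_coe _) (le_max_left _ _)).ne'

theorem glue_of_notMem {z : Cn n} (hz : z ∉ L) : glue L a ρ z = (ρ z).toReal := if_neg hz

theorem glue_of_mem_of_ne_bot {z : Cn n} (hz : z ∈ L) (ht : ρ z < ⊤) (hb : ρ z ≠ ⊥) :
    glue L a ρ z = max (a z) (ρ z).toReal := by
  rw [← EReal.coe_eq_coe_iff, coe_glue_of_mem hz ht, EReal.coe_strictMono.monotone.map_max,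
    EReal.coe_toReal ht.ne hb]

/-- If `a` lies below `ρ` on `L` outside a compact subset `L'` of its interior, the glued function
is again approximable. -/
theorem rApprox_glue (hm : 1 ≤ m) (hmn : m ≤ n) (hD : IsOpen D) (hρ : IsMSubharmonicOn m D ρ)
    (ha : LUA m a) (hL : IsCompact L) (hL' : IsCompact L') (hLD : L ⊆ D) (hLL : L' ⊆ interior L)
    (hη : 0 < η) (haL : ∀ z ∈ L, a z ≤ -(2 * η)) (hρL : ∀ z ∈ D, z ∉ L' → ((-η : ℝ) : EReal) ≤ ρ z) :
    RApprox m D (glue L a ρ) := by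
  classical
  -- away from `L'` the glued function is `ρ`
  have hbot : ∀ z ∈ D, z ∉ L' → ρ z ≠ ⊥ := fun z hz hzL =>
    (lt_of_lt_of_le (EReal.bot_lt_coe _) (hρL z hz hzL)).ne'
  have hout : ∀ z ∈ D, z ∉ L' → (glue L a ρ z : EReal) = ρ z := by
    intro z hz hzL
    by_cases hzm : z ∈ L
    · rw [coe_glue_of_mem hzm (hρ.lt_top z hz)]
      refine max_eq_right (le_trans ?_ (hρL z hz hzL))
      exact EReal.coe_le_coe_iff.2 ((haL z hzm).trans (by linarith))
    · rw [glue_of_notMem hzm, EReal.coe_toReal (hρ.lt_top z hz).ne (hbot z hz hzL)]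
  have hae : ∀ᵐ y, y ∈ D → ρ y ≠ ⊥ := (ae_restrict_iff' hD.measurableSet).1 hρ.ae_finite
  have hlocInt : ∀ K ⊆ D, IsCompact K → IntegrableOn (glue L a ρ) K := by
    intro K hKD hK
    have h1 : IntegrableOn (fun z => (ρ z).toReal) K :=
      hρ.locallyIntegrable.integrableOn_compact_subset hKD hK
    have h2 : IntegrableOn (fun z => max (a z) (ρ z).toReal) K :=
      (ha.cont.continuousOn.integrableOn_compact hK).sup h1
    have h3 : IntegrableOn (L.piecewise (fun z => max (a z) (ρ z).toReal) fun z => (ρ z).toReal) K :=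
      Integrable.piecewise hL.measurableSet h2.integrableOn h1.integrableOn
    refine h3.congr ?_
    filter_upwards [ae_restrict_mem hK.measurableSet, ae_restrict_of_ae hae] with z hz hz2
    by_cases hzL : z ∈ L
    · rw [Set.piecewise_eq_of_mem _ _ _ hzL,
        glue_of_mem_of_ne_bot hzL (hρ.lt_top z (hKD hz)) (hz2 (hKD hz))]
    · rw [Set.piecewise_eq_of_notMem _ _ _ hzL, glue_of_notMem hzL]
  refine ⟨?_, (locallyIntegrableOn_iff hD.isLocallyClosed).2 hlocInt, ?_⟩
  · intro z hz y hy
    rw [hD.nhdsWithin_eq hz]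
    have huscρ : ∀ c : EReal, ρ z < c → ∀ᶠ x in 𝓝 z, ρ x < c := fun c hc => by
      have := hρ.usc z hz c hc
      rwa [hD.nhdsWithin_eq hz] at this
    by_cases hzL : z ∈ L'
    · have hzL2 := interior_subset (hLL hzL)
      rw [← EReal.coe_lt_coe_iff, coe_glue_of_mem hzL2 (hρ.lt_top z hz), max_lt_iff] at hy
      filter_upwards [huscρ y hy.2, isOpen_interior.mem_nhds (hLL hzL), hD.mem_nhds hz,
        ha.cont.continuousAt.eventually_lt continuousAt_const (EReal.coe_lt_coe_iff.1 hy.1)]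
        with x h1 h2 h3 h4
      rw [← EReal.coe_lt_coe_iff, coe_glue_of_mem (interior_subset h2) (hρ.lt_top x h3), max_lt_iff]
      exact ⟨EReal.coe_lt_coe_iff.2 h4, h1⟩
    · rw [← EReal.coe_lt_coe_iff, hout z hz hzL] at hy
      filter_upwards [huscρ y hy, hL'.isClosed.isOpen_compl.mem_nhds hzL, hD.mem_nhds hz]
        with x h1 h2 h3
      rw [← EReal.coe_lt_coe_iff, hout x h3 h2]
      exact h1
  · intro K hKD hK ε hε
    have hK1 : IsCompact (K ∪ L) := hK.union hL
    have hK1D : K ∪ L ⊆ D := Set.union_subset hKD hLD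
    set V := volume.real (K ∪ L)
    have hV : 0 ≤ V := measureReal_nonneg
    set θ := min (η / 3) (ε / (2 * (3 * (V + 1)))) with hθ
    have hθ0 : 0 < θ := lt_min (by positivity) (by positivity)
    have hθ1 : 3 * θ ≤ η := by linarith [min_le_left (η / 3) (ε / (2 * (3 * (V + 1))))]
    have hθ2 : 3 * θ * V ≤ ε / 2 := by
      have h1 : θ ≤ ε / (2 * (3 * (V + 1))) := min_le_right _ _
      rw [le_div_iff₀ (by positivity)] at h1
      nlinarith
    obtain ⟨w, O, hO, hKO, hOD, hw, hρw, hint⟩ :=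
      hρ.exists_smooth_above hm hmn hD hK1 hK1D (half_pos hε)
    obtain ⟨a', ha', haa⟩ := ha.approx _ hK1 θ hθ0
    set b : Cn n → ℝ := fun z => a' z + θ with hb
    have hba : ∀ z ∈ K ∪ L, a z ≤ b z ∧ b z ≤ a z + 2 * θ := fun z hz => by
      have := abs_le.1 (haa z hz)
      constructor <;> simp only [hb] <;> linarith [this.1, this.2]
    have hbw : ∀ z ∈ L, z ∉ L' → regMax θ b w z = w z := by
      intro z hz hzL
      refine regMax_eq_right hθ0 ?_
      have h1 := (hba z (Or.inr hz)).2
      have h2 := haL z hz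
      have h3 := (hρL z (hLD hz) hzL).trans (hρw z (Or.inr hz))
      rw [EReal.coe_le_coe_iff] at h3
      linarith
    let W : Cn n → ℝ := fun z => if z ∈ L' then regMax θ b w z else w z
    have hWL : ∀ z ∈ L, W z = regMax θ b w z := by
      intro z hz
      simp only [W]
      split_ifs with h
      · rfl
      · exact (hbw z hz h).symm
    have hWM : ∀ z ∈ O, MSHAt m W z := by
      intro z hz
      by_cases hzL : z ∈ L'
      · refine (MSHAt.regMax hmn hθ0 ((ha' z).add_const θ) (hw z hz)).congr ?_
        filter_upwards [isOpen_interior.mem_nhds (hLL hzL)] with x hx using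
          hWL x (interior_subset hx)
      · refine (hw z hz).congr ?_
        filter_upwards [hL'.isClosed.isOpen_compl.mem_nhds hzL] with x hx using if_neg hx
    have hglW : ∀ z ∈ K ∪ L, glue L a ρ z ≤ W z := by
      intro z hz
      have hρz := hρw z hz
      by_cases hzL : z ∈ L'
      · have hzL2 := interior_subset (hLL hzL)
        rw [← EReal.coe_le_coe_iff, coe_glue_of_mem hzL2 (hρ.lt_top z (hK1D hz)), hWL z hzL2]
        have h1 := max_le_regMax (v := b) (w := w) (z := z) hθ0
        refine (max_le ?_ ?_).trans (EReal.coe_le_coe_iff.2 h1)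
        · exact EReal.coe_le_coe_iff.2 ((hba z hz).1.trans (le_max_left _ _))
        · exact hρz.trans (EReal.coe_le_coe_iff.2 (le_max_right _ _))
      · rw [← EReal.coe_le_coe_iff, hout z (hK1D hz) hzL]
        simpa only [W, if_neg hzL] using hρz
    have hWg : ∀ᵐ z ∂volume.restrict (K ∪ L),
        W z - glue L a ρ z ≤ (w z - (ρ z).toReal) + 3 * θ := by
      filter_upwards [ae_restrict_mem hK1.measurableSet, ae_restrict_of_ae hae] with z hz hz2
      have hb := hz2 (hK1D hz)
      have ht := hρ.lt_top z (hK1D hz)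
      by_cases hzL : z ∈ L
      · rw [hWL z hzL, glue_of_mem_of_ne_bot hzL ht hb]
        have h1 := regMax_le (v := b) (w := w) (z := z) hθ0
        have h2 := (hba z hz).2
        have h3 := hρw z hz
        rw [← EReal.coe_toReal ht.ne hb, EReal.coe_le_coe_iff] at h3
        rcases max_cases (b z) (w z) with h | h <;> rcases max_cases (a z) (ρ z).toReal with h' | h' <;>
          linarith [h.1, h.2, h'.1, h'.2]
      · have : W z = w z := if_neg fun h => hzL (interior_subset (hLL h))
        rw [this, glue_of_notMem hzL]
        linarith
    have hWi := integrableOn_of_mshAt hWM hK1 hKO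
    have hgi := hlocInt _ hK1D hK1
    have hwi : IntegrableOn (fun z => w z - (ρ z).toReal) (K ∪ L) :=
      (integrableOn_of_mshAt hw hK1 hKO).sub
        (hρ.locallyIntegrable.integrableOn_compact_subset hK1D hK1)
    have hci : IntegrableOn (fun _ : Cn n => 3 * θ) (K ∪ L) :=
      continuousOn_const.integrableOn_compact hK1
    refine ⟨W, O, hO, Set.subset_union_left.trans hKO, hOD, hWM,
      fun z hz => hglW z (Or.inl hz), ?_⟩
    calc ∫ z in K, (W z - glue L a ρ z) ≤ ∫ z in K ∪ L, (W z - glue L a ρ z) :=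
          setIntegral_mono_set (hWi.sub hgi)
            ((ae_restrict_mem hK1.measurableSet).mono fun z hz => sub_nonneg.2 (hglW z hz))
            (Eventually.of_forall fun z hz => Or.inl hz)
      _ ≤ ∫ z in K ∪ L, ((w z - (ρ z).toReal) + 3 * θ) :=
          integral_mono_ae (hWi.sub hgi) (hwi.add hci) hWg
      _ = (∫ z in K ∪ L, (w z - (ρ z).toReal)) + V * (3 * θ) := by
          rw [integral_add hwi hci, setIntegral_const, smul_eq_mul]
      _ ≤ ε := by linarith

end Gluing

/-! ### Envelopes below an obstacle -/

section Envelope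

variable {n m : ℕ}

/-- `f - C ‖·‖²` is concave. The inequality is written at the barycentre `z` of the points
`z + b h` and `z - a h` with weights `a` and `b`, so that it speaks of translates of `f`. -/
def SemiConcave {E : Type*} [NormedAddCommGroup E] [NormedSpace ℝ E] (C : ℝ) (f : E → ℝ) : Prop :=
  ∀ (z h : E) (a b : ℝ), 0 ≤ a → 0 ≤ b → a + b = 1 →
    a * f (z + b • h) + b * f (z - a • h) ≤ f z + C * (a * b * ‖h‖ ^ 2)

section General

variable {E : Type*} [NormedAddCommGroup E] [InnerProductSpace ℝ E]

theorem semiConcave_norm_sq (δ : ℝ) : SemiConcave δ fun z : E => δ * ‖z‖ ^ 2 := by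
  intro z h a b ha hb hab
  have h1 := norm_add_sq_real z (b • h)
  have h2 := norm_sub_sq_real z (a • h)
  simp only [inner_smul_right, norm_smul, Real.norm_of_nonneg ha, Real.norm_of_nonneg hb] at h1 h2
  simp only [h1, h2]
  have : a = 1 - b := by linarith
  subst this
  apply le_of_eq
  ring

theorem SemiConcave.add {f g : E → ℝ} {C C' : ℝ} (hf : SemiConcave C f) (hg : SemiConcave C' g) :
    SemiConcave (C + C') fun z => f z + g z := by
  intro z h a b ha hb hab
  have h1 := hf z h a b ha hb hab
  have h2 := hg z h a b ha hb hab
  simp only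
  nlinarith

theorem exists_semiConcave_of_contDiff [FiniteDimensional ℝ E] {χ : E → ℝ} (hχ : ContDiff ℝ ∞ χ)
    (hχc : HasCompactSupport χ) : ∃ C, 0 ≤ C ∧ SemiConcave C χ := by
  obtain ⟨M, hM⟩ := ContDiff.lipschitzWith_of_hasCompactSupport (𝕂 := ℝ) (hχc.fderiv ℝ)
    (hχ.fderiv_right (m := ∞) (by simp)) (by simp)
  have hq : ∀ z h : E, |χ (z + h) - χ z - fderiv ℝ χ z h| ≤ M * ‖h‖ ^ 2 := by
    intro z h
    have hd : ∀ y, HasFDerivAt (fun y => χ y - fderiv ℝ χ z y) (fderiv ℝ χ y - fderiv ℝ χ z) y :=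
      fun y => ((hχ.differentiable (by simp) y).hasFDerivAt).sub (fderiv ℝ χ z).hasFDerivAt
    have h1 := (convex_closedBall z ‖h‖).norm_image_sub_le_of_norm_hasFDerivWithin_le
      (f := fun y => χ y - fderiv ℝ χ z y) (C := M * ‖h‖)
      (fun y _ => (hd y).hasFDerivWithinAt) (fun y hy => ?_)
      (Metric.mem_closedBall_self (norm_nonneg h)) (y := z + h) (by simp)
    · rw [Real.norm_eq_abs, add_sub_cancel_left, map_add] at h1
      calc _ = _ := by congr 1; ring
        _ ≤ _ := h1
        _ = _ := by ring
    · rw [← dist_eq_norm]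
      exact (hM.dist_le_mul y z).trans (mul_le_mul_of_nonneg_left hy M.2)
  refine ⟨M, M.2, fun z h a b ha hb hab => ?_⟩
  have h1 := (abs_le.1 (hq z (b • h))).2
  have h2 := (abs_le.1 (hq z (-(a • h)))).2
  rw [norm_neg] at h2
  simp only [map_neg, map_smul, smul_eq_mul, norm_smul, Real.norm_of_nonneg ha,
    Real.norm_of_nonneg hb, ← sub_eq_add_neg] at h1 h2
  have h3 := mul_le_mul_of_nonneg_left h1 ha
  have h4 := mul_le_mul_of_nonneg_left h2 hb
  have h5 : a = 1 - b := by linarith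
  subst h5
  nlinarith

theorem SemiConcave.continuous [FiniteDimensional ℝ E] {f : E → ℝ} {C : ℝ} (hf : SemiConcave C f) :
    Continuous f := by
  have h1 : ConcaveOn ℝ Set.univ fun z => f z + -C * ‖z‖ ^ 2 := by
    refine ⟨convex_univ, fun x _ y _ a b ha hb hab => ?_⟩
    have h2 := hf (a • x + b • y) (x - y) a b ha hb hab
    have h3 := semiConcave_norm_sq (-C) (a • x + b • y) (x - y) a b ha hb hab
    have e1 : a • x + b • y + b • (x - y) = x := by
      rw [smul_sub, add_add_sub_cancel, ← add_smul, hab, one_smul]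
    have e2 : a • x + b • y - a • (x - y) = y := by
      rw [smul_sub, add_sub_sub_cancel, ← add_smul, add_comm b, hab, one_smul]
    rw [e1, e2] at h2
    simp only [e1, e2] at h3
    simp only [smul_eq_mul]
    linarith
  have h2 := (h1.continuousOn isOpen_univ)
  rw [← continuousOn_univ]
  have h3 : ContinuousOn (fun z : E => C * ‖z‖ ^ 2) Set.univ := by fun_prop
  refine (h2.add h3).congr fun z _ => ?_
  simp

/-- A continuous function whose mollifications have uniformly bounded second derivatives is
differentiable, and almost everywhere twice differentiable. -/
theorem differentiable_of_moll_bound [FiniteDimensional ℝ E] [MeasurableSpace E] [BorelSpace E]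
    {φ : E → ℝ} (hφ : Continuous φ) {M : ℝ} (hM0 : 0 ≤ M)
    (hM : ∀ ε, 0 < ε → ∀ z h : E, |secondDeriv (moll ε φ) z h h| ≤ M * ‖h‖ ^ 2) :
    (∀ z, DifferentiableAt ℝ φ z) ∧ ∀ᵐ z, DifferentiableAt ℝ (fderiv ℝ φ) z := by
  have hs : ∀ ε, 0 < ε → ContDiff ℝ ∞ (moll ε φ) := fun ε hε => moll_contDiff hε hφ.locallyIntegrable
  have hT : ∀ ε, 0 < ε → ∀ z h, |moll ε φ (z + h) - moll ε φ z - fderiv ℝ (moll ε φ) z h| ≤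
      M * ‖h‖ ^ 2 := by
    intro ε hε z h
    have hl : ∀ t : ℝ, HasDerivAt (fun t : ℝ => z + t • h) h t := fun t => by
      simpa using ((hasDerivAt_id t).smul_const h).const_add z
    have hd1 : ∀ t : ℝ, HasDerivAt (fun t : ℝ => moll ε φ (z + t • h))
        (fderiv ℝ (moll ε φ) (z + t • h) h) t := fun t =>
      ((hs ε hε).differentiable (by simp) _).hasFDerivAt.comp_hasDerivAt t (hl t)
    have hd2 : ∀ t : ℝ, HasDerivAt (fun t : ℝ => fderiv ℝ (moll ε φ) (z + t • h) h)
        (secondDeriv (moll ε φ) (z + t • h) h h) t := fun t => by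
      have h1 := (contDiffAt_fderiv_differentiableAt ((hs ε hε).of_le two_le_infty).contDiffAt
        (z := z + t • h)).hasFDerivAt.comp_hasDerivAt t (hl t)
      have h2 : HasDerivAt (fun t : ℝ => fderiv ℝ (moll ε φ) (z + t • h) h) _ t :=
        h1.clm_apply (hasDerivAt_const t h)
      simpa using h2
    have hb : ∀ t ∈ Set.Icc (0 : ℝ) 1,
        ‖fderiv ℝ (moll ε φ) (z + t • h) h - fderiv ℝ (moll ε φ) z h‖ ≤ M * ‖h‖ ^ 2 := by
      intro t ht
      have := (convex_Icc (0 : ℝ) 1).norm_image_sub_le_of_norm_hasDerivWithin_le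
        (fun t _ => (hd2 t).hasDerivWithinAt) (fun t _ => hM ε hε (z + t • h) h)
        (show (0 : ℝ) ∈ Set.Icc (0 : ℝ) 1 by simp) ht
      simp only [zero_smul, add_zero, sub_zero, Real.norm_eq_abs] at this ⊢
      refine this.trans ?_
      rw [abs_of_nonneg ht.1]
      nlinarith [ht.2, mul_nonneg hM0 (sq_nonneg ‖h‖)]
    have := (convex_Icc (0 : ℝ) 1).norm_image_sub_le_of_norm_hasDerivWithin_le
      (f := fun t => moll ε φ (z + t • h) - t * fderiv ℝ (moll ε φ) z h)
      (f' := fun t => fderiv ℝ (moll ε φ) (z + t • h) h - fderiv ℝ (moll ε φ) z h)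
      (fun t _ => ((hd1 t).sub (by simpa using (hasDerivAt_id t).mul_const _)).hasDerivWithinAt)
      hb (show (0 : ℝ) ∈ Set.Icc (0 : ℝ) 1 by simp) (show (1 : ℝ) ∈ Set.Icc (0 : ℝ) 1 by simp)
    simp only [zero_smul, add_zero, one_smul, one_mul, zero_mul, sub_zero, norm_one, mul_one,
      Real.norm_eq_abs] at this
    rwa [sub_right_comm]
  have hlim : ∀ z, Tendsto (fun ε => moll ε φ z) (𝓝[>] 0) (𝓝 (φ z)) := by
    intro z
    rw [Metric.tendsto_nhds]
    intro η hη
    obtain ⟨r, hr, hball⟩ := Metric.continuousAt_iff.1 (hφ.continuousAt (x := z)) (η / 2) (by positivity)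
    filter_upwards [self_mem_nhdsWithin, nhdsWithin_le_nhds (Iio_mem_nhds hr)] with ε hε hεr
    have hε : 0 < ε := hε
    have h2 := abs_moll_sub_le hε hφ.locallyIntegrable (z := z) (r := φ z)
      (η := η / 2) fun y hy => (hball (lt_of_le_of_lt hy hεr)).le
    rw [Real.dist_eq]
    linarith
  -- cluster points of the derivatives at `z` are derivatives of `φ`
  have hℓ : ∀ z, ∃ ℓ : E →L[ℝ] ℝ, ∀ h, |φ (z + h) - φ z - ℓ h| ≤ M * ‖h‖ ^ 2 := by
    intro z
    obtain ⟨B, hB⟩ := (isCompact_closedBall z 2).exists_bound_of_continuousOn hφ.continuousOn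
    have hbound : ∀ ε, 0 < ε → ε < 1 → ‖fderiv ℝ (moll ε φ) z‖ ≤ 2 * B + M := by
      intro ε hε hε1
      have hmb : ∀ h : E, ‖h‖ ≤ 1 → |moll ε φ (z + h)| ≤ B := by
        intro h hh
        have := abs_moll_sub_le hε hφ.locallyIntegrable (z := z + h) (r := 0) (η := B)
          fun y hy => by
            rw [sub_zero]
            refine hB y ?_
            have h1 := dist_triangle y (z + h) z
            have h2 : dist (z + h) z = ‖h‖ := by simp
            have h3 : dist y (z + h) ≤ ε := hy
            rw [Metric.mem_closedBall]
            linarith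
        simpa using this
      have hB0 : 0 ≤ B := (abs_nonneg _).trans (hmb 0 (by simp))
      refine ContinuousLinearMap.opNorm_le_of_unit_norm (by positivity) fun h hh => ?_
      have h1 := hT ε hε z h
      have h2 := hmb h hh.le
      have h3 := hmb 0 (by simp)
      rw [add_zero] at h3
      rw [hh] at h1
      rw [Real.norm_eq_abs]
      rw [abs_le] at *
      constructor <;> linarith [h1.1, h1.2, h2.1, h2.2, h3.1, h3.2]
    let 𝒰 : Ultrafilter ℝ := Ultrafilter.of (𝓝[>] (0 : ℝ))
    have h𝒰 : (𝒰 : Filter ℝ) ≤ 𝓝[>] 0 := Ultrafilter.of_le _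
    have hmem : ∀ᶠ ε in (𝒰 : Filter ℝ), fderiv ℝ (moll ε φ) z ∈
        Metric.closedBall (0 : E →L[ℝ] ℝ) (2 * B + M) := by
      refine h𝒰 ?_
      filter_upwards [self_mem_nhdsWithin, nhdsWithin_le_nhds (Iio_mem_nhds one_pos)] with ε h1 h2
      simpa using hbound ε h1 h2
    have : ProperSpace (E →L[ℝ] ℝ) := FiniteDimensional.proper_real _
    obtain ⟨ℓ, -, hℓ⟩ := (isCompact_closedBall (0 : E →L[ℝ] ℝ) (2 * B + M)).ultrafilter_le_nhds'
      (𝒰.map fun ε => fderiv ℝ (moll ε φ) z) hmem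
    refine ⟨ℓ, fun h => ?_⟩
    have h1 : Tendsto (fun ε => fderiv ℝ (moll ε φ) z h) 𝒰 (𝓝 (ℓ h)) :=
      ((ContinuousLinearMap.apply ℝ ℝ h).continuous.tendsto ℓ).comp hℓ
    have h2 : Tendsto (fun ε => |moll ε φ (z + h) - moll ε φ z - fderiv ℝ (moll ε φ) z h|) 𝒰
        (𝓝 |φ (z + h) - φ z - ℓ h|) :=
      ((((hlim (z + h)).mono_left h𝒰).sub ((hlim z).mono_left h𝒰)).sub h1).abs
    refine le_of_tendsto h2 (h𝒰 ?_)
    filter_upwards [self_mem_nhdsWithin] with ε hε using hT ε hε z h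
  choose ℓ hℓ using hℓ
  have hd : ∀ z, HasFDerivAt φ (ℓ z) z := by
    intro z
    rw [hasFDerivAt_iff_isLittleO_nhds_zero]
    refine Asymptotics.IsBigO.trans_isLittleO (g := fun h : E => ‖h‖ ^ 2) ?_ ?_
    · exact Asymptotics.IsBigO.of_bound M (Eventually.of_forall fun h => by
        rw [Real.norm_eq_abs, Real.norm_of_nonneg (sq_nonneg ‖h‖)]; exact hℓ z h)
    · exact Asymptotics.isLittleO_norm_pow_id one_lt_two
  have hfd : fderiv ℝ φ = ℓ := funext fun z => (hd z).fderiv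
  refine ⟨fun z => (hd z).differentiableAt, ?_⟩
  have hlip : LipschitzWith (Real.toNNReal (6 * M)) (fderiv ℝ φ) := by
    rw [hfd]
    refine LipschitzWith.of_dist_le_mul fun x z => ?_
    rw [Real.coe_toNNReal _ (by positivity), dist_eq_norm, dist_eq_norm]
    obtain ⟨k, rfl⟩ : ∃ k, x = z + k := ⟨x - z, by abel⟩
    rw [add_sub_cancel_left]
    rcases eq_or_ne k 0 with rfl | hk
    · simp
    have hk0 : 0 < ‖k‖ := norm_pos_iff.2 hk
    refine ContinuousLinearMap.opNorm_le_of_unit_norm (by positivity) fun h hh => ?_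
    have h1 := hℓ (z + k) (‖k‖ • h)
    have h2 := hℓ z (k + ‖k‖ • h)
    have h3 := hℓ z k
    have hn : ‖‖k‖ • h‖ = ‖k‖ := by rw [norm_smul, norm_norm, hh, mul_one]
    have hn2 : ‖k + ‖k‖ • h‖ ^ 2 ≤ 4 * ‖k‖ ^ 2 := by
      have h4 := norm_add_le k (‖k‖ • h)
      rw [hn] at h4
      nlinarith [norm_nonneg (k + ‖k‖ • h)]
    rw [hn] at h1
    rw [← add_assoc] at h2
    simp only [map_add, map_smul, smul_eq_mul] at h1 h2
    have h5 : M * ‖k + ‖k‖ • h‖ ^ 2 ≤ M * (4 * ‖k‖ ^ 2) := mul_le_mul_of_nonneg_left hn2 hM0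
    have h6 : ‖k‖ * |ℓ (z + k) h - ℓ z h| ≤ ‖k‖ * (6 * M * ‖k‖) := by
      rw [← abs_of_pos hk0, ← abs_mul, abs_of_pos hk0, abs_le]
      rw [abs_le] at h1 h2 h3
      constructor <;> nlinarith [h1.1, h1.2, h2.1, h2.2, h3.1, h3.2]
    rw [_root_.sub_apply, Real.norm_eq_abs]
    exact le_of_mul_le_mul_left h6 hk0
  exact hlip.ae_differentiableAt

end General

/-- Admissible competitors for the envelope of `f`. -/
def Admissible (m : ℕ) (f v : Cn n → ℝ) : Prop := (∀ z, MSHAt m v z) ∧ ∀ z, v z ≤ f z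

/-- The envelope of `f`: the supremum of the smooth `m`-subharmonic functions below `f`. -/
noncomputable def envelope (m : ℕ) (f : Cn n → ℝ) (z : Cn n) : ℝ :=
  ⨆ v : {v : Cn n → ℝ // Admissible m f v}, v.1 z

variable {f v : Cn n → ℝ} {z : Cn n}

theorem Admissible.le_envelope (hv : Admissible m f v) : v z ≤ envelope m f z :=
  le_ciSup (f := fun v : {v : Cn n → ℝ // Admissible m f v} => v.1 z)
    ⟨f z, by rintro _ ⟨w, rfl⟩; exact w.2.2 z⟩ ⟨v, hv⟩

theorem envelope_le (hv : Admissible m f v) {c : ℝ} (hc : ∀ w, Admissible m f w → w z ≤ c) :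
    envelope m f z ≤ c := by
  have : Nonempty {v : Cn n → ℝ // Admissible m f v} := ⟨⟨v, hv⟩⟩
  exact ciSup_le fun w => hc w.1 w.2

theorem exists_admissible_gt (hv : Admissible m f v) {c : ℝ} (hc : c < envelope m f z) :
    ∃ w, Admissible m f w ∧ c < w z := by
  by_contra h
  push Not at h
  exact absurd (envelope_le hv h) (not_le.2 hc)

/-- The envelope inherits semiconcavity from the obstacle: average two translates of competitors. -/
theorem envelope_semiConcave (hmn : m ≤ n) (hv : Admissible m f v) {C : ℝ} (hf : SemiConcave C f) :
    SemiConcave C (envelope m f) := by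
  intro z h a b ha hb hab
  have key : ∀ v1 v2, Admissible m f v1 → Admissible m f v2 →
      a * v1 (z + b • h) + b * v2 (z - a • h) ≤ envelope m f z + C * (a * b * ‖h‖ ^ 2) := by
    intro v1 v2 h1 h2
    have hadm : Admissible m f fun y => a * v1 (y + b • h) + b * v2 (y + -(a • h)) +
        -(C * (a * b * ‖h‖ ^ 2)) := by
      refine ⟨fun y => (((h1.1 _).comp_add.const_mul hmn ha).add
        ((h2.1 _).comp_add.const_mul hmn hb)).add_const _, fun y => ?_⟩
      have e1 := mul_le_mul_of_nonneg_left (h1.2 (y + b • h)) ha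
      have e2 := mul_le_mul_of_nonneg_left (h2.2 (y + -(a • h))) hb
      have e3 := hf y h a b ha hb hab
      rw [sub_eq_add_neg] at e3
      linarith
    have := hadm.le_envelope (z := z)
    rw [sub_eq_add_neg z]
    linarith
  -- pass to the suprema one after the other
  rcases ha.eq_or_lt with rfl | ha'
  · have hb1 : b = 1 := by linarith
    subst hb1
    simp
  rcases hb.eq_or_lt with rfl | hb'
  · have ha1 : a = 1 := by linarith
    subst ha1
    simp
  have k1 : ∀ v2, Admissible m f v2 → a * envelope m f (z + b • h) + b * v2 (z - a • h) ≤
      envelope m f z + C * (a * b * ‖h‖ ^ 2) := by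
    intro v2 h2
    have : envelope m f (z + b • h) ≤
        (envelope m f z + C * (a * b * ‖h‖ ^ 2) - b * v2 (z - a • h)) / a :=
      envelope_le hv fun v1 h1 => by
        rw [le_div_iff₀ ha']
        linarith [key v1 v2 h1 h2]
    rw [le_div_iff₀ ha'] at this
    linarith
  have : envelope m f (z - a • h) ≤
      (envelope m f z + C * (a * b * ‖h‖ ^ 2) - a * envelope m f (z + b • h)) / b :=
    envelope_le hv fun v2 h2 => by
      rw [le_div_iff₀ hb']
      linarith [k1 v2 h2]
  rw [le_div_iff₀ hb'] at this
  linarith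

/-- Up to a small error, the maximum of finitely many competitors is below a competitor. -/
theorem Admissible.exists_finset_max (hmn : m ≤ n) (hv : Admissible m f v)
    (s : Finset (Cn n → ℝ)) (hs : ∀ w ∈ s, Admissible m f w) {η : ℝ} (hη : 0 < η) :
    ∃ w, Admissible m f w ∧ ∀ v' ∈ s, ∀ z, v' z - η ≤ w z := by
  classical
  induction s using Finset.induction_on generalizing η with
  | empty => exact ⟨v, hv, by simp⟩
  | insert v1 s hi ih =>
    obtain ⟨w, hw, hws⟩ := ih (fun w hw => hs w (Finset.mem_insert_of_mem hw)) (half_pos hη)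
    have h1 := hs v1 (Finset.mem_insert_self v1 s)
    have hη2 := half_pos hη
    refine ⟨fun z => regMax (η / 2) v1 w z + -(η / 2), ⟨fun z =>
      (MSHAt.regMax hmn hη2 (h1.1 z) (hw.1 z)).add_const _, fun z => ?_⟩, fun v' hv' z => ?_⟩
    · have := regMax_le (v := v1) (w := w) (z := z) hη2
      linarith [max_le (h1.2 z) (hw.2 z)]
    · have h2 := max_le_regMax (v := v1) (w := w) (z := z) hη2
      rcases Finset.mem_insert.1 hv' with rfl | hv'
      · linarith [le_max_left (v' z) (w z)]
      · linarith [le_max_right (v1 z) (w z), hws v' hv' z]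

/-- On a compact set a single competitor comes uniformly close to a continuous envelope. -/
theorem exists_admissible_near (hmn : m ≤ n) (hv : Admissible m f v)
    (hc : Continuous (envelope m f)) {K : Set (Cn n)} (hK : IsCompact K) {ε : ℝ} (hε : 0 < ε) :
    ∃ w, Admissible m f w ∧ ∀ z ∈ K, envelope m f z - ε ≤ w z := by
  classical
  choose w hw hwz using fun z : Cn n => exists_admissible_gt hv
    (show envelope m f z - ε / 2 < envelope m f z by linarith)
  have hwc : ∀ z, Continuous (w z) := fun z =>
    continuous_iff_continuousAt.2 fun y => ((hw z).1 y).1.continuousAt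
  obtain ⟨t, -, htK⟩ := hK.elim_nhds_subcover (fun z => {y | envelope m f y - ε / 2 < w z y})
    fun z _ => (isOpen_lt (hc.sub continuous_const) (hwc z)).mem_nhds (hwz z)
  obtain ⟨w', hw', hws⟩ := hv.exists_finset_max hmn (t.image w)
    (fun w' h' => by obtain ⟨z, -, rfl⟩ := Finset.mem_image.1 h'; exact hw z) (half_pos hε)
  refine ⟨w', hw', fun z hz => ?_⟩
  obtain ⟨x, hx, hxz⟩ := Set.mem_iUnion₂.1 (htK hz)
  have h1 := hws (w x) (Finset.mem_image_of_mem w hx) z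
  have h2 : envelope m f z - ε / 2 < w x z := hxz
  linarith

theorem envelope_lua (hmn : m ≤ n) (hv : Admissible m f v) (hc : Continuous (envelope m f)) :
    LUA m (envelope m f) := by
  refine ⟨hc, fun K hK ε hε => ?_⟩
  obtain ⟨w, hw, hwK⟩ := exists_admissible_near hmn hv hc hK hε
  refine ⟨w, hw.1, fun z hz => abs_le.2 ⟨by linarith [hwK z hz], by
    linarith [hw.le_envelope (z := z)]⟩⟩

end Envelope

/-! ### Second order behaviour of envelopes -/

section EnvelopeRegularity

variable {n m : ℕ}

theorem secondDeriv_const_mul_norm_sq (δ : ℝ) (z a b : Cn n) :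
    secondDeriv (fun y : Cn n => δ * ‖y‖ ^ 2) z a b = δ * (2 * inner ℝ a b) := by
  have h1 := secondDeriv_const_mul (v := fun y : Cn n => ‖y - 0‖ ^ 2) (z := z)
    (by simpa using (contDiff_norm_sq ℝ (n := 2)).contDiffAt) δ
  have h2 : (fun y : Cn n => δ * ‖y‖ ^ 2) = fun y => δ * ‖y - 0‖ ^ 2 := by simp
  rw [h2, h1, _root_.smul_apply, _root_.smul_apply, secondDeriv_norm_sq, smul_eq_mul]

theorem mshAt_const_mul_norm_sq (hmn : m ≤ n) {δ : ℝ} (hδ : 0 ≤ δ) (z : Cn n) :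
    MSHAt m (fun y => δ * ‖y‖ ^ 2) z := by
  simpa using (mshAt_norm_sq (m := m) (0 : Cn n) z).const_mul hmn hδ

theorem ddc_const_mul_norm_sq (δ : ℝ) (z : Cn n) :
    ddc (fun y : Cn n => δ * ‖y‖ ^ 2) z = (δ : ℂ) • (1 : CMat n) := by
  have h1 := ddc_const_mul (v := fun y : Cn n => ‖y - 0‖ ^ 2) (z := z)
    (by simpa using (contDiff_norm_sq ℝ (n := 2)).contDiffAt) δ
  rw [ddc_norm_sq] at h1
  simpa using h1

/-- A symmetric form bounded above whose trace is nonnegative is bounded. -/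
theorem abs_apply_le_of_trace_nonneg {H : Cn n →L[ℝ] Cn n →L[ℝ] ℝ} (hH : ∀ a b, H a b = H b a)
    {C : ℝ} (hC0 : 0 ≤ C) (hC : ∀ a, H a a ≤ C * ‖a‖ ^ 2)
    (htr : 0 ≤ ∑ j : Fin n, (H (EuclideanSpace.single j 1) (EuclideanSpace.single j 1) +
        H (EuclideanSpace.single j Complex.I) (EuclideanSpace.single j Complex.I))) (a b : Cn n) :
    |H a b| ≤ (4 * n ^ 2 + 1) * C * ‖a‖ * ‖b‖ := by
  -- `K` is the nonnegative form `C ‖·‖² - H`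
  set K : Cn n → Cn n → ℝ := fun a b => C * inner ℝ a b - H a b with hK
  have hKsymm : ∀ a b, K a b = K b a := fun a b => by simp only [hK, hH a b, real_inner_comm]
  have hK0 : ∀ a, 0 ≤ K a a := fun a => by
    simp only [hK, real_inner_self_eq_norm_sq]; linarith [hC a]
  have hKadd : ∀ a b, K (a + b) (a + b) = K a a + 2 * K a b + K b b := fun a b => by
    have := hKsymm a b
    simp only [hK, map_add, _root_.add_apply, inner_add_left, inner_add_right] at this ⊢
    linarith
  have hKsub : ∀ a b, K (a - b) (a - b) = K a a - 2 * K a b + K b b := fun a b => by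
    have := hKsymm a b
    simp only [hK, map_sub, _root_.sub_apply, inner_sub_left, inner_sub_right] at this ⊢
    linarith
  have hK2 : ∀ a b, 2 * K a b ≤ K a a + K b b := fun a b => by
    linarith [hK0 (a - b), hKsub a b]
  have hKs : ∀ (r : ℝ) a, K (r • a) (r • a) = r ^ 2 * K a a := fun r a => by
    simp only [hK, map_smul, _root_.smul_apply, inner_smul_left, inner_smul_right, smul_eq_mul,
      conj_trivial]
    ring
  have hlow : ∀ y, K y y ≤ 4 * n ^ 2 * C * ‖y‖ ^ 2 := by
    intro y
    set x : Fin n → Cn n := fun j => (y j).re • (EuclideanSpace.single j 1 : Cn n) +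
      (y j).im • (EuclideanSpace.single j Complex.I : Cn n) with hx
    set T : Fin n → ℝ := fun j => K (EuclideanSpace.single j 1) (EuclideanSpace.single j 1) +
      K (EuclideanSpace.single j Complex.I) (EuclideanSpace.single j Complex.I) with hT
    have hy : y = ∑ j, x j := eq_sum_single y
    have h1 : K y y = ∑ i, ∑ j, K (x j) (x i) := by
      conv_lhs => rw [hy]
      simp only [hK, map_sum, _root_.sum_apply, sum_inner, inner_sum,
        Finset.mul_sum, Finset.sum_sub_distrib]
    have hj : ∀ j, K (x j) (x j) ≤ 2 * ‖y‖ ^ 2 * T j := by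
      intro j
      have e1 : (y j).re ^ 2 ≤ ‖y‖ ^ 2 :=
        sq_le_sq' (by linarith [abs_le.1 ((Complex.abs_re_le_norm (y j)).trans
          (PiLp.norm_apply_le y j))]) (by linarith [abs_le.1 ((Complex.abs_re_le_norm (y j)).trans
          (PiLp.norm_apply_le y j))])
      have e2 : (y j).im ^ 2 ≤ ‖y‖ ^ 2 :=
        sq_le_sq' (by linarith [abs_le.1 ((Complex.abs_im_le_norm (y j)).trans
          (PiLp.norm_apply_le y j))]) (by linarith [abs_le.1 ((Complex.abs_im_le_norm (y j)).trans
          (PiLp.norm_apply_le y j))])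
      have e3 := hK2 ((y j).re • (EuclideanSpace.single j 1 : Cn n))
        ((y j).im • (EuclideanSpace.single j Complex.I : Cn n))
      have e4 := mul_le_mul_of_nonneg_right e1 (hK0 (EuclideanSpace.single j 1))
      have e5 := mul_le_mul_of_nonneg_right e2 (hK0 (EuclideanSpace.single j Complex.I))
      rw [hKs, hKs] at e3
      simp only [hx, hT, hKadd, hKs]
      linarith
    have h2 : K y y ≤ n * ∑ j, K (x j) (x j) := by
      rw [h1]
      calc ∑ i, ∑ j, K (x j) (x i) ≤ ∑ i : Fin n, ∑ j : Fin n,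
            (1 / 2 * K (x i) (x i) + 1 / 2 * K (x j) (x j)) :=
            Finset.sum_le_sum fun i _ => Finset.sum_le_sum fun j _ => by
              linarith [hK2 (x j) (x i)]
        _ = n * ∑ j, K (x j) (x j) := by
            simp only [Finset.sum_add_distrib, Finset.sum_const, Finset.card_univ,
              Fintype.card_fin, nsmul_eq_mul, ← Finset.mul_sum]
            ring
    have h3 : ∑ j, T j ≤ 2 * n * C := by
      have : ∑ j, T j = 2 * n * C - ∑ j : Fin n,
          (H (EuclideanSpace.single j 1) (EuclideanSpace.single j 1) +
          H (EuclideanSpace.single j Complex.I) (EuclideanSpace.single j Complex.I)) := by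
        rw [eq_sub_iff_add_eq, ← Finset.sum_add_distrib]
        have : ∀ j : Fin n, T j + (H (EuclideanSpace.single j 1) (EuclideanSpace.single j 1) +
          H (EuclideanSpace.single j Complex.I) (EuclideanSpace.single j Complex.I)) = 2 * C := by
          intro j
          simp only [hT, hK, real_inner_single]
          simp
          ring
        simp only [this, Finset.sum_const, Finset.card_univ, Fintype.card_fin, nsmul_eq_mul]
        ring
      linarith
    calc K y y ≤ n * ∑ j, K (x j) (x j) := h2
      _ ≤ n * ∑ j, 2 * ‖y‖ ^ 2 * T j :=
          mul_le_mul_of_nonneg_left (Finset.sum_le_sum fun j _ => hj j) (Nat.cast_nonneg n)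
      _ = n * (2 * ‖y‖ ^ 2) * ∑ j, T j := by rw [← Finset.mul_sum]; ring
      _ ≤ n * (2 * ‖y‖ ^ 2) * (2 * n * C) := mul_le_mul_of_nonneg_left h3 (by positivity)
      _ = 4 * n ^ 2 * C * ‖y‖ ^ 2 := by ring
  set M := (4 * (n : ℝ) ^ 2 + 1) * C with hM
  have hM0 : 0 ≤ M := by positivity
  have hHa : ∀ y, |H y y| ≤ M * ‖y‖ ^ 2 := by
    intro y
    have h1 := hlow y
    have h2 := hC y
    simp only [hK, real_inner_self_eq_norm_sq] at h1
    have h3 : 0 ≤ C * ‖y‖ ^ 2 := by positivity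
    have h4 : 0 ≤ 4 * n ^ 2 * C * ‖y‖ ^ 2 := by positivity
    rw [abs_le]
    constructor <;> nlinarith
  have hpol : ∀ a b, |2 * H a b| ≤ M * (‖a‖ ^ 2 + ‖b‖ ^ 2) := by
    intro a b
    have h1 := hHa (a + b)
    have h2 := hHa (a - b)
    have h3 := parallelogram_law_with_norm ℝ a b
    have h4 := hH a b
    simp only [map_add, map_sub, _root_.add_apply, _root_.sub_apply] at h1 h2
    rw [abs_le] at *
    constructor <;> nlinarith [h1.1, h1.2, h2.1, h2.2]
  rcases eq_or_ne a 0 with rfl | ha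
  · simp
  rcases eq_or_ne b 0 with rfl | hb
  · simp
  have ha' : 0 < ‖a‖ := norm_pos_iff.2 ha
  have hb' : 0 < ‖b‖ := norm_pos_iff.2 hb
  have h1 := hpol (‖b‖ • a) (‖a‖ • b)
  simp only [map_smul, _root_.smul_apply, smul_eq_mul, norm_smul, norm_norm] at h1
  rw [show 2 * (‖a‖ * (‖b‖ * H a b)) = (2 * (‖a‖ * ‖b‖)) * H a b by ring, abs_mul,
    abs_of_pos (by positivity)] at h1
  have h2 : 2 * (‖a‖ * ‖b‖) * |H a b| ≤ 2 * (‖a‖ * ‖b‖) * (M * ‖a‖ * ‖b‖) := by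
    refine h1.trans (le_of_eq ?_)
    ring
  exact le_of_mul_le_mul_left h2 (by positivity)

/-- Upper bounds for second differences and the sign of the Laplacian control all second derivatives
of the mollifications. -/
theorem LUA.exists_moll_bound (hm : 1 ≤ m) (hmn : m ≤ n) {φ : Cn n → ℝ} (hφ : LUA m φ) {C : ℝ}
    (hC0 : 0 ≤ C) (hC : SemiConcave C φ) : ∃ M, 0 ≤ M ∧
      ∀ ε, 0 < ε → ∀ z a b, |secondDeriv (moll ε φ) z a b| ≤ M * ‖a‖ * ‖b‖ := by
  refine ⟨(4 * n ^ 2 + 1) * (2 * C), by positivity, fun ε hε z a b => ?_⟩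
  have hs : ContDiff ℝ 2 (moll ε φ) :=
    (moll_contDiff hε hφ.cont.locallyIntegrable).of_le two_le_infty
  refine abs_apply_le_of_trace_nonneg (fun a b => ?_) (by positivity) (fun h => ?_) ?_ a b
  · exact (hs.contDiffAt.isSymmSndFDerivAt (by simp)).eq a b
  · refine secondDeriv_self_le hs fun t => ?_
    refine moll_second_difference hε hφ.cont.locallyIntegrable (fun y => ?_) z
    have h1 := hC y ((2 * t) • h) (1 / 2) (1 / 2) (by norm_num) (by norm_num) (by norm_num)
    rw [smul_smul, show 1 / 2 * (2 * t) = t by ring, norm_smul, mul_pow, Real.norm_eq_abs,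
      sq_abs] at h1
    nlinarith
  · exact laplace_nonneg hm (hm.trans hmn) (smoothing_mshAt hm hmn (kern_contDiff ε)
      (kern_hasCompactSupport hε) (kern_nonneg hε) hφ.cont.locallyIntegrable
      (hφ.distMSH hm hmn) fun _ _ => Set.mem_univ _).2

theorem LUA.moll_mshAt (hm : 1 ≤ m) (hmn : m ≤ n) {φ : Cn n → ℝ} (hφ : LUA m φ) {ε : ℝ}
    (hε : 0 < ε) (z : Cn n) : MSHAt m (moll ε φ) z :=
  smoothing_mshAt hm hmn (kern_contDiff ε) (kern_hasCompactSupport hε) (kern_nonneg hε)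
    hφ.cont.locallyIntegrable (hφ.distMSH hm hmn) fun _ _ => Set.mem_univ _

theorem tendsto_leviMatrix {ι : Type*} {l : Filter ι} {H : ι → Cn n →L[ℝ] Cn n →L[ℝ] ℝ}
    {H₀ : Cn n →L[ℝ] Cn n →L[ℝ] ℝ} (h : ∀ a b, Tendsto (fun i => H i a b) l (𝓝 (H₀ a b))) :
    Tendsto (fun i => leviMatrix (H i)) l (𝓝 (leviMatrix H₀)) := by
  have h' : ∀ a b, Tendsto (fun i => (H i a b : ℂ)) l (𝓝 (H₀ a b : ℂ)) := fun a b =>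
    (Complex.continuous_ofReal.tendsto _).comp (h a b)
  refine tendsto_pi_nhds.2 fun j => tendsto_pi_nhds.2 fun k => ?_
  simp only [leviMatrix, leviForm, Matrix.of_apply]
  exact (((h' _ _).add (h' _ _)).add (((h' _ _).sub (h' _ _)).const_mul _)).const_mul _

/-- Almost everywhere, a semiconcave limit of smooth `m`-subharmonic functions is twice
differentiable and its mollifications converge to it to second order. -/
theorem LUA.ae_second_order (hm : 1 ≤ m) (hmn : m ≤ n) {φ : Cn n → ℝ} (hφ : LUA m φ) {C : ℝ}
    (hC0 : 0 ≤ C) (hC : SemiConcave C φ) : (∀ z, DifferentiableAt ℝ φ z) ∧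
      ∀ᵐ z, DifferentiableAt ℝ (fderiv ℝ φ) z ∧ MPos m (ddc φ z) ∧
        Tendsto (fun ε => ddc (moll ε φ) z) (𝓝[>] 0) (𝓝 (ddc φ z)) := by
  obtain ⟨M, hM0, hM⟩ := hφ.exists_moll_bound hm hmn hC0 hC
  obtain ⟨hd, hae⟩ := differentiable_of_moll_bound hφ.cont hM0 fun ε hε z h => by
    simpa [sq, mul_assoc] using hM ε hε z h h
  refine ⟨hd, hae.mono fun z hz => ?_⟩
  have hsymm : ∀ a b, secondDeriv φ z a b = secondDeriv φ z b a :=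
    second_derivative_symmetric (fun y => (hd y).hasFDerivAt) hz.hasFDerivAt
  have hlim : Tendsto (fun ε => ddc (moll ε φ) z) (𝓝[>] 0) (𝓝 (ddc φ z)) := by
    simp only [ddc_eq]
    exact tendsto_leviMatrix fun a b => tendsto_secondDeriv_moll hφ.cont.locallyIntegrable hsymm
      (L := fderiv ℝ φ z) (fun η hη => taylor_two_isLittleO hd hz hη) a b
  refine ⟨hz, (isClosed_mPos m).mem_of_tendsto hlim ?_, hlim⟩
  filter_upwards [self_mem_nhdsWithin] with ε hε using (hφ.moll_mshAt hm hmn hε z).2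

variable {f v : Cn n → ℝ} {z : Cn n}

/-- Where the envelope lies strictly below the obstacle its Hessian is degenerate: otherwise a
slightly bent osculating quadratic polynomial could be glued to a competitor. -/
theorem sigmaForm_ddc_envelope_eq_zero (hmn : m ≤ n) (hv : Admissible m f v) (hf : Continuous f)
    (hc : Continuous (envelope m f)) (hd : ∀ z, DifferentiableAt ℝ (envelope m f) z)
    (h2 : DifferentiableAt ℝ (fderiv ℝ (envelope m f)) z) (hpos : MPos m (ddc (envelope m f) z))
    (hlt : envelope m f z < f z) : sigmaForm m (ddc (envelope m f) z) = 0 := by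
  classical
  set φ := envelope m f with hφ
  by_contra hne
  have hσ : 0 < sigmaForm m (ddc φ z) := lt_of_le_of_ne (hpos.2 m le_rfl) (Ne.symm hne)
  obtain ⟨ε, hε, hB⟩ := hpos.exists_sub_of_pos hσ
  obtain ⟨r, hr, hT⟩ := taylor_two_isLittleO hd h2 (show 0 < ε / 4 by positivity)
  set g := f z - φ z with hg
  have hg0 : 0 < g := sub_pos.2 hlt
  obtain ⟨r', hr', hgap⟩ := Metric.continuousAt_iff.1
    ((hf.sub hc).continuousAt (x := z)) (g / 2) (by positivity)
  -- the radius `ρ` is so small that the Taylor expansion is accurate and the gap `f - φ` survives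
  obtain ⟨ρ, hρ0, hρr, hρr', hρg⟩ : ∃ ρ, 0 < ρ ∧ ρ < r ∧ ρ < r' ∧ ε * ρ ^ 2 ≤ g := by
    have h0 : Tendsto (fun ρ : ℝ => ε * ρ ^ 2) (𝓝[>] 0) (𝓝 0) := by
      have : Continuous fun ρ : ℝ => ε * ρ ^ 2 := by fun_prop
      simpa using (this.tendsto 0).mono_left nhdsWithin_le_nhds
    have e1 : ∀ᶠ ρ : ℝ in 𝓝[>] 0, 0 < ρ := self_mem_nhdsWithin
    have e2 : ∀ᶠ ρ : ℝ in 𝓝[>] 0, ρ < r := nhdsWithin_le_nhds (Iio_mem_nhds hr)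
    have e3 : ∀ᶠ ρ : ℝ in 𝓝[>] 0, ρ < r' := nhdsWithin_le_nhds (Iio_mem_nhds hr')
    obtain ⟨ρ, h1, h2, h3, h4⟩ := (e1.and (e2.and (e3.and
      (h0.eventually (ge_mem_nhds hg0))))).exists
    exact ⟨ρ, h1, h2, h3, h4⟩
  set s := ε * ρ ^ 2 / 16 with hs
  have hs0 : 0 < s := by positivity
  set L := fderiv ℝ φ z
  set H := secondDeriv φ z with hH
  have hsymm : ∀ a b, H a b = H b a :=
    second_derivative_symmetric (fun y => (hd y).hasFDerivAt) h2.hasFDerivAt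
  -- `Q` exceeds the envelope by `s` at `z`, but lies below it by `2 s` between radii `ρ / 2` and `ρ`
  set T : Cn n → ℝ := fun y => (1 / 2) * H y y + L y + (φ z + s) with hTdef
  set Q : Cn n → ℝ := fun y => T (y + -z) + -ε * ‖y - z‖ ^ 2 with hQ
  have hTc : ContDiff ℝ ∞ T := contDiff_quadratic H L _
  have hQm : ∀ y, MSHAt m Q y := by
    intro y
    have c1 : ContDiff ℝ ∞ fun y : Cn n => T (y + -z) := hTc.comp (by fun_prop)
    have c2 : ContDiff ℝ ∞ fun y : Cn n => ‖y - z‖ ^ 2 :=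
      (contDiff_id.sub contDiff_const).norm_sq ℝ
    have c3 : ContDiff ℝ ∞ fun y : Cn n => -ε * ‖y - z‖ ^ 2 := contDiff_const.mul c2
    refine ⟨(c1.add c3).contDiffAt, ?_⟩
    rw [hQ, ddc_add (c1.of_le two_le_infty).contDiffAt (c3.of_le two_le_infty).contDiffAt,
      ddc_comp_add, ddc_const_mul (c2.of_le two_le_infty).contDiffAt, ddc_norm_sq, ddc_eq,
      secondDeriv_quadratic hsymm]
    rw [ddc_eq, ← hH] at hB
    simpa [sub_eq_add_neg] using hB
  have hQφ : ∀ y, dist y z ≤ ρ → Q y ≤ φ y + s - 3 / 4 * ε * dist y z ^ 2 := by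
    intro y hy
    have h1 := hT (y + -z) (by rw [← sub_eq_add_neg, ← dist_eq_norm]; linarith)
    rw [add_neg_cancel_comm_assoc] at h1
    have h3 := (abs_le.1 h1).1
    simp only [hQ, hTdef]
    rw [← sub_eq_add_neg, ← dist_eq_norm] at *
    linarith
  have hfφ : ∀ y, dist y z ≤ ρ → φ y + 2 * s ≤ f y := by
    intro y hy
    have h1 := hgap (lt_of_le_of_lt hy hρr')
    rw [Real.dist_eq] at h1
    have h3 := (abs_lt.1 h1).1
    simp only [Pi.sub_apply] at h3
    linarith
  obtain ⟨v', hv', hvK⟩ := exists_admissible_near hmn hv hc (isCompact_closedBall z ρ)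
    (half_pos hs0)
  have hs4 : 0 < s / 4 := by positivity
  set w : Cn n → ℝ := fun y => if y ∈ Metric.ball z ρ then regMax (s / 4) Q v' y else v' y with hw
  have hwv : ∀ y, ρ / 2 < dist y z → w y = v' y := by
    intro y hy
    by_cases hyb : y ∈ Metric.ball z ρ
    · simp only [hw, if_pos hyb]
      refine regMax_eq_right hs4 ?_
      have h1 := hQφ y (le_of_lt hyb)
      have h3 := hvK y (Metric.ball_subset_closedBall hyb)
      have h4 : (ρ / 2) ^ 2 ≤ dist y z ^ 2 := pow_le_pow_left₀ (by positivity) hy.le 2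
      have h5 := mul_le_mul_of_nonneg_left h4 hε.le
      simp only [hs] at *
      nlinarith
    · simp only [hw, if_neg hyb]
  have hwa : Admissible m f w := by
    refine ⟨fun y => ?_, fun y => ?_⟩
    · by_cases hy : dist y z < ρ
      · refine (MSHAt.regMax hmn hs4 (hQm y) (hv'.1 y)).congr ?_
        filter_upwards [Metric.isOpen_ball.mem_nhds hy] with x hx
        simp only [hw, if_pos hx]
      · refine (hv'.1 y).congr ?_
        have : {x | ρ / 2 < dist x z} ∈ 𝓝 y :=
          (isOpen_lt continuous_const (continuous_id.dist continuous_const)).mem_nhds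
            (by simp only [id, Set.mem_ofPred_eq]; linarith [not_lt.1 hy])
        filter_upwards [this] with x hx using hwv x hx
    · by_cases hy : y ∈ Metric.ball z ρ
      · simp only [hw, if_pos hy]
        have h1 := regMax_le (v := Q) (w := v') (z := y) hs4
        have h3 := hQφ y (le_of_lt hy)
        have h4 := hfφ y (le_of_lt hy)
        have h5 : v' y ≤ φ y := hv'.le_envelope
        have h6 : 0 ≤ 3 / 4 * ε * dist y z ^ 2 := by positivity
        have h7 : max (Q y) (v' y) ≤ φ y + s := max_le (by linarith) (by linarith)
        linarith
      · simp only [hw, if_neg hy]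
        exact hv'.2 y
  have h1 : w z ≤ φ z := hwa.le_envelope
  have h3 : w z = regMax (s / 4) Q v' z := by simp [hw, hρ0]
  have h4 := max_le_regMax (v := Q) (w := v') (z := z) hs4
  have h5 : Q z = φ z + s := by simp [hQ, hTdef]
  linarith [le_max_left (Q z) (v' z)]

/-- At a contact point with `δ ‖·‖²` the Hessian is bounded by that of `δ ‖·‖²`. -/
theorem sigmaForm_ddc_le_of_contact (hmn : m ≤ n) {φ : Cn n → ℝ} {δ : ℝ}
    (hle : ∀ z, φ z ≤ δ * ‖z‖ ^ 2) (hd : ∀ z, DifferentiableAt ℝ φ z)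
    (h2 : DifferentiableAt ℝ (fderiv ℝ φ) z) (hpos : MPos m (ddc φ z))
    (heq : φ z = δ * ‖z‖ ^ 2) : sigmaForm m (ddc φ z) ≤ n.factorial * δ ^ m := by
  set H := secondDeriv φ z with hH
  set K := secondDeriv (fun y : Cn n => δ * ‖y‖ ^ 2) z with hK
  have hsymm : ∀ a b, H a b = H b a :=
    second_derivative_symmetric (fun y => (hd y).hasFDerivAt) h2.hasFDerivAt
  have hle2 : ∀ a, H a a ≤ 2 * δ * ‖a‖ ^ 2 := by
    intro a
    refine le_of_forall_pos_le_add fun η hη => ?_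
    have hη' : 0 < η / (2 * ‖a‖ ^ 2 + 1) := by positivity
    obtain ⟨r, hr, hT⟩ := taylor_two_isLittleO hd h2 hη'
    obtain ⟨t, ht, htr⟩ : ∃ t : ℝ, 0 < t ∧ ‖t • a‖ < r := by
      refine ⟨r / (‖a‖ + 1), by positivity, ?_⟩
      rw [norm_smul, Real.norm_of_nonneg (by positivity), div_mul_eq_mul_div, div_lt_iff₀
        (by positivity)]
      nlinarith [norm_nonneg a]
    have h3 := (abs_le.1 (hT (t • a) htr)).1
    have h4 := (abs_le.1 (hT (-(t • a)) (by rwa [norm_neg]))).1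
    have h5 := hle (z + t • a)
    have h6 := hle (z + -(t • a))
    have h7 := parallelogram_law_with_norm ℝ z (t • a)
    rw [← sub_eq_add_neg] at h4 h6
    simp only [map_neg, _root_.neg_apply, map_smul, _root_.smul_apply, smul_eq_mul,
      norm_neg, norm_smul, Real.norm_of_nonneg ht.le] at h3 h4 h7
    have h8 : η / (2 * ‖a‖ ^ 2 + 1) * (2 * ‖a‖ ^ 2) ≤ η := by
      rw [div_mul_eq_mul_div, div_le_iff₀ (by positivity)]
      nlinarith
    have h9 : t ^ 2 * H a a ≤ t ^ 2 * (2 * δ * ‖a‖ ^ 2 + η / (2 * ‖a‖ ^ 2 + 1) * (2 * ‖a‖ ^ 2)) := by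
      rw [heq] at h3 h4
      have h10 : δ * (‖z + t • a‖ ^ 2 + ‖z - t • a‖ ^ 2) =
        δ * (2 * (‖z‖ ^ 2 + (t * ‖a‖) ^ 2)) := by rw [h7]
      nlinarith
    have := le_of_mul_le_mul_left h9 (by positivity)
    linarith
  have hKs : ∀ a b, K a b = K b a := fun a b => by
    simp only [hK, secondDeriv_const_mul_norm_sq, real_inner_comm]
  have hB : MPos m (leviMatrix (K + (-1 : ℝ) • H)) := by
    refine mPos_leviMatrix_of_nonneg (fun a b => ?_) (fun a => ?_) m
    · simp only [_root_.add_apply, _root_.smul_apply, hKs a b, hsymm a b]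
    · have h3 := hle2 a
      have h4 : K a a = δ * (2 * ‖a‖ ^ 2) := by
        rw [hK, secondDeriv_const_mul_norm_sq, real_inner_self_eq_norm_sq]
      simp only [_root_.add_apply, _root_.smul_apply, h4, smul_eq_mul]
      linarith
  have h3 := sigmaForm_le_add hpos hB le_rfl
  have h4 : ddc φ z + leviMatrix (K + (-1 : ℝ) • H) = (δ : ℂ) • (1 : CMat n) := by
    rw [leviMatrix_add, leviMatrix_smul, hK, ← ddc_eq, ddc_const_mul_norm_sq, hH, ← ddc_eq]
    push_cast
    simp
  rw [h4, sigmaForm_smul hmn, sigmaForm_one] at h3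
  linarith

/-- Affine functions tangent to `δ ‖·‖²` far from the support of `χ` are competitors. -/
theorem envelope_eq_of_far {χ : Cn n → ℝ} {δ : ℝ} (hδ : 0 < δ) (hχ0 : ∀ z, 0 ≤ χ z)
    (hχ1 : ∀ z, χ z ≤ 1) (hz : ∀ y, χ y ≠ 0 → 1 ≤ δ * ‖y - z‖ ^ 2) :
    envelope m (fun y => δ * ‖y‖ ^ 2 - χ y) z = δ * ‖z‖ ^ 2 := by
  have key : ∀ y, 2 * δ * inner ℝ z y - δ * ‖z‖ ^ 2 = δ * ‖y‖ ^ 2 - δ * ‖y - z‖ ^ 2 := by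
    intro y
    rw [norm_sub_sq_real, real_inner_comm]
    ring
  have hadm : Admissible m (fun y => δ * ‖y‖ ^ 2 - χ y)
      fun y => ((2 * δ) • innerSL ℝ z) y + -(δ * ‖z‖ ^ 2) := by
    refine ⟨fun y => mshAt_affine _ _ _, fun y => ?_⟩
    simp only [_root_.smul_apply, innerSL_apply_apply, smul_eq_mul]
    rw [← sub_eq_add_neg, key]
    by_cases hy : χ y = 0
    · rw [hy]
      have : 0 ≤ δ * ‖y - z‖ ^ 2 := by positivity
      linarith
    · linarith [hz y hy, hχ1 y]
  refine le_antisymm (envelope_le hadm fun w hw => (hw.2 z).trans (by linarith [hχ0 z])) ?_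
  have h1 := hadm.le_envelope (z := z)
  simp only [_root_.smul_apply, innerSL_apply_apply, smul_eq_mul] at h1
  rw [← sub_eq_add_neg, key] at h1
  simpa using h1

end EnvelopeRegularity

/-! ### Estimates for Hessian measures -/

section Estimates

variable {n m : ℕ}

/-- Telescoping `α^m - γ^m` for `(1,1)`-forms. -/
theorem sigmaForm_sub_eq_sum (hm : 1 ≤ m) (hmn : m ≤ n) (A B : CMat n) :
    sigmaForm m A - sigmaForm m B = ∑ j ∈ Finset.range m, (wedgeCoeff fun l : Fin n =>
      if (l : ℕ) < m - 1 then (if (l : ℕ) < j then A else B)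
      else if (l : ℕ) = m - 1 then A - B else 1).re := by
  set g : ℕ → ℝ := fun j => (wedgeCoeff fun l : Fin n =>
    if (l : ℕ) < m then (if (l : ℕ) < j then A else B) else 1).re with hg
  have h0 : g 0 = sigmaForm m B := by simp [hg, sigmaForm]
  have h1 : g m = sigmaForm m A := by
    simp only [hg, sigmaForm]
    congr 2
    ext l : 1
    split_ifs <;> rfl
  rw [← h0, ← h1, ← Finset.sum_range_sub]
  refine Finset.sum_congr rfl fun j hj => ?_
  have hjm : j < m := Finset.mem_range.1 hj
  set i : Fin n := ⟨j, by omega⟩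
  set i' : Fin n := ⟨m - 1, by omega⟩
  set F : Fin n → CMat n := fun l => if (l : ℕ) < m then (if (l : ℕ) < j then A else B) else 1
  have e1 : (fun l : Fin n => if (l : ℕ) < m then (if (l : ℕ) < j + 1 then A else B) else 1) =
      Function.update F i A := by
    ext l : 1
    by_cases hl : l = i
    · subst hl; simp [i, hjm]
    · have : (l : ℕ) ≠ j := fun h => hl (Fin.ext h)
      rw [Function.update_of_ne hl]
      simp only [F, show (l : ℕ) < j + 1 ↔ (l : ℕ) < j by omega]
  have e2 : (fun l : Fin n => if (l : ℕ) < m then (if (l : ℕ) < j then A else B) else 1) =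
      Function.update F i B := by
    rw [eq_comm, Function.update_eq_self_iff]
    simp [F, i, hjm]
  have e3 : (wedgeCoeff fun l : Fin n => if (l : ℕ) < m - 1 then (if (l : ℕ) < j then A else B)
      else if (l : ℕ) = m - 1 then A - B else 1) = wedgeCoeff (Function.update F i (A - B)) := by
    rw [← wedgeCoeff_comp_perm _ (Equiv.swap i i')]
    congr 1
    ext l : 1
    rcases eq_or_ne l i with rfl | hli
    · simp [i']
    rw [Function.update_of_ne hli]
    rcases eq_or_ne l i' with rfl | hli'
    · have hjne : j ≠ m - 1 := fun h => hli (Fin.ext h.symm)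
      simp only [Equiv.swap_apply_right, F, i, i']
      rw [if_pos (by omega), if_neg (by omega), if_pos (by omega), if_neg (by omega)]
    · have h2 : (l : ℕ) ≠ m - 1 := fun h => hli' (Fin.ext h)
      rw [Equiv.swap_apply_of_ne_of_ne hli hli', if_neg h2]
      simp only [F, show (l : ℕ) < m - 1 ↔ (l : ℕ) < m by omega]
  rw [e3]
  simp only [hg]
  rw [e1, e2, ← wedgeForm_apply, ← wedgeForm_apply, ← wedgeForm_apply,
    MultilinearMap.map_update_sub, Complex.sub_re]

theorem isMSubharmonicOn_const (hm : 1 ≤ m) (hmn : m ≤ n) {D : Set (Cn n)} (hD : IsOpen D) (r : ℝ) :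
    IsMSubharmonicOn m D fun _ => (r : EReal) := by
  have := isMSubharmonicOn_iInf hm hmn hD (S := fun _ _ => r)
    (fun _ => (LUA.of_mshAt fun z => mshAt_const r z).rApprox hD) (fun z _ => antitone_const)
    fun K _ _ => ⟨0, fun _ => by simp⟩
  simpa using this

variable {D : Set (Cn n)} {u : Cn n → EReal} {Φ ψ θ : Cn n → ℝ}

theorem contDiff_of_mshAt {v : Cn n → ℝ} (hv : ∀ z, MSHAt m v z) : ContDiff ℝ ∞ v :=
  contDiff_iff_contDiffAt.2 fun z => (hv z).1

theorem continuous_sigmaForm_ddc {v : Cn n → ℝ} (hv : ∀ z, MSHAt m v z) (k : ℕ) :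
    Continuous fun z => sigmaForm k (ddc v z) :=
  (continuous_sigmaForm k).comp (continuous_ddc (contDiff_of_mshAt hv))

theorem sigmaForm_ddc_eq_of_notMem_tsupport (h : ∀ z, Φ z = ψ z + θ z) {z : Cn n}
    (hz : z ∉ tsupport θ) (k : ℕ) : sigmaForm k (ddc Φ z) = sigmaForm k (ddc ψ z) := by
  rw [ddc_congr (v := Φ) (w := ψ)]
  filter_upwards [(isClosed_tsupport θ).isOpen_compl.mem_nhds hz] with y hy
  rw [h, image_eq_zero_of_notMem_tsupport hy, add_zero]

theorem IsMSubharmonicOn.integrableOn_mul_sub (hu : IsMSubharmonicOn m D u)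
    (hΦ : ∀ z, MSHAt m Φ z) (hψ : ∀ z, MSHAt m ψ z) (k : ℕ) {K : Set (Cn n)} (hK : IsCompact K)
    (hKD : K ⊆ D) : IntegrableOn
      (fun z => (u z).toReal * (sigmaForm k (ddc Φ z) - sigmaForm k (ddc ψ z))) K := by
  have hc : Continuous fun z => sigmaForm k (ddc Φ z) - sigmaForm k (ddc ψ z) :=
    (continuous_sigmaForm_ddc hΦ k).sub (continuous_sigmaForm_ddc hψ k)
  obtain ⟨B, hB⟩ := hK.exists_bound_of_continuousOn hc.continuousOn
  exact (hu.locallyIntegrable.integrableOn_compact_subset hKD hK).mul_bdd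
    hc.aestronglyMeasurable.restrict ((ae_restrict_mem hK.measurableSet).mono hB)

/-- Positivity of the current `dd^c u ∧ …`, tested on two functions agreeing near the boundary. -/
theorem IsMSubharmonicOn.integral_mul_sub_nonneg (hm : 1 ≤ m) (hmn : m ≤ n) (hD : IsOpen D)
    (hu : IsMSubharmonicOn m D u) (hΦ : ∀ z, MSHAt m Φ z) (hψ : ∀ z, MSHAt m ψ z)
    (hθc : HasCompactSupport θ) (hθD : tsupport θ ⊆ D)
    (hθ0 : ∀ z, 0 ≤ θ z) (h : ∀ z, Φ z = ψ z + θ z) :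
    0 ≤ ∫ z in tsupport θ,
      (u z).toReal * (sigmaForm m (ddc Φ z) - sigmaForm m (ddc ψ z)) := by
  have hθe : θ = fun z => Φ z - ψ z := funext fun z => by rw [h]; ring
  have hθ : ContDiff ℝ ∞ θ := by
    rw [hθe]; exact (contDiff_of_mshAt hΦ).sub (contDiff_of_mshAt hψ)
  set K := tsupport θ with hKdef
  have hK : IsCompact K := hθc.isCompact
  set v : ℕ → Fin (m - 1) → Cn n → ℝ := fun j i => if (i : ℕ) < j then Φ else ψ with hv
  have hvm : ∀ j i, IsC2MSubharmonicOn m D (v j i) := by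
    intro j i
    simp only [hv]
    split_ifs
    exacts [isC2MSubharmonicOn_of_mshAt fun z _ => hΦ z,
      isC2MSubharmonicOn_of_mshAt fun z _ => hψ z]
  have hsum : ∀ z, sigmaForm m (ddc Φ z) - sigmaForm m (ddc ψ z) =
      ∑ j ∈ Finset.range m, mixedCoeff m (v j) θ z := by
    intro z
    rw [sigmaForm_sub_eq_sum hm hmn]
    refine Finset.sum_congr rfl fun j _ => ?_
    rw [← ddc_sub (hΦ z).contDiffAt_two (hψ z).contDiffAt_two, ← hθe, mixedCoeff]
    congr 2
    ext l : 1
    simp only [hv]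
    split_ifs <;> rfl
  have hint : ∀ j, IntegrableOn (fun z => (u z).toReal * mixedCoeff m (v j) θ z) K := by
    intro j
    have hc : ContinuousOn (fun z => mixedCoeff m (v j) θ z) K :=
      (continuousOn_mixedCoeff hD (fun i => (hvm j i).1) hθ).mono hθD
    obtain ⟨B, hB⟩ := hK.exists_bound_of_continuousOn hc
    exact (hu.locallyIntegrable.integrableOn_compact_subset hθD hK).mul_bdd
      (hc.aestronglyMeasurable hK.measurableSet) ((ae_restrict_mem hK.measurableSet).mono hB)
  simp only [hsum, Finset.mul_sum]
  rw [integral_finsetSum _ fun j _ => hint j]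
  refine Finset.sum_nonneg fun j _ => ?_
  have h1 := hu.current_nonneg (v j) (hvm j) θ hθ hθc hθD hθ0
  rwa [← setIntegral_eq_of_subset_of_forall_sdiff_eq_zero hD.measurableSet hθD fun z hz => by
    rw [mixedCoeff_eq_zero hm hmn hz.2, mul_zero]]

/-- Functions agreeing near the boundary have the same total Hessian mass: both constants `1` and
`-1` are `m`-subharmonic. -/
theorem integral_sigmaForm_eq (hm : 1 ≤ m) (hmn : m ≤ n) (hΦ : ∀ z, MSHAt m Φ z)
    (hψ : ∀ z, MSHAt m ψ z) (hθc : HasCompactSupport θ) (hθ0 : ∀ z, 0 ≤ θ z)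
    (h : ∀ z, Φ z = ψ z + θ z) {K : Set (Cn n)} (hK : IsCompact K) (hθK : tsupport θ ⊆ K) :
    ∫ z in K, sigmaForm m (ddc Φ z) = ∫ z in K, sigmaForm m (ddc ψ z) := by
  have key : ∀ r : ℝ, 0 ≤ r * ((∫ z in K, sigmaForm m (ddc Φ z)) -
      ∫ z in K, sigmaForm m (ddc ψ z)) := by
    intro r
    have h1 := (isMSubharmonicOn_const hm hmn isOpen_univ r).integral_mul_sub_nonneg hm hmn
      isOpen_univ hΦ hψ hθc (Set.subset_univ _) hθ0 h
    simp only [EReal.toReal_coe] at h1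
    rw [integral_const_mul, ← setIntegral_eq_of_subset_of_forall_sdiff_eq_zero hK.measurableSet hθK
      fun z hz => by rw [sigmaForm_ddc_eq_of_notMem_tsupport h hz.2, sub_self],
      integral_sub ((continuous_sigmaForm_ddc hΦ m).continuousOn.integrableOn_compact hK)
        ((continuous_sigmaForm_ddc hψ m).continuousOn.integrableOn_compact hK)] at h1
    exact h1
  linarith [key 1, key (-1)]

/-- The Chern–Levine–Nirenberg estimate: the Hessian measures of uniformly bounded smooth
`m`-subharmonic functions `w` put little mass where `u` is very negative. Replacing `w` by a fixed
quadratic polynomial `ψ` near the boundary, one gets a function `Φ` for which the integral of `-u`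
against the Hessian measure is at most the one for `ψ`, because the current `dd^c u ∧ …` is
positive. -/
theorem IsMSubharmonicOn.exists_hessian_bound (hm : 1 ≤ m) (hmn : m ≤ n) {c : Cn n} {r : ℝ}
    (hr : 0 < r) (hu : IsMSubharmonicOn m (Metric.ball c (4 * r)) u) : ∃ C, 0 ≤ C ∧
      ∀ w : Cn n → ℝ, (∀ z, MSHAt m w z) → (∀ z, -1 ≤ w z) → (∀ z, w z ≤ (‖z‖ + 1) ^ 2) →
      ∀ t, 0 < t → ∀ s ⊆ Metric.ball c r, MeasurableSet s → (∀ z ∈ s, u z < ((-t : ℝ) : EReal)) →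
        ∫ z in s, sigmaForm m (ddc w z) ≤ C / t := by
  set D := Metric.ball c (4 * r) with hDdef
  have hD : IsOpen D := Metric.isOpen_ball
  set K := Metric.closedBall c (3 * r) with hKdef
  have hK : IsCompact K := isCompact_closedBall c _
  have hKD : K ⊆ D := Metric.closedBall_subset_ball (by linarith)
  obtain ⟨M', hM'⟩ := hu.exists_bound hK hKD
  set M := max M' 0
  have hM0 : 0 ≤ M := le_max_right _ _
  have hM : ∀ z ∈ K, (u z).toReal ≤ M := by
    intro z hz
    by_cases hb : u z = ⊥
    · simpa [hb] using hM0
    · have h1 := (hM' z hz).le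
      rw [← EReal.coe_toReal (hu.lt_top z (hKD hz)).ne hb, EReal.coe_le_coe_iff] at h1
      exact h1.trans (le_max_left _ _)
  -- a quadratic polynomial crossing all the functions `w` between radii `r` and `3 r`
  set k := 4 + (2 * (‖c‖ + 1) ^ 2 + 1) / r ^ 2 with hk
  have hk0 : 0 ≤ k := by positivity
  have hkr : k * r ^ 2 = 4 * r ^ 2 + (2 * (‖c‖ + 1) ^ 2 + 1) := by
    rw [hk, add_mul, div_mul_cancel₀ _ (by positivity)]
  set ψ : Cn n → ℝ := fun z => k * ‖z - c‖ ^ 2 + -(k * (4 * r ^ 2)) with hψdef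
  have hψ : ∀ z, MSHAt m ψ z := fun z => ((mshAt_norm_sq c z).const_mul hmn hk0).add_const _
  -- integrability, and the bound given by `ψ`
  have hi : ∀ {v : Cn n → ℝ}, (∀ z, MSHAt m v z) → IntegrableOn (fun z => sigmaForm m (ddc v z)) K :=
    fun hv => (continuous_sigmaForm_ddc hv m).continuousOn.integrableOn_compact hK
  have hui : IntegrableOn (fun z => (u z).toReal) K :=
    hu.locallyIntegrable.integrableOn_compact_subset hKD hK
  have hmul : ∀ {v : Cn n → ℝ}, (∀ z, MSHAt m v z) →
      IntegrableOn (fun z => (M - (u z).toReal) * sigmaForm m (ddc v z)) K := by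
    intro v hv
    have hc := continuous_sigmaForm_ddc hv m
    obtain ⟨B, hB⟩ := hK.exists_bound_of_continuousOn hc.continuousOn
    exact ((integrableOn_const hK.measure_lt_top.ne).sub hui).mul_bdd
      hc.aestronglyMeasurable.restrict ((ae_restrict_mem hK.measurableSet).mono hB)
  refine ⟨∫ z in K, (M - (u z).toReal) * sigmaForm m (ddc ψ z), ?_, ?_⟩
  · exact setIntegral_nonneg hK.measurableSet fun z hz =>
      mul_nonneg (sub_nonneg.2 (hM z hz)) ((hψ z).2.2 m le_rfl)
  intro w hw hw1 hw2 t ht s hs hsm hst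
  set θ : Cn n → ℝ := fun z => softRamp 1 (w z - ψ z) with hθdef
  set Φ := regMax 1 w ψ with hΦdef
  have hΦ : ∀ z, MSHAt m Φ z := fun z => MSHAt.regMax hmn one_pos (hw z) (hψ z)
  have hsplit : ∀ z, Φ z = ψ z + θ z := fun z => rfl
  have hθz : ∀ z, z ∉ K → θ z = 0 := by
    intro z hz
    refine softRamp_of_le one_pos ?_
    rw [hKdef, Metric.mem_closedBall, dist_eq_norm, not_le] at hz
    have h1 := hw2 z
    have h2 : ‖z‖ ≤ ‖z - c‖ + ‖c‖ := by simpa using norm_add_le (z - c) c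
    have h3 : (‖z‖ + 1) ^ 2 ≤ (‖z - c‖ + (‖c‖ + 1)) ^ 2 :=
      pow_le_pow_left₀ (by positivity) (by linarith) 2
    have h4 : 9 * r ^ 2 ≤ ‖z - c‖ ^ 2 := by nlinarith
    have h5 : 0 ≤ (2 * (‖c‖ + 1) ^ 2 + 1) / r ^ 2 := by positivity
    have h6 : (2 * (‖c‖ + 1) ^ 2 + 1) / r ^ 2 * (9 * r ^ 2) ≤
        (2 * (‖c‖ + 1) ^ 2 + 1) / r ^ 2 * ‖z - c‖ ^ 2 := mul_le_mul_of_nonneg_left h4 h5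
    have h7 : (2 * (‖c‖ + 1) ^ 2 + 1) / r ^ 2 * (9 * r ^ 2) = 9 * (2 * (‖c‖ + 1) ^ 2 + 1) := by
      field_simp
    have h8 : k * ‖z - c‖ ^ 2 = 4 * ‖z - c‖ ^ 2 +
        (2 * (‖c‖ + 1) ^ 2 + 1) / r ^ 2 * ‖z - c‖ ^ 2 := by rw [hk]; ring
    simp only [hψdef]
    nlinarith [sq_nonneg (‖z - c‖ - (‖c‖ + 1)), sq_nonneg (‖c‖ + 1)]
  have hθK : tsupport θ ⊆ K :=
    closure_minimal (fun z hz => by_contra fun h => hz (hθz z h)) hK.isClosed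
  have hθc : HasCompactSupport θ := HasCompactSupport.of_support_subset_isCompact hK
    ((subset_tsupport θ).trans hθK)
  have hθ0 : ∀ z, 0 ≤ θ z := fun z => softRamp_nonneg one_pos _
  have h1 := hu.integral_mul_sub_nonneg hm hmn hD hΦ hψ hθc (hθK.trans hKD) hθ0 hsplit
  rw [← setIntegral_eq_of_subset_of_forall_sdiff_eq_zero hK.measurableSet hθK fun z hz => by
    rw [sigmaForm_ddc_eq_of_notMem_tsupport hsplit hz.2, sub_self, mul_zero]] at h1
  have h2 := integral_sigmaForm_eq hm hmn hΦ hψ hθc hθ0 hsplit hK hθK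
  have h3 : ∫ z in K, (M - (u z).toReal) * sigmaForm m (ddc Φ z) ≤
      ∫ z in K, (M - (u z).toReal) * sigmaForm m (ddc ψ z) := by
    have e1 : (∫ z in K, (M - (u z).toReal) * sigmaForm m (ddc Φ z)) -
        ∫ z in K, (M - (u z).toReal) * sigmaForm m (ddc ψ z) =
        M * ((∫ z in K, sigmaForm m (ddc Φ z)) - ∫ z in K, sigmaForm m (ddc ψ z)) -
        ∫ z in K, (u z).toReal * (sigmaForm m (ddc Φ z) - sigmaForm m (ddc ψ z)) := by
      have i3 : IntegrableOn (fun z => M * (sigmaForm m (ddc Φ z) - sigmaForm m (ddc ψ z))) K :=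
        ((hi hΦ).sub (hi hψ)).const_mul M
      rw [← integral_sub (hmul hΦ) (hmul hψ), ← integral_sub (hi hΦ) (hi hψ),
        ← integral_const_mul, ← integral_sub i3 (hu.integrableOn_mul_sub hΦ hψ m hK hKD)]
      refine integral_congr_ae (Eventually.of_forall fun z => ?_)
      ring
    rw [h2, sub_self, mul_zero] at e1
    linarith
  have hsK : s ⊆ K := hs.trans (Metric.ball_subset_closedBall.trans
    (Metric.closedBall_subset_closedBall (by linarith)))
  have hΦw : ∀ z ∈ s, sigmaForm m (ddc Φ z) = sigmaForm m (ddc w z) := by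
    intro z hz
    have : Φ =ᶠ[𝓝 z] fun y => w y + softRamp 1 0 := by
      filter_upwards [Metric.isOpen_ball.mem_nhds (hs hz)] with y hy
      rw [Metric.mem_ball, dist_eq_norm] at hy
      have h4 := hw1 y
      have h5 : ‖y - c‖ ^ 2 ≤ r ^ 2 := pow_le_pow_left₀ (norm_nonneg _) hy.le 2
      have h6 : k * ‖y - c‖ ^ 2 ≤ k * r ^ 2 := mul_le_mul_of_nonneg_left h5 hk0
      have h7 : 0 ≤ w y - ψ y := by
        simp only [hψdef]
        nlinarith [sq_nonneg (‖c‖ + 1), sq_nonneg r]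
      rw [hsplit]
      simp only [hθdef]
      rw [softRamp_of_nonneg one_pos h7]
      ring
    rw [ddc_congr this, ddc_add_const (hw z).contDiffAt_two]
  rw [le_div_iff₀ ht, mul_comm, ← integral_const_mul]
  have hae : ∀ᵐ z ∂volume.restrict s, u z ≠ ⊥ :=
    ae_restrict_of_ae_restrict_of_subset (hsK.trans hKD) hu.ae_finite
  calc ∫ z in s, t * sigmaForm m (ddc w z)
      ≤ ∫ z in s, (M - (u z).toReal) * sigmaForm m (ddc Φ z) := by
        refine setIntegral_mono_on_ae (((hi hw).mono_set hsK).const_mul t)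
          ((hmul hΦ).mono_set hsK) hsm ?_
        filter_upwards [(ae_restrict_iff' hsm).1 hae] with z hz hzs
        rw [hΦw z hzs]
        refine mul_le_mul_of_nonneg_right ?_ ((hw z).2.2 m le_rfl)
        have h4 := hst z hzs
        rw [← EReal.coe_toReal (hu.lt_top z (hKD (hsK hzs))).ne (hz hzs),
          EReal.coe_lt_coe_iff] at h4
        linarith
    _ ≤ ∫ z in K, (M - (u z).toReal) * sigmaForm m (ddc Φ z) :=
        setIntegral_mono_set (hmul hΦ) ((ae_restrict_mem hK.measurableSet).mono fun z hz =>
          mul_nonneg (sub_nonneg.2 (hM z hz)) ((hΦ z).2.2 m le_rfl)) (ae_of_all _ hsK)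
    _ ≤ _ := h3

end Estimates

/-! ### Envelopes that leave the quadratic on a small set -/

section Obstacle

variable {n m : ℕ}

theorem envelope_mono {f g v : Cn n → ℝ} (hv : Admissible m f v) (h : ∀ z, f z ≤ g z) (z : Cn n) :
    envelope m f z ≤ envelope m g z :=
  envelope_le hv fun _ hw => Admissible.le_envelope ⟨hw.1, fun y => (hw.2 y).trans (h y)⟩

/-- The obstacle `δ ‖·‖² - χ`. -/
noncomputable def obstacle (δ : ℝ) (χ : Cn n → ℝ) (z : Cn n) : ℝ := δ * ‖z‖ ^ 2 - χ z

variable {δ : ℝ} {χ : Cn n → ℝ}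

theorem admissible_obstacle (hmn : m ≤ n) (hδ : 0 ≤ δ) (hχ1 : ∀ z, χ z ≤ 1) :
    Admissible m (obstacle δ χ) fun z => δ * ‖z‖ ^ 2 + -1 :=
  ⟨fun z => (mshAt_const_mul_norm_sq hmn hδ z).add_const _, fun z => by
    rw [obstacle]; linarith [hχ1 z]⟩

theorem envelope_obstacle_le (hmn : m ≤ n) (hδ : 0 ≤ δ) (hχ1 : ∀ z, χ z ≤ 1) (z : Cn n) :
    envelope m (obstacle δ χ) z ≤ δ * ‖z‖ ^ 2 - χ z :=
  envelope_le (admissible_obstacle hmn hδ hχ1) fun _ hw => hw.2 z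

theorem le_envelope_obstacle (hmn : m ≤ n) (hδ : 0 ≤ δ) (hχ1 : ∀ z, χ z ≤ 1) (z : Cn n) :
    δ * ‖z‖ ^ 2 - 1 ≤ envelope m (obstacle δ χ) z := by
  rw [sub_eq_add_neg]
  exact (admissible_obstacle hmn hδ hχ1).le_envelope

theorem exists_semiConcave_envelope (hmn : m ≤ n) (hδ : 0 ≤ δ) (hχ : ContDiff ℝ ∞ χ)
    (hχc : HasCompactSupport χ) (hχ1 : ∀ z, χ z ≤ 1) :
    ∃ C, 0 ≤ C ∧ SemiConcave C (envelope m (obstacle δ χ)) := by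
  obtain ⟨C, hC0, hC⟩ := exists_semiConcave_of_contDiff (χ := fun z => -χ z) hχ.neg
    (hχc.comp_left (g := fun x : ℝ => -x) (by simp))
  refine ⟨δ + C, by positivity, envelope_semiConcave hmn (admissible_obstacle hmn hδ hχ1)
    fun z h a b ha hb hab => ?_⟩
  have := (semiConcave_norm_sq δ).add hC z h a b ha hb hab
  simpa only [obstacle, ← sub_eq_add_neg] using this

theorem envelope_obstacle_lua (hmn : m ≤ n) (hδ : 0 ≤ δ) (hχ : ContDiff ℝ ∞ χ)
    (hχc : HasCompactSupport χ) (hχ1 : ∀ z, χ z ≤ 1) : LUA m (envelope m (obstacle δ χ)) := by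
  obtain ⟨C, -, hC⟩ := exists_semiConcave_envelope hmn hδ hχ hχc hχ1
  exact envelope_lua hmn (admissible_obstacle hmn hδ hχ1) hC.continuous

theorem abs_sigmaForm_le {H : Cn n →L[ℝ] Cn n →L[ℝ] ℝ} {M : ℝ} (hM0 : 0 ≤ M)
    (hM : ∀ a b, |H a b| ≤ M * ‖a‖ * ‖b‖) (k : ℕ) :
    |sigmaForm k (leviMatrix H)| ≤ n.factorial * n.factorial * (M + 1) ^ n := by
  have h1 := norm_wedgeCoeff_le (A := fun l : Fin n => if (l : ℕ) < k then leviMatrix H else 1)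
    (R := fun _ => M + 1) fun l i j => by
      have h2 := norm_leviMatrix_le hM i j
      by_cases hl : (l : ℕ) < k
      · simp only [if_pos hl]; linarith
      · simp only [if_neg hl, Matrix.one_apply]
        split_ifs <;> simp <;> linarith
  rw [Finset.prod_const, Finset.card_univ, Fintype.card_fin] at h1
  exact (Complex.abs_re_le_norm _).trans h1

theorem exists_moll_mul_norm_sq (δ : ℝ) {ε : ℝ} (hε : 0 < ε) :
    ∃ c', moll ε (fun z : Cn n => δ * ‖z‖ ^ 2) = fun z => δ * ‖z‖ ^ 2 + c' := by
  have h := moll_quadratic hε (E := Cn n) (H := (2 * δ) • innerSL ℝ)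
    (fun a b => by
      change 2 * δ * inner ℝ a b = 2 * δ * inner ℝ b a
      rw [real_inner_comm]) 0 0
  have e : ∀ (c' : ℝ) (z : Cn n), 1 / 2 * ((2 * δ) • innerSL ℝ (E := Cn n)) z z +
      (0 : Cn n →L[ℝ] ℝ) z + c' = δ * ‖z‖ ^ 2 + c' := fun c' z => by
    change 1 / 2 * (2 * δ * inner ℝ z z) + 0 + c' = _
    rw [real_inner_self_eq_norm_sq]
    ring
  obtain ⟨c', hc'⟩ := h
  refine ⟨c', ?_⟩
  simp only [e] at hc'
  simpa using hc'

theorem envelope_obstacle_eq_of_far (hδ : 0 < δ) (hδ1 : δ ≤ 1) (hχ0 : ∀ z, 0 ≤ χ z)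
    (hχ1 : ∀ z, χ z ≤ 1) {s : Set (Cn n)} {c : Cn n} {r : ℝ} (hs : s ⊆ Metric.ball c r)
    (hχs : ∀ z ∉ s, χ z = 0) {z : Cn n} (hz : r + 1 / δ ≤ dist z c) :
    envelope m (obstacle δ χ) z = δ * ‖z‖ ^ 2 := by
  refine envelope_eq_of_far hδ hχ0 hχ1 fun y hy => ?_
  have hyr : dist y c < r := hs (by_contra fun h => hy (hχs y h))
  have h1 := dist_triangle z y c
  rw [dist_comm z y, dist_eq_norm y z] at h1
  have h2 : 1 / δ ≤ ‖y - z‖ := by linarith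
  rw [div_le_iff₀ hδ] at h2
  nlinarith [norm_nonneg (y - z)]

/-- The set where the envelope leaves `δ ‖·‖²` is small when Hessian measures charge little the set
where the obstacle does: outside the latter, the Hessian measure of the envelope vanishes on this
set and is at most that of `δ ‖·‖²` elsewhere, while both have the same total mass. -/
theorem measure_envelope_lt_le (hm : 1 ≤ m) (hmn : m ≤ n) (hδ : 0 < δ) (hδ1 : δ ≤ 1)
    (hχ : ContDiff ℝ ∞ χ) (hχc : HasCompactSupport χ) (hχ0 : ∀ z, 0 ≤ χ z) (hχ1 : ∀ z, χ z ≤ 1)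
    {s : Set (Cn n)} (hsm : MeasurableSet s) {c : Cn n} {r : ℝ} (hs : s ⊆ Metric.ball c r)
    (hχs : ∀ z ∉ s, χ z = 0) {B : ℝ} (hB : ∀ w : Cn n → ℝ, (∀ z, MSHAt m w z) → (∀ z, -1 ≤ w z) →
      (∀ z, w z ≤ (‖z‖ + 1) ^ 2) → ∫ z in s, sigmaForm m (ddc w z) ≤ B) :
    n.factorial * δ ^ m * volume.real {z | envelope m (obstacle δ χ) z < δ * ‖z‖ ^ 2} ≤ B := by
  set φ := envelope m (obstacle δ χ) with hφdef
  set N := {z | φ z < δ * ‖z‖ ^ 2} with hNdef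
  have hadm := admissible_obstacle (χ := χ) hmn hδ.le hχ1
  obtain ⟨C, hC0, hC⟩ := exists_semiConcave_envelope hmn hδ.le hχ hχc hχ1
  have hlua : LUA m φ := envelope_obstacle_lua hmn hδ.le hχ hχc hχ1
  have hcont := hlua.cont
  have hup : ∀ z, φ z ≤ δ * ‖z‖ ^ 2 := fun z =>
    (envelope_obstacle_le hmn hδ.le hχ1 z).trans (by linarith [hχ0 z])
  have hlow : ∀ z, δ * ‖z‖ ^ 2 - 1 ≤ φ z := le_envelope_obstacle hmn hδ.le hχ1
  obtain ⟨hd, hae⟩ := hlua.ae_second_order hm hmn hC0 hC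
  obtain ⟨M, hM0, hM⟩ := hlua.exists_moll_bound hm hmn hC0 hC
  have hf0c : Continuous fun z : Cn n => δ * ‖z‖ ^ 2 := by fun_prop
  have hNo : IsOpen N := isOpen_lt hcont hf0c
  -- the envelope agrees with `δ ‖·‖²` outside a ball of radius `R₀`
  set R₀ := r + 1 / δ with hR₀
  have hfar : ∀ z, R₀ ≤ dist z c → φ z = δ * ‖z‖ ^ 2 := fun z hz =>
    envelope_obstacle_eq_of_far hδ hδ1 hχ0 hχ1 hs hχs hz
  set K := Metric.closedBall c (R₀ + 1) with hKdef
  have hK : IsCompact K := isCompact_closedBall c _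
  have hNK : N ⊆ K := by
    intro z hz
    by_contra h
    rw [hKdef, Metric.mem_closedBall, not_le] at h
    exact absurd (hfar z (by linarith)) (ne_of_lt hz)
  have hr1 : 0 < 1 / δ := by positivity
  have hsK : s ⊆ K := hs.trans (Metric.ball_subset_closedBall.trans
    (Metric.closedBall_subset_closedBall (by linarith)))
  set κ : ℝ := n.factorial * δ ^ m with hκ
  have hκ0 : 0 ≤ κ := by positivity
  -- total mass of the mollified envelope
  have hmass : ∀ ε, 0 < ε → ε < 1 → ∫ z in K, sigmaForm m (ddc (moll ε φ) z) = κ * volume.real K := by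
    intro ε hε hε1
    obtain ⟨c', hc'⟩ := exists_moll_mul_norm_sq (n := n) δ hε
    set Φ := moll ε (fun z : Cn n => δ * ‖z‖ ^ 2) with hΦdef
    have hΦ : ∀ z, MSHAt m Φ z := fun z => by
      rw [hc']; exact (mshAt_const_mul_norm_sq hmn hδ.le z).add_const c'
    have hθ0 : ∀ z, 0 ≤ Φ z - moll ε φ z := fun z => sub_nonneg.2
      (moll_mono hε hcont.locallyIntegrable hf0c.locallyIntegrable (ae_of_all _ fun y _ => hup y))
    have hθK : tsupport (fun z => Φ z - moll ε φ z) ⊆ K := by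
      refine closure_minimal (fun z hz => ?_) hK.isClosed
      by_contra h
      rw [hKdef, Metric.mem_closedBall, not_le] at h
      refine hz (sub_eq_zero.2 ?_)
      have hy : ∀ y ∈ Metric.closedBall z ε, φ y = δ * ‖y‖ ^ 2 := fun y hy => hfar y (by
        have h1 := dist_triangle z y c
        rw [Metric.mem_closedBall, dist_comm] at hy
        linarith)
      exact le_antisymm
        (moll_mono hε hf0c.locallyIntegrable hcont.locallyIntegrable
          (ae_of_all _ fun y h => (hy y h).ge))
        (moll_mono hε hcont.locallyIntegrable hf0c.locallyIntegrable
          (ae_of_all _ fun y h => (hy y h).le))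
    rw [← integral_sigmaForm_eq hm hmn hΦ (hlua.moll_mshAt hm hmn hε)
      (HasCompactSupport.of_support_subset_isCompact hK ((subset_tsupport _).trans hθK)) hθ0
      (fun z => by ring) hK hθK]
    have : ∀ z, sigmaForm m (ddc Φ z) = κ := fun z => by
      rw [hc', ddc_add_const (mshAt_const_mul_norm_sq (m := m) hmn hδ.le z).contDiffAt_two,
        ddc_const_mul_norm_sq, sigmaForm_smul hmn, sigmaForm_one, hκ, mul_comm]
    simp only [this, setIntegral_const, smul_eq_mul, mul_comm]
  have hints : ∀ ε, 0 < ε → IntegrableOn (fun z => sigmaForm m (ddc (moll ε φ) z)) K := fun ε hε =>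
    (continuous_sigmaForm_ddc (hlua.moll_mshAt hm hmn hε) m).continuousOn.integrableOn_compact hK
  have hpart : ∀ ε, 0 < ε → ε < 1 →
      κ * volume.real K - B ≤ ∫ z in K \ s, sigmaForm m (ddc (moll ε φ) z) := by
    intro ε hε hε1
    have hc1 : ∀ z : Cn n, ∀ y ∈ Metric.closedBall z ε, φ y ≤ (‖z‖ + 1) ^ 2 := fun z y hy => by
      rw [Metric.mem_closedBall, dist_eq_norm] at hy
      have h1 : ‖y‖ ≤ ‖z‖ + 1 := by
        have := norm_add_le (y - z) z
        rw [sub_add_cancel] at this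
        linarith
      have h2 : ‖y‖ ^ 2 ≤ (‖z‖ + 1) ^ 2 := pow_le_pow_left₀ (norm_nonneg _) h1 2
      nlinarith [hup y, sq_nonneg ‖y‖]
    have h1 := hB (moll ε φ) (hlua.moll_mshAt hm hmn hε)
      (fun z => le_moll hε hcont.locallyIntegrable (ae_of_all _ fun y _ => by
        have := hlow y
        have : 0 ≤ δ * ‖y‖ ^ 2 := by positivity
        linarith))
      (fun z => moll_le hε hcont.locallyIntegrable (ae_of_all _ (hc1 z)))
    have h2 := setIntegral_sdiff hsm (hints ε hε) hsK
    rw [hmass ε hε hε1] at h2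
    linarith
  -- pass to the limit
  set ε : ℕ → ℝ := fun k => 1 / ((k : ℝ) + 2) with hεdef
  have hε0 : ∀ k, 0 < ε k := fun k => by positivity
  have hε1 : ∀ k, ε k < 1 := fun k => by
    rw [hεdef, div_lt_one (by positivity)]
    have : (0 : ℝ) ≤ k := Nat.cast_nonneg k
    linarith
  have hεlim : Tendsto ε atTop (𝓝[>] 0) := by
    refine tendsto_nhdsWithin_iff.2 ⟨?_, Eventually.of_forall hε0⟩
    exact tendsto_const_nhds.div_atTop
      (tendsto_atTop_add_const_right _ _ tendsto_natCast_atTop_atTop)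
  have hKs : MeasurableSet (K \ s) := hK.measurableSet.diff hsm
  have hlim : Tendsto (fun k => ∫ z in K \ s, sigmaForm m (ddc (moll (ε k) φ) z)) atTop
      (𝓝 (∫ z in K \ s, sigmaForm m (ddc φ z))) := by
    refine tendsto_integral_of_dominated_convergence
      (fun _ => n.factorial * n.factorial * (M + 1) ^ n) (fun k => ?_) ?_ (fun k => ?_) ?_
    · exact (continuous_sigmaForm_ddc (hlua.moll_mshAt hm hmn (hε0 k)) m).aestronglyMeasurable
    · exact (integrableOn_const hK.measure_lt_top.ne).mono_set Set.sdiff_subset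
    · refine ae_of_all _ fun z => ?_
      rw [Real.norm_eq_abs, ddc_eq]
      exact abs_sigmaForm_le hM0 (hM (ε k) (hε0 k) z) m
    · refine ae_restrict_of_ae (hae.mono fun z hz => ?_)
      exact ((continuous_sigmaForm m).tendsto _).comp (hz.2.2.comp hεlim)
  have hge : κ * volume.real K - B ≤ ∫ z in K \ s, sigmaForm m (ddc φ z) :=
    ge_of_tendsto' hlim fun k => hpart (ε k) (hε0 k) (hε1 k)
  have hpt : ∀ᵐ z, z ∈ K \ s → sigmaForm m (ddc φ z) ≤ (Nᶜ).indicator (fun _ => κ) z := by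
    filter_upwards [hae] with z hz hzs
    by_cases hzN : z ∈ N
    · rw [Set.indicator_of_notMem (by simpa using hzN)]
      refine (sigmaForm_ddc_envelope_eq_zero hmn hadm ?_ hcont hd hz.1 hz.2.1 ?_).le
      · exact hf0c.sub hχ.continuous
      · rw [obstacle, hχs z hzs.2, sub_zero]
        exact hzN
    · rw [Set.indicator_of_mem (by simpa using hzN)]
      exact sigmaForm_ddc_le_of_contact hmn hup hd hz.1 hz.2.1
        (le_antisymm (hup z) (not_lt.1 hzN))
  have hle : ∫ z in K \ s, sigmaForm m (ddc φ z) ≤ κ * volume.real (K \ N) := by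
    have hi1 : IntegrableOn ((Nᶜ).indicator fun _ => κ) K :=
      (integrableOn_const hK.measure_lt_top.ne).indicator hNo.measurableSet.compl
    calc ∫ z in K \ s, sigmaForm m (ddc φ z)
        ≤ ∫ z in K \ s, (Nᶜ).indicator (fun _ => κ) z := by
          by_cases hi : IntegrableOn (fun z => sigmaForm m (ddc φ z)) (K \ s)
          · exact setIntegral_mono_on_ae hi (hi1.mono_set Set.sdiff_subset) hKs hpt
          · rw [integral_undef hi]
            exact setIntegral_nonneg hKs fun z _ => Set.indicator_nonneg (fun _ _ => hκ0) z
      _ ≤ ∫ z in K, (Nᶜ).indicator (fun _ => κ) z :=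
          setIntegral_mono_set hi1 (ae_of_all _ fun z => Set.indicator_nonneg (fun _ _ => hκ0) z)
            (ae_of_all _ Set.sdiff_subset)
      _ = κ * volume.real (K \ N) := by
          rw [setIntegral_indicator hNo.measurableSet.compl, setIntegral_const, smul_eq_mul,
            mul_comm, Set.sdiff_eq]
  have hvol : volume.real (K \ N) + volume.real N = volume.real K := by
    have := measureReal_sdiff_add_inter (μ := volume) (s := K) (t := N) hNo.measurableSet
      (h := hK.measure_lt_top.ne)
    rwa [Set.inter_eq_self_of_subset_right hNK] at this
  rw [← hvol] at hge
  nlinarith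

theorem isOpen_sublevel {D O : Set (Cn n)} {u : Cn n → EReal} (hO : IsOpen O) (hOD : O ⊆ D)
    (hu : UpperSemicontinuousOn u D) (a : EReal) : IsOpen {z | z ∈ O ∧ u z < a} := by
  refine isOpen_iff_mem_nhds.2 fun z hz => ?_
  have h1 := (hu.mono hOD) z hz.1 a hz.2
  rw [hO.nhdsWithin_eq hz.1] at h1
  filter_upwards [h1, hO.mem_nhds hz.1] with y h1 h2 using ⟨h2, h1⟩

/-- A decreasing sequence of envelopes, of small total defect, which eventually drops by one where
`u = -∞`. The obstacles are `δ ‖·‖² - χ j`, where the cutoff functions `χ j` exhaust an open set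
`{u < -t}`; the estimate of the defect does not depend on `j`. -/
theorem IsMSubharmonicOn.exists_envelope_seq (hm : 1 ≤ m) (hmn : m ≤ n) {c : Cn n} {r : ℝ}
    (hr : 0 < r) {u : Cn n → EReal} (hu : IsMSubharmonicOn m (Metric.ball c (4 * r)) u)
    (hδ : 0 < δ) (hδ1 : δ ≤ 1) {η : ℝ} (hη : 0 < η) : ∃ φ : ℕ → Cn n → ℝ,
      (∀ j, LUA m (φ j)) ∧ (∀ z, Antitone fun j => φ j z) ∧ (∀ j z, φ j z ≤ δ * ‖z‖ ^ 2) ∧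
      (∀ j, Integrable fun z => δ * ‖z‖ ^ 2 - φ j z) ∧
      (∀ j, ∫ z, (δ * ‖z‖ ^ 2 - φ j z) ≤ η) ∧
      ∀ z ∈ Metric.ball c r, u z = ⊥ → ∃ J, ∀ j ≥ J, φ j z ≤ δ * ‖z‖ ^ 2 - 1 := by
  obtain ⟨C, hC0, hC⟩ := hu.exists_hessian_bound hm hmn hr
  set κ : ℝ := n.factorial * δ ^ m with hκ
  have hκ0 : 0 < κ := by positivity
  -- the level `t` makes the bound `C / t` for the Hessian mass at most `κ η`
  set t : ℝ := C / (κ * η) + 1 with ht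
  have ht0 : 0 < t := by positivity
  set U : Set (Cn n) := {z | z ∈ Metric.ball c r ∧ u z < ((-t : ℝ) : EReal)} with hU
  have hUo : IsOpen U := isOpen_sublevel Metric.isOpen_ball (Metric.ball_subset_ball (by linarith))
    hu.usc _
  have hUb : U ⊆ Metric.ball c r := fun z hz => hz.1
  obtain ⟨g, hgs, hg, hg01⟩ := hUo.exists_contDiff_support_eq (n := ⊤)
  have hg0 : ∀ z, 0 ≤ g z := fun z => (hg01 ⟨z, rfl⟩).1
  set χ : ℕ → Cn n → ℝ := fun j z => Real.smoothTransition (j * g z - 1) with hχ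
  have hχs : ∀ j, ContDiff ℝ ∞ (χ j) := fun j =>
    Real.smoothTransition.contDiff.comp ((contDiff_const.mul hg).sub contDiff_const)
  have hχ0 : ∀ j z, 0 ≤ χ j z := fun j z => Real.smoothTransition.nonneg _
  have hχ1 : ∀ j z, χ j z ≤ 1 := fun j z => Real.smoothTransition.le_one _
  have hχU : ∀ j, ∀ z ∉ U, χ j z = 0 := by
    intro j z hz
    have : g z = 0 := by
      rw [← hgs] at hz
      simpa using hz
    simp only [hχ, this]
    exact Real.smoothTransition.zero_of_nonpos (by norm_num)
  have hχc : ∀ j, HasCompactSupport (χ j) := fun j =>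
    HasCompactSupport.of_support_subset_isCompact (isCompact_closedBall c r) fun z hz =>
      Metric.ball_subset_closedBall (hUb (by_contra fun h => hz (hχU j z h)))
  have hχm : ∀ z, Monotone fun j => χ j z := fun z i j hij =>
    Real.smoothTransition.monotone (by
      have : (i : ℝ) ≤ j := Nat.cast_le.2 hij
      nlinarith [hg0 z])
  have hup : ∀ j z, envelope m (obstacle δ (χ j)) z ≤ δ * ‖z‖ ^ 2 := fun j z =>
    (envelope_obstacle_le hmn hδ.le (hχ1 j) z).trans (by linarith [hχ0 j z])
  have hlua : ∀ j, LUA m (envelope m (obstacle δ (χ j))) := fun j =>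
    envelope_obstacle_lua hmn hδ.le (hχs j) (hχc j) (hχ1 j)
  have hbound : ∀ j, κ * volume.real {z | envelope m (obstacle δ (χ j)) z < δ * ‖z‖ ^ 2} ≤ C / t :=
    fun j => measure_envelope_lt_le hm hmn hδ hδ1 (hχs j) (hχc j) (hχ0 j) (hχ1 j) hUo.measurableSet
      hUb (hχU j) fun w h1 h2 h3 => hC w h1 h2 h3 t ht0 U hUb hUo.measurableSet fun z hz => hz.2
  have hfar : ∀ j z, z ∉ Metric.closedBall c (r + 1 / δ) →
      envelope m (obstacle δ (χ j)) z = δ * ‖z‖ ^ 2 := fun j z hz =>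
    envelope_obstacle_eq_of_far hδ hδ1 (hχ0 j) (hχ1 j) hUb (hχU j) (not_le.1 hz).le
  have hint : ∀ j, Integrable fun z => δ * ‖z‖ ^ 2 - envelope m (obstacle δ (χ j)) z := by
    intro j
    have hc : Continuous fun z => δ * ‖z‖ ^ 2 - envelope m (obstacle δ (χ j)) z :=
      Continuous.sub (by fun_prop) (hlua j).cont
    refine hc.integrable_of_hasCompactSupport
      (HasCompactSupport.of_support_subset_isCompact (isCompact_closedBall c (r + 1 / δ)) ?_)
    exact fun z hz => by_contra fun h => hz (sub_eq_zero.2 (hfar j z h).symm)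
  refine ⟨fun j => envelope m (obstacle δ (χ j)), hlua, fun z i j hij => ?_, hup, hint, fun j => ?_,
    fun z hz hzu => ?_⟩
  · refine envelope_mono (admissible_obstacle hmn hδ.le (hχ1 j)) (fun y => ?_) z
    exact sub_le_sub_left (hχm y hij) _
  · set N := {z | envelope m (obstacle δ (χ j)) z < δ * ‖z‖ ^ 2} with hN
    have hNm : MeasurableSet N := (isOpen_lt (hlua j).cont (by fun_prop)).measurableSet
    have hNf : volume N ≠ ⊤ := by
      refine ne_top_of_le_ne_top (isCompact_closedBall c (r + 1 / δ)).measure_lt_top.ne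
        (measure_mono fun z hz => ?_)
      exact by_contra fun h => absurd (hfar j z h) (ne_of_lt hz)
    calc ∫ z, (δ * ‖z‖ ^ 2 - envelope m (obstacle δ (χ j)) z) ≤ ∫ z, N.indicator (fun _ => 1) z := by
          refine integral_mono (hint j) ((integrableOn_const hNf).integrable_indicator hNm)
            fun z => ?_
          by_cases hz : z ∈ N
          · rw [Set.indicator_of_mem hz]
            linarith [le_envelope_obstacle (m := m) hmn hδ.le (hχ1 j) z]
          · rw [Set.indicator_of_notMem hz]
            exact sub_nonpos.2 (not_lt.1 hz)
      _ = volume.real N := by rw [integral_indicator hNm]; simp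
      _ ≤ η := by
          have h1 : C / t ≤ κ * η := by
            rw [div_le_iff₀ ht0, ht, mul_add, mul_one, mul_div_cancel₀ _ (by positivity)]
            linarith [mul_pos hκ0 hη]
          exact le_of_mul_le_mul_left ((hbound j).trans h1) hκ0
  · have hzU : z ∈ U := ⟨hz, by rw [hzu]; exact EReal.bot_lt_coe _⟩
    have hgz : 0 < g z := lt_of_le_of_ne (hg0 z) (by
      rw [← hgs] at hzU; exact (Function.mem_support.1 hzU).symm)
    obtain ⟨J, hJ⟩ := exists_nat_ge (2 / g z)
    refine ⟨J, fun j hj => (envelope_obstacle_le hmn hδ.le (hχ1 j) z).trans ?_⟩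
    have h1 : (2 : ℝ) ≤ j * g z := by
      rw [← div_le_iff₀ hgz]
      exact hJ.trans (Nat.cast_le.2 hj)
    have h2 : χ j z = 1 := Real.smoothTransition.one_of_one_le (by linarith)
    rw [h2]

end Obstacle

/-! ### Assembling the potential -/

section Assembly

variable {n m : ℕ} {D E : Set (Cn n)}

theorem sum_half_pow_add (K : ℕ) :
    ∑ k ∈ Finset.range K, (1 / 2 : ℝ) ^ (k + 1) + (1 / 2) ^ K = 1 := by
  induction K with
  | zero => simp
  | succ K ih =>
    rw [Finset.sum_range_succ]
    linarith [pow_succ (1 / 2 : ℝ) K]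

/-- A set that is `m`-polar in small balls is contained in the `-∞` set of the limit of a
decreasing sequence of locally uniform limits of smooth `m`-subharmonic functions on the whole
space. The `k`-th envelope lies below `2^(-k-1) ‖·‖²`, with defect of integral at most `2^(-k-1)`;
replacing more and more terms of `‖·‖² = ∑ 2^(-k-1) ‖·‖²` by the envelopes gives the sequence. -/
theorem exists_potential (hm : 1 ≤ m) (hmn : m ≤ n) (hD : IsOpen D) (hDne : D.Nonempty) (hED : E ⊆ D)
    (hE : ∀ G : Set (Cn n), IsDomainSet G → IsCompact (closure G) → closure G ⊆ D →
      IsMPolarIn m (E ∩ G) G) :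
    ∃ V : ℕ → Cn n → ℝ, (∀ N, LUA m (V N)) ∧ (∀ z, Antitone fun N => V N z) ∧
      (∀ N, Integrable fun z => V 0 z - V N z) ∧ (∀ N, ∫ z, (V 0 z - V N z) ≤ 1) ∧
      ∀ z ∈ E, ∀ M : ℝ, ∃ N, V N z ≤ M := by
  -- countably many balls covering `D`
  obtain ⟨c, r, hr, hcl, hcov⟩ : ∃ (c : ℕ → Cn n) (r : ℕ → ℝ), (∀ i, 0 < r i) ∧
      (∀ i, Metric.closedBall (c i) (4 * r i) ⊆ D) ∧ D ⊆ ⋃ i, Metric.ball (c i) (r i) := by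
    have h1 : ∀ z ∈ D, ∃ r, 0 < r ∧ Metric.closedBall z (4 * r) ⊆ D := by
      intro z hz
      obtain ⟨R, hR, hRD⟩ := Metric.nhds_basis_closedBall.mem_iff.1 (hD.mem_nhds hz)
      exact ⟨R / 4, by positivity, by rwa [mul_div_cancel₀ _ (by norm_num)]⟩
    choose! ρ hρ hρD using h1
    obtain ⟨t, htD, htc, htcov⟩ := TopologicalSpace.countable_cover_nhdsWithin
      (f := fun z => Metric.ball z (ρ z)) (s := D)
      fun z hz => mem_nhdsWithin_of_mem_nhds (Metric.ball_mem_nhds z (hρ z hz))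
    have htne : t.Nonempty := by
      obtain ⟨z, hz⟩ := hDne
      obtain ⟨i, hi, -⟩ := Set.mem_iUnion₂.1 (htcov hz)
      exact ⟨i, hi⟩
    obtain ⟨c, rfl⟩ := htc.exists_eq_range htne
    refine ⟨c, fun i => ρ (c i), fun i => hρ _ (htD ⟨i, rfl⟩), fun i => hρD _ (htD ⟨i, rfl⟩), ?_⟩
    simpa using htcov
  have hpol : ∀ i, ∃ u, IsMSubharmonicOn m (Metric.ball (c i) (4 * r i)) u ∧
      ∀ z ∈ E ∩ Metric.ball (c i) (4 * r i), u z = ⊥ := by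
    intro i
    have hri : 0 < 4 * r i := by linarith [hr i]
    obtain ⟨-, u, hu, -, hub⟩ := hE (Metric.ball (c i) (4 * r i))
      ⟨Metric.isOpen_ball, Metric.nonempty_ball.2 hri, (convex_ball _ _).isPreconnected⟩
      ((isCompact_closedBall _ _).of_isClosed_subset isClosed_closure
        Metric.closure_ball_subset_closedBall) (Metric.closure_ball_subset_closedBall.trans (hcl i))
    exact ⟨u, hu, hub⟩
  choose u hu hub using hpol
  -- the `k`-th term treats the ball with index `k.unpair.1`, so each ball occurs infinitely often
  choose φ hlua hanti hup hint hη hdrop using fun k : ℕ =>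
    (hu k.unpair.1).exists_envelope_seq hm hmn (hr k.unpair.1) (δ := (1 / 2) ^ (k + 1))
      (by positivity) (pow_le_one₀ (by norm_num) (by norm_num)) (η := (1 / 2) ^ (k + 1))
      (by positivity)
  set V : ℕ → Cn n → ℝ := fun N z =>
    ∑ k ∈ Finset.range N, φ k N z + (1 / 2) ^ N * ‖z‖ ^ 2 with hV
  have hdiff : ∀ N z, V 0 z - V N z =
      ∑ k ∈ Finset.range N, ((1 / 2) ^ (k + 1) * ‖z‖ ^ 2 - φ k N z) := by
    intro N z
    have h1 := sum_half_pow_add N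
    simp only [hV, Finset.range_zero, Finset.sum_empty, pow_zero, one_mul, zero_add,
      Finset.sum_sub_distrib, ← Finset.sum_mul]
    rw [eq_sub_of_add_eq h1]
    ring
  refine ⟨V, fun N => ?_, fun z => ?_, fun N => ?_, fun N => ?_, fun z hz M => ?_⟩
  · exact (LUA.sum _ fun k _ => hlua k N).add
      (LUA.of_mshAt fun z => mshAt_const_mul_norm_sq hmn (by positivity) z)
  · refine antitone_nat_of_succ_le fun N => ?_
    simp only [hV]
    rw [Finset.sum_range_succ]
    have h1 : ∑ k ∈ Finset.range N, φ k (N + 1) z ≤ ∑ k ∈ Finset.range N, φ k N z :=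
      Finset.sum_le_sum fun k _ => hanti k z (Nat.le_succ N)
    have h2 := hup N (N + 1) z
    have h3 : (1 / 2 : ℝ) ^ N * ‖z‖ ^ 2 = 2 * ((1 / 2) ^ (N + 1) * ‖z‖ ^ 2) := by ring
    linarith
  · simp only [hdiff]
    exact integrable_finsetSum _ fun k _ => hint k N
  · simp only [hdiff]
    rw [integral_finsetSum _ fun k _ => hint k N]
    have h1 := sum_half_pow_add N
    have h2 : (0 : ℝ) ≤ (1 / 2) ^ N := by positivity
    have h3 := Finset.sum_le_sum fun k (_ : k ∈ Finset.range N) => hη k N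
    linarith
  · obtain ⟨i, hi⟩ := Set.mem_iUnion.1 (hcov (hED hz))
    have hbot : u i z = ⊥ := hub i z ⟨hz, Metric.ball_subset_ball (by linarith [hr i]) hi⟩
    have hd : ∀ j, ∃ J, ∀ N ≥ J, φ (Nat.pair i j) N z ≤
        (1 / 2) ^ (Nat.pair i j + 1) * ‖z‖ ^ 2 - 1 := fun j =>
      hdrop (Nat.pair i j) z (by simpa using hi) (by simpa using hbot)
    choose J hJ using hd
    obtain ⟨p, hp⟩ := exists_nat_ge (V 0 z - M)
    set S := (Finset.range p).image (Nat.pair i) with hS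
    obtain ⟨N, hN1, hN2⟩ : ∃ N, (∀ j ∈ Finset.range p, J j ≤ N) ∧ S ⊆ Finset.range N := by
      refine ⟨(Finset.range p).sup J + S.sup fun k => k + 1, fun j hj =>
        le_add_right (Finset.le_sup hj), fun k hk => Finset.mem_range.2 ?_⟩
      have := Finset.le_sup (f := fun k => k + 1) hk
      omega
    refine ⟨N, ?_⟩
    have h1 : (p : ℝ) ≤ V 0 z - V N z := by
      rw [hdiff]
      calc (p : ℝ) = ∑ k ∈ S, (1 : ℝ) := by
            rw [Finset.sum_const, nsmul_eq_mul, mul_one, hS, Finset.card_image_of_injective,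
              Finset.card_range]
            exact fun a b h => (Nat.pair_eq_pair.1 h).2
        _ ≤ ∑ k ∈ S, ((1 / 2) ^ (k + 1) * ‖z‖ ^ 2 - φ k N z) := by
            refine Finset.sum_le_sum fun k hk => ?_
            obtain ⟨j, hj, rfl⟩ := Finset.mem_image.1 hk
            linarith [hJ j N (hN1 j hj)]
        _ ≤ _ := Finset.sum_le_sum_of_subset_of_nonneg hN2 fun k _ _ => sub_nonneg.2 (hup k N z)
    linarith

theorem IsMSubharmonicOn.exists_ne_bot {u : Cn n → EReal} (hu : IsMSubharmonicOn m D u)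
    (hD : IsOpen D) (hDne : D.Nonempty) : ∃ z ∈ D, u z ≠ ⊥ := by
  by_contra! h
  have h1 : ∀ᵐ z ∂volume.restrict D, False := by
    filter_upwards [hu.ae_finite, ae_restrict_mem hD.measurableSet] with z h2 h3 using h2 (h z h3)
  rw [eventually_false_iff_eq_bot, ae_eq_bot, Measure.restrict_eq_zero] at h1
  exact (hD.measure_pos volume hDne).ne' h1

theorem iInf_coe_eq_bot {S : ℕ → ℝ} (h : ∀ M : ℝ, ∃ N, S N ≤ M) : ⨅ N, (S N : EReal) = ⊥ := by
  refine iInf_eq_bot.2 fun b hb => ?_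
  obtain ⟨M, -, hM⟩ := EReal.lt_iff_exists_real_btwn.1 hb
  obtain ⟨N, hN⟩ := h M
  exact ⟨N, lt_of_le_of_lt (EReal.coe_le_coe_iff.2 hN) hM⟩

theorem IsMSubharmonicOn.exists_neg_bound {ρ : Cn n → EReal} (hρ : IsMSubharmonicOn m D ρ)
    (hneg : ∀ z ∈ D, ρ z < 0) {K : Set (Cn n)} (hK : IsCompact K) (hKD : K ⊆ D) :
    ∃ α : ℝ, 0 < α ∧ ∀ z ∈ K, ρ z ≤ ((-α : ℝ) : EReal) := by
  refine hK.induction_on (p := fun S => ∃ α : ℝ, 0 < α ∧ ∀ z ∈ S, ρ z ≤ ((-α : ℝ) : EReal))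
    ⟨1, one_pos, by simp⟩ (fun S T hST ⟨α, h0, h⟩ => ⟨α, h0, fun z hz => h z (hST hz)⟩)
    (fun S T ⟨α, h0, h⟩ ⟨β, h0', h'⟩ => ⟨min α β, lt_min h0 h0', fun z hz => ?_⟩) fun z hz => ?_
  · rcases hz with hz | hz
    · exact (h z hz).trans (EReal.coe_le_coe_iff.2 (neg_le_neg (min_le_left _ _)))
    · exact (h' z hz).trans (EReal.coe_le_coe_iff.2 (neg_le_neg (min_le_right _ _)))
  · obtain ⟨a, h1, h2⟩ := EReal.lt_iff_exists_real_btwn.1 (hneg z (hKD hz))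
    have h3 : a < 0 := by exact_mod_cast h2
    have h4 := (hρ.usc.mono hKD) z hz a h1
    exact ⟨{y | ρ y < a}, h4, -a, neg_pos.2 h3, fun y hy => by rw [neg_neg]; exact le_of_lt hy⟩

/-- Gluing a small multiple of the potential to a negative function `ρ` vanishing at the boundary
gives negative approximable functions that are small in the mean. -/
theorem exists_glued_seq (hm : 1 ≤ m) (hmn : m ≤ n) (hD : IsOpen D) {ρ : Cn n → EReal}
    (hρ : IsMSubharmonicOn m D ρ) (hneg : ∀ z ∈ D, ρ z < 0)
    (hlim : Tendsto (fun z : D => ρ z) (cocompact D) (𝓝 0)) {V : ℕ → Cn n → ℝ}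
    (hV : ∀ N, LUA m (V N)) (hanti : ∀ z, Antitone fun N => V N z)
    (hVint : ∀ N, Integrable fun z => V 0 z - V N z) (hV1 : ∀ N, ∫ z, (V 0 z - V N z) ≤ 1)
    {K : Set (Cn n)} (hK : IsCompact K) (hKD : K ⊆ D) {η : ℝ} (hη : 0 < η) (hη1 : η < 1) :
    ∃ g : ℕ → Cn n → ℝ, (∀ N, RApprox m D (g N)) ∧ (∀ z ∈ D, Antitone fun N => g N z) ∧
      (∀ N, ∀ z ∈ D, g N z < 0) ∧
      (∀ T ⊆ D, IsCompact T → ∀ N, ∫ z in T, -g N z ≤ η * (2 * volume.real T + 1)) ∧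
      ∀ z ∈ K, (∀ M, ∃ N, V N z ≤ M) → ∃ J, ∀ N ≥ J, g N z ≤ -1 := by
  obtain ⟨α, hα, hαK⟩ := hρ.exists_neg_bound hneg hK hKD
  set e := η * α with he
  have he0 : 0 < e := by positivity
  -- `ρ ≥ -e` off the compact set `L'`
  obtain ⟨T, hT, hTρ⟩ : ∃ T : Set D, IsCompact T ∧ ∀ z ∉ T, ((-e : ℝ) : EReal) < ρ z := by
    have h1 : {x : EReal | ((-e : ℝ) : EReal) < x} ∈ 𝓝 (0 : EReal) := by
      refine isOpen_Ioi.mem_nhds ?_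
      have : ((-e : ℝ) : EReal) < ((0 : ℝ) : EReal) := EReal.coe_lt_coe_iff.2 (neg_neg_of_pos he0)
      simpa using this
    obtain ⟨T, hT, hTs⟩ := mem_cocompact.1 (hlim h1)
    exact ⟨T, hT, fun z hz => hTs hz⟩
  set L' : Set (Cn n) := Subtype.val '' T with hL'def
  have hL' : IsCompact L' := hT.image continuous_subtype_val
  have hL'D : L' ⊆ D := by
    rintro _ ⟨z, -, rfl⟩
    exact z.2
  have hρL : ∀ z ∈ D, z ∉ L' → ((-e : ℝ) : EReal) ≤ ρ z := fun z hz hzL =>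
    (hTρ ⟨z, hz⟩ fun h => hzL ⟨⟨z, hz⟩, h, rfl⟩).le
  obtain ⟨L, hL, hLL, hLD⟩ := exists_compact_between hL' hD hL'D
  -- `V N ≤ c` on `L`, and `I` bounds the integral over `L` of `c - V N` for all `N`
  obtain ⟨c, hc⟩ := (hL.exists_bound_of_continuousOn (hV 0).cont.continuousOn)
  have hVc : ∀ N, ∀ z ∈ L, V N z ≤ c := fun N z hz =>
    (hanti z (Nat.zero_le N)).trans ((le_abs_self _).trans (hc z hz))
  have hiV : ∀ N, IntegrableOn (fun z => c - V N z) L := fun N =>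
    (continuous_const.sub (hV N).cont).continuousOn.integrableOn_compact hL
  set I := (∫ z in L, (c - V 0 z)) + 1 with hI
  have hI1 : 1 ≤ I := by
    have := setIntegral_nonneg (μ := volume) hL.measurableSet fun z hz => sub_nonneg.2 (hVc 0 z hz)
    linarith
  have hIN : ∀ N, ∫ z in L, (c - V N z) ≤ I := by
    intro N
    have h1 : ∫ z in L, (V 0 z - V N z) ≤ 1 := (setIntegral_le_integral (hVint N)
      (ae_of_all _ fun z => sub_nonneg.2 (hanti z (Nat.zero_le N)))).trans (hV1 N)
    have h2 : ∫ z in L, (c - V N z) = (∫ z in L, (c - V 0 z)) + ∫ z in L, (V 0 z - V N z) := by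
      rw [← integral_add (hiV 0) (hVint N).integrableOn]
      simp
    linarith
  set k := η * α / I with hk
  have hk0 : 0 < k := by positivity
  set a : ℕ → Cn n → ℝ := fun N z => k * V N z + (-(k * c) - 2 * e) with hadef
  have haV : ∀ N z, a N z = -(k * (c - V N z)) - 2 * e := fun N z => by simp only [hadef]; ring
  have ha : ∀ N, LUA m (a N) := fun N =>
    ((hV N).const_mul hmn hk0.le).add (LUA.of_mshAt fun z => mshAt_const _ z)
  have haL : ∀ N, ∀ z ∈ L, a N z ≤ -(2 * e) := by
    intro N z hz
    rw [haV]
    have := mul_nonneg hk0.le (sub_nonneg.2 (hVc N z hz))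
    linarith
  have hR : ∀ N, RApprox m D (glue L (a N) ρ) := fun N =>
    rApprox_glue hm hmn hD hρ (ha N) hL hL' hLD hLL he0 (haL N) hρL
  have hLL' : L' ⊆ L := hLL.trans interior_subset
  have hbot : ∀ z ∈ D, z ∉ L → ρ z ≠ ⊥ := fun z hz hzL =>
    (lt_of_lt_of_le (EReal.bot_lt_coe _) (hρL z hz fun h => hzL (hLL' h))).ne'
  have hlow : ∀ N, ∀ z ∈ D, -glue L (a N) ρ z ≤ 2 * e + L.indicator (fun z => k * (c - V N z)) z := by
    intro N z hz
    by_cases hzL : z ∈ L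
    · rw [Set.indicator_of_mem hzL]
      have h1 : ((a N z : ℝ) : EReal) ≤ glue L (a N) ρ z := by
        rw [coe_glue_of_mem hzL (hρ.lt_top z hz)]
        exact le_max_left _ _
      have h2 := EReal.coe_le_coe_iff.1 h1
      rw [haV] at h2
      linarith
    · rw [Set.indicator_of_notMem hzL, glue_of_notMem hzL]
      have h1 := hρL z hz fun h => hzL (hLL' h)
      rw [← EReal.coe_toReal (hρ.lt_top z hz).ne (hbot z hz hzL), EReal.coe_le_coe_iff] at h1
      linarith
  have hglue0 : ∀ N, ∀ z ∈ D, glue L (a N) ρ z < 0 := by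
    intro N z hz
    rw [← EReal.coe_lt_coe_iff, EReal.coe_zero]
    by_cases hzL : z ∈ L
    · rw [coe_glue_of_mem hzL (hρ.lt_top z hz)]
      refine max_lt ?_ (hneg z hz)
      exact_mod_cast (haL N z hzL).trans_lt (by linarith)
    · rw [glue_of_notMem hzL, EReal.coe_toReal (hρ.lt_top z hz).ne (hbot z hz hzL)]
      exact hneg z hz
  refine ⟨fun N z => α⁻¹ * glue L (a N) ρ z, fun N => (hR N).const_mul hmn (by positivity),
    fun z hz i j hij => ?_, fun N z hz => mul_neg_of_pos_of_neg (by positivity) (hglue0 N z hz),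
    fun S hSD hS N => ?_, fun z hz hzV => ?_⟩
  · refine mul_le_mul_of_nonneg_left ?_ (by positivity)
    by_cases hzL : z ∈ L
    · rw [← EReal.coe_le_coe_iff, coe_glue_of_mem hzL (hρ.lt_top z hz),
        coe_glue_of_mem hzL (hρ.lt_top z hz)]
      refine max_le_max_right _ (EReal.coe_le_coe_iff.2 ?_)
      exact add_le_add_left (mul_le_mul_of_nonneg_left (hanti z hij) hk0.le) _
    · simp only [glue_of_notMem hzL, le_refl]
  · have hSi : IntegrableOn (glue L (a N) ρ) S := (hR N).locInt.integrableOn_compact_subset hSD hS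
    have hind : Integrable (L.indicator fun z => k * (c - V N z)) :=
      IntegrableOn.integrable_indicator (Integrable.const_mul (hiV N) k) hL.measurableSet
    have hcon : IntegrableOn (fun _ : Cn n => 2 * e) S := integrableOn_const hS.measure_lt_top.ne
    have h1 : ∫ z in S, -glue L (a N) ρ z ≤ 2 * e * volume.real S + k * I := by
      calc ∫ z in S, -glue L (a N) ρ z
          ≤ ∫ z in S, (2 * e + L.indicator (fun z => k * (c - V N z)) z) :=
            setIntegral_mono_on hSi.neg
              (hcon.add hind.integrableOn) hS.measurableSet
              fun z hz => hlow N z (hSD hz)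
        _ = 2 * e * volume.real S + ∫ z in S, L.indicator (fun z => k * (c - V N z)) z := by
            rw [integral_add hcon hind.integrableOn,
              setIntegral_const, smul_eq_mul, mul_comm]
        _ ≤ 2 * e * volume.real S + k * I := by
            refine add_le_add_right ?_ _
            refine (setIntegral_le_integral hind (ae_of_all _ fun z => Set.indicator_nonneg
              (fun y hy => mul_nonneg hk0.le (sub_nonneg.2 (hVc N y hy))) z)).trans ?_
            rw [integral_indicator hL.measurableSet, integral_const_mul]
            exact mul_le_mul_of_nonneg_left (hIN N) hk0.le
    have h2 : k * I = e := by rw [hk, div_mul_cancel₀ _ (by positivity)]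
    have h3 : ∫ z in S, -(α⁻¹ * glue L (a N) ρ z) = α⁻¹ * ∫ z in S, -glue L (a N) ρ z := by
      rw [← integral_const_mul]
      simp
    rw [h3]
    calc α⁻¹ * ∫ z in S, -glue L (a N) ρ z ≤ α⁻¹ * (2 * e * volume.real S + k * I) :=
          mul_le_mul_of_nonneg_left h1 (by positivity)
      _ = η * (2 * volume.real S + 1) := by
          rw [h2, he]
          field_simp
  · have hzL : z ∈ L := by
      by_contra h
      have h1 := (hρL z (hKD hz) fun h' => h (hLL' h')).trans (hαK z hz)
      have h2 := EReal.coe_le_coe_iff.1 h1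
      nlinarith
    obtain ⟨J, hJ⟩ := hzV (c - α / k)
    refine ⟨J, fun N hN => ?_⟩
    have h1 : glue L (a N) ρ z ≤ -α := by
      rw [← EReal.coe_le_coe_iff, coe_glue_of_mem hzL (hρ.lt_top z (hKD hz))]
      refine max_le (EReal.coe_le_coe_iff.2 ?_) (hαK z hz)
      have h2 := (hanti z hN).trans hJ
      have h3 : α / k ≤ c - V N z := by simp only at h2; linarith
      rw [div_le_iff₀ hk0] at h3
      rw [haV]
      linarith
    have h2 := mul_le_mul_of_nonneg_left h1 (inv_nonneg.2 hα.le)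
    rwa [mul_neg, inv_mul_cancel₀ hα.ne'] at h2

end Assembly

theorem theorem3 (n m : ℕ) (hm : 1 ≤ m) (hmn : m ≤ n)
    (D : Set (Cn n)) (hD : IsDomainSet D) (hconv : IsMConvex m D)
    (E : Set (Cn n)) (hED : E ⊆ D)
    (hE : ∀ G : Set (Cn n), IsDomainSet G → IsCompact (closure G) → closure G ⊆ D →
      IsMPolarIn m (E ∩ G) G) :
    IsMPolarIn m E D ∧
      (IsMRegular m D →
        ∃ u : Cn n → EReal, IsMSubharmonicOn m D u ∧ (∀ z ∈ D, u z < 0) ∧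
          (∃ z ∈ D, u z ≠ ⊥) ∧ ∀ z ∈ E, u z = ⊥) := by
  obtain ⟨V, hV, hanti, hVint, hV1, hVE⟩ := exists_potential hm hmn hD.1 hD.2.nonempty hED hE
  constructor
  · have hu : IsMSubharmonicOn m D fun z => ⨅ N, (V N z : EReal) :=
      isMSubharmonicOn_iInf hm hmn hD.1 (fun N => (hV N).rApprox hD.1) (fun z _ => hanti z)
        fun K _ _ => ⟨1, fun N => (setIntegral_le_integral (hVint N)
          (ae_of_all _ fun z => sub_nonneg.2 (hanti z (Nat.zero_le N)))).trans (hV1 N)⟩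
    exact ⟨hED, _, hu, hu.exists_ne_bot hD.1 hD.2.nonempty, fun z hz => iInf_coe_eq_bot (hVE z hz)⟩
  · rintro ⟨ρ, hρ, hneg, hlim⟩
    have : LocallyCompactSpace D := hD.1.locallyCompactSpace
    -- the `s`-th summand forces the value `-∞` on the `s`-th set of a compact exhaustion
    let X : CompactExhaustion D := CompactExhaustion.choice D
    choose g hg hganti hg0 hgint hgE using fun s : ℕ => exists_glued_seq hm hmn hD.1 hρ hneg hlim hV
      hanti hVint hV1 ((X.isCompact s).image continuous_subtype_val)
      (by rintro _ ⟨z, -, rfl⟩; exact z.2) (η := (1 / 2) ^ (s + 1)) (by positivity)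
      (pow_lt_one₀ (by norm_num) (by norm_num) (by simp))
    set S : ℕ → Cn n → ℝ := fun N z => ∑ s ∈ Finset.range (N + 1), g s N z with hS
    have hSR : ∀ N, RApprox m D (S N) := fun N => RApprox.sum hD.1 _ fun s _ => hg s N
    have hSanti : ∀ z ∈ D, Antitone fun N => S N z := by
      intro z hz
      refine antitone_nat_of_succ_le fun N => ?_
      simp only [hS]
      rw [Finset.sum_range_succ _ (N + 1)]
      have h1 := Finset.sum_le_sum fun s (_ : s ∈ Finset.range (N + 1)) =>
        hganti s z hz (Nat.le_succ N)
      have h2 := hg0 (N + 1) (N + 1) z hz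
      simp only [Nat.succ_eq_add_one] at h1
      linarith
    have hu : IsMSubharmonicOn m D fun z => ⨅ N, (S N z : EReal) := by
      refine isMSubharmonicOn_iInf hm hmn hD.1 hSR hSanti fun K hKD hK =>
        ⟨2 * volume.real K + 1, fun N => ?_⟩
      have hi : ∀ s N, IntegrableOn (g s N) K := fun s N =>
        (hg s N).locInt.integrableOn_compact_subset hKD hK
      have hiS : ∀ N, IntegrableOn (S N) K := fun N =>
        (hSR N).locInt.integrableOn_compact_subset hKD hK
      calc ∫ z in K, (S 0 z - S N z) ≤ ∫ z in K, -S N z := by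
            refine setIntegral_mono_on ((hiS 0).sub (hiS N)) (hiS N).neg hK.measurableSet
              fun z hz => ?_
            have : S 0 z < 0 := by simpa [hS] using hg0 0 0 z (hKD hz)
            linarith
        _ = ∑ s ∈ Finset.range (N + 1), ∫ z in K, -g s N z := by
            simp only [hS, integral_neg, Finset.sum_neg_distrib]
            rw [integral_finsetSum _ fun s _ => hi s N]
        _ ≤ ∑ s ∈ Finset.range (N + 1), (1 / 2) ^ (s + 1) * (2 * volume.real K + 1) :=
            Finset.sum_le_sum fun s _ => hgint s K hKD hK N
        _ ≤ 2 * volume.real K + 1 := by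
            rw [← Finset.sum_mul]
            have h1 := sum_half_pow_add (N + 1)
            have h2 : (0 : ℝ) ≤ (1 / 2) ^ (N + 1) := by positivity
            have h3 : 0 ≤ 2 * volume.real K + 1 := by positivity
            exact mul_le_of_le_one_left h3 (by linarith)
    refine ⟨_, hu, fun z hz => ?_, hu.exists_ne_bot hD.1 hD.2.nonempty, fun z hz => ?_⟩
    · refine (iInf_le _ 0).trans_lt ?_
      have : S 0 z < 0 := by simpa [hS] using hg0 0 0 z hz
      exact_mod_cast this
    · refine iInf_coe_eq_bot fun M => ?_
      obtain ⟨s₀, hs₀⟩ := X.exists_mem ⟨z, hED hz⟩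
      have hd : ∀ s, ∃ J, ∀ N ≥ J, g (s₀ + s) N z ≤ -1 := fun s =>
        hgE (s₀ + s) z ⟨⟨z, hED hz⟩, X.subset (Nat.le_add_right _ _) hs₀, rfl⟩ (hVE z hz)
      choose J hJ using hd
      obtain ⟨p, hp⟩ := exists_nat_ge (-M)
      refine ⟨(Finset.range p).sup J + (s₀ + p), ?_⟩
      set N := (Finset.range p).sup J + (s₀ + p) with hN
      have h1 : (p : ℝ) ≤ -S N z := by
        simp only [hS, ← Finset.sum_neg_distrib]
        calc (p : ℝ) = ∑ s ∈ (Finset.range p).image (s₀ + ·), (1 : ℝ) := by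
              rw [Finset.sum_const, nsmul_eq_mul, mul_one, Finset.card_image_of_injective _
                (add_right_injective s₀), Finset.card_range]
          _ ≤ ∑ s ∈ (Finset.range p).image (s₀ + ·), -g s N z := by
              refine Finset.sum_le_sum fun k hk => ?_
              obtain ⟨s, hs, rfl⟩ := Finset.mem_image.1 hk
              have h2 : J s ≤ N := (Finset.le_sup hs).trans (Nat.le_add_right _ _)
              linarith [hJ s N h2]
          _ ≤ ∑ s ∈ Finset.range (N + 1), -g s N z := by
              refine Finset.sum_le_sum_of_subset_of_nonneg (fun k hk => ?_) fun k _ _ =>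
                neg_nonneg.2 (hg0 k N z (hED hz)).le
              obtain ⟨s, hs, rfl⟩ := Finset.mem_image.1 hk
              rw [Finset.mem_range] at hs ⊢
              omega
      linarith
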